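/- For $\lambda\in\mathbb{R}$ and $0<\alpha\le 1$ let $L(\lambda,\alpha,s)$ be the Lerch zeta-function: for $\lambda\notin\mathbb{Z}$ it is given by $L(\lambda,\alpha,s)=\sum_{n=0}^\infty e^{2\pi i\lambda n}(n+\alpha)^{-s}$ for $\operatorname{Re}s>0$, and for $\lambda\in\mathbb{Z}$ it is the analytically continued Hurwitz zeta-function $\zeta(s,\alpha)$. Let $N(T,\sigma_1,\sigma_2;\lambda,\alpha)$ be the number of zeros of $L(\lambda,\alpha,s)$, counted with multiplicity, in the rectangle $\sigma_1<\operatorname{Re}s<\sigma_2$, $0<\operatorname{Im}s<T$. Let $S$ be the set of all $\alpha\in(0,1]$ such that (1) the system $\{\log(n+\alpha)\}_{n\ge0}$ is linearly independent over $\mathbb{Q}$, and (2) there are constants $\Omega=\Omega(\alpha)>0$ and $X_0=X_0(\alpha)$ such that for all $X\ge X_0$, all $N$, all integers $0\le n_1,\dots,n_N\le X$ and all $\epsilon_1,\dots,\epsilon_N\in\{1,-1\}$, $$\Big|\sum_{j=1}^N\epsilon_j\log(n_j+\alpha)\Big|\ge X^{-\Omega N^2}\quad\text{whenever}\quad \sum_{j=1}^N\epsilon_j\log(n_j+\alpha)\ne0.$$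 Write $|dz|=(2\pi)^{-1}dx\,dy$ on $\mathbb{C}$. For $\sigma>1/2$ let $\phi_n$ be the uniform probability distribution on the circle $|z|=(n+\alpha)^{-\sigma}$, and let $M_\sigma(z;\alpha)$ be the non-negative continuous density with respect to $|dz|$ of the weak limit of $\phi_0*\phi_1*\cdots*\phi_n$ as $n\to\infty$. Theorem. There is an absolute constant $A>0$ with the following property. Let $\lambda\in\mathbb{R}$, $\alpha\in S$ and $1/2<\sigma_1<\sigma_2$. Then $M_\sigma(z;\alpha)$ exists for every $\sigma>1/2$, is twice continuously differentiable in $\sigma$ for each $z$, and the integrals in $$C(\sigma_1,\sigma_2;\alpha)=\frac1{2\pi}\int_{\sigma_1}^{\sigma_2}\Big(\int_{\mathbb{C}}\log|z|\,\frac{\partial^2}{\partial\sigma^2}M_\sigma(z;\alpha)\,|dz|\Big)d\sigma$$ converge absolutely; $L(\lambda,\alpha,s)$ is holomorphic in $\operatorname{Re}s>1/2$, $\operatorname{Im}s>0$ and $N(T,\sigma_1,\sigma_2;\lambda,\alpha)$ is finite for every $T$; moreover $C(\sigma_1,\sigma_2;\alpha)\ge0$ and $$N(T,\sigma_1,\sigma_2;\lambda,\alpha)=C(\sigma_1,\sigma_2;\alpha)\,T+O\big(T(\log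 T)^{-A}\big)\qquad(T\to\infty),$$ where the implied constant depends only on $\sigma_1,\sigma_2,\lambda,\alpha$. -/

import Mathlib

open Filter Topology MeasureTheory Set

noncomputable section

namespace LerchZeros

/-- The admissible set `S` of all `α ∈ (0, 1]` such that
(1) the system `log (n + α)`, `n ≥ 0`, is linearly independent over `ℚ`;
(2) there is `Ω > 0` such that for all sufficiently large `X`, all `N`, all integers
`0 ≤ n₁, …, n_N ≤ X` and all signs `ε_j ∈ {1, -1}`, the sum `∑ ε_j log (n_j + α)` is either zero
or at least `X ^ (-Ω N²)` in absolute value. -/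
def admissibleSet : Set ℝ :=
  {α | α ∈ Ioc (0 : ℝ) 1 ∧
    LinearIndependent ℚ (fun n : ℕ => Real.log ((n : ℝ) + α)) ∧
    ∃ Ω : ℝ, 0 < Ω ∧ ∃ X₀ : ℝ, ∀ X : ℝ, X₀ ≤ X →
      ∀ (N : ℕ) (n : Fin N → ℕ) (ε : Fin N → ℝ),
        (∀ j, (n j : ℝ) ≤ X) → (∀ j, ε j = 1 ∨ ε j = -1) →
        ∑ j, ε j * Real.log ((n j : ℝ) + α) ≠ 0 →
        X ^ (-(Ω * (N : ℝ) ^ 2)) ≤ |∑ j, ε j * Real.log ((n j : ℝ) + α)|}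

/-- The partial sums `∑_{n < N} e^{2πiλn} / (n + α)^s` of the Lerch series. -/
def lerchPartialSum (lam α : ℝ) (s : ℂ) (N : ℕ) : ℂ :=
  ∑ n ∈ Finset.range N,
    Complex.exp (2 * Real.pi * Complex.I * lam * n) / ((n : ℂ) + α) ^ s

open Classical in
/-- The Lerch zeta-function `L(λ, α, s)` in the half-plane `Re s > 0`, for `0 < α ≤ 1`.
If `λ` is an integer it is the (meromorphically continued) Hurwitz zeta-function `ζ(s, α)`;
otherwise it is the sum of the series `∑ e^{2πiλn} / (n + α)^s`, which converges (conditionally)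
for `Re s > 0`. -/
def lerchZeta (lam α : ℝ) (s : ℂ) : ℂ :=
  if ∃ k : ℤ, (k : ℝ) = lam then HurwitzZeta.hurwitzZeta (α : UnitAddCircle) s
  else limUnder atTop (lerchPartialSum lam α s)

/-- The series defining `L(λ, α, s)` converges for `λ ∉ ℤ`, `α > 0` and `Re s > 0`. -/
theorem tendsto_lerchPartialSum {lam α : ℝ} (hlam : ¬ ∃ k : ℤ, (k : ℝ) = lam) (hα : 0 < α)
    {s : ℂ} (hs : 0 < s.re) :
    Tendsto (lerchPartialSum lam α s) atTop (𝓝 (lerchZeta lam α s)) := by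
  rw [lerchZeta, if_neg hlam]
  apply tendsto_nhds_limUnder
  set z : ℂ := Complex.exp (2 * Real.pi * Complex.I * lam) with hz
  have hz1 : z - 1 ≠ 0 := by
    intro h
    obtain ⟨n, hn⟩ := Complex.exp_eq_one_iff.1 (sub_eq_zero.1 h)
    apply hlam
    refine ⟨n, ?_⟩
    have h2 : (2 * Real.pi * Complex.I : ℂ) ≠ 0 := by
      simp [Real.pi_ne_zero]
    have h3 : (2 * Real.pi * Complex.I : ℂ) * (lam - n) = 0 := by
      linear_combination hn
    have h4 : (lam : ℂ) = n := sub_eq_zero.1 ((mul_eq_zero.1 h3).resolve_left h2)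
    exact_mod_cast h4.symm
  have hznorm : ‖z‖ = 1 := by
    rw [hz, show (2 * Real.pi * Complex.I * lam : ℂ) = ((2 * Real.pi * lam : ℝ) : ℂ) * Complex.I by
      push_cast; ring]
    exact Complex.norm_exp_ofReal_mul_I _
  set b : ℕ → ℂ := fun n => (((n : ℝ) + α : ℝ) : ℂ) ^ (-s) with hb
  have hpos : ∀ n : ℕ, 0 < (n : ℝ) + α := fun n => by positivity
  have hS : ∀ N, (z - 1) * lerchPartialSum lam α s N
      = z ^ N * b N - b 0 + ∑ n ∈ Finset.range N, z ^ (n + 1) * (b n - b (n + 1)) := by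
    intro N
    induction N with
    | zero => simp [lerchPartialSum]
    | succ N ih =>
      have h1 : lerchPartialSum lam α s (N + 1) = lerchPartialSum lam α s N + z ^ N * b N := by
        simp only [lerchPartialSum, Finset.sum_range_succ, hb, hz]
        rw [← Complex.exp_nat_mul, Complex.cpow_neg]
        push_cast
        rw [div_eq_mul_inv, mul_comm (2 * (Real.pi : ℂ) * Complex.I * lam) (N : ℂ)]
      rw [h1, mul_add, ih, Finset.sum_range_succ]
      ring
  have hbound : ∀ n : ℕ, ‖b n - b (n + 1)‖ ≤ ‖s‖ * (1 / |(n : ℝ) + α| ^ (s.re + 1)) := by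
    intro n
    have hs0 : -s ≠ 0 := by
      intro h
      rw [neg_eq_zero.1 h] at hs
      simp at hs
    have hd : ∀ x ∈ Icc ((n : ℝ) + α) ((n : ℝ) + α + 1),
        HasDerivWithinAt (fun y : ℝ => (y : ℂ) ^ (-s)) (-s * (x : ℂ) ^ (-s - 1))
          (Icc ((n : ℝ) + α) ((n : ℝ) + α + 1)) x := fun x hx =>
      (hasDerivAt_ofReal_cpow_const ((hpos n).trans_le hx.1).ne' hs0).hasDerivWithinAt
    have hC : ∀ x ∈ Ico ((n : ℝ) + α) ((n : ℝ) + α + 1),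
        ‖-s * (x : ℂ) ^ (-s - 1)‖ ≤ ‖s‖ * (1 / |(n : ℝ) + α| ^ (s.re + 1)) := by
      intro x hx
      have hx0 := (hpos n).trans_le hx.1
      rw [norm_mul, norm_neg, Complex.norm_cpow_eq_rpow_re_of_pos hx0, abs_of_pos (hpos n),
        one_div, ← Real.rpow_neg (hpos n).le]
      have h5 : (-s - 1).re = -(s.re + 1) := by simp; ring
      rw [h5]
      exact mul_le_mul_of_nonneg_left
        (Real.rpow_le_rpow_of_nonpos (hpos n) hx.1 (by linarith)) (norm_nonneg _)
    have h6 := norm_image_sub_le_of_norm_deriv_le_segment' hd hC ((n : ℝ) + α + 1)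
      ⟨by linarith, le_rfl⟩
    rw [norm_sub_rev]
    have h7 : b (n + 1) = (((n : ℝ) + α + 1 : ℝ) : ℂ) ^ (-s) := by
      simp only [hb]
      push_cast
      ring_nf
    rw [h7]
    simpa [hb] using h6
  have hsum : Summable fun n : ℕ => z ^ (n + 1) * (b n - b (n + 1)) := by
    refine Summable.of_norm_bounded
      (((Real.summable_one_div_nat_add_rpow α (s.re + 1)).2 (by linarith)).mul_left ‖s‖) ?_
    intro n
    rw [norm_mul, norm_pow, hznorm, one_pow, one_mul]
    exact hbound n
  have hb0 : Tendsto (fun N => z ^ N * b N) atTop (𝓝 0) := by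
    rw [tendsto_zero_iff_norm_tendsto_zero]
    have h8 : (fun N : ℕ => ‖z ^ N * b N‖) = fun N : ℕ => ((N : ℝ) + α) ^ (-s.re) := by
      funext N
      rw [norm_mul, norm_pow, hznorm, one_pow, one_mul]
      simp only [hb]
      rw [Complex.norm_cpow_eq_rpow_re_of_pos (hpos N), Complex.neg_re]
    rw [h8]
    exact (tendsto_rpow_neg_atTop hs).comp
      (tendsto_atTop_add_const_right _ _ tendsto_natCast_atTop_atTop)
  have hlim := ((hb0.sub_const (b 0)).add hsum.hasSum.tendsto_sum_nat).const_mul (z - 1)⁻¹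
  refine ⟨_, hlim.congr fun N => ?_⟩
  rw [← hS N, inv_mul_cancel_left₀ hz1]

/-- The zeros of `L(λ, α, s)` in the open rectangle `σ₁ < Re s < σ₂`, `0 < Im s < T`. -/
def zerosInRectangle (lam α σ₁ σ₂ T : ℝ) : Set ℂ :=
  {s | σ₁ < s.re ∧ s.re < σ₂ ∧ 0 < s.im ∧ s.im < T ∧ lerchZeta lam α s = 0}

/-- `N(T, σ₁, σ₂; λ, α)`: the number of zeros of `L(λ, α, s)` in the rectangle
`σ₁ < Re s < σ₂`, `0 < Im s < T`, counted with multiplicity. -/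
def zeroCount (lam α σ₁ σ₂ T : ℝ) : ℕ :=
  ∑ᶠ s ∈ zerosInRectangle lam α σ₁ σ₂ T, analyticOrderNatAt (lerchZeta lam α) s

/-- The measure `|dz| = (2π)⁻¹ dx dy` on `ℂ`. -/
def dzMeasure : Measure ℂ := ENNReal.ofReal (2 * Real.pi)⁻¹ • (volume : Measure ℂ)

/-- The equidistribution on the circle `|z| = r`: the push-forward of the normalized Haar measure
of the unit circle `ℝ / ℤ` under `θ ↦ r e^{2πiθ}`. -/
def circleEquidistribution (r : ℝ) : ProbabilityMeasure ℂ :=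
  ⟨(AddCircle.haarAddCircle : Measure UnitAddCircle).map
      (fun θ => (r : ℂ) * (AddCircle.toCircle θ : ℂ)),
    Measure.isProbabilityMeasure_map (Continuous.aemeasurable (continuous_const.mul
      (continuous_subtype_val.comp AddCircle.continuous_toCircle)))⟩

/-- The convolution `φ₀ ∗ φ₁ ∗ ⋯ ∗ φ_n`, where `φ_k` is the equidistribution on the circle
`|z| = (k + α)^{-σ}`. -/
def partialConvolution (α σ : ℝ) : ℕ → ProbabilityMeasure ℂ
  | 0 => circleEquidistribution (((0 : ℕ) + α) ^ (-σ))
  | n + 1 =>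
    ⟨Measure.conv (partialConvolution α σ n : Measure ℂ)
        (circleEquidistribution (((n + 1 : ℕ) + α) ^ (-σ)) : Measure ℂ),
      inferInstance⟩

/-- `M` is the non-negative continuous density, with respect to `|dz|`, of the weak limit of the
convolutions `φ₀ ∗ φ₁ ∗ ⋯ ∗ φ_n`. -/
structure IsLimitDensity (α σ : ℝ) (M : ℂ → ℝ) : Prop where
  continuous : Continuous M
  nonneg : ∀ z, 0 ≤ M z
  density : ∃ φ : ProbabilityMeasure ℂ, Tendsto (partialConvolution α σ) atTop (𝓝 φ) ∧
    (φ : Measure ℂ) = dzMeasure.withDensity (fun z => ENNReal.ofReal (M z))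

/-- There is at most one such density. -/
theorem IsLimitDensity.unique {α σ : ℝ} {M M' : ℂ → ℝ} (h : IsLimitDensity α σ M)
    (h' : IsLimitDensity α σ M') : M = M' := by
  obtain ⟨φ, hφ, hM⟩ := h.density
  obtain ⟨φ', hφ', hM'⟩ := h'.density
  obtain rfl := tendsto_nhds_unique hφ hφ'
  have hfin : ∫⁻ z, ENNReal.ofReal (M z) ∂dzMeasure ≠ ⊤ := by
    have h1 : (φ : Measure ℂ) univ = 1 := measure_univ
    rw [hM, withDensity_apply _ MeasurableSet.univ, Measure.restrict_univ] at h1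
    simp [h1]
  have hae : (fun z => ENNReal.ofReal (M z)) =ᵐ[dzMeasure] fun z => ENNReal.ofReal (M' z) :=
    (withDensity_eq_iff h.continuous.measurable.ennreal_ofReal.aemeasurable
      h'.continuous.measurable.ennreal_ofReal.aemeasurable hfin).1 (hM.symm.trans hM')
  have hc : ENNReal.ofReal (2 * Real.pi)⁻¹ ≠ 0 := by
    simp only [ne_eq, ENNReal.ofReal_eq_zero, not_le]
    positivity
  have hae' : M =ᵐ[(volume : Measure ℂ)] M' := by
    have h2 := (Measure.ae_ennreal_smul_measure_iff hc).1 hae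
    filter_upwards [h2] with z hz
    exact (ENNReal.ofReal_eq_ofReal_iff (h.nonneg z) (h'.nonneg z)).1 hz
  exact Continuous.ae_eq_iff_eq volume h.continuous h'.continuous |>.1 hae'

open Classical in
/-- The density function `M_σ(z; α)`. -/
def densityM (α σ : ℝ) : ℂ → ℝ :=
  if h : ∃ M, IsLimitDensity α σ M then h.choose else 0

/-- The second partial derivative `∂²/∂σ² M_σ(z; α)`. -/
def densityM_deriv2 (α σ : ℝ) (z : ℂ) : ℝ :=
  iteratedDeriv 2 (fun u : ℝ => densityM α u z) σ

/-- The inner integral `∫_ℂ log |z| ∂²/∂σ² M_σ(z; α) |dz|`. -/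
def logIntegral (α σ : ℝ) : ℝ :=
  ∫ z : ℂ, Real.log ‖z‖ * densityM_deriv2 α σ z ∂dzMeasure

/-- The constant
`C(σ₁, σ₂; α) = (1/2π) ∫_{σ₁}^{σ₂} (∫_ℂ log |z| ∂²/∂σ² M_σ(z; α) |dz|) dσ`. -/
def zeroConstant (α σ₁ σ₂ : ℝ) : ℝ :=
  1 / (2 * Real.pi) * ∫ σ in σ₁..σ₂, logIntegral α σ

end LerchZeros

end

open scoped FourierTransform ComplexConjugate

noncomputable section

namespace LerchZeros

/-! Zeros are counted through the logarithm of |L|. Let m(σ) be the mean of log |z| under the limit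
law, `logMean α 0 σ`. The Laplacian of log |L| is 2π times the sum of the point masses at the zeros.
So if log |L(σ + it)| has mean value m(σ) along vertical lines, there should be (m'(σ₂) - m'(σ₁)) /
2π zeros per unit height in the strip. This is the constant of the theorem, because two derivatives
in σ pass under the integral of log |z| against the density (`zeroConstant_eq`).

The Laplacian is replaced by Jensen's formula on circles of radius r, integrated over centres in a
rectangle (`exists_sum_eq_setIntegral`). A zero whose disc of radius r lies in the rectangle
contributes exactly πr²/2. The other side is the mean of the integrals of log |L| over rectangles
shifted by r e^{iθ}, minus the integral over the rectangle itself (`circleExcess`). If the mean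
value of log |L| is known with error T (log T)^(-1/144), integrated over σ, then Taylor's formula
evaluates this excess as T (r²/4)(m'(σ₂) - m'(σ₁)) + O(T (log T)^(-1/144) + T r³). Division by πr²/2
with r = (log T)^(-1/432) balances the errors and gives A = 1/432.

The mean value of log |L| rests on three inputs. First, let q⁸ ≤ log T ≤ q⁹. The partial sum of
length 2^q approximates L in mean square with an error exponentially small in q, up to powers of q.
Secondly, linear independence identifies the resonant terms in the moments of the partial sum with
those of independent random phases. The lower bound for linear forms in log (n + α) separates the
other frequencies from 0 well enough to compare moments up to order 2q³. Hence the Fourier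
transforms of the value distribution of L and of the limit law differ by O(q^(-4)) for ‖w‖ ≤ q
(`exists_norm_integral_phase_sub_mgf_le`). Thirdly, log |z| is smoothed to (1/2) log (|z|² + d²),
whose x-derivative with x in place of d² is a superposition of Gaussians, so that closeness of
Fourier transforms suffices. Removing the smoothing costs √d times the mean of log² |L|. That mean
is bounded on average over σ by a local argument (Jensen's formula and the Poisson kernel) on discs
centred far to the right, where |L| ≥ 1/2.

The limit law has as Fourier transform an infinite product of Bessel factors, analytic in σ. Each
factor decays like ‖w‖^(-1/3), so 24 of them give ‖w‖^(-8), and ‖w‖^(-5) is left after three Cauchy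
estimates in σ. Tilting by exp ⟨η, z⟩ with ‖η‖ ≤ 1 keeps these bounds and yields the majorant exp
(-‖z‖) for the density and its first three σ-derivatives. -/

/-! ### The Bessel factor: series, circle integral and decay. -/

/-- The entire function `I₀(√w)`, where `I₀` is the modified Bessel function. -/
def bes (w : ℂ) : ℂ := ∑' j : ℕ, w ^ j / (4 ^ j * (j.factorial : ℂ) ^ 2)

theorem norm_bes_term_le (w : ℂ) (j : ℕ) :
    ‖w ^ j / (4 ^ j * (j.factorial : ℂ) ^ 2)‖ ≤ (‖w‖ / 4) ^ j / j.factorial := by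
  rw [norm_div, norm_mul, norm_pow, norm_pow, norm_pow, Complex.norm_natCast, div_pow, div_div,
    show ‖(4 : ℂ)‖ = 4 by norm_num]
  have h : (1 : ℝ) ≤ j.factorial := by exact_mod_cast j.factorial_pos
  gcongr
  nlinarith

theorem summable_bes (w : ℂ) :
    Summable fun j : ℕ => w ^ j / (4 ^ j * (j.factorial : ℂ) ^ 2) :=
  Summable.of_norm_bounded (Real.summable_pow_div_factorial _) (norm_bes_term_le w)

theorem norm_bes_le (w : ℂ) : ‖bes w‖ ≤ Real.exp (‖w‖ / 4) := by
  rw [Real.exp_eq_exp_ℝ, NormedSpace.exp_eq_tsum_div]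
  exact tsum_of_norm_bounded (Real.summable_pow_div_factorial _).hasSum (norm_bes_term_le w)

theorem norm_bes_sub_one_le (w : ℂ) : ‖bes w - 1‖ ≤ ‖w‖ * Real.exp ‖w‖ := by
  have h := (summable_bes w).tsum_eq_zero_add
  have h1 : bes w - 1 = ∑' j : ℕ, w ^ (j + 1) / (4 ^ (j + 1) * ((j + 1).factorial : ℂ) ^ 2) := by
    rw [bes, h]; simp
  rw [h1, Real.exp_eq_exp_ℝ, NormedSpace.exp_eq_tsum_div]
  refine tsum_of_norm_bounded ((Real.summable_pow_div_factorial ‖w‖).hasSum.mul_left ‖w‖) ?_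
  intro j
  refine (norm_bes_term_le w (j + 1)).trans ?_
  rw [← mul_div_assoc, ← pow_succ']
  have h2 : (j.factorial : ℝ) ≤ (j + 1).factorial := by
    exact_mod_cast Nat.factorial_le (Nat.le_succ j)
  have h3 : (0 : ℝ) < j.factorial := by exact_mod_cast j.factorial_pos
  gcongr
  linarith [norm_nonneg w]

theorem differentiable_bes : Differentiable ℂ bes := by
  intro w
  have h : DifferentiableOn ℂ bes (Metric.ball 0 (‖w‖ + 1)) := by
    refine Complex.differentiableOn_tsum_of_summable_norm
      (Real.summable_pow_div_factorial ((‖w‖ + 1) / 4)) (fun j => ?_) Metric.isOpen_ball ?_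
    · exact (differentiable_id.pow j |>.div_const _).differentiableOn
    · intro j v hv
      refine (norm_bes_term_le v j).trans ?_
      have : ‖v‖ ≤ ‖w‖ + 1 := by simpa using (mem_ball_zero_iff.1 hv).le
      gcongr
  exact h.differentiableAt (Metric.isOpen_ball.mem_nhds (by simp))

theorem integral_fourier (n : ℤ) :
    ∫ θ : UnitAddCircle, fourier n θ ∂AddCircle.haarAddCircle = if n = 0 then 1 else 0 := by
  have h := congrFun (fourierCoeff_fourier (T := 1) n) 0
  rw [fourierCoeff] at h
  simp only [neg_zero, fourier_zero, one_smul] at h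
  rw [h]
  by_cases hn : n = 0
  · simp [hn]
  · simp [hn]

/-- Only the diagonal terms of the product of the two exponential series survive integration over
the circle. `A` and `A'` are independent of each other, not conjugate, so that complex (tilted)
frequencies are covered. -/
theorem integral_exp_toCircle (A A' : ℂ) :
    ∫ θ : UnitAddCircle, Complex.exp ((A * fourier 1 θ + A' * fourier (-1) θ) / 2)
      ∂AddCircle.haarAddCircle = bes (A * A') := by
  set F : ℕ × ℕ → UnitAddCircle → ℂ := fun p θ =>
    ((A / 2) ^ p.1 / p.1.factorial * ((A' / 2) ^ p.2 / p.2.factorial)) *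
      fourier ((p.1 : ℤ) - p.2) θ with hF
  have hfp : ∀ (n : ℕ) (m : ℤ) (θ : UnitAddCircle), (fourier m θ : ℂ) ^ n = fourier (n * m) θ := by
    intro n m θ
    induction n with
    | zero => simp
    | succ n ih => rw [pow_succ, ih, ← fourier_add]; congr 1; push_cast; ring_nf
  have hnorm : ∀ p θ, ‖F p θ‖ = (‖A / 2‖ ^ p.1 / p.1.factorial) * (‖A' / 2‖ ^ p.2 / p.2.factorial) := by
    intro p θ
    simp only [hF, norm_mul, norm_div, norm_pow, Complex.norm_natCast]
    rw [fourier_apply, Circle.norm_coe, mul_one]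
  have hS : Summable fun p : ℕ × ℕ =>
      (‖A / 2‖ ^ p.1 / p.1.factorial) * (‖A' / 2‖ ^ p.2 / p.2.factorial) :=
    (Real.summable_pow_div_factorial ‖A / 2‖).mul_of_nonneg
      (Real.summable_pow_div_factorial ‖A' / 2‖) (fun _ => by positivity) (fun _ => by positivity)
  have hsn : ∀ w : ℂ, Summable fun n : ℕ => ‖w ^ n / (n.factorial : ℂ)‖ := fun w => by
    simpa only [norm_div, norm_pow, Complex.norm_natCast] using
      Real.summable_pow_div_factorial ‖w‖
  have hexp : ∀ θ, Complex.exp ((A * fourier 1 θ + A' * fourier (-1) θ) / 2) = ∑' p, F p θ := by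
    intro θ
    rw [add_div, Complex.exp_add, Complex.exp_eq_exp_ℂ, NormedSpace.exp_eq_tsum_div]
    rw [tsum_mul_tsum_of_summable_norm (hsn (A * fourier 1 θ / 2)) (hsn (A' * fourier (-1) θ / 2))]
    refine tsum_congr fun p => ?_
    simp only [hF]
    rw [show ((p.1 : ℤ) - p.2) = p.1 * 1 + p.2 * (-1) by ring, fourier_add, ← hfp, ← hfp]
    ring
  simp_rw [hexp]
  have hint : ∀ p, Integrable (F p) AddCircle.haarAddCircle := fun p => by
    refine (Continuous.integrable_of_hasCompactSupport ?_ (HasCompactSupport.of_compactSpace _))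
    exact continuous_const.mul (fourier _).continuous
  rw [← integral_tsum_of_summable_integral_norm hint]
  · have hval : ∀ p : ℕ × ℕ, ∫ θ, F p θ ∂AddCircle.haarAddCircle =
        if p.1 = p.2 then (A / 2) ^ p.1 / p.1.factorial * ((A' / 2) ^ p.2 / p.2.factorial) else 0 := by
      intro p
      simp only [hF]
      rw [integral_const_mul, integral_fourier]
      by_cases h : p.1 = p.2
      · simp [h]
      · rw [if_neg h, if_neg (by omega), mul_zero]
    simp_rw [hval]
    have hinj : Function.Injective (fun j : ℕ => (j, j)) := fun a b h => (Prod.ext_iff.1 h).1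
    rw [bes, ← hinj.tsum_eq]
    · refine tsum_congr fun j => ?_
      simp only [if_true]
      have : (j.factorial : ℂ) ≠ 0 := by exact_mod_cast j.factorial_ne_zero
      rw [div_pow, div_pow, mul_pow, show (4 : ℂ) ^ j = 2 ^ j * 2 ^ j by rw [← mul_pow]; norm_num]
      field_simp
    · intro p hp
      have : p.1 = p.2 := by
        by_contra h
        simp [h] at hp
      exact ⟨p.1, by ext <;> simp [this]⟩
  · simpa [hnorm] using hS

/-- The case `A = A' = v`. It turns bounds for `bes` into bounds for an oscillatory integral. -/
theorem bes_sq_eq (v : ℂ) :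
    bes (v ^ 2) = ∫ x in (0 : ℝ)..1, Complex.exp (v * Real.cos (2 * Real.pi * x)) := by
  rw [sq, ← integral_exp_toCircle, AddCircle.integral_haarAddCircle, inv_one, one_smul,
    ← UnitAddCircle.intervalIntegral_preimage 0, zero_add]
  refine intervalIntegral.integral_congr fun x _ => ?_
  simp only [fourier_coe_apply]
  congr 1
  rw [← mul_add, mul_div_assoc]
  congr 1
  push_cast
  rw [Complex.cos]
  congr 2 <;> congr 1 <;> ring

/-- The integral is dominated by its value at `v.re`, where the power series bound is available. The
exponent is quadratic in `v.re`, which makes products over square-summable radii bounded uniformly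
in the imaginary part. -/
theorem norm_bes_sq_le (v : ℂ) : ‖bes (v ^ 2)‖ ≤ Real.exp (v.re ^ 2 / 4) := by
  have h : ‖bes (v ^ 2)‖ ≤ ∫ x in (0 : ℝ)..1, Real.exp (v.re * Real.cos (2 * Real.pi * x)) := by
    rw [bes_sq_eq]
    refine (intervalIntegral.norm_integral_le_integral_norm zero_le_one).trans_eq ?_
    refine intervalIntegral.integral_congr fun x _ => ?_
    simp only [Complex.norm_exp, Complex.re_mul_ofReal]
  have h2 : bes (((v.re : ℝ) : ℂ) ^ 2) =
      ((∫ x in (0 : ℝ)..1, Real.exp (v.re * Real.cos (2 * Real.pi * x)) : ℝ) : ℂ) := by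
    rw [bes_sq_eq, ← intervalIntegral.integral_ofReal]
    refine intervalIntegral.integral_congr fun x _ => ?_
    push_cast
    rfl
  have h3 := norm_bes_le (((v.re : ℝ) : ℂ) ^ 2)
  rw [h2, Complex.norm_real, norm_pow, Complex.norm_real, Real.norm_eq_abs, Real.norm_eq_abs, sq_abs] at h3
  exact h.trans ((le_abs_self _).trans h3)

theorem norm_exp_mul_cos_le (v : ℂ) (y : ℝ) :
    ‖Complex.exp (v * Real.cos y)‖ ≤ Real.exp |v.re| := by
  rw [Complex.norm_exp]
  rw [Complex.re_mul_ofReal]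
  refine Real.exp_le_exp.2 ((le_abs_self _).trans ?_)
  rw [abs_mul]
  exact mul_le_of_le_one_right (abs_nonneg _) (Real.abs_cos_le_one y)

theorem norm_bes_sq_le_exp_abs (v : ℂ) : ‖bes (v ^ 2)‖ ≤ Real.exp |v.re| := by
  rw [bes_sq_eq]
  have := intervalIntegral.norm_integral_le_of_norm_le_const (a := 0) (b := 1)
    (fun x _ => norm_exp_mul_cos_le v (2 * Real.pi * x))
  simpa using this

/-- Integration by parts away from the stationary points 0 and 1/2 of the cosine, where the sine is
at least 4ε. -/
theorem norm_integral_exp_cos_le {v : ℂ} (hv : v ≠ 0) {ε : ℝ} (hε : 0 < ε) (hε' : ε ≤ 1 / 4) :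
    ‖∫ x in ε..(1 / 2 - ε), Complex.exp (v * Real.cos (2 * Real.pi * x))‖
      ≤ Real.exp |v.re| * (1 / (‖v‖ * ε ^ 2)) / 8 := by
  have hsin : ∀ x ∈ Icc ε (1 / 2 - ε), 4 * ε ≤ Real.sin (2 * Real.pi * x) := by
    intro x hx
    have key : ∀ y, ε ≤ y → y ≤ 1 / 4 → 4 * ε ≤ Real.sin (2 * Real.pi * y) := by
      intro y h1 h2
      have h0 : 0 ≤ y := hε.le.trans h1
      have h3 := Real.mul_le_sin (x := 2 * Real.pi * y) (by positivity)
        (by nlinarith [Real.pi_pos])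
      have h4 : 2 / Real.pi * (2 * Real.pi * y) = 4 * y := by field_simp; ring
      linarith
    rcases le_total x (1 / 4) with h | h
    · exact key x hx.1 h
    · have := key (1 / 2 - x) (by linarith [hx.2]) (by linarith)
      rwa [show 2 * Real.pi * (1 / 2 - x) = Real.pi - 2 * Real.pi * x by ring, Real.sin_pi_sub] at this
  have hle : ε ≤ 1 / 2 - ε := by linarith
  have hE := norm_exp_mul_cos_le v
  set E := Real.exp |v.re|
  have hE0 : 0 ≤ E := (Real.exp_pos _).le
  have hsinc : ∀ x ∈ Icc ε (1 / 2 - ε), ((Real.sin (2 * Real.pi * x) : ℝ) : ℂ) ≠ 0 := fun x hx => by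
    have := hsin x hx
    exact_mod_cast (show Real.sin (2 * Real.pi * x) ≠ 0 by linarith)
  have hπ : ((2 * Real.pi : ℝ) : ℂ) ≠ 0 := by exact_mod_cast (by positivity : (2 * Real.pi : ℝ) ≠ 0)
  -- `F` is the exponential divided by the derivative of its exponent, and `H` is the correction
  -- left by differentiating the denominator: `F' = exp + H`.
  set F : ℝ → ℂ := fun x => Complex.exp (v * Real.cos (2 * Real.pi * x)) /
    (-((2 * Real.pi : ℝ) : ℂ) * v * Real.sin (2 * Real.pi * x)) with hF
  set H : ℝ → ℂ := fun x => Complex.exp (v * Real.cos (2 * Real.pi * x)) *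
    (Real.cos (2 * Real.pi * x) / (v * Real.sin (2 * Real.pi * x) ^ 2)) with hH
  have hder : ∀ x ∈ uIcc ε (1 / 2 - ε),
      HasDerivAt F (Complex.exp (v * Real.cos (2 * Real.pi * x)) + H x) x := by
    intro x hx
    rw [uIcc_of_le hle] at hx
    have hs := hsinc x hx
    have hl : HasDerivAt (fun x : ℝ => 2 * Real.pi * x) (2 * Real.pi) x := by
      simpa using (hasDerivAt_id x).const_mul (2 * Real.pi)
    have h1 : HasDerivAt (fun x : ℝ => ((Real.cos (2 * Real.pi * x) : ℝ) : ℂ))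
        ((-Real.sin (2 * Real.pi * x) * (2 * Real.pi) : ℝ) : ℂ) x := (hl.cos).ofReal_comp
    have h2 : HasDerivAt (fun x : ℝ => ((Real.sin (2 * Real.pi * x) : ℝ) : ℂ))
        ((Real.cos (2 * Real.pi * x) * (2 * Real.pi) : ℝ) : ℂ) x := (hl.sin).ofReal_comp
    have h3 := (h1.const_mul v).cexp.div (h2.const_mul (-((2 * Real.pi : ℝ) : ℂ) * v))
      (mul_ne_zero (mul_ne_zero (neg_ne_zero.2 hπ) hv) hs)
    convert! h3 using 1
    simp only [hH]
    push_cast at hs hπ ⊢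
    field_simp
    ring
  have hcF : ContinuousOn (fun x : ℝ => Complex.exp (v * Real.cos (2 * Real.pi * x))) (uIcc ε (1 / 2 - ε)) := by
    fun_prop
  have hcH : ContinuousOn H (uIcc ε (1 / 2 - ε)) := by
    refine hcF.mul (ContinuousOn.div (by fun_prop) (by fun_prop) ?_)
    intro x hx
    rw [uIcc_of_le hle] at hx
    exact mul_ne_zero hv (pow_ne_zero 2 (hsinc x hx))
  have hint := intervalIntegral.integral_eq_sub_of_hasDerivAt hder
    ((hcF.add hcH).intervalIntegrable)
  rw [intervalIntegral.integral_add hcF.intervalIntegrable hcH.intervalIntegrable] at hint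
  have hv0 : 0 < ‖v‖ := norm_pos_iff.2 hv
  have hFb : ∀ x ∈ Icc ε (1 / 2 - ε), ‖F x‖ ≤ E / (‖v‖ * ε ^ 2) / 32 := by
    intro x hx
    simp only [hF]
    rw [norm_div, norm_mul, norm_mul, norm_neg, Complex.norm_real, Complex.norm_real, div_div]
    refine div_le_div₀ hE0 (hE _) (by positivity) ?_
    have h1 := hsin x hx
    rw [Real.norm_of_nonneg (by linarith : 0 ≤ Real.sin (2 * Real.pi * x)),
      Real.norm_of_nonneg (by positivity : 0 ≤ 2 * Real.pi)]
    have h2 : 8 * ε ≤ 2 * Real.pi * Real.sin (2 * Real.pi * x) := by nlinarith [Real.pi_gt_three]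
    calc ‖v‖ * ε ^ 2 * 32 = ‖v‖ * (32 * ε ^ 2) := by ring
      _ ≤ ‖v‖ * (2 * Real.pi * Real.sin (2 * Real.pi * x)) := by refine mul_le_mul_of_nonneg_left ?_ hv0.le; nlinarith
      _ = _ := by ring
  have hHb : ‖∫ x in ε..(1 / 2 - ε), H x‖ ≤ E / (‖v‖ * ε ^ 2) / 16 * (1 / 2) := by
    have := intervalIntegral.norm_integral_le_of_norm_le_const (a := ε) (b := 1 / 2 - ε) (f := H)
      (C := E / (‖v‖ * ε ^ 2) / 16) ?_
    · refine this.trans ?_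
      gcongr
      rw [abs_of_nonneg (by linarith)]; linarith
    · intro x hx
      rw [uIoc_of_le hle] at hx
      have h1 := hsin x ⟨hx.1.le, hx.2⟩
      simp only [hH, norm_mul, norm_div, norm_pow, Complex.norm_real]
      rw [mul_div_assoc', div_div]
      refine div_le_div₀ hE0 ?_ (by positivity) ?_
      · refine (mul_le_of_le_one_right (norm_nonneg _) ?_).trans (hE _)
        exact Real.abs_cos_le_one _
      · rw [Real.norm_eq_abs, sq_abs]
        calc ‖v‖ * ε ^ 2 * 16 = ‖v‖ * (4 * ε) ^ 2 := by ring
          _ ≤ _ := by gcongr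
  have heq : ∫ x in ε..(1 / 2 - ε), Complex.exp (v * Real.cos (2 * Real.pi * x)) =
      F (1 / 2 - ε) - F ε - ∫ x in ε..(1 / 2 - ε), H x := by
    rw [← hint]; ring
  rw [heq]
  refine (norm_sub_le _ _).trans ?_
  refine (add_le_add ((norm_sub_le _ _).trans (add_le_add (hFb _ ⟨hle, le_rfl⟩) (hFb _ ⟨le_rfl, hle⟩))) hHb).trans ?_
  have : 0 ≤ E / (‖v‖ * ε ^ 2) := by positivity
  have h9 : E * (1 / (‖v‖ * ε ^ 2)) = E / (‖v‖ * ε ^ 2) := mul_one_div _ _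
  linarith

/-- The interval is cut at distance ε = ‖v‖^(-1/3) from the stationary points 0, 1/2 and 1. Their
neighbourhoods have total length 4ε, and integration by parts costs ε/8 on each of the two remaining
intervals, because ‖v‖ε³ = 1. For ‖v‖ < 64 the trivial bound is enough, since 5 · 64^(-1/3) ≥ 1. The
exponent 1/3 is not optimal, but as many factors as needed are available. -/
theorem norm_bes_sq_le_rpow {v : ℂ} (hv : v ≠ 0) :
    ‖bes (v ^ 2)‖ ≤ 5 * Real.exp |v.re| * ‖v‖ ^ (-(1 / 3) : ℝ) := by
  have hv0 : 0 < ‖v‖ := norm_pos_iff.2 hv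
  rcases le_or_gt 64 ‖v‖ with h64 | h64
  swap
  · refine (norm_bes_sq_le_exp_abs v).trans ?_
    have h1 : (64 : ℝ) ^ (-(1 / 3) : ℝ) = 1 / 4 := by
      rw [show (64 : ℝ) = 4 ^ (3 : ℝ) by norm_num, ← Real.rpow_mul (by norm_num)]
      norm_num
    have h2 : (64 : ℝ) ^ (-(1 / 3) : ℝ) ≤ ‖v‖ ^ (-(1 / 3) : ℝ) :=
      Real.rpow_le_rpow_of_nonpos hv0 h64.le (by norm_num)
    rw [h1] at h2
    nlinarith [Real.exp_pos |v.re|]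
  set ε := ‖v‖ ^ (-(1 / 3) : ℝ) with hε
  have hε0 : 0 < ε := Real.rpow_pos_of_pos hv0 _
  have hε4 : ε ≤ 1 / 4 := by
    have h1 : (64 : ℝ) ^ (-(1 / 3) : ℝ) = 1 / 4 := by
      rw [show (64 : ℝ) = 4 ^ (3 : ℝ) by norm_num, ← Real.rpow_mul (by norm_num)]
      norm_num
    rw [← h1]
    exact Real.rpow_le_rpow_of_nonpos (by norm_num) h64 (by norm_num)
  have hcube : ‖v‖ * ε ^ 3 = 1 := by
    rw [hε, ← Real.rpow_natCast, ← Real.rpow_mul hv0.le]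
    norm_num
    rw [Real.rpow_neg_one, mul_inv_cancel₀ hv0.ne']
  have hinv : 1 / (‖v‖ * ε ^ 2) = ε := by
    rw [div_eq_iff (by positivity)]
    rw [← hcube]; ring
  set f : ℝ → ℂ := fun x => Complex.exp (v * Real.cos (2 * Real.pi * x)) with hf
  have hcf : Continuous f := by fun_prop
  have hi : ∀ a b, IntervalIntegrable f volume a b := fun a b => hcf.intervalIntegrable a b
  have hb : ∀ a b, ‖∫ x in a..b, f x‖ ≤ Real.exp |v.re| * |b - a| := fun a b =>
    intervalIntegral.norm_integral_le_of_norm_le_const fun x _ => norm_exp_mul_cos_le v _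
  have h3 : ‖∫ x in ε..(1 / 2 - ε), f x‖ ≤ Real.exp |v.re| * ε / 8 := by
    have := norm_integral_exp_cos_le hv hε0 hε4
    rwa [hinv] at this
  have hrefl : ∫ x in (1 / 2 + ε)..(1 - ε), f x = ∫ x in ε..(1 / 2 - ε), f x := by
    have h := intervalIntegral.integral_comp_sub_left (a := ε) (b := 1 / 2 - ε) f 1
    rw [show (1 : ℝ) - (1 / 2 - ε) = 1 / 2 + ε by ring] at h
    rw [← h]
    refine intervalIntegral.integral_congr fun x _ => ?_
    simp only [hf]
    rw [show 2 * Real.pi * (1 - x) = 2 * Real.pi - 2 * Real.pi * x by ring, Real.cos_two_pi_sub]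
  have hsplit : ∫ x in (0 : ℝ)..1, f x = (∫ x in (0 : ℝ)..ε, f x) + (∫ x in ε..(1 / 2 - ε), f x)
      + (∫ x in (1 / 2 - ε)..(1 / 2 + ε), f x) + (∫ x in (1 / 2 + ε)..(1 - ε), f x)
      + ∫ x in (1 - ε)..1, f x := by
    simp only [intervalIntegral.integral_add_adjacent_intervals (hi _ _) (hi _ _)]
  rw [bes_sq_eq, hsplit, hrefl]
  have e1 := hb 0 ε
  have e2 := hb (1 / 2 - ε) (1 / 2 + ε)
  have e3 := hb (1 - ε) 1
  rw [show ε - 0 = ε by ring, abs_of_pos hε0] at e1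
  rw [show 1 / 2 + ε - (1 / 2 - ε) = 2 * ε by ring, abs_of_pos (by linarith : 0 < 2 * ε)] at e2
  rw [show 1 - (1 - ε) = ε by ring, abs_of_pos hε0] at e3
  refine (norm_add_le _ _).trans ?_
  have n1 := norm_add_le (((∫ x in (0 : ℝ)..ε, f x) + (∫ x in ε..(1 / 2 - ε), f x))
      + (∫ x in (1 / 2 - ε)..(1 / 2 + ε), f x)) (∫ x in ε..(1 / 2 - ε), f x)
  have n2 := norm_add_le ((∫ x in (0 : ℝ)..ε, f x) + (∫ x in ε..(1 / 2 - ε), f x))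
      (∫ x in (1 / 2 - ε)..(1 / 2 + ε), f x)
  have n3 := norm_add_le (∫ x in (0 : ℝ)..ε, f x) (∫ x in ε..(1 / 2 - ε), f x)
  have : 0 ≤ Real.exp |v.re| * ε := by positivity
  nlinarith

/-! ### The infinite product of Bessel factors: convergence, analyticity and decay. -/

/-- The factor `I₀((n + α)^{-s} √κ)` of the moment generating function. -/
def mgfFactor (α : ℝ) (n : ℕ) (s κ : ℂ) : ℂ := bes ((((n : ℝ) + α : ℝ) : ℂ) ^ (-2 * s) * κ)

def mgfPartial (α : ℝ) (N : ℕ) (s κ : ℂ) : ℂ := ∏ n ∈ Finset.range N, mgfFactor α n s κ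

/-- The factors are written as one plus a summable perturbation, the form to which the convergence
criterion for products applies. -/
def mgf (α : ℝ) (s κ : ℂ) : ℂ := ∏' n, (1 + (mgfFactor α n s κ - 1))

theorem base_pos {α : ℝ} (hα : 0 < α) (n : ℕ) : 0 < (n : ℝ) + α := by positivity

theorem one_le_base_succ {α : ℝ} (hα : 0 < α) (n : ℕ) : 1 ≤ ((n + 1 : ℕ) : ℝ) + α := by
  push_cast; nlinarith [(Nat.cast_nonneg n : (0 : ℝ) ≤ n)]

/-- The base `n + α` can be below 1 when `n = 0`, so neither end of the range of σ dominates alone.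
-/
theorem rpow_neg_le_add {x a b σ : ℝ} (hx : 0 < x) (ha : a ≤ σ) (hb : σ ≤ b) :
    x ^ (-σ) ≤ x ^ (-a) + x ^ (-b) := by
  rcases le_total 1 x with h | h
  · exact (Real.rpow_le_rpow_of_exponent_le h (neg_le_neg ha)).trans
      (le_add_of_nonneg_right (Real.rpow_nonneg hx.le _))
  · exact (Real.rpow_le_rpow_of_exponent_ge hx h (neg_le_neg hb)).trans
      (le_add_of_nonneg_left (Real.rpow_nonneg hx.le _))

/-- A majorant of `(n + α)^{-σ} (1 + |log (n + α)|)` for `a ≤ σ ≤ b`. -/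
def baseBound (α a b : ℝ) (n : ℕ) : ℝ :=
  (((n : ℝ) + α) ^ (-a) + ((n : ℝ) + α) ^ (-b)) * (1 + |Real.log ((n : ℝ) + α)|)

theorem baseBound_nonneg {α : ℝ} (hα : 0 < α) (a b : ℝ) (n : ℕ) : 0 ≤ baseBound α a b n := by
  have := base_pos hα n
  unfold baseBound; positivity

theorem rpow_le_baseBound {α a b σ : ℝ} (hα : 0 < α) (ha : a ≤ σ) (hb : σ ≤ b) (n : ℕ) :
    ((n : ℝ) + α) ^ (-σ) ≤ baseBound α a b n := by
  have h := rpow_neg_le_add (base_pos hα n) ha hb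
  refine h.trans (le_mul_of_one_le_right ?_ (by linarith [abs_nonneg (Real.log ((n : ℝ) + α))]))
  have := base_pos hα n
  positivity

/-- The logarithm is absorbed by a power ε = (a - 1/2)/2, and 2(a - ε) > 1 remains. The shift by one
discards the term whose base may be below 1. -/
theorem summable_baseBound_sq {α a b : ℝ} (hα : 0 < α) (ha : 1 / 2 < a) (hab : a ≤ b) :
    Summable fun n => baseBound α a b n ^ 2 := by
  set ε := (a - 1 / 2) / 2 with hε
  have hε0 : 0 < ε := by linarith
  rw [← summable_nat_add_iff 1]
  have hs : Summable fun n : ℕ => (2 * (1 + 1 / ε)) ^ 2 * (1 / |((n + 1 : ℕ) : ℝ) + α| ^ (2 * (a - ε))) :=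
    (((summable_nat_add_iff (f := fun n : ℕ => 1 / |(n : ℝ) + α| ^ (2 * (a - ε))) 1).2
      ((Real.summable_one_div_nat_add_rpow α _).2 (by linarith)))).mul_left _
  refine Summable.of_nonneg_of_le (fun n => sq_nonneg _) (fun n => ?_) hs
  have h1 := one_le_base_succ hα n
  set x := ((n + 1 : ℕ) : ℝ) + α with hx
  have hx0 : 0 < x := by linarith
  have hb : baseBound α a b (n + 1) ≤ 2 * (1 + 1 / ε) * x ^ (-(a - ε)) := by
    rw [baseBound, ← hx, abs_of_nonneg (Real.log_nonneg h1)]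
    have e1 : x ^ (-b) ≤ x ^ (-a) := Real.rpow_le_rpow_of_exponent_le h1 (by linarith)
    have e2 : Real.log x ≤ x ^ ε / ε := Real.log_le_rpow_div hx0.le hε0
    have e3 : 1 ≤ x ^ ε := Real.one_le_rpow h1 hε0.le
    have e4 : x ^ (-(a - ε)) = x ^ (-a) * x ^ ε := by
      rw [← Real.rpow_add hx0]; congr 1; ring
    rw [e4]
    have e5 : 0 < x ^ (-a) := Real.rpow_pos_of_pos hx0 _
    have e6 : 1 + Real.log x ≤ (1 + 1 / ε) * x ^ ε := by
      rw [add_mul, one_mul, one_div_mul_eq_div]; linarith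
    calc (x ^ (-a) + x ^ (-b)) * (1 + Real.log x) ≤ (2 * x ^ (-a)) * ((1 + 1 / ε) * x ^ ε) := by
          gcongr
          · linarith [Real.log_nonneg h1]
          · linarith
      _ = _ := by ring
  calc baseBound α a b (n + 1) ^ 2 ≤ (2 * (1 + 1 / ε) * x ^ (-(a - ε))) ^ 2 := by
        gcongr
        exact baseBound_nonneg hα _ _ _
    _ = _ := by
        rw [mul_pow, abs_of_pos hx0]
        congr 1
        rw [← Real.rpow_natCast, ← Real.rpow_mul hx0.le, one_div, ← Real.rpow_neg hx0.le]
        congr 1; push_cast; ring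

theorem norm_base_cpow {α : ℝ} (hα : 0 < α) (n : ℕ) (s : ℂ) :
    ‖(((n : ℝ) + α : ℝ) : ℂ) ^ s‖ = ((n : ℝ) + α) ^ s.re :=
  Complex.norm_cpow_eq_rpow_re_of_pos (base_pos hα n) s

theorem base_cpow_neg_two_mul {α : ℝ} (hα : 0 < α) (n : ℕ) (s : ℂ) :
    (((n : ℝ) + α : ℝ) : ℂ) ^ (-2 * s) = ((((n : ℝ) + α : ℝ) : ℂ) ^ (-s)) ^ 2 := by
  have h : (((n : ℝ) + α : ℝ) : ℂ) ≠ 0 := by exact_mod_cast (base_pos hα n).ne'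
  rw [sq, ← Complex.cpow_add _ _ h]
  congr 1; ring

theorem norm_mgfFactor_sub_one_le {α a b : ℝ} (hα : 0 < α) {s κ : ℂ} (ha : a ≤ s.re)
    (hb : s.re ≤ b) (n : ℕ) {K : ℝ} (hK : ∀ n, baseBound α a b n ^ 2 ≤ K) :
    ‖mgfFactor α n s κ - 1‖ ≤ baseBound α a b n ^ 2 * (‖κ‖ * Real.exp (K * ‖κ‖)) := by
  have h1 : ‖(((n : ℝ) + α : ℝ) : ℂ) ^ (-2 * s) * κ‖ ≤ baseBound α a b n ^ 2 * ‖κ‖ := by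
    rw [norm_mul, base_cpow_neg_two_mul hα, norm_pow, norm_base_cpow hα]
    have := rpow_le_baseBound hα ha hb n
    gcongr
    exact this
  refine (norm_bes_sub_one_le _).trans ?_
  rw [← mul_assoc]
  gcongr
  exact h1.trans (mul_le_mul_of_nonneg_right (hK n) (norm_nonneg _))

theorem continuous_mgfFactor {α : ℝ} (hα : 0 < α) (n : ℕ) :
    Continuous fun p : ℂ × ℂ => mgfFactor α n p.1 p.2 := by
  have h : (((n : ℝ) + α : ℝ) : ℂ) ≠ 0 := by exact_mod_cast (base_pos hα n).ne'
  refine differentiable_bes.continuous.comp (Continuous.mul ?_ continuous_snd)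
  exact Continuous.const_cpow (by fun_prop) (Or.inl h)

theorem differentiable_mgfFactor {α : ℝ} (hα : 0 < α) (n : ℕ) (κ : ℂ) :
    Differentiable ℂ fun s => mgfFactor α n s κ := by
  have h : (((n : ℝ) + α : ℝ) : ℂ) ≠ 0 := by exact_mod_cast (base_pos hα n).ne'
  refine differentiable_bes.comp (Differentiable.mul_const ?_ κ)
  exact (differentiable_id.const_mul (-2 : ℂ)).const_cpow (Or.inl h)

theorem exists_baseBound_sq_le {α a b : ℝ} (hα : 0 < α) (ha : 1 / 2 < a) (hab : a ≤ b) :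
    ∃ K, 0 ≤ K ∧ ∀ n, baseBound α a b n ^ 2 ≤ K :=
  ⟨∑' n, baseBound α a b n ^ 2, tsum_nonneg fun _ => sq_nonneg _, fun n =>
    (summable_baseBound_sq hα ha hab).le_tsum n fun _ _ => sq_nonneg _⟩

theorem isOpen_strip (a b : ℝ) : IsOpen {q : ℂ | a < q.re ∧ q.re < b} := by
  have h1 : IsOpen {q : ℂ | a < q.re} := isOpen_lt continuous_const Complex.continuous_re
  have h2 : IsOpen {q : ℂ | q.re < b} := isOpen_lt Complex.continuous_re continuous_const
  exact h1.inter h2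

theorem isOpen_strip_prod_ball (a b R : ℝ) :
    IsOpen {p : ℂ × ℂ | a < p.1.re ∧ p.1.re < b ∧ ‖p.2‖ < R} := by
  have h1 : IsOpen {p : ℂ × ℂ | a < p.1.re ∧ p.1.re < b} :=
    (isOpen_strip a b).preimage continuous_fst
  have h2 : IsOpen {p : ℂ × ℂ | ‖p.2‖ < R} := isOpen_lt (by fun_prop) continuous_const
  convert! h1.inter h2 using 1
  ext p
  simp [and_assoc]

/-- Local uniformity jointly in `(s, κ)` yields both joint continuity and holomorphy in `s`. -/
theorem hasProdLocallyUniformlyOn_mgf {α a b R : ℝ} (hα : 0 < α) (ha : 1 / 2 < a) (hab : a ≤ b) :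
    HasProdLocallyUniformlyOn (fun n (p : ℂ × ℂ) => 1 + (mgfFactor α n p.1 p.2 - 1))
      (fun p => mgf α p.1 p.2) {p : ℂ × ℂ | a < p.1.re ∧ p.1.re < b ∧ ‖p.2‖ < R} := by
  obtain ⟨K, hK0, hK⟩ := exists_baseBound_sq_le hα ha hab
  refine Summable.hasProdLocallyUniformlyOn_nat_one_add ?_
    ((summable_baseBound_sq hα ha hab).mul_right (R * Real.exp (K * R))) ?_ ?_
  · exact isOpen_strip_prod_ball a b R
  · refine Eventually.of_forall fun n p hp => ?_
    refine (norm_mgfFactor_sub_one_le hα hp.1.le hp.2.1.le n hK).trans ?_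
    have := hp.2.2.le
    have h0 : 0 ≤ R := (norm_nonneg _).trans this
    gcongr
  · exact fun n => ((continuous_mgfFactor hα n).sub continuous_const).continuousOn

theorem tendstoLocallyUniformlyOn_mgfPartial {α a b R : ℝ} (hα : 0 < α) (ha : 1 / 2 < a)
    (hab : a ≤ b) :
    TendstoLocallyUniformlyOn (fun N (p : ℂ × ℂ) => mgfPartial α N p.1 p.2)
      (fun p => mgf α p.1 p.2) atTop {p : ℂ × ℂ | a < p.1.re ∧ p.1.re < b ∧ ‖p.2‖ < R} := by
  have h := hasProdLocallyUniformlyOn_iff_tendstoLocallyUniformlyOn.1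
    (hasProdLocallyUniformlyOn_mgf (R := R) hα ha hab)
  intro u hu x hx
  obtain ⟨t, ht, he⟩ := h u hu x hx
  refine ⟨t, ht, (tendsto_finset_range.eventually he).mono fun N hN y hy => ?_⟩
  have := hN y hy
  simpa [mgfPartial] using this

theorem mem_mgf_region {s κ : ℂ} (hs : 1 / 2 < s.re) :
    (s, κ) ∈ {p : ℂ × ℂ | (s.re + 1 / 2) / 2 < p.1.re ∧ p.1.re < s.re + 1 ∧ ‖p.2‖ < ‖κ‖ + 1} :=
  ⟨by simp only; linarith, by simp, by simp⟩

theorem tendsto_mgfPartial {α : ℝ} (hα : 0 < α) {s : ℂ} (hs : 1 / 2 < s.re) (κ : ℂ) :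
    Tendsto (fun N => mgfPartial α N s κ) atTop (𝓝 (mgf α s κ)) := by
  have h := tendstoLocallyUniformlyOn_mgfPartial hα (a := (s.re + 1 / 2) / 2) (b := s.re + 1)
    (R := ‖κ‖ + 1) (by linarith) (by linarith)
  have h2 := h.tendsto_at (mem_mgf_region (κ := κ) hs)
  exact h2

theorem continuousOn_mgf {α : ℝ} (hα : 0 < α) :
    ContinuousOn (fun p : ℂ × ℂ => mgf α p.1 p.2) {p | 1 / 2 < p.1.re} := by
  intro p hp
  have hop : IsOpen {q : ℂ × ℂ | (p.1.re + 1 / 2) / 2 < q.1.re ∧ q.1.re < p.1.re + 1 ∧ ‖q.2‖ < ‖p.2‖ + 1} :=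
    isOpen_strip_prod_ball _ _ _
  have hp' : 1 / 2 < p.1.re := hp
  have h := (tendstoLocallyUniformlyOn_mgfPartial hα (a := (p.1.re + 1 / 2) / 2)
    (b := p.1.re + 1) (R := ‖p.2‖ + 1) (by linarith) (by linarith)).continuousOn
    (Frequently.of_forall fun N => Continuous.continuousOn
      (continuous_finsetProd _ fun n _ => continuous_mgfFactor hα n))
  exact (h.continuousAt (hop.mem_nhds (mem_mgf_region hp'))).continuousWithinAt

theorem differentiableOn_mgf {α : ℝ} (hα : 0 < α) (κ : ℂ) :
    DifferentiableOn ℂ (fun s => mgf α s κ) {s | 1 / 2 < s.re} := by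
  intro s hs
  have hs' : 1 / 2 < s.re := hs
  set O : Set ℂ := {q : ℂ | (s.re + 1 / 2) / 2 < q.re ∧ q.re < s.re + 1}
  have hop : IsOpen O := isOpen_strip _ _
  have h := tendstoLocallyUniformlyOn_mgfPartial hα (a := (s.re + 1 / 2) / 2)
    (b := s.re + 1) (R := ‖κ‖ + 1) (by linarith) (by linarith)
  have h2 : TendstoLocallyUniformlyOn (fun N (q : ℂ) => mgfPartial α N q κ)
      (fun q => mgf α q κ) atTop O := by
    have := h.comp (t := O) (fun q : ℂ => (q, κ)) (fun q hq => ⟨hq.1, hq.2, by simp⟩)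
      (Continuous.continuousOn (by fun_prop))
    exact this
  have h3 := h2.differentiableOn (Eventually.of_forall fun N => Differentiable.differentiableOn
    (by
      unfold mgfPartial
      exact Differentiable.fun_finsetProd fun n _ => differentiable_mgfFactor hα n κ)) hop
  exact (h3.differentiableAt (hop.mem_nhds ⟨by linarith, by linarith⟩)).differentiableWithinAt

/-- The real part of `(n + α)^{-s} v` is under control near the real axis. -/
theorem abs_re_base_cpow_mul_le {α a b : ℝ} (hα : 0 < α) {s v : ℂ} (ha : a ≤ s.re) (hb : s.re ≤ b)
    (hv : |v.re| ≤ 1) (him : |s.im| * (1 + ‖v‖) ≤ 1) (n : ℕ) :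
    |((((n : ℝ) + α : ℝ) : ℂ) ^ (-s) * v).re| ≤ baseBound α a b n := by
  have hx := base_pos hα n
  set x := (n : ℝ) + α with hxdef
  have h1 : ((x : ℂ) ^ (-s) * v).re = x ^ (-s.re) *
      (v.re * Real.cos (s.im * Real.log x) + v.im * Real.sin (s.im * Real.log x)) := by
    have e : -s = ((-s.re : ℝ) : ℂ) + ((-s.im : ℝ) : ℂ) * Complex.I := by
      apply Complex.ext <;> simp
    rw [e, Complex.cpow_add _ _ (by exact_mod_cast hx.ne'), ← Complex.ofReal_cpow hx.le, mul_assoc,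
      Complex.re_ofReal_mul]
    congr 1
    rw [Complex.cpow_def_of_ne_zero (by exact_mod_cast hx.ne'), ← Complex.ofReal_log hx.le,
      show ((Real.log x : ℝ) : ℂ) * (((-s.im : ℝ) : ℂ) * Complex.I)
        = ((-(s.im * Real.log x) : ℝ) : ℂ) * Complex.I by push_cast; ring, Complex.mul_re,
      Complex.exp_ofReal_mul_I_re, Complex.exp_ofReal_mul_I_im, Real.cos_neg, Real.sin_neg]
    ring
  rw [h1, abs_mul, abs_of_pos (Real.rpow_pos_of_pos hx _), baseBound, ← hxdef]
  -- The dangerous term is `v.im` times the sine. It is at most ‖v‖ |Im s| |log x| in size, and the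
  -- constraint on `s.im` reduces this to |log x|; this is why `baseBound` carries a logarithm.
  have h2 : |v.re * Real.cos (s.im * Real.log x) + v.im * Real.sin (s.im * Real.log x)|
      ≤ 1 + |Real.log x| := by
    refine (abs_add_le _ _).trans (add_le_add ?_ ?_)
    · rw [abs_mul]
      exact mul_le_one₀ hv (abs_nonneg _) (Real.abs_cos_le_one _)
    · rw [abs_mul]
      have e1 : |Real.sin (s.im * Real.log x)| ≤ |s.im| * |Real.log x| := by
        rw [← abs_mul]; exact Real.abs_sin_le_abs
      have e2 : |v.im| ≤ 1 + ‖v‖ := (Complex.abs_im_le_norm v).trans (by linarith)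
      calc |v.im| * |Real.sin (s.im * Real.log x)| ≤ (1 + ‖v‖) * (|s.im| * |Real.log x|) := by gcongr
        _ = (|s.im| * (1 + ‖v‖)) * |Real.log x| := by ring
        _ ≤ 1 * |Real.log x| := by gcongr
        _ = _ := one_mul _
  have := rpow_neg_le_add hx ha hb
  gcongr

theorem mgfFactor_sq {α : ℝ} (hα : 0 < α) (n : ℕ) (s v : ℂ) :
    mgfFactor α n s (v ^ 2) = bes (((((n : ℝ) + α : ℝ) : ℂ) ^ (-s) * v) ^ 2) := by
  rw [mgfFactor, base_cpow_neg_two_mul hα, mul_pow]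

/-- Twenty-four factors decay like ‖v‖^(-1/3), together ‖v‖^(-8). The remaining ones have Gaussian
bounds whose exponents add up to at most S/4. Complex `s` is allowed in a region that shrinks like
1/‖v‖ around the real axis, which is enough room for Cauchy's estimates. -/
theorem exists_norm_mgfPartial_le {α a b : ℝ} (hα : 0 < α) (ha : 1 / 2 < a) (hab : a ≤ b) :
    ∃ C, 0 < C ∧ ∀ N, 24 ≤ N → ∀ s v : ℂ, a ≤ s.re → s.re ≤ b → |v.re| ≤ 1 →
      |s.im| * (1 + ‖v‖) ≤ 1 → ‖mgfPartial α N s (v ^ 2)‖ ≤ C * ((1 + ‖v‖) ^ 8)⁻¹ := by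
  set G := baseBound α a b with hG
  set S := ∑' n, G n ^ 2 with hS
  have hsum := summable_baseBound_sq hα ha hab
  set D : ℕ → ℝ := fun n => 5 * Real.exp (G n) * (1 + ((n : ℝ) + α)) ^ b with hD
  have hD0 : ∀ n, 0 < D n := fun n => by
    have := base_pos hα n
    simp only [hD]; positivity
  set P := ∏ n ∈ Finset.range 24, D n with hP
  have hP0 : 0 < P := Finset.prod_pos fun n _ => hD0 n
  -- 256 = 2⁸ is the cost of passing from ‖v‖ to 1 + ‖v‖ when ‖v‖ ≥ 1, and also bounds (1 + ‖v‖)⁸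
  -- when ‖v‖ ≤ 1.
  refine ⟨256 * (P + 1) * Real.exp (S / 4), by positivity, ?_⟩
  intro N hN s v h1 h2 h3 h4
  have hGn := abs_re_base_cpow_mul_le hα h1 h2 h3 h4
  have hf1 : ∀ n, ‖mgfFactor α n s (v ^ 2)‖ ≤ Real.exp (G n ^ 2 / 4) := by
    intro n
    rw [mgfFactor_sq hα]
    refine (norm_bes_sq_le _).trans (Real.exp_le_exp.2 ?_)
    have := hGn n
    have := sq_le_sq' (by linarith [neg_abs_le ((((((n : ℝ) + α : ℝ) : ℂ) ^ (-s) * v).re))])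
      ((le_abs_self _).trans this)
    linarith
  have hprod : ∀ A : Finset ℕ, ∏ n ∈ A, ‖mgfFactor α n s (v ^ 2)‖ ≤ Real.exp (S / 4) := by
    intro A
    refine (Finset.prod_le_prod (fun _ _ => norm_nonneg _) fun n _ => hf1 n).trans ?_
    rw [← Real.exp_sum]
    refine Real.exp_le_exp.2 ?_
    rw [← Finset.sum_div]
    have : ∑ i ∈ A, G i ^ 2 ≤ S := hsum.sum_le_tsum A fun i _ => sq_nonneg _
    linarith
  rw [mgfPartial, norm_prod]
  have hE := Real.exp_pos (S / 4)
  rcases le_total ‖v‖ 1 with hv | hv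
  · refine (hprod _).trans ?_
    rw [← div_eq_mul_inv, le_div_iff₀ (by positivity)]
    have : (1 + ‖v‖) ^ 8 ≤ 2 ^ 8 := by gcongr; linarith
    calc Real.exp (S / 4) * (1 + ‖v‖) ^ 8 ≤ Real.exp (S / 4) * 2 ^ 8 := by gcongr
      _ ≤ 256 * (P + 1) * Real.exp (S / 4) := by nlinarith
  · have hv0 : 0 < ‖v‖ := by linarith
    have hf2 : ∀ n, ‖mgfFactor α n s (v ^ 2)‖ ≤ D n * ‖v‖ ^ (-(1 / 3) : ℝ) := by
      intro n
      have hx := base_pos hα n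
      rw [mgfFactor_sq hα]
      have hne : (((n : ℝ) + α : ℝ) : ℂ) ^ (-s) * v ≠ 0 := by
        refine mul_ne_zero ?_ (norm_pos_iff.1 hv0)
        rw [Complex.cpow_ne_zero_iff]; left; exact_mod_cast hx.ne'
      refine (norm_bes_sq_le_rpow hne).trans ?_
      rw [norm_mul, norm_base_cpow hα, Complex.neg_re,
        Real.mul_rpow (Real.rpow_nonneg hx.le _) hv0.le, ← Real.rpow_mul hx.le, ← mul_assoc]
      simp only [hD]
      have e1 : ((n : ℝ) + α) ^ (-s.re * -(1 / 3)) ≤ (1 + ((n : ℝ) + α)) ^ b := by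
        calc ((n : ℝ) + α) ^ (-s.re * -(1 / 3)) ≤ (1 + ((n : ℝ) + α)) ^ (-s.re * -(1 / 3)) :=
              Real.rpow_le_rpow hx.le (by linarith) (by linarith)
          _ ≤ _ := Real.rpow_le_rpow_of_exponent_le (by linarith) (by linarith)
      have := hGn n
      gcongr
    have hsplit : ∏ n ∈ Finset.range N, ‖mgfFactor α n s (v ^ 2)‖ =
        (∏ n ∈ Finset.range 24, ‖mgfFactor α n s (v ^ 2)‖) *
          ∏ n ∈ Finset.Ico 24 N, ‖mgfFactor α n s (v ^ 2)‖ :=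
      (Finset.prod_range_mul_prod_Ico _ hN).symm
    rw [hsplit]
    have h24 : ∏ n ∈ Finset.range 24, ‖mgfFactor α n s (v ^ 2)‖ ≤ P * (‖v‖ ^ 8)⁻¹ := by
      refine (Finset.prod_le_prod (fun _ _ => norm_nonneg _) fun n _ => hf2 n).trans_eq ?_
      rw [Finset.prod_mul_distrib, Finset.prod_const, Finset.card_range, ← Real.rpow_natCast,
        ← Real.rpow_mul hv0.le]
      congr 1
      rw [← Real.rpow_natCast, ← Real.rpow_neg hv0.le]
      norm_num
    have h256 : (‖v‖ ^ 8)⁻¹ ≤ 256 * ((1 + ‖v‖) ^ 8)⁻¹ := by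
      rw [← div_eq_mul_inv, inv_eq_one_div, div_le_div_iff₀ (by positivity) (by positivity), one_mul]
      calc (1 + ‖v‖) ^ 8 ≤ (2 * ‖v‖) ^ 8 := by gcongr; linarith
        _ = 256 * ‖v‖ ^ 8 := by ring
    calc _ ≤ P * (‖v‖ ^ 8)⁻¹ * Real.exp (S / 4) := by
          gcongr
          exact hprod _
      _ ≤ (P + 1) * (256 * ((1 + ‖v‖) ^ 8)⁻¹) * Real.exp (S / 4) := by gcongr; linarith
      _ = _ := by ring

theorem exists_norm_mgf_le {α a b : ℝ} (hα : 0 < α) (ha : 1 / 2 < a) (hab : a ≤ b) :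
    ∃ C, 0 < C ∧ (∀ N, 24 ≤ N → ∀ s v : ℂ, a ≤ s.re → s.re ≤ b → |v.re| ≤ 1 →
      |s.im| * (1 + ‖v‖) ≤ 1 → ‖mgfPartial α N s (v ^ 2)‖ ≤ C * ((1 + ‖v‖) ^ 8)⁻¹) ∧
      ∀ s v : ℂ, a ≤ s.re → s.re ≤ b → |v.re| ≤ 1 →
      |s.im| * (1 + ‖v‖) ≤ 1 → ‖mgf α s (v ^ 2)‖ ≤ C * ((1 + ‖v‖) ^ 8)⁻¹ := by
  obtain ⟨C, hC, h⟩ := exists_norm_mgfPartial_le hα ha hab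
  refine ⟨C, hC, h, fun s v h1 h2 h3 h4 => ?_⟩
  exact le_of_tendsto (tendsto_mgfPartial hα (by linarith) (v ^ 2)).norm
    ((eventually_ge_atTop 24).mono fun N hN => h N hN s v h1 h2 h3 h4)

/-- Cauchy's estimate on a disc of radius d/(1 + ‖v‖), on which the previous bound holds. Three
derivatives cost three of the eight powers of decay; the remaining exponent 5 is still integrable
over the plane. -/
theorem exists_norm_iteratedDeriv_mgf_le {α a b : ℝ} (hα : 0 < α) (ha : 1 / 2 < a) (hab : a ≤ b) :
    ∃ C, 0 < C ∧ ∀ j ≤ 3, ∀ (σ : ℝ) (v : ℂ), a ≤ σ → σ ≤ b → |v.re| ≤ 1 →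
      ‖iteratedDeriv j (fun s => mgf α s (v ^ 2)) σ‖ ≤ C * ((1 + ‖v‖) ^ 5)⁻¹ := by
  set d := min 1 ((a - 1 / 2) / 2) with hd
  have hd0 : 0 < d := lt_min one_pos (by linarith)
  have hd1 : d ≤ 1 := min_le_left _ _
  have hd2 : d ≤ (a - 1 / 2) / 2 := min_le_right _ _
  obtain ⟨C, hC, -, h⟩ := exists_norm_mgf_le hα (a := a - d) (b := b + d) (by linarith) (by linarith)
  refine ⟨6 * C / d ^ 3, by positivity, fun j hj σ v h1 h2 h3 => ?_⟩
  set V := 1 + ‖v‖ with hV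
  have hV1 : 1 ≤ V := by simp [hV]
  set R := d / V with hR
  have hR0 : 0 < R := by positivity
  have hRd : R ≤ d := div_le_self hd0.le hV1
  have hRe : ∀ z ∈ Metric.closedBall (σ : ℂ) R, |z.re - σ| ≤ R ∧ |z.im| ≤ R := by
    intro z hz
    rw [mem_closedBall_iff_norm] at hz
    have e1 := (Complex.abs_re_le_norm (z - σ)).trans hz
    have e2 := (Complex.abs_im_le_norm (z - σ)).trans hz
    simp at e1 e2
    exact ⟨e1, e2⟩
  have hdiff : DiffContOnCl ℂ (fun s => mgf α s (v ^ 2)) (Metric.ball (σ : ℂ) R) := by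
    refine DifferentiableOn.diffContOnCl ?_
    rw [closure_ball _ hR0.ne']
    refine (differentiableOn_mgf hα (v ^ 2)).mono fun z hz => ?_
    have := abs_le.1 (hRe z hz).1
    simp only [mem_ofPred_eq]
    linarith
  have hb := Complex.norm_iteratedDeriv_le_of_forall_mem_sphere_norm_le (C := C * (V ^ 8)⁻¹) j hR0 hdiff ?_
  · refine hb.trans ?_
    have hj2 : (j.factorial : ℝ) ≤ 6 := by
      interval_cases j <;> norm_num [Nat.factorial]
    -- As `R ≤ 1`, the worst case is `j = 3`.
    have hRj : d ^ 3 / V ^ 3 ≤ R ^ j := by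
      rw [← div_pow]
      exact pow_le_pow_of_le_one hR0.le (hRd.trans hd1) hj
    calc (j.factorial : ℝ) * (C * (V ^ 8)⁻¹) / R ^ j ≤ 6 * (C * (V ^ 8)⁻¹) / (d ^ 3 / V ^ 3) := by
          gcongr
      _ = _ := by field_simp
  · intro z hz
    have hz' := hRe z (Metric.sphere_subset_closedBall hz)
    have e1 := abs_le.1 hz'.1
    refine h z v (by linarith) (by linarith) h3 ?_
    calc |z.im| * V ≤ R * V := by gcongr; exact hz'.2
      _ = d := by rw [hR]; field_simp
      _ ≤ 1 := hd1

/-! ### Fourier inversion for finite measures on the plane. -/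

/-- The Fourier transform of a measure, in the normalization of `𝓕`. -/
def measFT (ν : Measure ℂ) (w : ℂ) : ℂ :=
  ∫ x, Complex.exp (((-2 * Real.pi * inner ℝ x w : ℝ) : ℂ) * Complex.I) ∂ν

theorem measFT_eq_charFun (ν : Measure ℂ) (w : ℂ) :
    measFT ν w = charFun ν ((-2 * Real.pi : ℝ) • w) := by
  rw [measFT, charFun_apply]
  simp only [inner_smul_right]

/-- Fubini for a kernel of modulus one: the multiplication formula of Fourier analysis, with
measures allowed on both sides. -/
theorem integral_mul_phase_swap {μ ν : Measure ℂ} [SFinite μ] [SFinite ν] {f g : ℂ → ℂ}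
    (hf : Integrable f μ) (hg : Integrable g ν) {p : ℂ × ℂ → ℝ} (hp : Continuous p) :
    ∫ x, f x * ∫ w, g w * Complex.exp ((p (x, w) : ℂ) * Complex.I) ∂ν ∂μ =
      ∫ w, g w * ∫ x, f x * Complex.exp ((p (x, w) : ℂ) * Complex.I) ∂μ ∂ν := by
  have h : Integrable (Function.uncurry fun x w =>
      f x * (g w * Complex.exp ((p (x, w) : ℂ) * Complex.I))) (μ.prod ν) := by
    have h1 := (hf.mul_prod hg).mul_bdd (c := 1) (f := fun z : ℂ × ℂ => f z.1 * g z.2)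
      (g := fun z : ℂ × ℂ => Complex.exp ((p z : ℂ) * Complex.I))
      (by fun_prop) (Eventually.of_forall fun z => (Complex.norm_exp_ofReal_mul_I _).le)
    refine h1.congr (Eventually.of_forall fun z => ?_)
    simp only [Function.uncurry, mul_assoc]
  have := integral_integral_swap h
  simp only [integral_const_mul] at this
  rw [this]
  refine integral_congr_ae (Eventually.of_forall fun w => ?_)
  simp only
  rw [← integral_const_mul]
  refine integral_congr_ae (Eventually.of_forall fun x => ?_)
  simp only
  ring

theorem integrable_gaussian_complex {b : ℝ} (hb : 0 < b) :
    Integrable fun w : ℂ => Complex.exp (-(b : ℂ) * ‖w‖ ^ 2) := by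
  simpa using GaussianFourier.integrable_cexp_neg_mul_sq_norm_add (V := ℂ) (b := (b : ℂ))
    (by simpa using hb) 0 0

theorem integral_gaussian_phase {b : ℝ} (hb : 0 < b) (x z : ℂ) :
    ∫ w : ℂ, Complex.exp (-(b : ℂ) * ‖w‖ ^ 2) *
      Complex.exp (((2 * Real.pi * inner ℝ z w - 2 * Real.pi * inner ℝ x w : ℝ) : ℂ) * Complex.I) =
      ((Real.pi / b * Real.exp (-(Real.pi ^ 2 / b) * ‖x - z‖ ^ 2) : ℝ) : ℂ) := by
  have h := fourier_gaussian_innerProductSpace (V := ℂ) (b := (b : ℂ)) (by simpa using hb) (x - z)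
  rw [Real.fourier_eq'] at h
  simp only [Complex.finrank_real_complex, Nat.cast_ofNat, div_self (two_ne_zero' ℂ),
    Complex.cpow_one, smul_eq_mul] at h
  push_cast
  rw [show (-((Real.pi : ℂ) ^ 2 / b) * (‖x - z‖ : ℂ) ^ 2) = -(Real.pi : ℂ) ^ 2 * ‖x - z‖ ^ 2 / b by
    ring, ← h]
  refine integral_congr_ae (Eventually.of_forall fun w => ?_)
  simp only
  rw [mul_comm, inner_sub_right, real_inner_comm x w, real_inner_comm z w]
  congr 2
  push_cast
  ring

/-- The damped inversion integral is an average of positive Gaussians under `ν`. Both the positivity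
and the integrability of the inverse transform come from this identity. -/
theorem integral_gaussian_mul_measFT {ν : Measure ℂ} [IsFiniteMeasure ν] {b : ℝ} (hb : 0 < b)
    (z : ℂ) :
    ∫ w : ℂ, Complex.exp (-(b : ℂ) * ‖w‖ ^ 2) *
      (Complex.exp (((2 * Real.pi * inner ℝ z w : ℝ) : ℂ) * Complex.I) * measFT ν w) =
      ((∫ x, Real.pi / b * Real.exp (-(Real.pi ^ 2 / b) * ‖x - z‖ ^ 2) ∂ν : ℝ) : ℂ) := by
  have h := integral_mul_phase_swap (μ := ν) (ν := volume) (f := fun _ => (1 : ℂ))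
    (integrable_const _) (integrable_gaussian_complex hb)
    (p := fun q => 2 * Real.pi * inner ℝ z q.2 - 2 * Real.pi * inner ℝ q.1 q.2) (by fun_prop)
  simp only [integral_gaussian_phase hb, one_mul] at h
  rw [← integral_complex_ofReal, h]
  refine integral_congr_ae (Eventually.of_forall fun w => ?_)
  simp only [measFT]
  rw [← integral_const_mul]
  congr 1
  refine integral_congr_ae (Eventually.of_forall fun x => ?_)
  simp only
  rw [← Complex.exp_add]
  congr 1
  push_cast
  ring

theorem norm_measFT_le (ν : Measure ℂ) [IsFiniteMeasure ν] (w : ℂ) : ‖measFT ν w‖ ≤ ν.real univ := by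
  refine (norm_integral_le_of_norm_le_const (C := 1) (Eventually.of_forall fun x => ?_)).trans
    (by simp)
  exact (Complex.norm_exp_ofReal_mul_I _).le

theorem continuous_measFT (ν : Measure ℂ) [IsFiniteMeasure ν] : Continuous (measFT ν) := by
  have : measFT ν = fun w => charFun ν ((-2 * Real.pi : ℝ) • w) := funext (measFT_eq_charFun ν)
  rw [this]
  exact continuous_charFun.comp (continuous_const_smul _)

theorem continuous_fourierInv {h : ℂ → ℂ} (hh : Integrable h) : Continuous (𝓕⁻ h) := by
  have e : 𝓕⁻ h = fun z => ∫ w, Complex.exp (((2 * Real.pi * inner ℝ w z : ℝ) : ℂ) * Complex.I) • h w :=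
    funext fun z => Real.fourierInv_eq' h z
  rw [e]
  refine continuous_of_dominated (bound := fun w => ‖h w‖) (fun z => ?_) (fun z => ?_) hh.norm ?_
  · have hc : Continuous fun w : ℂ =>
        Complex.exp (((2 * Real.pi * inner ℝ w z : ℝ) : ℂ) * Complex.I) := by fun_prop
    exact hc.aestronglyMeasurable.smul hh.1
  · refine Eventually.of_forall fun w => ?_
    rw [norm_smul, Complex.norm_exp_ofReal_mul_I, one_mul]
  · exact Eventually.of_forall fun w => by fun_prop

/-- For every `b > 0` the damped inversion integral is a nonnegative real number. It tends to the
inversion integral as `b → 0` by dominated convergence. -/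
theorem exists_nonneg_fourierInv {ν : Measure ℂ} [IsFiniteMeasure ν] (hν : Integrable (measFT ν))
    (z : ℂ) : ∃ r : ℝ, 0 ≤ r ∧ 𝓕⁻ (measFT ν) z = r := by
  set I : ℝ → ℂ := fun b => ∫ w : ℂ, Complex.exp (-(b : ℂ) * ‖w‖ ^ 2) *
      (Complex.exp (((2 * Real.pi * inner ℝ z w : ℝ) : ℂ) * Complex.I) * measFT ν w) with hI
  have hlim : Tendsto I (𝓝[>] 0) (𝓝 (𝓕⁻ (measFT ν) z)) := by
    have e : 𝓕⁻ (measFT ν) z = ∫ w : ℂ, Complex.exp (-((0 : ℝ) : ℂ) * ‖w‖ ^ 2) *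
      (Complex.exp (((2 * Real.pi * inner ℝ z w : ℝ) : ℂ) * Complex.I) * measFT ν w) := by
      rw [Real.fourierInv_eq']
      refine integral_congr_ae (Eventually.of_forall fun w => ?_)
      simp [real_inner_comm]
    rw [e]
    refine tendsto_integral_filter_of_dominated_convergence (fun w => ‖measFT ν w‖) ?_ ?_ hν.norm ?_
    · refine Eventually.of_forall fun b => ?_
      exact AEStronglyMeasurable.mul (Continuous.aestronglyMeasurable (by fun_prop))
        (AEStronglyMeasurable.mul (Continuous.aestronglyMeasurable (by fun_prop)) hν.1)
    · filter_upwards [self_mem_nhdsWithin] with b hb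
      refine Eventually.of_forall fun w => ?_
      rw [norm_mul, norm_mul, Complex.norm_exp_ofReal_mul_I, one_mul]
      refine mul_le_of_le_one_left (norm_nonneg _) ?_
      rw [Complex.norm_exp, Real.exp_le_one_iff]
      have : (-(b : ℂ) * (‖w‖ : ℂ) ^ 2).re = -b * ‖w‖ ^ 2 := by norm_cast
      rw [this]
      have hb0 : 0 < b := hb
      nlinarith [sq_nonneg ‖w‖, mul_nonneg hb0.le (sq_nonneg ‖w‖)]
    · refine Eventually.of_forall fun w => ?_
      have : Continuous fun b : ℝ => Complex.exp (-(b : ℂ) * ‖w‖ ^ 2) *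
        (Complex.exp (((2 * Real.pi * inner ℝ z w : ℝ) : ℂ) * Complex.I) * measFT ν w) := by fun_prop
      exact (this.tendsto 0).mono_left nhdsWithin_le_nhds
  have hcl : IsClosed {c : ℂ | 0 ≤ c.re ∧ c.im = 0} := by
    have h1 : IsClosed {c : ℂ | 0 ≤ c.re} := isClosed_le continuous_const Complex.continuous_re
    have h2 : IsClosed {c : ℂ | c.im = 0} := isClosed_eq Complex.continuous_im continuous_const
    exact h1.inter h2
  have hmem : 𝓕⁻ (measFT ν) z ∈ {c : ℂ | 0 ≤ c.re ∧ c.im = 0} := by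
    refine hcl.mem_of_tendsto hlim ?_
    filter_upwards [self_mem_nhdsWithin] with b hb
    simp only [hI]
    rw [integral_gaussian_mul_measFT hb]
    refine ⟨?_, Complex.ofReal_im _⟩
    rw [Complex.ofReal_re]
    have hb0 : 0 < b := hb
    exact integral_nonneg fun x => by positivity
  exact ⟨_, hmem.1, Complex.ext rfl (by simpa using hmem.2)⟩

/-- Tested against exp (-c‖x‖²), the inverse transform has integral at most the total mass of `ν`,
for every `c > 0`; positivity turns this into integrability. -/
theorem integrable_fourierInv_measFT {ν : Measure ℂ} [IsFiniteMeasure ν]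
    (hν : Integrable (measFT ν)) : Integrable fun z => (𝓕⁻ (measFT ν) z).re := by
  set g : ℂ → ℝ := fun z => (𝓕⁻ (measFT ν) z).re with hg
  have hg0 : ∀ z, 0 ≤ g z := fun z => by
    obtain ⟨r, hr, h⟩ := exists_nonneg_fourierInv hν z
    simp only [hg, h, Complex.ofReal_re, hr]
  have hgc : ∀ z, 𝓕⁻ (measFT ν) z = (g z : ℂ) := fun z => by
    obtain ⟨r, hr, h⟩ := exists_nonneg_fourierInv hν z
    simp only [hg, h, Complex.ofReal_re]
  have hcont : Continuous g := Complex.continuous_re.comp (continuous_fourierInv hν)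
  have key : ∀ c : ℝ, 0 < c → ∫ x : ℂ, Real.exp (-c * ‖x‖ ^ 2) * g x ≤ ν.real univ := by
    intro c hc
    have h1 := integral_mul_phase_swap (μ := volume) (ν := volume) (integrable_gaussian_complex hc) hν
      (p := fun q => 2 * Real.pi * inner ℝ q.2 q.1) (by fun_prop)
    have hL : ∀ x, ∫ w, measFT ν w * Complex.exp (((2 * Real.pi * inner ℝ w x : ℝ) : ℂ) * Complex.I)
        = (g x : ℂ) := by
      intro x
      rw [← hgc, Real.fourierInv_eq']
      simp only [smul_eq_mul, mul_comm]
    have hR : ∀ w, ∫ x : ℂ, Complex.exp (-(c : ℂ) * ‖x‖ ^ 2) *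
        Complex.exp (((2 * Real.pi * inner ℝ w x : ℝ) : ℂ) * Complex.I) =
        ((Real.pi / c * Real.exp (-(Real.pi ^ 2 / c) * ‖w‖ ^ 2) : ℝ) : ℂ) := by
      intro w
      have := integral_gaussian_phase hc 0 w
      simpa using this
    simp only [hL, hR] at h1
    have hc2 : 0 < Real.pi ^ 2 / c := by positivity
    have h2 := integral_gaussian_mul_measFT (ν := ν) hc2 0
    have h3 : ∫ w, measFT ν w * ((Real.pi / c * Real.exp (-(Real.pi ^ 2 / c) * ‖w‖ ^ 2) : ℝ) : ℂ) =
        ((Real.pi / c : ℝ) : ℂ) * ∫ w : ℂ, Complex.exp (-((Real.pi ^ 2 / c : ℝ) : ℂ) * ‖w‖ ^ 2) *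
      (Complex.exp (((2 * Real.pi * inner ℝ (0 : ℂ) w : ℝ) : ℂ) * Complex.I) * measFT ν w) := by
      rw [← integral_const_mul]
      refine integral_congr_ae (Eventually.of_forall fun w => ?_)
      simp only [inner_zero_left, mul_zero, Complex.ofReal_zero, zero_mul, Complex.exp_zero, one_mul]
      push_cast
      ring
    rw [h3, h2] at h1
    have h4 : ∫ x : ℂ, Real.exp (-c * ‖x‖ ^ 2) * g x =
        Real.pi / c * ∫ x, Real.pi / (Real.pi ^ 2 / c) *
          Real.exp (-(Real.pi ^ 2 / (Real.pi ^ 2 / c)) * ‖x - 0‖ ^ 2) ∂ν := by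
      have h5 : ((∫ x : ℂ, Real.exp (-c * ‖x‖ ^ 2) * g x : ℝ) : ℂ) =
        ∫ x : ℂ, Complex.exp (-(c : ℂ) * ‖x‖ ^ 2) * (g x : ℂ) := by
        rw [← integral_complex_ofReal]
        push_cast
        rfl
      rw [← h5] at h1
      exact_mod_cast h1
    rw [h4, ← integral_const_mul]
    have h6 : ∀ x : ℂ, Real.pi / c * (Real.pi / (Real.pi ^ 2 / c) *
          Real.exp (-(Real.pi ^ 2 / (Real.pi ^ 2 / c)) * ‖x - 0‖ ^ 2)) = Real.exp (-c * ‖x‖ ^ 2) := by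
      intro x
      have := Real.pi_pos
      rw [show Real.pi ^ 2 / (Real.pi ^ 2 / c) = c by field_simp, sub_zero, ← mul_assoc,
        show Real.pi / c * (Real.pi / (Real.pi ^ 2 / c)) = 1 by field_simp, one_mul]
    simp only [h6]
    have h7 : ‖∫ x : ℂ, Real.exp (-c * ‖x‖ ^ 2) ∂ν‖ ≤ 1 * ν.real univ := by
      refine norm_integral_le_of_norm_le_const (Eventually.of_forall fun x => ?_)
      rw [Real.norm_of_nonneg (Real.exp_pos _).le, Real.exp_le_one_iff]
      nlinarith [mul_nonneg hc.le (sq_nonneg ‖x‖)]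
    rw [one_mul] at h7
    exact (le_abs_self _).trans h7
  -- On the ball of radius `R` the weight with `c = 1/R²` is at least 1/e, whence the bound e times
  -- the mass, uniformly in `R`.
  refine (aecover_ball (x := (0 : ℂ)) (r := fun n : ℕ => (n : ℝ) + 1)
    (tendsto_atTop_add_const_right _ _ tendsto_natCast_atTop_atTop)).integrable_of_integral_bounded_of_nonneg_ae
    (Real.exp 1 * ν.real univ) (fun n => ?_) (Eventually.of_forall hg0) (Eventually.of_forall fun n => ?_)
  · exact (hcont.continuousOn.integrableOn_compact (isCompact_closedBall 0 _)).mono_set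
      Metric.ball_subset_closedBall
  · set R : ℝ := (n : ℝ) + 1 with hR
    have hR0 : 0 < R := by positivity
    have hint : Integrable fun x : ℂ => Real.exp (-(1 / R ^ 2) * ‖x‖ ^ 2) * g x := by
      have h8 : Integrable fun x : ℂ => Real.exp (-(1 / R ^ 2) * ‖x‖ ^ 2) := by
        have := (integrable_gaussian_complex (b := 1 / R ^ 2) (by positivity)).norm
        refine this.congr (Eventually.of_forall fun x => ?_)
        simp only [Complex.norm_exp]
        congr 1
        have : (-((1 / R ^ 2 : ℝ) : ℂ) * (‖x‖ : ℂ) ^ 2).re = -(1 / R ^ 2) * ‖x‖ ^ 2 := by norm_cast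
        exact this
      refine h8.mul_bdd (c := ∫ w, ‖measFT ν w‖) hcont.aestronglyMeasurable (Eventually.of_forall fun x => ?_)
      refine (Complex.abs_re_le_norm _).trans ?_
      rw [Real.fourierInv_eq']
      refine (norm_integral_le_integral_norm _).trans_eq ?_
      simp only [norm_smul, Complex.norm_exp_ofReal_mul_I, one_mul]
    calc ∫ x in Metric.ball (0 : ℂ) R, g x
        ≤ ∫ x in Metric.ball (0 : ℂ) R, Real.exp 1 * (Real.exp (-(1 / R ^ 2) * ‖x‖ ^ 2) * g x) := by
          refine setIntegral_mono_on ?_ (hint.const_mul _).integrableOn measurableSet_ball fun x hx => ?_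
          · exact (hcont.continuousOn.integrableOn_compact (isCompact_closedBall 0 _)).mono_set
              Metric.ball_subset_closedBall
          · rw [← mul_assoc, ← Real.exp_add]
            refine le_mul_of_one_le_left (hg0 x) (Real.one_le_exp ?_)
            have : ‖x‖ ^ 2 ≤ R ^ 2 := by
              have := (mem_ball_zero_iff.1 hx).le
              gcongr
            have h9 : 1 / R ^ 2 * ‖x‖ ^ 2 ≤ 1 := by
              rw [one_div, inv_mul_le_iff₀ (by positivity)]; linarith
            linarith
      _ ≤ ∫ x, Real.exp 1 * (Real.exp (-(1 / R ^ 2) * ‖x‖ ^ 2) * g x) := by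
          refine setIntegral_le_integral (hint.const_mul _) (Eventually.of_forall fun x => ?_)
          have := hg0 x
          simp only [Pi.zero_apply]; positivity
      _ ≤ _ := by
          rw [integral_const_mul]
          exact mul_le_mul_of_nonneg_left (key _ (by positivity)) (Real.exp_pos _).le

/-- A finite measure with integrable Fourier transform has a continuous density. -/
theorem eq_withDensity_of_integrable_measFT {ν : Measure ℂ} [IsFiniteMeasure ν]
    (hν : Integrable (measFT ν)) :
    ν = volume.withDensity fun z => ENNReal.ofReal (𝓕⁻ (measFT ν) z).re := by
  set g : ℂ → ℝ := fun z => (𝓕⁻ (measFT ν) z).re with hg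
  have hg0 : ∀ z, 0 ≤ g z := fun z => by
    obtain ⟨r, hr, h⟩ := exists_nonneg_fourierInv hν z
    simp only [hg, h, Complex.ofReal_re, hr]
  have hgc : ∀ z, 𝓕⁻ (measFT ν) z = (g z : ℂ) := fun z => by
    obtain ⟨r, hr, h⟩ := exists_nonneg_fourierInv hν z
    simp only [hg, h, Complex.ofReal_re]
  have hcont : Continuous g := Complex.continuous_re.comp (continuous_fourierInv hν)
  have hgi : Integrable g := integrable_fourierInv_measFT hν
  have : IsFiniteMeasure (volume.withDensity fun z => ENNReal.ofReal (g z)) :=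
    isFiniteMeasure_withDensity_ofReal hgi.2
  refine Measure.ext_of_charFun (funext fun t => ?_)
  -- The inversion theorem requires the Fourier transform of `measFT ν` to be integrable. It is the
  -- reflection of `g`, whose integrability has just been obtained from positivity.
  have hinv : 𝓕 (𝓕⁻ (measFT ν)) = measFT ν := by
    refine (continuous_measFT ν).fourier_fourierInv_eq hν ?_
    have : (fun z => 𝓕 (measFT ν) z) = fun z => (g (-z) : ℂ) := by
      funext z
      rw [← hgc, Real.fourierInv_eq_fourier_neg, neg_neg]
    change Integrable (fun z => 𝓕 (measFT ν) z)
    rw [this]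
    exact hgi.comp_neg.ofReal
  have h1 := congrFun hinv ((-2 * Real.pi : ℝ)⁻¹ • t)
  have hne : (-2 * Real.pi : ℝ) ≠ 0 := by
    have := Real.pi_pos
    simp [this.ne']
  rw [measFT_eq_charFun, smul_smul, mul_inv_cancel₀ hne, one_smul] at h1
  rw [← h1, Real.fourier_eq', charFun_apply,
    integral_withDensity_eq_integral_toReal_smul hcont.measurable.ennreal_ofReal
      (Eventually.of_forall fun _ => ENNReal.ofReal_lt_top)]
  refine integral_congr_ae (Eventually.of_forall fun x => ?_)
  simp only
  rw [ENNReal.toReal_ofReal (hg0 x), hgc, inner_smul_right, Complex.real_smul, smul_eq_mul, mul_comm]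
  congr 3
  field_simp

/-! ### The limit density: exponential tilting, decay and smoothness in σ. -/

/-- The quadratic form `⟨p, p⟩` of the complex vector `p = η - 2πiw`. -/
def kap (η w : ℂ) : ℂ :=
  (conj η - 2 * Real.pi * Complex.I * conj w) * (η - 2 * Real.pi * Complex.I * w)

/-- The exponential `exp (⟨η, z⟩ - 2πi⟨w, z⟩)`. -/
def gexp (η w z : ℂ) : ℂ :=
  Complex.exp (((inner ℝ z η : ℝ) : ℂ) + ((-2 * Real.pi * inner ℝ z w : ℝ) : ℂ) * Complex.I)

theorem inner_eq_conj (z w : ℂ) : ((inner ℝ z w : ℝ) : ℂ) = (conj w * z + w * conj z) / 2 := by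
  rw [Complex.inner]
  apply Complex.ext
  · simp
  · simp
    ring

theorem gexp_eq (η w z : ℂ) : gexp η w z =
    Complex.exp (((conj η - 2 * Real.pi * Complex.I * conj w) * z +
      (η - 2 * Real.pi * Complex.I * w) * conj z) / 2) := by
  rw [gexp]
  congr 1
  push_cast
  rw [inner_eq_conj, inner_eq_conj]
  ring

theorem gexp_add (η w z z' : ℂ) : gexp η w (z + z') = gexp η w z * gexp η w z' := by
  rw [gexp_eq, gexp_eq, gexp_eq, ← Complex.exp_add]
  congr 1
  rw [map_add]; ring

@[fun_prop]
theorem continuous_gexp (η w : ℂ) : Continuous (gexp η w) := by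
  unfold gexp; fun_prop

theorem continuous_kap (η : ℂ) : Continuous (kap η) := by
  unfold kap
  have : Continuous fun w : ℂ => conj w := Complex.continuous_conj
  fun_prop

/-- The two coefficients in the circle integral multiply to r² times `kap η w`, so a
rotation-invariant law sees the pair `(η, w)` only through this quadratic form. -/
theorem integrable_gexp_circle (η w : ℂ) (r : ℝ) :
    Integrable (gexp η w) (circleEquidistribution r : Measure ℂ) ∧
    ∫ z, gexp η w z ∂(circleEquidistribution r : Measure ℂ) = bes ((r : ℂ) ^ 2 * kap η w) := by
  have hc : Continuous fun θ : UnitAddCircle => (r : ℂ) * (AddCircle.toCircle θ : ℂ) :=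
    continuous_const.mul (continuous_subtype_val.comp AddCircle.continuous_toCircle)
  have hco : Continuous fun θ : UnitAddCircle => gexp η w ((r : ℂ) * (AddCircle.toCircle θ : ℂ)) :=
    (continuous_gexp η w).comp hc
  constructor
  · refine (integrable_map_measure (continuous_gexp η w).aestronglyMeasurable hc.aemeasurable).2 ?_
    exact hco.integrable_of_hasCompactSupport (HasCompactSupport.of_compactSpace _)
  · change ∫ z, gexp η w z ∂((AddCircle.haarAddCircle : Measure UnitAddCircle).map _) = _
    rw [integral_map hc.aemeasurable (continuous_gexp η w).aestronglyMeasurable, kap,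
      show ∀ A A' : ℂ, (r : ℂ) ^ 2 * (A * A') = (r * A) * (r * A') by intros; ring,
      ← integral_exp_toCircle]
    refine integral_congr_ae (Eventually.of_forall fun θ => ?_)
    simp only
    rw [gexp_eq, fourier_neg, fourier_one, map_mul, Complex.conj_ofReal]
    congr 1
    ring

theorem integrable_gexp_partialConvolution {α : ℝ} (hα : 0 < α) (σ : ℝ) (η w : ℂ) (n : ℕ) :
    Integrable (gexp η w) (partialConvolution α σ n : Measure ℂ) ∧
    ∫ z, gexp η w z ∂(partialConvolution α σ n : Measure ℂ) =
      mgfPartial α (n + 1) σ (kap η w) := by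
  have hfac : ∀ k : ℕ, bes ((((((k : ℕ) : ℝ) + α) ^ (-σ) : ℝ) : ℂ) ^ 2 * kap η w) =
      mgfFactor α k σ (kap η w) := by
    intro k
    rw [mgfFactor, base_cpow_neg_two_mul hα, ← Complex.ofReal_neg,
      Complex.ofReal_cpow (base_pos hα k).le]
  induction n with
  | zero =>
    have := integrable_gexp_circle η w ((((0 : ℕ) : ℝ) + α) ^ (-σ))
    rw [hfac] at this
    simpa [mgfPartial, partialConvolution] using this
  | succ n ih =>
    have h2 := integrable_gexp_circle η w ((((n + 1 : ℕ) : ℝ) + α) ^ (-σ))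
    rw [hfac] at h2
    have hP : Integrable (fun p : ℂ × ℂ => gexp η w (p.1 + p.2))
        ((partialConvolution α σ n : Measure ℂ).prod
          (circleEquidistribution ((((n + 1 : ℕ) : ℝ) + α) ^ (-σ)) : Measure ℂ)) := by
      simp only [gexp_add]
      exact ih.1.mul_prod h2.1
    have hI : Integrable (gexp η w) (Measure.conv (partialConvolution α σ n : Measure ℂ)
        (circleEquidistribution ((((n + 1 : ℕ) : ℝ) + α) ^ (-σ)) : Measure ℂ)) :=
      (integrable_map_measure (continuous_gexp η w).aestronglyMeasurable
        (by fun_prop)).2 hP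
    refine ⟨hI, ?_⟩
    change ∫ z, gexp η w z ∂(Measure.conv (partialConvolution α σ n : Measure ℂ)
        (circleEquidistribution ((((n + 1 : ℕ) : ℝ) + α) ^ (-σ)) : Measure ℂ)) = _
    rw [integral_conv hI]
    simp only [gexp_add, integral_const_mul, integral_mul_const]
    rw [ih.2, h2.2]
    exact (Finset.prod_range_succ _ _).symm

/-- With W = 4π²‖w‖² one has (Re v)² - (Im v)² = ‖η‖² - W, and (Re v)²(Im v)² ≤ ‖η‖²W by
Cauchy–Schwarz. If (Re v)² exceeded ‖η‖², then (Im v)² would exceed W, a contradiction. So a tilt of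
length at most 1 respects the condition |Re v| ≤ 1 under which the product decays. -/
theorem exists_sq_eq_kap {η w : ℂ} (hη : ‖η‖ ≤ 1) :
    ∃ v : ℂ, v ^ 2 = kap η w ∧ |v.re| ≤ 1 ∧ 1 + ‖w‖ ≤ 2 * (1 + ‖v‖) := by
  obtain ⟨v, hv⟩ := IsAlgClosed.exists_pow_nat_eq (kap η w) (n := 2) two_pos
  have hη2 : ‖η‖ ^ 2 = η.re ^ 2 + η.im ^ 2 := by rw [Complex.sq_norm, Complex.normSq_apply]; ring
  have hw2 : ‖w‖ ^ 2 = w.re ^ 2 + w.im ^ 2 := by rw [Complex.sq_norm, Complex.normSq_apply]; ring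
  have hv2 : ‖v‖ ^ 2 = v.re ^ 2 + v.im ^ 2 := by rw [Complex.sq_norm, Complex.normSq_apply]; ring
  set W := 4 * Real.pi ^ 2 * ‖w‖ ^ 2 with hW
  have hW0 : 0 ≤ W := by positivity
  have hre : v.re ^ 2 - v.im ^ 2 = ‖η‖ ^ 2 - W := by
    have := congrArg Complex.re hv
    simp [kap, sq, Complex.mul_re, Complex.mul_im] at this
    rw [hW, hη2, hw2]
    linarith
  have him : v.re * v.im = -2 * Real.pi * (η.re * w.re + η.im * w.im) := by
    have := congrArg Complex.im hv
    simp [kap, sq, Complex.mul_re, Complex.mul_im] at this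
    linarith
  have hprod : v.re ^ 2 * v.im ^ 2 ≤ ‖η‖ ^ 2 * W := by
    rw [← mul_pow, him, hW, hη2, hw2]
    nlinarith [mul_nonneg (sq_nonneg Real.pi) (sq_nonneg (η.re * w.im - η.im * w.re))]
  have hx : v.re ^ 2 ≤ ‖η‖ ^ 2 := by
    by_contra hcon
    push Not at hcon
    have h1 : W < v.im ^ 2 := by linarith
    nlinarith [sq_nonneg ‖η‖]
  have hη1 : ‖η‖ ^ 2 ≤ 1 := pow_le_one₀ (norm_nonneg _) hη
  refine ⟨v, hv, ?_, ?_⟩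
  · rw [← sq_le_one_iff_abs_le_one]; linarith
  · have h1 : ‖w‖ ^ 2 ≤ (1 + ‖v‖) ^ 2 := by
      have h2 : ‖w‖ ^ 2 ≤ W := by
        have h4 : 1 ≤ 4 * Real.pi ^ 2 := by nlinarith [Real.pi_gt_three]
        rw [hW]; exact le_mul_of_one_le_left (sq_nonneg _) h4
      nlinarith [norm_nonneg v, sq_nonneg v.re]
    have h3 := le_of_abs_le (abs_le_of_sq_le_sq h1 (by positivity))
    linarith [norm_nonneg v]

/-- The `j`-th derivative in `σ` of the moment generating function. -/
def mgfDeriv (α : ℝ) (j : ℕ) (σ : ℝ) (κ : ℂ) : ℂ := iteratedDeriv j (fun s => mgf α s κ) (σ : ℂ)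

theorem hasDerivAt_mgfDeriv {α : ℝ} (hα : 0 < α) (j : ℕ) {σ : ℝ} (hσ : 1 / 2 < σ) (κ : ℂ) :
    HasDerivAt (fun σ => mgfDeriv α j σ κ) (mgfDeriv α (j + 1) σ κ) σ := by
  have hop : IsOpen {s : ℂ | 1 / 2 < s.re} := isOpen_lt continuous_const Complex.continuous_re
  have han := ((differentiableOn_mgf hα κ).analyticOnNhd hop) (σ : ℂ) (by simpa using hσ)
  have h2 := (han.iterated_deriv j).differentiableAt.hasDerivAt
  rw [← iteratedDeriv_eq_iterate, ← iteratedDeriv_succ] at h2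
  exact h2.comp_ofReal

/-- Measurability passes to derivatives through difference quotients with steps 1/(n + 1). -/
theorem measurable_mgfDeriv_kap {α : ℝ} (hα : 0 < α) (j : ℕ) (η : ℂ) :
    ∀ σ : ℝ, 1 / 2 < σ → Measurable fun w => mgfDeriv α j σ (kap η w) := by
  induction j with
  | zero =>
    intro σ hσ
    have h : Continuous fun w => mgf α (σ : ℂ) (kap η w) := by
      rw [← continuousOn_univ]
      exact (continuousOn_mgf hα).comp (f := fun w => ((σ : ℂ), kap η w))
        (Continuous.continuousOn (by have := continuous_kap η; fun_prop))
        (fun w _ => by simpa using hσ)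
    simpa [mgfDeriv] using h.measurable
  | succ j ih =>
    intro σ hσ
    have ht : Tendsto (fun n : ℕ => 1 / ((n : ℝ) + 1)) atTop (𝓝[≠] 0) := by
      refine tendsto_nhdsWithin_iff.2 ⟨tendsto_one_div_add_atTop_nhds_zero_nat, ?_⟩
      exact Eventually.of_forall fun n => by
        have : (0 : ℝ) < 1 / ((n : ℝ) + 1) := by positivity
        exact this.ne'
    refine measurable_of_tendsto_metrizable (f := fun (n : ℕ) w =>
      (1 / ((n : ℝ) + 1))⁻¹ • (mgfDeriv α j (σ + 1 / ((n : ℝ) + 1)) (kap η w) -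
        mgfDeriv α j σ (kap η w))) (fun n => ?_) (tendsto_pi_nhds.2 fun w => ?_)
    · have : (0 : ℝ) < 1 / ((n : ℝ) + 1) := by positivity
      exact ((ih (σ + 1 / ((n : ℝ) + 1)) (by linarith)).sub (ih σ hσ)).const_smul
        ((1 / ((n : ℝ) + 1))⁻¹)
    · exact (hasDerivAt_iff_tendsto_slope_zero.1 (hasDerivAt_mgfDeriv hα j hσ (kap η w))).comp ht

theorem exists_norm_mgf_kap_le {α a b : ℝ} (hα : 0 < α) (ha : 1 / 2 < a) (hab : a ≤ b) :
    ∃ C, 0 < C ∧ ∀ σ : ℝ, a ≤ σ → σ ≤ b → ∀ η w : ℂ, ‖η‖ ≤ 1 →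
      (∀ N, 24 ≤ N → ‖mgfPartial α N σ (kap η w)‖ ≤ C * (1 + ‖w‖) ^ (-(5 : ℝ))) ∧
      ∀ j ≤ 3, ‖mgfDeriv α j σ (kap η w)‖ ≤ C * (1 + ‖w‖) ^ (-(5 : ℝ)) := by
  obtain ⟨C₁, hC₁, h₁, -⟩ := exists_norm_mgf_le hα ha hab
  obtain ⟨C₂, hC₂, h₂⟩ := exists_norm_iteratedDeriv_mgf_le hα ha hab
  -- 32 = 2⁵ comes from 1 + ‖w‖ ≤ 2(1 + ‖v‖).
  refine ⟨32 * (C₁ + C₂), by positivity, fun σ h3 h4 η w hη => ?_⟩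
  obtain ⟨v, hv, hv1, hvw⟩ := exists_sq_eq_kap (w := w) hη
  have hrp : (1 + ‖w‖) ^ (-(5 : ℝ)) = ((1 + ‖w‖) ^ 5)⁻¹ := by
    rw [Real.rpow_neg (by positivity)]; norm_cast
  have h5 : ((1 + ‖v‖) ^ 5)⁻¹ ≤ 32 * ((1 + ‖w‖) ^ 5)⁻¹ := by
    rw [← div_eq_mul_inv, inv_eq_one_div, div_le_div_iff₀ (by positivity) (by positivity), one_mul]
    calc (1 + ‖w‖) ^ 5 ≤ (2 * (1 + ‖v‖)) ^ 5 := by gcongr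
      _ = _ := by ring
  have h8 : ((1 + ‖v‖) ^ 8)⁻¹ ≤ ((1 + ‖v‖) ^ 5)⁻¹ := by
    have : 1 ≤ 1 + ‖v‖ := by linarith [norm_nonneg v]
    gcongr
    norm_num
  have h0 : 0 < ((1 + ‖w‖) ^ 5)⁻¹ := by positivity
  rw [hrp]
  constructor
  · intro N hN
    rw [← hv]
    refine (h₁ N hN σ v (by simpa using h3) (by simpa using h4) hv1 (by simp)).trans ?_
    calc C₁ * ((1 + ‖v‖) ^ 8)⁻¹ ≤ C₁ * (32 * ((1 + ‖w‖) ^ 5)⁻¹) := by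
          gcongr; exact h8.trans h5
      _ ≤ _ := by nlinarith
  · intro j hj
    rw [← hv, mgfDeriv]
    refine (h₂ j hj σ v h3 h4 hv1).trans ?_
    calc C₂ * ((1 + ‖v‖) ^ 5)⁻¹ ≤ C₂ * (32 * ((1 + ‖w‖) ^ 5)⁻¹) := by gcongr
      _ ≤ _ := by nlinarith

theorem integrable_decay : Integrable fun w : ℂ => (1 + ‖w‖) ^ (-(5 : ℝ)) :=
  integrable_one_add_norm (by rw [Complex.finrank_real_complex]; norm_num)

theorem exists_norm_mgf_kap_le_at {α σ : ℝ} (hα : 0 < α) (hσ : 1 / 2 < σ) :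
    ∃ C, 0 < C ∧ ∀ η w : ℂ, ‖η‖ ≤ 1 →
      (∀ N, 24 ≤ N → ‖mgfPartial α N σ (kap η w)‖ ≤ C * (1 + ‖w‖) ^ (-(5 : ℝ))) ∧
      ∀ j ≤ 3, ‖mgfDeriv α j σ (kap η w)‖ ≤ C * (1 + ‖w‖) ^ (-(5 : ℝ)) := by
  obtain ⟨C, hC, h⟩ := exists_norm_mgf_kap_le hα hσ le_rfl
  exact ⟨C, hC, h σ le_rfl le_rfl⟩

theorem integrable_mgfDeriv_kap {α σ : ℝ} (hα : 0 < α) (hσ : 1 / 2 < σ) {j : ℕ} (hj : j ≤ 3)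
    {η : ℂ} (hη : ‖η‖ ≤ 1) : Integrable fun w => mgfDeriv α j σ (kap η w) := by
  obtain ⟨C, hC, h⟩ := exists_norm_mgf_kap_le_at hα hσ
  exact (integrable_decay.const_mul C).mono' (measurable_mgfDeriv_kap hα j η σ hσ).aestronglyMeasurable
    (Eventually.of_forall fun w => (h η w hη).2 j hj)

theorem continuous_mgfPartial_kap {α : ℝ} (hα : 0 < α) (N : ℕ) (σ : ℝ) (η : ℂ) :
    Continuous fun w => mgfPartial α N σ (kap η w) := by
  unfold mgfPartial
  refine continuous_finsetProd _ fun n _ => ?_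
  exact (continuous_mgfFactor hα n).comp (f := fun w => ((σ : ℂ), kap η w))
    (by have := continuous_kap η; fun_prop)

theorem integrable_mgfPartial_kap {α σ : ℝ} (hα : 0 < α) (hσ : 1 / 2 < σ) {N : ℕ} (hN : 24 ≤ N)
    {η : ℂ} (hη : ‖η‖ ≤ 1) : Integrable fun w => mgfPartial α N σ (kap η w) := by
  obtain ⟨C, hC, h⟩ := exists_norm_mgf_kap_le_at hα hσ
  exact (integrable_decay.const_mul C).mono' (continuous_mgfPartial_kap hα N σ η).aestronglyMeasurable
    (Eventually.of_forall fun w => (h η w hη).1 N hN)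

theorem measFT_partialConvolution {α : ℝ} (hα : 0 < α) (σ : ℝ) (n : ℕ) :
    measFT (partialConvolution α σ n : Measure ℂ) = fun w => mgfPartial α (n + 1) σ (kap 0 w) := by
  funext w
  rw [← (integrable_gexp_partialConvolution hα σ 0 w n).2, measFT]
  refine integral_congr_ae (Eventually.of_forall fun x => ?_)
  simp [gexp]

/-- The density of the partial convolution with respect to Lebesgue measure. -/
def partialDensity (α σ : ℝ) (n : ℕ) (z : ℂ) : ℝ :=
  (𝓕⁻ (measFT (partialConvolution α σ n : Measure ℂ)) z).re

theorem partialDensity_spec {α σ : ℝ} (hα : 0 < α) (hσ : 1 / 2 < σ) {n : ℕ} (hn : 23 ≤ n) :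
    Continuous (partialDensity α σ n) ∧ (∀ z, 0 ≤ partialDensity α σ n z) ∧
    (partialConvolution α σ n : Measure ℂ) =
      volume.withDensity fun z => ENNReal.ofReal (partialDensity α σ n z) := by
  have hi : Integrable (measFT (partialConvolution α σ n : Measure ℂ)) := by
    rw [measFT_partialConvolution hα]
    exact integrable_mgfPartial_kap hα hσ (by omega) (by simp)
  refine ⟨Complex.continuous_re.comp (continuous_fourierInv hi), fun z => ?_,
    eq_withDensity_of_integrable_measFT hi⟩
  obtain ⟨r, hr, h⟩ := exists_nonneg_fourierInv hi z
  rw [partialDensity, h, Complex.ofReal_re]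
  exact hr

theorem integral_partialConvolution {α σ : ℝ} (hα : 0 < α) (hσ : 1 / 2 < σ) {n : ℕ} (hn : 23 ≤ n)
    {E : Type*} [NormedAddCommGroup E] [NormedSpace ℝ E] (f : ℂ → E) :
    ∫ z, f z ∂(partialConvolution α σ n : Measure ℂ) = ∫ z, partialDensity α σ n z • f z := by
  obtain ⟨h1, h2, h3⟩ := partialDensity_spec hα hσ hn
  rw [h3, integral_withDensity_eq_integral_toReal_smul h1.measurable.ennreal_ofReal
      (Eventually.of_forall fun _ => ENNReal.ofReal_lt_top)]
  refine integral_congr_ae (Eventually.of_forall fun z => ?_)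
  simp only
  rw [ENNReal.toReal_ofReal (h2 z)]

/-- Fourier inversion applied to the density times exp ⟨z, η⟩, whose transform is the finite product
at `kap η w`. The prefactor exp (-⟨z, η⟩) is the gain. The condition `23 ≤ n` provides the 24
factors needed for integrability. -/
theorem partialDensity_eq_tilted {α σ : ℝ} (hα : 0 < α) (hσ : 1 / 2 < σ) {n : ℕ} (hn : 23 ≤ n)
    {η : ℂ} (hη : ‖η‖ ≤ 1) (z : ℂ) :
    (partialDensity α σ n z : ℂ) = Complex.exp (-((inner ℝ z η : ℝ) : ℂ)) *
      ∫ w, Complex.exp (((2 * Real.pi * inner ℝ w z : ℝ) : ℂ) * Complex.I) *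
        mgfPartial α (n + 1) σ (kap η w) := by
  obtain ⟨h1, h2, h3⟩ := partialDensity_spec hα hσ hn
  set G : ℂ → ℂ := fun z => (partialDensity α σ n z : ℂ) * Complex.exp ((inner ℝ z η : ℝ) : ℂ) with hG
  have hGc : Continuous G := by simp only [hG]; fun_prop
  have hGi : Integrable G := by
    have h4 := (integrable_gexp_partialConvolution hα σ η 0 n).1
    rw [h3, integrable_withDensity_iff_integrable_smul' h1.measurable.ennreal_ofReal
      (Eventually.of_forall fun _ => ENNReal.ofReal_lt_top)] at h4
    refine h4.congr (Eventually.of_forall fun z => ?_)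
    simp only
    rw [ENNReal.toReal_ofReal (h2 z), Complex.real_smul]
    simp [hG, gexp]
  have hGF : 𝓕 G = fun w => mgfPartial α (n + 1) σ (kap η w) := by
    funext w
    rw [← (integrable_gexp_partialConvolution hα σ η w n).2, integral_partialConvolution hα hσ hn,
      Real.fourier_eq']
    refine integral_congr_ae (Eventually.of_forall fun x => ?_)
    simp only [hG, gexp, smul_eq_mul, Complex.real_smul]
    rw [Complex.exp_add]
    ring
  have h5 := hGc.fourierInv_fourier_eq hGi (by
    rw [hGF]; exact integrable_mgfPartial_kap hα hσ (by omega) hη)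
  have h6 := congrFun h5 z
  rw [hGF, Real.fourierInv_eq'] at h6
  simp only [smul_eq_mul] at h6
  rw [h6, hG]
  simp only
  rw [mul_comm, mul_assoc, ← Complex.exp_add]
  simp

/-- The tilted Fourier integral representing the `j`-th derivative of the limit density. -/
def densC (α : ℝ) (j : ℕ) (σ : ℝ) (η z : ℂ) : ℂ :=
  Complex.exp (-((inner ℝ z η : ℝ) : ℂ)) *
    ∫ w, Complex.exp (((2 * Real.pi * inner ℝ w z : ℝ) : ℂ) * Complex.I) * mgfDeriv α j σ (kap η w)

theorem tendsto_partialDensity {α σ : ℝ} (hα : 0 < α) (hσ : 1 / 2 < σ) {η : ℂ} (hη : ‖η‖ ≤ 1)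
    (z : ℂ) : Tendsto (fun n => (partialDensity α σ n z : ℂ)) atTop (𝓝 (densC α 0 σ η z)) := by
  obtain ⟨C, hC, h⟩ := exists_norm_mgf_kap_le_at hα hσ
  have hlim : Tendsto (fun n => Complex.exp (-((inner ℝ z η : ℝ) : ℂ)) *
      ∫ w, Complex.exp (((2 * Real.pi * inner ℝ w z : ℝ) : ℂ) * Complex.I) *
        mgfPartial α (n + 1) σ (kap η w)) atTop (𝓝 (densC α 0 σ η z)) := by
    refine Tendsto.const_mul _ ?_
    refine tendsto_integral_filter_of_dominated_convergence
      (fun w => C * (1 + ‖w‖) ^ (-(5 : ℝ))) ?_ ?_ (integrable_decay.const_mul C) ?_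
    · refine Eventually.of_forall fun n => ?_
      have := continuous_mgfPartial_kap hα (n + 1) σ η
      exact Continuous.aestronglyMeasurable (by fun_prop)
    · filter_upwards [eventually_ge_atTop 23] with n hn
      refine Eventually.of_forall fun w => ?_
      rw [norm_mul, Complex.norm_exp_ofReal_mul_I, one_mul]
      exact (h η w hη).1 _ (by omega)
    · refine Eventually.of_forall fun w => Tendsto.const_mul _ ?_
      have := (tendsto_mgfPartial hα (s := (σ : ℂ)) (by simpa using hσ) (kap η w)).comp
        (tendsto_add_atTop_nat 1)
      simp only [mgfDeriv, iteratedDeriv_zero]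
      exact this
  refine hlim.congr' ?_
  filter_upwards [eventually_ge_atTop 23] with n hn
  exact (partialDensity_eq_tilted hα hσ hn hη z).symm

theorem norm_densC_le {α : ℝ} {σ C : ℝ} {j : ℕ} {η : ℂ}
    (h : ∀ w, ‖mgfDeriv α j σ (kap η w)‖ ≤ C * (1 + ‖w‖) ^ (-(5 : ℝ))) (z : ℂ) :
    ‖densC α j σ η z‖ ≤ (C * ∫ w : ℂ, (1 + ‖w‖) ^ (-(5 : ℝ))) * Real.exp (-inner ℝ z η) := by
  rw [densC, norm_mul, mul_comm, Complex.norm_exp]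
  have e : (-((inner ℝ z η : ℝ) : ℂ)).re = -inner ℝ z η := by
    rw [← Complex.ofReal_neg, Complex.ofReal_re]
  rw [e, ← integral_const_mul]
  refine mul_le_mul_of_nonneg_right ?_ (Real.exp_pos _).le
  refine norm_integral_le_of_norm_le (integrable_decay.const_mul C) (Eventually.of_forall fun w => ?_)
  rw [norm_mul, Complex.norm_exp_ofReal_mul_I, one_mul]
  exact h w

theorem continuous_densC {α σ : ℝ} (hα : 0 < α) (hσ : 1 / 2 < σ) {j : ℕ} (hj : j ≤ 3)
    {η : ℂ} (hη : ‖η‖ ≤ 1) : Continuous (densC α j σ η) := by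
  have h := continuous_fourierInv (integrable_mgfDeriv_kap hα hσ hj hη)
  have e : densC α j σ η = fun z => Complex.exp (-((inner ℝ z η : ℝ) : ℂ)) *
      𝓕⁻ (fun w => mgfDeriv α j σ (kap η w)) z := by
    funext z
    rw [densC, Real.fourierInv_eq']
    simp only [smul_eq_mul]
  rw [e]
  fun_prop

theorem hasDerivAt_densC {α σ : ℝ} (hα : 0 < α) (hσ : 1 / 2 < σ) {j : ℕ} (hj : j ≤ 2)
    {η : ℂ} (hη : ‖η‖ ≤ 1) (z : ℂ) :
    HasDerivAt (fun σ => densC α j σ η z) (densC α (j + 1) σ η z) σ := by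
  set a := (σ + 1 / 2) / 2 with ha
  have ha1 : 1 / 2 < a := by linarith
  have ha2 : a < σ := by linarith
  obtain ⟨C, hC, h⟩ := exists_norm_mgf_kap_le hα ha1 (by linarith : a ≤ σ + 1)
  have hexp : Continuous fun w : ℂ =>
    Complex.exp (((2 * Real.pi * inner ℝ w z : ℝ) : ℂ) * Complex.I) := by fun_prop
  refine HasDerivAt.const_mul _ ?_
  have hnhds : Icc a (σ + 1) ∈ 𝓝 σ := Icc_mem_nhds ha2 (by linarith)
  refine (hasDerivAt_integral_of_dominated_loc_of_deriv_le (s := Icc a (σ + 1))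
    (bound := fun w => C * (1 + ‖w‖) ^ (-(5 : ℝ)))
    (F := fun σ w => Complex.exp (((2 * Real.pi * inner ℝ w z : ℝ) : ℂ) * Complex.I) *
      mgfDeriv α j σ (kap η w))
    (F' := fun σ w => Complex.exp (((2 * Real.pi * inner ℝ w z : ℝ) : ℂ) * Complex.I) *
      mgfDeriv α (j + 1) σ (kap η w))
    hnhds ?_ ?_ ?_ ?_ (integrable_decay.const_mul C) ?_).2
  · filter_upwards [hnhds] with τ hτ
    exact hexp.aestronglyMeasurable.mul
      (measurable_mgfDeriv_kap hα j η τ (by linarith [hτ.1])).aestronglyMeasurable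
  · refine (integrable_mgfDeriv_kap hα hσ (by omega) hη).bdd_mul (c := 1) hexp.aestronglyMeasurable ?_
    exact Eventually.of_forall fun w => (Complex.norm_exp_ofReal_mul_I _).le
  · exact hexp.aestronglyMeasurable.mul (measurable_mgfDeriv_kap hα (j + 1) η σ hσ).aestronglyMeasurable
  · refine Eventually.of_forall fun w τ hτ => ?_
    rw [norm_mul, Complex.norm_exp_ofReal_mul_I, one_mul]
    exact (h τ hτ.1 hτ.2 η w hη).2 _ (by omega)
  · exact Eventually.of_forall fun w τ hτ =>
      (hasDerivAt_mgfDeriv hα j (by linarith [hτ.1]) _).const_mul _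

/-- For `j = 0` both sides are the limit of the same partial densities. As this holds on an open set
of σ, it may be differentiated, and no contour has to be shifted. -/
theorem densC_eq_zero_tilt {α : ℝ} (hα : 0 < α) {j : ℕ} (hj : j ≤ 3) {η : ℂ} (hη : ‖η‖ ≤ 1) (z : ℂ) :
    ∀ σ : ℝ, 1 / 2 < σ → densC α j σ η z = densC α j σ 0 z := by
  induction j with
  | zero =>
    intro σ hσ
    exact tendsto_nhds_unique (tendsto_partialDensity hα hσ hη z)
      (tendsto_partialDensity hα hσ (by simp) z)
  | succ j ih =>
    intro σ hσ
    have h1 := hasDerivAt_densC hα hσ (by omega : j ≤ 2) hη z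
    have h2 := hasDerivAt_densC hα hσ (by omega : j ≤ 2) (η := 0) (by simp) z
    refine h1.unique (h2.congr_of_eventuallyEq ?_)
    filter_upwards [lt_mem_nhds hσ] with τ hτ
    exact ih (by omega) τ hτ

/-- The `j`-th derivative in `σ` of the limit density. -/
def dens (α : ℝ) (j : ℕ) (σ : ℝ) (z : ℂ) : ℝ := 2 * Real.pi * (densC α j σ 0 z).re

theorem hasDerivAt_dens {α σ : ℝ} (hα : 0 < α) (hσ : 1 / 2 < σ) {j : ℕ} (hj : j ≤ 2) (z : ℂ) :
    HasDerivAt (fun σ => dens α j σ z) (dens α (j + 1) σ z) σ := by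
  have h := hasDerivAt_densC hα hσ hj (η := 0) (by simp) z
  have h2 : HasDerivAt (fun σ => (densC α j σ 0 z).re) (densC α (j + 1) σ 0 z).re σ := by
    exact (Complex.reCLM.hasFDerivAt (x := densC α j σ 0 z)).comp_hasDerivAt σ h
  exact h2.const_mul _

theorem continuous_dens {α σ : ℝ} (hα : 0 < α) (hσ : 1 / 2 < σ) {j : ℕ} (hj : j ≤ 3) :
    Continuous (dens α j σ) :=
  continuous_const.mul (Complex.continuous_re.comp (continuous_densC hα hσ hj (by simp)))

/-- The density does not depend on the tilt, so η may be chosen for each `z` as the unit vector in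
the direction of `z`; then ⟨z, η⟩ = ‖z‖. -/
theorem exists_abs_dens_le {α a b : ℝ} (hα : 0 < α) (ha : 1 / 2 < a) (hab : a ≤ b) :
    ∃ C, 0 < C ∧ ∀ σ : ℝ, a ≤ σ → σ ≤ b → ∀ z : ℂ,
      (∀ j ≤ 3, |dens α j σ z| ≤ C * Real.exp (-‖z‖)) ∧
      ∀ n, 23 ≤ n → partialDensity α σ n z ≤ C * Real.exp (-‖z‖) := by
  obtain ⟨C, hC, h⟩ := exists_norm_mgf_kap_le hα ha hab
  set I := ∫ w : ℂ, (1 + ‖w‖) ^ (-(5 : ℝ)) with hI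
  have hI0 : 0 ≤ I := integral_nonneg fun w => by positivity
  have hπ := Real.pi_gt_three
  refine ⟨2 * Real.pi * (C * I) + 1, by positivity, fun σ h1 h2 z => ?_⟩
  set η : ℂ := if z = 0 then 0 else ((‖z‖⁻¹ : ℝ) : ℂ) * z with hη
  have hη1 : ‖η‖ ≤ 1 := by
    by_cases hz : z = 0
    · simp [hη, hz]
    · rw [hη, if_neg hz, norm_mul, Complex.norm_real, norm_inv, norm_norm,
        inv_mul_cancel₀ (norm_ne_zero_iff.2 hz)]
  have hinner : inner ℝ z η = ‖z‖ := by
    by_cases hz : z = 0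
    · simp [hη, hz]
    · rw [hη, if_neg hz, ← Complex.real_smul, inner_smul_right, real_inner_self_eq_norm_sq, sq,
        inv_mul_cancel_left₀ (norm_ne_zero_iff.2 hz)]
  have hσ : 1 / 2 < σ := by linarith
  have hCI : 0 ≤ C * I := by positivity
  have he := Real.exp_pos (-‖z‖)
  constructor
  · intro j hj
    rw [dens, ← densC_eq_zero_tilt hα hj hη1 z σ hσ, abs_mul, abs_of_pos (by positivity : 0 < 2 * Real.pi)]
    have h3 := (Complex.abs_re_le_norm _).trans (norm_densC_le (fun w => (h σ h1 h2 η w hη1).2 j hj) z)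
    rw [hinner] at h3
    calc 2 * Real.pi * |(densC α j σ η z).re| ≤ 2 * Real.pi * ((C * I) * Real.exp (-‖z‖)) := by gcongr
      _ ≤ _ := by nlinarith
  · intro n hn
    have h3 : |partialDensity α σ n z| ≤ C * I * Real.exp (-‖z‖) := by
      rw [← Real.norm_eq_abs, ← Complex.norm_real, partialDensity_eq_tilted hα hσ hn hη1 z, norm_mul,
        mul_comm, Complex.norm_exp]
      have e : (-((inner ℝ z η : ℝ) : ℂ)).re = -‖z‖ := by
        rw [← Complex.ofReal_neg, Complex.ofReal_re, hinner]
      rw [e, hI, ← integral_const_mul]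
      refine mul_le_mul_of_nonneg_right ?_ he.le
      refine norm_integral_le_of_norm_le (integrable_decay.const_mul C)
        (Eventually.of_forall fun w => ?_)
      rw [norm_mul, Complex.norm_exp_ofReal_mul_I, one_mul]
      exact (h σ h1 h2 η w hη1).1 _ (by omega)
    refine (le_abs_self _).trans (h3.trans ?_)
    have : C * I ≤ 2 * Real.pi * (C * I) := le_mul_of_one_le_left hCI (by linarith)
    nlinarith

theorem integrable_exp_neg_norm : Integrable fun z : ℂ => Real.exp (-‖z‖) := by
  have h : Integrable fun w : ℂ => (1 + ‖w‖) ^ (-(3 : ℝ)) :=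
    integrable_one_add_norm (by rw [Complex.finrank_real_complex]; norm_num)
  refine (h.const_mul (6 * Real.exp 1)).mono' (Continuous.aestronglyMeasurable (by fun_prop))
    (Eventually.of_forall fun z => ?_)
  rw [Real.norm_of_nonneg (Real.exp_pos _).le, Real.rpow_neg (by positivity)]
  have h1 := Real.pow_div_factorial_le_exp (1 + ‖z‖) (by positivity) 3
  have h2 : Real.exp (-‖z‖) = Real.exp 1 / Real.exp (1 + ‖z‖) := by
    rw [← Real.exp_sub]; congr 1; ring
  have h3 : (1 + ‖z‖) ^ (3 : ℝ) = (1 + ‖z‖) ^ 3 := by norm_cast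
  rw [h2, h3, ← div_eq_mul_inv, div_le_div_iff₀ (Real.exp_pos _) (by positivity)]
  norm_num [Nat.factorial] at h1
  nlinarith [Real.exp_pos 1]

theorem tendsto_partialDensity_dens {α σ : ℝ} (hα : 0 < α) (hσ : 1 / 2 < σ) (z : ℂ) :
    Tendsto (fun n => partialDensity α σ n z) atTop (𝓝 ((2 * Real.pi)⁻¹ * dens α 0 σ z)) := by
  have h := (Complex.continuous_re.tendsto _).comp
    (tendsto_partialDensity hα hσ (η := 0) (by simp) z)
  have e : (2 * Real.pi)⁻¹ * dens α 0 σ z = (densC α 0 σ 0 z).re := by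
    rw [dens, inv_mul_cancel_left₀ (by positivity)]
  rw [e]
  exact h

theorem dens_nonneg {α σ : ℝ} (hα : 0 < α) (hσ : 1 / 2 < σ) (z : ℂ) : 0 ≤ dens α 0 σ z := by
  have h := ge_of_tendsto (tendsto_partialDensity_dens hα hσ z)
    ((eventually_ge_atTop 23).mono fun n hn => (partialDensity_spec hα hσ hn).2.1 z)
  have hπ : 0 < (2 * Real.pi)⁻¹ := by positivity
  exact nonneg_of_mul_nonneg_right h hπ

/-- Integrals of functions of moderate growth converge. -/
theorem tendsto_integral_partialConvolution {α σ : ℝ} (hα : 0 < α) (hσ : 1 / 2 < σ)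
    {E : Type*} [NormedAddCommGroup E] [NormedSpace ℝ E] {f : ℂ → E} (hf : AEStronglyMeasurable f)
    {g : ℂ → ℝ} (hg : Integrable fun z => Real.exp (-‖z‖) * g z) (hfg : ∀ z, ‖f z‖ ≤ g z) :
    Tendsto (fun n => ∫ z, f z ∂(partialConvolution α σ n : Measure ℂ)) atTop
      (𝓝 (∫ z, ((2 * Real.pi)⁻¹ * dens α 0 σ z) • f z)) := by
  obtain ⟨C, hC, h⟩ := exists_abs_dens_le hα hσ le_rfl
  have hlim : Tendsto (fun n => ∫ z, partialDensity α σ n z • f z) atTop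
      (𝓝 (∫ z, ((2 * Real.pi)⁻¹ * dens α 0 σ z) • f z)) := by
    refine tendsto_integral_filter_of_dominated_convergence
      (fun z => C * (Real.exp (-‖z‖) * g z)) ?_ ?_ (hg.const_mul C) ?_
    · filter_upwards [eventually_ge_atTop 23] with n hn
      exact (partialDensity_spec hα hσ hn).1.aestronglyMeasurable.smul hf
    · filter_upwards [eventually_ge_atTop 23] with n hn
      refine Eventually.of_forall fun z => ?_
      rw [norm_smul, Real.norm_of_nonneg ((partialDensity_spec hα hσ hn).2.1 z), ← mul_assoc]
      have := (h σ le_rfl le_rfl z).2 n hn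
      have := hfg z
      gcongr
    · exact Eventually.of_forall fun z => (tendsto_partialDensity_dens hα hσ z).smul_const _
  refine hlim.congr' ?_
  filter_upwards [eventually_ge_atTop 23] with n hn
  exact (integral_partialConvolution hα hσ hn f).symm

theorem integral_dzMeasure {E : Type*} [NormedAddCommGroup E] [NormedSpace ℝ E] (f : ℂ → E) :
    ∫ z, f z ∂dzMeasure = (2 * Real.pi)⁻¹ • ∫ z, f z := by
  rw [dzMeasure, integral_smul_measure, ENNReal.toReal_ofReal (by positivity)]

theorem integrable_dzMeasure_iff {E : Type*} [NormedAddCommGroup E] {f : ℂ → E} :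
    Integrable f dzMeasure ↔ Integrable f := by
  rw [dzMeasure]
  refine integrable_smul_measure ?_ ENNReal.ofReal_ne_top
  simp only [ne_eq, ENNReal.ofReal_eq_zero, not_le]
  positivity

theorem integrable_dens {α σ : ℝ} (hα : 0 < α) (hσ : 1 / 2 < σ) {j : ℕ} (hj : j ≤ 3) :
    Integrable (dens α j σ) := by
  obtain ⟨C, hC, h⟩ := exists_abs_dens_le hα hσ le_rfl
  exact (integrable_exp_neg_norm.const_mul C).mono' (continuous_dens hα hσ hj).aestronglyMeasurable
    (Eventually.of_forall fun z => (h σ le_rfl le_rfl z).1 j hj)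

theorem integral_dens {α σ : ℝ} (hα : 0 < α) (hσ : 1 / 2 < σ) :
    ∫ z, dens α 0 σ z ∂dzMeasure = 1 := by
  have h := tendsto_integral_partialConvolution hα hσ (f := fun _ => (1 : ℝ)) (g := fun _ => 1)
    aestronglyMeasurable_const (by simpa using integrable_exp_neg_norm) (by simp)
  simp only [integral_const, probReal_univ, smul_eq_mul, mul_one] at h
  rw [integral_dzMeasure, ← tendsto_nhds_unique h tendsto_const_nhds, smul_eq_mul, integral_const_mul]

theorem isProbabilityMeasure_dens {α σ : ℝ} (hα : 0 < α) (hσ : 1 / 2 < σ) :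
    IsProbabilityMeasure (dzMeasure.withDensity fun z => ENNReal.ofReal (dens α 0 σ z)) := by
  constructor
  rw [withDensity_apply _ MeasurableSet.univ, Measure.restrict_univ,
    ← ofReal_integral_eq_lintegral_ofReal (integrable_dzMeasure_iff.2 (integrable_dens hα hσ (by norm_num)))
      (Eventually.of_forall (dens_nonneg hα hσ)), integral_dens hα hσ, ENNReal.ofReal_one]

theorem integral_withDensity_dens {α σ : ℝ} (hα : 0 < α) (hσ : 1 / 2 < σ)
    {E : Type*} [NormedAddCommGroup E] [NormedSpace ℝ E] (f : ℂ → E) :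
    ∫ z, f z ∂(dzMeasure.withDensity fun z => ENNReal.ofReal (dens α 0 σ z)) =
      ∫ z, ((2 * Real.pi)⁻¹ * dens α 0 σ z) • f z := by
  rw [integral_withDensity_eq_integral_toReal_smul
    (continuous_dens hα hσ (by norm_num)).measurable.ennreal_ofReal
      (Eventually.of_forall fun _ => ENNReal.ofReal_lt_top), integral_dzMeasure, ← integral_smul]
  refine integral_congr_ae (Eventually.of_forall fun z => ?_)
  simp only
  rw [ENNReal.toReal_ofReal (dens_nonneg hα hσ z), smul_smul]

/-- Pointwise convergence of the partial densities under a common exponential majorant gives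
convergence of the integrals of bounded continuous functions. -/
theorem isLimitDensity_dens {α σ : ℝ} (hα : 0 < α) (hσ : 1 / 2 < σ) :
    IsLimitDensity α σ (dens α 0 σ) := by
  let φ : ProbabilityMeasure ℂ := ⟨_, isProbabilityMeasure_dens hα hσ⟩
  refine ⟨continuous_dens hα hσ (by norm_num), dens_nonneg hα hσ, φ,
    ProbabilityMeasure.tendsto_iff_forall_integral_tendsto.2 fun f => ?_, rfl⟩
  have h := tendsto_integral_partialConvolution hα hσ (f := f) (g := fun _ => ‖f‖)
    f.continuous.aestronglyMeasurable (integrable_exp_neg_norm.mul_const _) f.norm_coe_le_norm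
  rw [← integral_withDensity_dens hα hσ] at h
  exact h

/-- The Fourier transform of the limit law. -/
theorem measFT_dens {α σ : ℝ} (hα : 0 < α) (hσ : 1 / 2 < σ) :
    measFT (dzMeasure.withDensity fun z => ENNReal.ofReal (dens α 0 σ z)) =
      fun w => mgf α σ (kap 0 w) := by
  funext w
  have h1 := tendsto_integral_partialConvolution hα hσ (f := gexp 0 w) (g := fun _ => 1)
    (continuous_gexp 0 w).aestronglyMeasurable (by simpa using integrable_exp_neg_norm)
    (fun z => by simp only [gexp, inner_zero_right, Complex.ofReal_zero, zero_add]
                 exact (Complex.norm_exp_ofReal_mul_I _).le)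
  rw [← integral_withDensity_dens hα hσ] at h1
  have h2 := (tendsto_mgfPartial hα (s := (σ : ℂ)) (by simpa using hσ) (kap 0 w)).comp
    (tendsto_add_atTop_nat 1)
  have h3 : (fun n => ∫ z, gexp 0 w z ∂(partialConvolution α σ n : Measure ℂ)) =
      (fun N => mgfPartial α N (σ : ℂ) (kap 0 w)) ∘ fun n => n + 1 := by
    funext n
    exact (integrable_gexp_partialConvolution hα σ 0 w n).2
  rw [h3] at h1
  rw [← tendsto_nhds_unique h1 h2, measFT]
  refine integral_congr_ae (Eventually.of_forall fun x => ?_)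
  simp [gexp]

theorem densityM_eq {α σ : ℝ} (hα : 0 < α) (hσ : 1 / 2 < σ) : densityM α σ = dens α 0 σ := by
  have h : ∃ M, IsLimitDensity α σ M := ⟨_, isLimitDensity_dens hα hσ⟩
  rw [densityM, dif_pos h]
  exact h.choose_spec.unique (isLimitDensity_dens hα hσ)

/-- The formula for `densityM` holds for exponents above 1/2, an open condition, and can therefore
be differentiated twice. -/
theorem densityM_deriv2_eq {α σ : ℝ} (hα : 0 < α) (hσ : 1 / 2 < σ) (z : ℂ) :
    densityM_deriv2 α σ z = dens α 2 σ z := by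
  have h1 : ∀ τ : ℝ, 1 / 2 < τ → deriv (fun u => densityM α u z) τ = dens α 1 τ z := by
    intro τ hτ
    refine ((hasDerivAt_dens hα hτ (by norm_num) z).congr_of_eventuallyEq ?_).deriv
    filter_upwards [lt_mem_nhds hτ] with u hu
    rw [densityM_eq hα hu]
  rw [densityM_deriv2, iteratedDeriv_succ, iteratedDeriv_one]
  refine ((hasDerivAt_dens hα hσ (by norm_num) z).congr_of_eventuallyEq ?_).deriv
  filter_upwards [lt_mem_nhds hσ] with u hu
  rw [h1 u hu]

theorem contDiffOn_densityM {α : ℝ} (hα : 0 < α) (z : ℂ) :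
    ContDiffOn ℝ 2 (fun σ => densityM α σ z) (Ioi (1 / 2)) := by
  have h0 : ContDiffOn ℝ 2 (fun σ => dens α 0 σ z) (Ioi (1 / 2)) := by
    rw [show (2 : WithTop ℕ∞) = 1 + 1 by norm_num, contDiffOn_succ_iff_deriv_of_isOpen isOpen_Ioi]
    refine ⟨fun τ hτ => (hasDerivAt_dens hα hτ (by norm_num) z).differentiableAt.differentiableWithinAt,
      by simp, ?_⟩
    have h1 : ContDiffOn ℝ 1 (fun σ => dens α 1 σ z) (Ioi (1 / 2)) := by
      rw [show (1 : WithTop ℕ∞) = 0 + 1 by norm_num, contDiffOn_succ_iff_deriv_of_isOpen isOpen_Ioi]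
      refine ⟨fun τ hτ => (hasDerivAt_dens hα hτ (by norm_num) z).differentiableAt.differentiableWithinAt,
        by simp, ?_⟩
      rw [contDiffOn_zero]
      refine ContinuousOn.congr (f := fun σ => dens α 2 σ z) (fun τ hτ =>
        (hasDerivAt_dens hα hτ (by norm_num) z).continuousAt.continuousWithinAt) ?_
      exact fun τ hτ => (hasDerivAt_dens hα hτ (by norm_num) z).deriv
    exact h1.congr fun τ hτ => (hasDerivAt_dens hα hτ (by norm_num) z).deriv
  exact h0.congr fun τ hτ => by rw [densityM_eq hα hτ]

/-! ### The mean of log |z| under the limit law as a function of σ. -/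

/-- The leading factor `y` is the Jacobian of polar coordinates. For y ≤ 1 the inequality log t ≤ t
- 1 at t = y^(-1/2) gives log² y ≤ 4/y. -/
theorem mul_log_sq_le {y : ℝ} (hy : 0 < y) : y * (1 + Real.log y ^ 2) ≤ 5 + y + y ^ 3 := by
  rcases le_total y 1 with h | h
  · have h1 := Real.log_le_sub_one_of_pos (Real.sqrt_pos.2 (inv_pos.2 hy))
    rw [Real.log_sqrt (inv_pos.2 hy).le, Real.log_inv] at h1
    have h2 : 0 ≤ -Real.log y := neg_nonneg.2 (Real.log_nonpos hy.le h)
    have h3 : (Real.log y) ^ 2 ≤ 4 * y⁻¹ := by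
      rw [← Real.sq_sqrt (inv_pos.2 hy).le]
      nlinarith [Real.sqrt_nonneg (y⁻¹)]
    have h4 : y * (4 * y⁻¹) = 4 := by field_simp
    nlinarith [pow_pos hy 3]
  · have h1 := Real.log_le_sub_one_of_pos hy
    have h2 := Real.log_nonneg h
    have h3 : Real.log y ^ 2 ≤ y ^ 2 := by nlinarith
    nlinarith

theorem integrable_log_sq_mul_exp_neg_norm :
    Integrable fun z : ℂ => (1 + Real.log ‖z‖ ^ 2) * Real.exp (-‖z‖) := by
  rw [integrable_fun_norm_addHaar (volume : Measure ℂ)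
    (f := fun y : ℝ => (1 + Real.log y ^ 2) * Real.exp (-y)), Complex.finrank_real_complex]
  have h0 : IntegrableOn (fun y : ℝ => 60 * Real.exp (-(1 / 2) * y)) (Ioi 0) :=
    (exp_neg_integrableOn_Ioi 0 (by norm_num : (0 : ℝ) < 1 / 2)).const_mul 60
  refine h0.mono' (Measurable.aestronglyMeasurable (by fun_prop)) ?_
  filter_upwards [ae_restrict_mem measurableSet_Ioi] with y hy
  have hy : 0 < y := hy
  have h1 := mul_log_sq_le hy
  rw [Real.norm_of_nonneg (by positivity), smul_eq_mul, show 2 - 1 = 1 from rfl, pow_one, ← mul_assoc]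
  have h2 : Real.exp (-(1 / 2) * y) = Real.exp (y / 2) * Real.exp (-y) := by
    rw [← Real.exp_add]; congr 1; ring
  rw [h2, ← mul_assoc]
  have h3 := Real.pow_div_factorial_le_exp (y / 2) (by positivity) 3
  have h4 := Real.add_one_le_exp (y / 2)
  norm_num [Nat.factorial] at h3
  have h5 : (y / 2) ^ 3 / 6 = y ^ 3 / 48 := by ring
  exact mul_le_mul_of_nonneg_right (by linarith) (Real.exp_pos _).le

theorem abs_log_le_one_add_sq (x : ℝ) : |Real.log x| ≤ 1 + Real.log x ^ 2 := by
  rw [← sq_abs]; nlinarith [sq_nonneg (|Real.log x| - 1), abs_nonneg (Real.log x)]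

/-- A single majorant for all σ in a compact interval and all `j ≤ 3`. It serves for differentiation
under the integral as well as for second moments of log |z|. -/
theorem integrable_of_abs_le_dens {α a b : ℝ} (hα : 0 < α) (ha : 1 / 2 < a) (hab : a ≤ b) :
    ∃ g : ℂ → ℝ, Integrable g dzMeasure ∧ ∀ σ : ℝ, a ≤ σ → σ ≤ b → ∀ j ≤ 3, ∀ z : ℂ,
      (1 + Real.log ‖z‖ ^ 2) * |dens α j σ z| ≤ g z := by
  obtain ⟨C, hC, h⟩ := exists_abs_dens_le hα ha hab
  refine ⟨fun z => C * ((1 + Real.log ‖z‖ ^ 2) * Real.exp (-‖z‖)),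
    integrable_dzMeasure_iff.2 (integrable_log_sq_mul_exp_neg_norm.const_mul C), ?_⟩
  intro σ h1 h2 j hj z
  calc _ ≤ (1 + Real.log ‖z‖ ^ 2) * (C * Real.exp (-‖z‖)) := by
        have := (h σ h1 h2 z).1 j hj; gcongr
    _ = _ := by ring

/-- The `j`-th derivative in `σ` of the mean of `log |z|` under the limit law. -/
def logMean (α : ℝ) (j : ℕ) (σ : ℝ) : ℝ := ∫ z : ℂ, Real.log ‖z‖ * dens α j σ z ∂dzMeasure

theorem measurable_log_norm : Measurable fun z : ℂ => Real.log ‖z‖ := by fun_prop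

theorem aestronglyMeasurable_log_mul_dens {α σ : ℝ} (hα : 0 < α) (hσ : 1 / 2 < σ) {j : ℕ} (hj : j ≤ 3) :
    AEStronglyMeasurable (fun z : ℂ => Real.log ‖z‖ * dens α j σ z) dzMeasure :=
  (measurable_log_norm.mul (continuous_dens hα hσ hj).measurable).aestronglyMeasurable

theorem integrable_log_mul_dens {α σ : ℝ} (hα : 0 < α) (hσ : 1 / 2 < σ) {j : ℕ} (hj : j ≤ 3) :
    Integrable (fun z : ℂ => Real.log ‖z‖ * dens α j σ z) dzMeasure := by
  obtain ⟨g, hg, h⟩ := integrable_of_abs_le_dens hα hσ le_rfl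
  refine hg.mono' (aestronglyMeasurable_log_mul_dens hα hσ hj) (Eventually.of_forall fun z => ?_)
  rw [norm_mul, Real.norm_eq_abs, Real.norm_eq_abs]
  exact (mul_le_mul_of_nonneg_right (abs_log_le_one_add_sq _) (abs_nonneg _)).trans
    (h σ le_rfl le_rfl j hj z)

theorem hasDerivAt_logMean {α σ : ℝ} (hα : 0 < α) (hσ : 1 / 2 < σ) {j : ℕ} (hj : j ≤ 2) :
    HasDerivAt (logMean α j) (logMean α (j + 1) σ) σ := by
  set a := (1 / 2 + σ) / 2 with ha
  have ha1 : 1 / 2 < a := by linarith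
  have ha2 : a < σ := by linarith
  obtain ⟨g, hg, h⟩ := integrable_of_abs_le_dens hα ha1 (by linarith : a ≤ σ + 1)
  have hnhds : Icc a (σ + 1) ∈ 𝓝 σ := Icc_mem_nhds ha2 (by linarith)
  refine (hasDerivAt_integral_of_dominated_loc_of_deriv_le (bound := g) (μ := dzMeasure)
    (F := fun σ z => Real.log ‖z‖ * dens α j σ z)
    (F' := fun σ z => Real.log ‖z‖ * dens α (j + 1) σ z) hnhds ?_
    (integrable_log_mul_dens hα hσ (by omega)) (aestronglyMeasurable_log_mul_dens hα hσ (by omega))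
    ?_ hg ?_).2
  · filter_upwards [hnhds] with τ hτ
    exact aestronglyMeasurable_log_mul_dens hα (by linarith [hτ.1]) (by omega)
  · refine Eventually.of_forall fun z τ hτ => ?_
    rw [norm_mul, Real.norm_eq_abs, Real.norm_eq_abs]
    exact (mul_le_mul_of_nonneg_right (abs_log_le_one_add_sq _) (abs_nonneg _)).trans
      (h τ hτ.1 hτ.2 _ (by omega) z)
  · exact Eventually.of_forall fun z τ hτ => (hasDerivAt_dens hα (by linarith [hτ.1]) hj z).const_mul _

theorem logIntegral_eq {α σ : ℝ} (hα : 0 < α) (hσ : 1 / 2 < σ) : logIntegral α σ = logMean α 2 σ := by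
  simp only [logIntegral, logMean, densityM_deriv2_eq hα hσ]

theorem integrable_log_mul_densityM_deriv2 {α σ : ℝ} (hα : 0 < α) (hσ : 1 / 2 < σ) :
    Integrable (fun z : ℂ => Real.log ‖z‖ * densityM_deriv2 α σ z) dzMeasure := by
  simp only [densityM_deriv2_eq hα hσ]
  exact integrable_log_mul_dens hα hσ (by norm_num)

theorem continuousOn_logMean {α : ℝ} (hα : 0 < α) {j : ℕ} (hj : j ≤ 2) :
    ContinuousOn (logMean α j) (Ioi (1 / 2)) := fun _ hσ =>
  (hasDerivAt_logMean hα hσ hj).continuousAt.continuousWithinAt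

theorem uIcc_subset_Ioi_half {a b : ℝ} (ha : 1 / 2 < a) (hab : a ≤ b) : uIcc a b ⊆ Ioi (1 / 2) := by
  rw [uIcc_of_le hab]; exact fun x hx => ha.trans_le hx.1

theorem intervalIntegrable_logIntegral {α a b : ℝ} (hα : 0 < α) (ha : 1 / 2 < a) (hab : a ≤ b) :
    IntervalIntegrable (logIntegral α) volume a b := by
  have h : ContinuousOn (logIntegral α) (uIcc a b) :=
    ((continuousOn_logMean hα le_rfl).mono (uIcc_subset_Ioi_half ha hab)).congr
      fun x hx => logIntegral_eq hα (uIcc_subset_Ioi_half ha hab hx)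
  exact h.intervalIntegrable

/-- The inner integral is the second derivative of the mean of log |z|, so integration over σ leaves
the increment of the first derivative. Only this increment enters the count of zeros. -/
theorem zeroConstant_eq {α a b : ℝ} (hα : 0 < α) (ha : 1 / 2 < a) (hab : a ≤ b) :
    zeroConstant α a b = 1 / (2 * Real.pi) * (logMean α 1 b - logMean α 1 a) := by
  rw [zeroConstant, intervalIntegral.integral_eq_sub_of_hasDerivAt
    (fun x hx => ?_) (intervalIntegrable_logIntegral hα ha hab)]
  have hx' := uIcc_subset_Ioi_half ha hab hx
  rw [logIntegral_eq hα hx']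
  exact hasDerivAt_logMean hα hx' (by norm_num)

/-! ### Approximation of the Lerch zeta-function by its partial sums. -/

theorem norm_one_add_cpow_sub_le {s : ℂ} (hs : 0 < s.re) {x y : ℝ} (hx : 0 ≤ x) (hy : 0 ≤ y) :
    ‖((1 + x : ℝ) : ℂ) ^ (-s) - ((1 + y : ℝ) : ℂ) ^ (-s)‖ ≤ ‖s‖ * |x - y| := by
  have hs0 : -s ≠ 0 := by
    intro h
    rw [neg_eq_zero.1 h] at hs
    simp at hs
  have hd : ∀ u ∈ Ici (1 : ℝ), HasDerivWithinAt (fun v : ℝ => (v : ℂ) ^ (-s))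
      (-s * (u : ℂ) ^ (-s - 1)) (Ici 1) u := fun u hu =>
    (hasDerivAt_ofReal_cpow_const (zero_lt_one.trans_le hu).ne' hs0).hasDerivWithinAt
  have hC : ∀ u ∈ Ici (1 : ℝ), ‖-s * (u : ℂ) ^ (-s - 1)‖ ≤ ‖s‖ := by
    intro u hu
    have hu1 : (1 : ℝ) ≤ u := hu
    rw [norm_mul, norm_neg, Complex.norm_cpow_eq_rpow_re_of_pos (by linarith)]
    refine mul_le_of_le_one_right (norm_nonneg _) (Real.rpow_le_one_of_one_le_of_nonpos hu1 ?_)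
    simp; linarith
  have h := (convex_Ici (1 : ℝ)).norm_image_sub_le_of_norm_hasDerivWithin_le hd hC
    (show 1 + y ∈ Ici (1 : ℝ) by simpa using hy) (show 1 + x ∈ Ici (1 : ℝ) by simpa using hx)
  simpa using h

/-- Summation by parts for a sum whose terms are nearly differences. -/
theorem norm_sum_sub_telescope_le {α : ℝ} (hα : 0 < α) {b B h : ℕ → ℂ} {κ β : ℝ} {M : ℕ}
    (hκ : 0 ≤ κ) (hβ : 0 ≤ β) (hM1 : 1 ≤ (M : ℝ) + α) (hM2 : 2 * κ ≤ (M : ℝ) + α)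
    (hB : ∀ n, B n - B (n + 1) = h n * b n)
    (h1 : ∀ n, ‖h n - 1‖ ≤ κ * ((n : ℝ) + α)⁻¹)
    (h2 : ∀ n, ‖h (n + 1) - h n‖ ≤ κ * (((n : ℝ) + α)⁻¹ - ((n : ℝ) + α + 1)⁻¹))
    (hBn : ∀ n, M ≤ n → ‖B n‖ ≤ β * √((n : ℝ) + α)) (R : ℕ) (hR : M ≤ R) :
    ‖∑ n ∈ Finset.Ico M R, (b n - (B n - B (n + 1)))‖ ≤ 20 * κ * β * (√((M : ℝ) + α))⁻¹ := by
  have hpos : ∀ n : ℕ, 0 < (n : ℝ) + α := fun n => base_pos hα n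
  have hge : ∀ n, M ≤ n → (M : ℝ) + α ≤ (n : ℝ) + α := fun n hn => by
    have : (M : ℝ) ≤ n := by exact_mod_cast hn
    linarith
  have hhalf : ∀ n, M ≤ n → 1 / 2 ≤ ‖h n‖ := by
    intro n hn
    have h3 : κ * ((n : ℝ) + α)⁻¹ ≤ 1 / 2 := by
      rw [← div_eq_mul_inv, div_le_iff₀ (hpos n)]
      linarith [hge n hn]
    have h4 := norm_sub_norm_le (1 : ℂ) (1 - h n)
    rw [norm_one, sub_sub_cancel, norm_sub_rev] at h4
    linarith [h1 n]
  have hne : ∀ n, M ≤ n → h n ≠ 0 := fun n hn h0 => by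
    have := hhalf n hn
    rw [h0, norm_zero] at this
    linarith
  -- Each summand equals `x n * (B n - B (n + 1))`, where `x` is small and of small variation, so
  -- Abel summation moves the difference from `B` onto `x`.
  set x : ℕ → ℂ := fun n => (h n)⁻¹ - 1 with hx
  have hinv : ∀ n, M ≤ n → ‖(h n)⁻¹‖ ≤ 2 := by
    intro n hn
    rw [norm_inv]
    exact (inv_anti₀ (by norm_num) (hhalf n hn)).trans (by norm_num)
  have hx1 : ∀ n, M ≤ n → ‖x n‖ ≤ 2 * κ * ((n : ℝ) + α)⁻¹ := by
    intro n hn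
    have e : x n = (h n)⁻¹ * (1 - h n) := by
      simp only [hx]; rw [mul_sub, inv_mul_cancel₀ (hne n hn)]; ring
    rw [e, norm_mul, norm_sub_rev, mul_assoc]
    have := h1 n
    have := hinv n hn
    gcongr
  have hx2 : ∀ n, M ≤ n → ‖x (n + 1) - x n‖ ≤ 4 * κ * (((n : ℝ) + α)⁻¹ - ((n : ℝ) + α + 1)⁻¹) := by
    intro n hn
    have e : x (n + 1) - x n = (h (n + 1))⁻¹ * (h n)⁻¹ * -(h (n + 1) - h n) := by
      have := hne n hn
      have := hne (n + 1) (by omega)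
      simp only [hx]; field_simp; ring
    rw [e, norm_mul, norm_mul, norm_neg]
    have i1 := hinv n hn
    have i2 := hinv (n + 1) (by omega)
    calc _ ≤ 2 * 2 * (κ * (((n : ℝ) + α)⁻¹ - ((n : ℝ) + α + 1)⁻¹)) := by
          have := h2 n; gcongr
      _ = _ := by ring
  have hsum : ∀ R, M ≤ R → ∑ n ∈ Finset.Ico M R, (b n - (B n - B (n + 1))) =
      x M * B M - x R * B R + ∑ n ∈ Finset.Ico M R, (x (n + 1) - x n) * B (n + 1) := by
    intro R hR
    induction R, hR using Nat.le_induction with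
    | base => simp
    | succ R hR ih =>
      rw [Finset.sum_Ico_succ_top hR, Finset.sum_Ico_succ_top hR, ih]
      have : b R = (h R)⁻¹ * (B R - B (R + 1)) := by
        rw [hB, inv_mul_cancel_left₀ (hne R hR)]
      rw [this]
      simp only [hx]
      ring
  have hsq : ∀ n, M ≤ n → ‖x n * B n‖ ≤ 2 * κ * β * (√((M : ℝ) + α))⁻¹ := by
    intro n hn
    have hs := Real.sqrt_pos.2 (hpos n)
    rw [norm_mul]
    calc _ ≤ (2 * κ * ((n : ℝ) + α)⁻¹) * (β * √((n : ℝ) + α)) := by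
          have := hx1 n hn; have := hBn n hn; gcongr
      _ = 2 * κ * β * (√((n : ℝ) + α))⁻¹ := by
          nth_rewrite 1 [← Real.mul_self_sqrt (hpos n).le]
          field_simp
      _ ≤ _ := by
          have := Real.sqrt_pos.2 (hpos M)
          have := hge n hn
          gcongr
  -- The bound has the form of a telescoping difference of (n + α)^(-1/2), so that the sum over `n`
  -- costs no more than its value at `M`.
  have hterm : ∀ n, M ≤ n → ‖(x (n + 1) - x n) * B (n + 1)‖ ≤
      16 * κ * β * ((√((n : ℝ) + α))⁻¹ - (√(((n + 1 : ℕ) : ℝ) + α))⁻¹) := by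
    intro n hn
    set r := √((n : ℝ) + α) with hr
    set r' := √(((n + 1 : ℕ) : ℝ) + α) with hr'
    have hr2 : r * r = (n : ℝ) + α := Real.mul_self_sqrt (hpos n).le
    have hr'2 : r' * r' = (n : ℝ) + α + 1 := by
      rw [hr', Real.mul_self_sqrt (hpos _).le]; push_cast; ring
    have hr0 : 1 ≤ r := Real.one_le_sqrt.2 (hM1.trans (hge n hn))
    have hr'0 : 0 ≤ r' := Real.sqrt_nonneg _
    have hrr : r ≤ r' := by nlinarith
    have hrr3 : r' ≤ 3 * r := by nlinarith
    rw [norm_mul]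
    calc _ ≤ (4 * κ * ((r * r)⁻¹ - (r' * r')⁻¹)) * (β * r') := by
          have i1 := hx2 n hn
          have i2 := hBn (n + 1) (by omega)
          rw [← hr'2, ← hr2] at i1
          exact mul_le_mul i1 i2 (norm_nonneg _) ((norm_nonneg _).trans i1)
      _ = 4 * κ * β * (((r * r)⁻¹ - (r' * r')⁻¹) * r') := by ring
      _ ≤ 4 * κ * β * (4 * (r⁻¹ - r'⁻¹)) := by
          refine mul_le_mul_of_nonneg_left ?_ (by positivity)
          have hr'1 : 0 < r' := by linarith
          have e1 : ((r * r)⁻¹ - (r' * r')⁻¹) * r' = (r' - r) * (r' + r) / (r * r * r') := by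
            field_simp; ring
          have e2 : 4 * (r⁻¹ - r'⁻¹) = (r' - r) * (4 * r) / (r * r * r') := by
            field_simp
          rw [e1, e2]
          have : 0 ≤ r' - r := by linarith
          gcongr
          linarith
      _ = _ := by ring
  have htel : ∑ n ∈ Finset.Ico M R, ((√((n : ℝ) + α))⁻¹ - (√(((n + 1 : ℕ) : ℝ) + α))⁻¹) ≤
      (√((M : ℝ) + α))⁻¹ := by
    have e : ∀ R, M ≤ R → ∑ n ∈ Finset.Ico M R, ((√((n : ℝ) + α))⁻¹ - (√(((n + 1 : ℕ) : ℝ) + α))⁻¹) =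
        (√((M : ℝ) + α))⁻¹ - (√((R : ℝ) + α))⁻¹ := by
      intro R hR
      induction R, hR using Nat.le_induction with
      | base => simp
      | succ R hR ih => rw [Finset.sum_Ico_succ_top hR, ih]; ring
    rw [e R hR]
    have : 0 ≤ (√((R : ℝ) + α))⁻¹ := by positivity
    linarith
  rw [hsum R hR]
  have hfin : ‖∑ n ∈ Finset.Ico M R, (x (n + 1) - x n) * B (n + 1)‖ ≤
      16 * κ * β * (√((M : ℝ) + α))⁻¹ := by
    refine (norm_sum_le_of_le _ fun n hn => hterm n (Finset.mem_Ico.1 hn).1).trans ?_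
    rw [← Finset.mul_sum]
    gcongr
  calc _ ≤ ‖x M * B M‖ + ‖x R * B R‖ + ‖∑ n ∈ Finset.Ico M R, (x (n + 1) - x n) * B (n + 1)‖ :=
        (norm_add_le _ _).trans (by gcongr; exact norm_sub_le _ _)
    _ ≤ 2 * κ * β * (√((M : ℝ) + α))⁻¹ + 2 * κ * β * (√((M : ℝ) + α))⁻¹ +
        16 * κ * β * (√((M : ℝ) + α))⁻¹ := by
        gcongr
        · exact hsq M le_rfl
        · exact hsq R hR
    _ = _ := by ring

/-- The number `e^{2πiλ}`. -/
def lerchZ (lam : ℝ) : ℂ := Complex.exp (2 * Real.pi * Complex.I * lam)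

theorem norm_lerchZ (lam : ℝ) : ‖lerchZ lam‖ = 1 := by
  rw [lerchZ, show (2 * Real.pi * Complex.I * lam : ℂ) = ((2 * Real.pi * lam : ℝ) : ℂ) * Complex.I by
    push_cast; ring]
  exact Complex.norm_exp_ofReal_mul_I _

theorem lerchZ_eq_one_iff {lam : ℝ} : lerchZ lam = 1 ↔ ∃ k : ℤ, (k : ℝ) = lam := by
  rw [lerchZ, Complex.exp_eq_one_iff]
  refine exists_congr fun n => ?_
  have h2 : (2 * Real.pi * Complex.I : ℂ) ≠ 0 := by simp [Real.pi_ne_zero]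
  rw [mul_comm (n : ℂ), mul_right_inj' h2]
  constructor
  · intro h; exact_mod_cast h.symm
  · intro h; exact_mod_cast h.symm

/-- The term `e^{2πiλn} / (n + α)^s`. -/
def lerchTerm (lam α : ℝ) (s : ℂ) (n : ℕ) : ℂ := lerchZ lam ^ n * (((n : ℝ) + α : ℝ) : ℂ) ^ (-s)

theorem lerchPartialSum_eq (lam α : ℝ) (s : ℂ) (N : ℕ) :
    lerchPartialSum lam α s N = ∑ n ∈ Finset.range N, lerchTerm lam α s n := by
  refine Finset.sum_congr rfl fun n _ => ?_
  rw [lerchTerm, lerchZ, ← Complex.exp_nat_mul, Complex.cpow_neg, div_eq_mul_inv,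
    mul_comm (2 * (Real.pi : ℂ) * Complex.I * lam) (n : ℂ)]
  push_cast
  rfl

theorem norm_lerchTerm {α : ℝ} (hα : 0 < α) (lam : ℝ) (s : ℂ) (n : ℕ) :
    ‖lerchTerm lam α s n‖ = ((n : ℝ) + α) ^ (-s.re) := by
  rw [lerchTerm, norm_mul, norm_pow, norm_lerchZ, one_pow, one_mul,
    Complex.norm_cpow_eq_rpow_re_of_pos (base_pos hα n), Complex.neg_re]

theorem base_succ (α : ℝ) (n : ℕ) : ((n + 1 : ℕ) : ℝ) + α = (n : ℝ) + α + 1 := by push_cast; ring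

theorem base_succ_cpow {α : ℝ} (hα : 0 < α) (n : ℕ) (s : ℂ) {u : ℝ} (hu : 0 ≤ u) :
    (((n : ℝ) + α + u : ℝ) : ℂ) ^ (-s) =
      (((n : ℝ) + α : ℝ) : ℂ) ^ (-s) * ((1 + u * ((n : ℝ) + α)⁻¹ : ℝ) : ℂ) ^ (-s) := by
  have h := base_pos hα n
  rw [← Complex.mul_cpow_ofReal_nonneg h.le (by positivity), ← Complex.ofReal_mul]
  congr 2
  field_simp

open Classical in
/-- The main term `B_n` of the tail of the Lerch series. -/
def lerchMain (lam α : ℝ) (s : ℂ) (n : ℕ) : ℂ :=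
  if lerchZ lam = 1 then (((n : ℝ) + α : ℝ) : ℂ) ^ (1 - s) / (s - 1)
  else lerchTerm lam α s n / (1 - lerchZ lam)

open Classical in
/-- The ratio of `B_n - B_{n+1}` to the term of the Lerch series. -/
def lerchRatio (lam α : ℝ) (s : ℂ) (n : ℕ) : ℂ :=
  if lerchZ lam = 1 then ∫ u in (0 : ℝ)..1, ((1 + u * ((n : ℝ) + α)⁻¹ : ℝ) : ℂ) ^ (-s)
  else (1 - lerchZ lam * ((1 + ((n : ℝ) + α)⁻¹ : ℝ) : ℂ) ^ (-s)) / (1 - lerchZ lam)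

/-- For integral λ the difference is the integral of x^(-s) over [n + α, n + α + 1]. Otherwise
consecutive terms form a geometric progression up to a slowly varying factor. -/
theorem lerchMain_sub {α : ℝ} (hα : 0 < α) (lam : ℝ) {s : ℂ} (hs : s ≠ 1) (n : ℕ) :
    lerchMain lam α s n - lerchMain lam α s (n + 1) = lerchRatio lam α s n * lerchTerm lam α s n := by
  have hpos := base_pos hα n
  rw [lerchMain, lerchMain, lerchRatio]
  split_ifs with hz
  · have h1 : ∫ u in (0 : ℝ)..1, (((n : ℝ) + α + u : ℝ) : ℂ) ^ (-s) =
        (((n : ℝ) + α : ℝ) : ℂ) ^ (-s) *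
          ∫ u in (0 : ℝ)..1, ((1 + u * ((n : ℝ) + α)⁻¹ : ℝ) : ℂ) ^ (-s) := by
      rw [← intervalIntegral.integral_const_mul]
      refine intervalIntegral.integral_congr fun u hu => ?_
      rw [uIcc_of_le zero_le_one] at hu
      exact base_succ_cpow hα n s hu.1
    rw [lerchTerm, hz, one_pow, one_mul, mul_comm, ← h1,
      intervalIntegral.integral_comp_add_left (fun x : ℝ => (x : ℂ) ^ (-s)), add_zero,
      integral_cpow (Or.inr ⟨fun h => hs (neg_injective h), fun h => by
        rw [uIcc_of_le (by linarith)] at h; linarith [h.1]⟩), base_succ]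
    have : s - 1 ≠ 0 := sub_ne_zero.2 hs
    have h3 : -s + 1 = 1 - s := by ring
    have h4 : (1 : ℂ) - s ≠ 0 := sub_ne_zero.2 hs.symm
    rw [h3]
    field_simp
    ring
  · have hz' : 1 - lerchZ lam ≠ 0 := sub_ne_zero.2 (Ne.symm hz)
    have h1 : lerchTerm lam α s (n + 1) =
        lerchZ lam * ((1 + ((n : ℝ) + α)⁻¹ : ℝ) : ℂ) ^ (-s) * lerchTerm lam α s n := by
      rw [lerchTerm, lerchTerm, base_succ, base_succ_cpow hα n s zero_le_one, one_mul, pow_succ]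
      ring
    rw [h1]
    field_simp

theorem continuousOn_one_add_cpow {α : ℝ} (hα : 0 < α) (n : ℕ) (s : ℂ) :
    ContinuousOn (fun u : ℝ => ((1 + u * ((n : ℝ) + α)⁻¹ : ℝ) : ℂ) ^ (-s)) (uIcc 0 1) := by
  have hpos := base_pos hα n
  intro u hu
  rw [uIcc_of_le zero_le_one] at hu
  have h1 : 0 < 1 + u * ((n : ℝ) + α)⁻¹ := by have := hu.1; positivity
  refine ContinuousAt.continuousWithinAt ?_
  refine ContinuousAt.cpow (Continuous.continuousAt (by fun_prop)) continuousAt_const ?_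
  exact Or.inl (by rw [Complex.ofReal_re]; exact h1)

/-- In both cases the ratio is built from (1 + x)^(-s) with x between 0 and 1/(n + α), and this
function of x ≥ 0 has Lipschitz constant ‖s‖. -/
theorem norm_lerchRatio_le {α : ℝ} (hα : 0 < α) (lam : ℝ) :
    ∃ K, 1 ≤ K ∧ ∀ s : ℂ, 0 < s.re → ∀ n,
      ‖lerchRatio lam α s n - 1‖ ≤ K * ‖s‖ * ((n : ℝ) + α)⁻¹ ∧
      ‖lerchRatio lam α s (n + 1) - lerchRatio lam α s n‖ ≤
        K * ‖s‖ * (((n : ℝ) + α)⁻¹ - ((n : ℝ) + α + 1)⁻¹) := by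
  have hanti : ∀ n : ℕ, ((n : ℝ) + α + 1)⁻¹ ≤ ((n : ℝ) + α)⁻¹ := fun n =>
    inv_anti₀ (base_pos hα n) (by linarith)
  by_cases hz : lerchZ lam = 1
  · refine ⟨1, le_rfl, fun s hs n => ?_⟩
    have hpos := base_pos hα n
    have hpos' := base_pos hα (n + 1)
    simp only [lerchRatio, if_pos hz]
    rw [one_mul]
    constructor
    · have e : (1 : ℂ) = ∫ u in (0 : ℝ)..1, (1 : ℂ) := by simp
      rw [e, ← intervalIntegral.integral_sub (continuousOn_one_add_cpow hα n s).intervalIntegrable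
        intervalIntegrable_const]
      refine (intervalIntegral.norm_integral_le_of_norm_le_const
        (C := ‖s‖ * ((n : ℝ) + α)⁻¹) fun u hu => ?_).trans (by simp)
      rw [uIoc_of_le zero_le_one] at hu
      have h := norm_one_add_cpow_sub_le hs (x := u * ((n : ℝ) + α)⁻¹) (y := 0)
        (by have := hu.1; positivity) le_rfl
      rw [add_zero, Complex.ofReal_one, Complex.one_cpow, sub_zero,
        abs_of_nonneg (by have := hu.1; positivity)] at h
      refine h.trans (mul_le_mul_of_nonneg_left ?_ (norm_nonneg _))
      exact mul_le_of_le_one_left (by positivity) hu.2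
    · rw [← intervalIntegral.integral_sub (continuousOn_one_add_cpow hα _ s).intervalIntegrable
        (continuousOn_one_add_cpow hα n s).intervalIntegrable]
      refine (intervalIntegral.norm_integral_le_of_norm_le_const
        (C := ‖s‖ * (((n : ℝ) + α)⁻¹ - ((n : ℝ) + α + 1)⁻¹)) fun u hu => ?_).trans (by simp)
      rw [uIoc_of_le zero_le_one] at hu
      have h := norm_one_add_cpow_sub_le hs (x := u * (((n + 1 : ℕ) : ℝ) + α)⁻¹)
        (y := u * ((n : ℝ) + α)⁻¹) (by have := hu.1; positivity) (by have := hu.1; positivity)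
      refine h.trans (mul_le_mul_of_nonneg_left ?_ (norm_nonneg _))
      rw [base_succ, ← mul_sub, abs_mul, abs_sub_comm, abs_of_pos hu.1,
        abs_of_nonneg (sub_nonneg.2 (hanti n))]
      exact mul_le_of_le_one_left (sub_nonneg.2 (hanti n)) hu.2
  · have hz' : 1 - lerchZ lam ≠ 0 := sub_ne_zero.2 (Ne.symm hz)
    have hn : 0 < ‖1 - lerchZ lam‖ := norm_pos_iff.2 hz'
    refine ⟨1 + ‖1 - lerchZ lam‖⁻¹, by have := inv_pos.2 hn; linarith, fun s hs n => ?_⟩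
    have hpos := base_pos hα n
    have hpos' := base_pos hα (n + 1)
    have key : ∀ x y : ℝ, 0 ≤ x → 0 ≤ y →
        ‖(1 - lerchZ lam * ((1 + x : ℝ) : ℂ) ^ (-s)) / (1 - lerchZ lam) -
          (1 - lerchZ lam * ((1 + y : ℝ) : ℂ) ^ (-s)) / (1 - lerchZ lam)‖ ≤
        (1 + ‖1 - lerchZ lam‖⁻¹) * ‖s‖ * |x - y| := by
      intro x y hx hy
      have e : (1 - lerchZ lam * ((1 + x : ℝ) : ℂ) ^ (-s)) / (1 - lerchZ lam) -
          (1 - lerchZ lam * ((1 + y : ℝ) : ℂ) ^ (-s)) / (1 - lerchZ lam) =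
          (1 - lerchZ lam)⁻¹ * (lerchZ lam *
            (((1 + y : ℝ) : ℂ) ^ (-s) - ((1 + x : ℝ) : ℂ) ^ (-s))) := by
        rw [← sub_div, div_eq_inv_mul]; ring
      rw [e, norm_mul, norm_mul, norm_lerchZ, one_mul, norm_inv, mul_assoc]
      have h := norm_one_add_cpow_sub_le hs hy hx
      rw [abs_sub_comm] at h
      have : 0 < ‖1 - lerchZ lam‖⁻¹ := inv_pos.2 hn
      gcongr
      linarith
    simp only [lerchRatio, if_neg hz]
    constructor
    · have h := key ((n : ℝ) + α)⁻¹ 0 (by positivity) le_rfl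
      rwa [add_zero, Complex.ofReal_one, Complex.one_cpow, mul_one, div_self hz', sub_zero,
        abs_of_pos (inv_pos.2 hpos)] at h
    · have h := key (((n + 1 : ℕ) : ℝ) + α)⁻¹ ((n : ℝ) + α)⁻¹ (by positivity) (by positivity)
      rw [base_succ, abs_sub_comm, abs_of_nonneg (sub_nonneg.2 (hanti n))] at h
      rw [base_succ]
      exact h

/-- The difference between a term of the Lerch series and `B_n - B_{n+1}`. -/
def lerchErr (lam α : ℝ) (n : ℕ) (s : ℂ) : ℂ :=
  lerchTerm lam α s n - (lerchMain lam α s n - lerchMain lam α s (n + 1))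

theorem sum_lerchErr (lam α : ℝ) (s : ℂ) (N : ℕ) :
    ∑ n ∈ Finset.range N, lerchErr lam α n s =
      lerchPartialSum lam α s N + lerchMain lam α s N - lerchMain lam α s 0 := by
  simp only [lerchErr]
  rw [Finset.sum_sub_distrib, Finset.sum_range_sub', lerchPartialSum_eq]
  ring

theorem differentiableAt_lerchTerm {α : ℝ} (hα : 0 < α) (lam : ℝ) (n : ℕ) (s : ℂ) :
    DifferentiableAt ℂ (fun s => lerchTerm lam α s n) s := by
  have h : ((((n : ℝ) + α : ℝ)) : ℂ) ≠ 0 := by exact_mod_cast (base_pos hα n).ne'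
  unfold lerchTerm
  exact (differentiableAt_const _).mul (differentiableAt_id.neg.const_cpow (Or.inl h))

theorem differentiableAt_lerchMain {α : ℝ} (hα : 0 < α) (lam : ℝ) (n : ℕ) {s : ℂ} (hs : s ≠ 1) :
    DifferentiableAt ℂ (fun s => lerchMain lam α s n) s := by
  have h : ((((n : ℝ) + α : ℝ)) : ℂ) ≠ 0 := by exact_mod_cast (base_pos hα n).ne'
  unfold lerchMain
  split_ifs
  · exact (((differentiableAt_const _).sub differentiableAt_id).const_cpow (Or.inl h)).div
      (differentiableAt_id.sub_const _) (sub_ne_zero.2 hs)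
  · exact (differentiableAt_lerchTerm hα lam n s).div_const _

/-- The error terms gain a full power of `n + α` over the terms of the series. Their sum converges
absolutely for Re s > 0 and supplies the analytic continuation. -/
theorem norm_lerchErr_le {α : ℝ} (hα : 0 < α) (lam : ℝ) :
    ∃ K, 1 ≤ K ∧ ∀ s : ℂ, 0 < s.re → s ≠ 1 → ∀ n,
      ‖lerchErr lam α n s‖ ≤ K * ‖s‖ * ((n : ℝ) + α) ^ (-(s.re + 1)) := by
  obtain ⟨K, hK, h⟩ := norm_lerchRatio_le hα lam
  refine ⟨K, hK, fun s hs hs1 n => ?_⟩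
  have e : lerchErr lam α n s = -(lerchRatio lam α s n - 1) * lerchTerm lam α s n := by
    rw [lerchErr, lerchMain_sub hα lam hs1]; ring
  have hpos := base_pos hα n
  rw [e, norm_mul, norm_neg, norm_lerchTerm hα, neg_add, Real.rpow_add hpos, Real.rpow_neg_one,
    mul_comm (((n : ℝ) + α) ^ (-s.re)), ← mul_assoc]
  have := (h s hs n).1
  gcongr

theorem summable_base_rpow {α σ : ℝ} (hα : 0 < α) (hσ : 1 < σ) :
    Summable fun n : ℕ => ((n : ℝ) + α) ^ (-σ) := by
  refine ((Real.summable_one_div_nat_add_rpow α σ).2 hσ).congr fun n => ?_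
  rw [Real.rpow_neg (base_pos hα n).le, abs_of_pos (base_pos hα n), one_div]

theorem summable_lerchErr {α : ℝ} (hα : 0 < α) (lam : ℝ) {s : ℂ} (hs : 0 < s.re) (hs1 : s ≠ 1) :
    Summable fun n => lerchErr lam α n s := by
  obtain ⟨K, hK, h⟩ := norm_lerchErr_le hα lam
  exact Summable.of_norm_bounded ((summable_base_rpow hα (by linarith)).mul_left _)
    fun n => h s hs hs1 n

/-- The analytic continuation of the Lerch series. -/
def lerchF (lam α : ℝ) (s : ℂ) : ℂ := lerchMain lam α s 0 + ∑' n, lerchErr lam α n s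

theorem tendsto_lerchF {α : ℝ} (hα : 0 < α) (lam : ℝ) {s : ℂ} (hs : 0 < s.re) (hs1 : s ≠ 1) :
    Tendsto (fun N => lerchPartialSum lam α s N + lerchMain lam α s N) atTop
      (𝓝 (lerchF lam α s)) := by
  have h := (summable_lerchErr hα lam hs hs1).hasSum.tendsto_sum_nat.const_add (lerchMain lam α s 0)
  refine h.congr fun N => ?_
  rw [sum_lerchErr]; ring

theorem differentiableAt_lerchF {α : ℝ} (hα : 0 < α) (lam : ℝ) {s : ℂ} (hs : 0 < s.re) (hs1 : s ≠ 1) :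
    DifferentiableAt ℂ (lerchF lam α) s := by
  obtain ⟨K, hK, h⟩ := norm_lerchErr_le hα lam
  set U : Set ℂ := {q | s.re / 2 < q.re} ∩ (Metric.ball 0 (‖s‖ + 1) ∩ {1}ᶜ) with hU
  have hUo : IsOpen U := (isOpen_lt continuous_const Complex.continuous_re).inter
    (Metric.isOpen_ball.inter isOpen_compl_singleton)
  have hsU : s ∈ U := ⟨by simp only [mem_ofPred_eq]; linarith, by simp, by simpa using hs1⟩
  have hsum : Summable fun n : ℕ => K * (‖s‖ + 1) *
      (((n : ℝ) + α) ^ (-(s.re / 2 + 1)) + ((n : ℝ) + α) ^ (-(‖s‖ + 2))) :=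
    ((summable_base_rpow hα (by linarith)).add
      (summable_base_rpow hα (by linarith [norm_nonneg s]))).mul_left _
  have hd := Complex.differentiableOn_tsum_of_summable_norm (F := fun n q => lerchErr lam α n q) hsum
    (fun n q hq => ?_) hUo (fun n q hq => ?_)
  · exact (differentiableAt_lerchMain hα lam 0 hs1).add (hd.differentiableAt (hUo.mem_nhds hsU))
  · have hq1 : q ≠ 1 := hq.2.2
    exact ((differentiableAt_lerchTerm hα lam n q).sub ((differentiableAt_lerchMain hα lam n hq1).sub
      (differentiableAt_lerchMain hα lam (n + 1) hq1))).differentiableWithinAt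
  · have hq1 : s.re / 2 < q.re := hq.1
    have hq2 : ‖q‖ < ‖s‖ + 1 := by simpa using hq.2.1
    have hpos := base_pos hα n
    refine (h q (by linarith) hq.2.2 n).trans ?_
    have := rpow_neg_le_add hpos (by linarith : s.re / 2 + 1 ≤ q.re + 1)
      (by linarith [Complex.re_le_norm q] : q.re + 1 ≤ ‖s‖ + 2)
    gcongr

theorem tendsto_base_cpow {α : ℝ} (hα : 0 < α) {s : ℂ} (hs : s.re < 0) :
    Tendsto (fun n : ℕ => (((n : ℝ) + α : ℝ) : ℂ) ^ s) atTop (𝓝 0) := by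
  rw [tendsto_zero_iff_norm_tendsto_zero]
  have h8 : (fun N : ℕ => ‖(((N : ℝ) + α : ℝ) : ℂ) ^ s‖) = fun N : ℕ => ((N : ℝ) + α) ^ (-(-s.re)) := by
    funext N
    rw [Complex.norm_cpow_eq_rpow_re_of_pos (base_pos hα N), neg_neg]
  rw [h8]
  exact (tendsto_rpow_neg_atTop (neg_pos.2 hs)).comp
    (tendsto_atTop_add_const_right _ _ tendsto_natCast_atTop_atTop)

theorem tendsto_lerchMain {α : ℝ} (hα : 0 < α) (lam : ℝ) {s : ℂ}
    (hs : lerchZ lam = 1 → 1 < s.re) (hs0 : 0 < s.re) :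
    Tendsto (lerchMain lam α s) atTop (𝓝 0) := by
  by_cases hz : lerchZ lam = 1
  · have h := (tendsto_base_cpow hα (s := 1 - s) (by have := hs hz; simp; linarith)).div_const (s - 1)
    rw [zero_div] at h
    refine h.congr fun n => ?_
    rw [lerchMain, if_pos hz]
  · have h : Tendsto (lerchTerm lam α s) atTop (𝓝 0) := by
      rw [tendsto_zero_iff_norm_tendsto_zero]
      simp only [norm_lerchTerm hα]
      exact (tendsto_rpow_neg_atTop hs0).comp
        (tendsto_atTop_add_const_right _ _ tendsto_natCast_atTop_atTop)
    have h2 := h.div_const (1 - lerchZ lam)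
    rw [zero_div] at h2
    refine h2.congr fun n => ?_
    rw [lerchMain, if_neg hz]

/-- For integral λ both sides are analytic in the open quadrant and agree with the Dirichlet series
for Re s > 1. Otherwise the main term tends to 0 and both sides are the limit of the partial sums.
The condition Im s > 0 excludes the point 1. -/
theorem lerchZeta_eq_lerchF {α : ℝ} (hα : 0 < α) (hα1 : α ≤ 1) (lam : ℝ) {s : ℂ} (hs : 0 < s.re)
    (ht : 0 < s.im) : lerchZeta lam α s = lerchF lam α s := by
  have hne : ∀ q : ℂ, 0 < q.im → q ≠ 1 := fun q hq h => by rw [h] at hq; simp at hq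
  by_cases hk : ∃ k : ℤ, (k : ℝ) = lam
  · have hz := lerchZ_eq_one_iff.2 hk
    set V : Set ℂ := {q | 0 < q.re} ∩ {q | 0 < q.im} with hV
    have hVo : IsOpen V := (isOpen_lt continuous_const Complex.continuous_re).inter
      (isOpen_lt continuous_const Complex.continuous_im)
    have hVc : IsPreconnected V :=
      ((convex_halfSpace_re_gt 0).inter (convex_halfSpace_im_gt 0)).isPreconnected
    have hL : lerchZeta lam α = HurwitzZeta.hurwitzZeta (α : UnitAddCircle) := by
      funext q; rw [lerchZeta, if_pos hk]
    have h1 : AnalyticOnNhd ℂ (lerchZeta lam α) V := by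
      refine DifferentiableOn.analyticOnNhd (fun q hq => ?_) hVo
      rw [hL]
      exact (HurwitzZeta.differentiableAt_hurwitzZeta _ (hne q hq.2)).differentiableWithinAt
    have h2 : AnalyticOnNhd ℂ (lerchF lam α) V :=
      DifferentiableOn.analyticOnNhd (fun q hq =>
        (differentiableAt_lerchF hα lam hq.1 (hne q hq.2)).differentiableWithinAt) hVo
    have h3 : (2 + Complex.I : ℂ) ∈ V := by simp [hV]
    refine h1.eqOn_of_preconnected_of_eventuallyEq h2 hVc h3 ?_ ⟨hs, ht⟩
    have hW : {q : ℂ | 1 < q.re} ∈ 𝓝 (2 + Complex.I : ℂ) :=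
      (isOpen_lt continuous_const Complex.continuous_re).mem_nhds (by simp)
    filter_upwards [hW, hVo.mem_nhds h3] with q hq hqV
    have hq : 1 < q.re := hq
    have h4 := tendsto_lerchF hα lam hqV.1 (hne q hqV.2)
    have h5 := h4.sub (tendsto_lerchMain hα lam (fun _ => hq) hqV.1)
    simp only [add_sub_cancel_right, sub_zero] at h5
    have h6 := (HurwitzZeta.hasSum_hurwitzZeta_of_one_lt_re ⟨hα.le, hα1⟩ hq).tendsto_sum_nat
    rw [hL]
    refine tendsto_nhds_unique h6 (h5.congr fun N => ?_)
    rw [lerchPartialSum_eq]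
    refine Finset.sum_congr rfl fun n _ => ?_
    rw [lerchTerm, hz, one_pow, one_mul, Complex.cpow_neg, one_div]
    push_cast
    rfl
  · have h4 := tendsto_lerchF hα lam hs (hne s ht)
    have h5 := h4.sub (tendsto_lerchMain hα lam
      (fun h => absurd (lerchZ_eq_one_iff.1 h) hk) hs)
    simp only [add_sub_cancel_right, sub_zero] at h5
    exact tendsto_nhds_unique (tendsto_lerchPartialSum hk hα hs) h5

theorem analyticOnNhd_lerchZeta {α : ℝ} (hα : 0 < α) (hα1 : α ≤ 1) (lam : ℝ) :
    AnalyticOnNhd ℂ (lerchZeta lam α) {s : ℂ | 0 < s.re ∧ 0 < s.im} := by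
  have hVo : IsOpen {s : ℂ | 0 < s.re ∧ 0 < s.im} :=
    (isOpen_lt continuous_const Complex.continuous_re).inter
      (isOpen_lt continuous_const Complex.continuous_im)
  have h : DifferentiableOn ℂ (lerchF lam α) {s : ℂ | 0 < s.re ∧ 0 < s.im} := fun q hq =>
    (differentiableAt_lerchF hα lam hq.1 fun h => by
      have := hq.2; rw [h] at this; simp at this).differentiableWithinAt
  exact (h.congr fun q hq => lerchZeta_eq_lerchF hα hα1 lam hq.1 hq.2).analyticOnNhd hVo

/-- Approximation of the Lerch zeta-function by a partial sum of length `≍ |s|`. -/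
theorem exists_norm_lerchZeta_sub_le {α : ℝ} (hα : 0 < α) (hα1 : α ≤ 1) (lam : ℝ) :
    ∃ C, 1 ≤ C ∧ ∀ s : ℂ, 1 / 2 ≤ s.re → 1 ≤ s.im → ∀ M : ℕ, C * ‖s‖ ≤ (M : ℝ) + α →
      ‖lerchZeta lam α s - lerchPartialSum lam α s M‖ ≤ C * (((M : ℝ) + α) ^ (1 - s.re) / ‖s‖) := by
  obtain ⟨K, hK, hr⟩ := norm_lerchRatio_le hα lam
  set E := ‖1 - lerchZ lam‖⁻¹ with hE
  have hE0 : 0 ≤ E := by positivity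
  -- 21 = 20 + 1: the tail estimated by summation by parts, and the main term at `M`. `E` pays for
  -- the division by 1 - e^{2πiλ}; it is 0 for integral λ, being the inverse of 0.
  refine ⟨21 * K * (2 + E), by nlinarith, fun s hs ht M hM => ?_⟩
  have hs0 : 0 < s.re := by linarith
  have hsn : 1 ≤ ‖s‖ := ht.trans ((le_abs_self _).trans (Complex.abs_im_le_norm s))
  have hs1 : s ≠ 1 := fun h => by rw [h] at ht; norm_num at ht
  have h1 : ‖s‖ ≤ 2 * ‖s - 1‖ := by
    have i1 : 1 ≤ ‖s - 1‖ := by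
      refine ht.trans ((le_abs_self _).trans ?_)
      simpa using Complex.abs_im_le_norm (s - 1)
    have i2 := norm_add_le (s - 1) 1
    rw [sub_add_cancel, norm_one] at i2
    linarith
  have hs1' : 0 < ‖s - 1‖ := by linarith
  set m := (M : ℝ) + α with hm
  have hmK : 2 * (K * ‖s‖) ≤ m := by
    refine le_trans ?_ hM
    nlinarith [mul_nonneg (by linarith : 0 ≤ K) (norm_nonneg s)]
  have hm1 : 1 ≤ m := by nlinarith
  have hm0 : 0 < m := by linarith
  -- One β serves for every `n ≥ M`, since (n + α)^(1/2 - σ) does not increase when σ ≥ 1/2.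
  set β := (2 + E) * (m ^ (1 / 2 - s.re) / ‖s‖) with hβ
  have hβ0 : 0 ≤ β := by positivity
  have hB : ∀ n, M ≤ n → ‖lerchMain lam α s n‖ ≤ β * √((n : ℝ) + α) := by
    intro n hn
    have hpos := base_pos hα n
    have hmn : m ≤ (n : ℝ) + α := by
      have : (M : ℝ) ≤ n := by exact_mod_cast hn
      linarith
    have hr1 : ((n : ℝ) + α) ^ (1 / 2 - s.re) ≤ m ^ (1 / 2 - s.re) :=
      Real.rpow_le_rpow_of_nonpos hm0 hmn (by linarith)
    have hsq : 0 ≤ √((n : ℝ) + α) := Real.sqrt_nonneg _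
    rw [lerchMain]
    split_ifs with hz
    · have e : ((n : ℝ) + α) ^ (1 - s.re) = ((n : ℝ) + α) ^ (1 / 2 - s.re) * √((n : ℝ) + α) := by
        rw [Real.sqrt_eq_rpow, ← Real.rpow_add hpos]; ring_nf
      rw [norm_div, Complex.norm_cpow_eq_rpow_re_of_pos hpos, Complex.sub_re, Complex.one_re, e,
        mul_div_right_comm]
      refine mul_le_mul_of_nonneg_right ?_ hsq
      calc _ ≤ m ^ (1 / 2 - s.re) / ‖s - 1‖ := by gcongr
        _ ≤ m ^ (1 / 2 - s.re) / (‖s‖ / 2) := by gcongr; linarith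
        _ = 2 * (m ^ (1 / 2 - s.re) / ‖s‖) := by field_simp
        _ ≤ β := by rw [hβ]; gcongr; linarith
    · have e : ((n : ℝ) + α) ^ (-s.re) =
          ((n : ℝ) + α) ^ (1 / 2 - s.re) * ((n : ℝ) + α)⁻¹ * √((n : ℝ) + α) := by
        rw [Real.sqrt_eq_rpow, ← Real.rpow_neg_one, ← Real.rpow_add hpos, ← Real.rpow_add hpos]
        ring_nf
      rw [norm_div, norm_lerchTerm hα, e, div_eq_mul_inv, mul_right_comm, ← hE]
      refine mul_le_mul_of_nonneg_right ?_ hsq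
      have h2 : ((n : ℝ) + α)⁻¹ ≤ ‖s‖⁻¹ := inv_anti₀ (by linarith) (by nlinarith)
      calc _ ≤ m ^ (1 / 2 - s.re) * ‖s‖⁻¹ * E := by gcongr
        _ = E * (m ^ (1 / 2 - s.re) / ‖s‖) := by ring
        _ ≤ β := by rw [hβ]; gcongr; linarith
  have htail := norm_sum_sub_telescope_le hα (b := lerchTerm lam α s) (by positivity : 0 ≤ K * ‖s‖) hβ0
    hm1 hmK (lerchMain_sub hα lam hs1) (fun n => (hr s hs0 n).1) (fun n => (hr s hs0 n).2) hB
  have hmain := hB M le_rfl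
  have hsqm : √m * √m = m := Real.mul_self_sqrt hm0.le
  have hsqp : 0 < √m := Real.sqrt_pos.2 hm0
  have hKs : K * ‖s‖ * (√m)⁻¹ ≤ √m := by
    rw [← div_eq_mul_inv, div_le_iff₀ hsqp, hsqm]; nlinarith
  have hlim : Tendsto (fun R => ∑ n ∈ Finset.Ico M R, lerchErr lam α n s) atTop
      (𝓝 (lerchZeta lam α s - lerchPartialSum lam α s M - lerchMain lam α s M)) := by
    rw [lerchZeta_eq_lerchF hα hα1 lam hs0 (by linarith)]
    have := (tendsto_lerchF hα lam hs0 hs1).sub_const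
      (lerchPartialSum lam α s M + lerchMain lam α s M)
    rw [sub_add_eq_sub_sub] at this
    refine this.congr' ?_
    filter_upwards [eventually_ge_atTop M] with R hR
    rw [Finset.sum_Ico_eq_sub _ hR, sum_lerchErr, sum_lerchErr]
    ring
  have h3 : ‖lerchZeta lam α s - lerchPartialSum lam α s M - lerchMain lam α s M‖ ≤ 20 * (β * √m) := by
    refine le_of_tendsto hlim.norm ?_
    filter_upwards [eventually_ge_atTop M] with R hR
    refine (htail R hR).trans ?_
    calc 20 * (K * ‖s‖) * β * (√m)⁻¹ = 20 * β * (K * ‖s‖ * (√m)⁻¹) := by ring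
      _ ≤ 20 * β * √m := by gcongr
      _ = _ := by ring
  have e : β * √m = (2 + E) * (m ^ (1 - s.re) / ‖s‖) := by
    have : m ^ (1 - s.re) = m ^ (1 / 2 - s.re) * √m := by
      rw [Real.sqrt_eq_rpow, ← Real.rpow_add hm0]; ring_nf
    rw [hβ, this]; ring
  have h4 : ‖lerchZeta lam α s - lerchPartialSum lam α s M‖ ≤ 21 * (β * √m) := by
    have := norm_add_le (lerchZeta lam α s - lerchPartialSum lam α s M - lerchMain lam α s M)
      (lerchMain lam α s M)
    rw [sub_add_cancel] at this
    linarith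
  refine h4.trans ?_
  rw [e]
  have : 0 ≤ (2 + E) * (m ^ (1 - s.re) / ‖s‖) := by positivity
  nlinarith

/-! ### Mean squares of exponential sums and of the Lerch zeta-function. -/

/-- The unimodular exponential `e^{ix}`. -/
def phase (x : ℝ) : ℂ := Complex.exp ((x : ℂ) * Complex.I)

theorem norm_phase (x : ℝ) : ‖phase x‖ = 1 := Complex.norm_exp_ofReal_mul_I x

theorem phase_add (x y : ℝ) : phase (x + y) = phase x * phase y := by
  rw [phase, phase, phase, ← Complex.exp_add]; congr 1; push_cast; ring

theorem conj_phase (x : ℝ) : conj (phase x) = phase (-x) := by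
  rw [phase, phase, ← Complex.exp_conj]; simp

theorem phase_zero : phase 0 = 1 := by simp [phase]

@[fun_prop]
theorem continuous_phase : Continuous phase := by unfold phase; fun_prop

theorem norm_integral_phase_le {δ : ℝ} (hδ : δ ≠ 0) (t₀ T : ℝ) :
    ‖∫ t in t₀..T, phase (δ * t)‖ ≤ 2 / |δ| := by
  have hc : (δ : ℂ) * Complex.I ≠ 0 := mul_ne_zero (by exact_mod_cast hδ) Complex.I_ne_zero
  have e : ∀ t : ℝ, phase (δ * t) = Complex.exp (((δ : ℂ) * Complex.I) * t) := by
    intro t; rw [phase]; congr 1; push_cast; ring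
  simp only [e]
  rw [integral_exp_mul_complex hc, norm_div, norm_mul, Complex.norm_I, mul_one, Complex.norm_real,
    Real.norm_eq_abs]
  refine div_le_div_of_nonneg_right ((norm_sub_le _ _).trans ?_) (abs_nonneg _)
  rw [← e, ← e, norm_phase, norm_phase]
  norm_num

/-- A mean value bound for exponential sums. -/
theorem integral_norm_sq_expSum_le (S : Finset ℕ) (c : ℕ → ℂ) (ω : ℕ → ℝ) {t₀ T K : ℝ} (hT : t₀ ≤ T)
    (hω : ∀ m ∈ S, ∀ n ∈ S, n ≠ m → ω m ≠ ω n)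
    (hK : ∀ m ∈ S, ∑ n ∈ S.erase m, 2 / |ω m - ω n| ≤ K) :
    ∫ t in t₀..T, ‖∑ n ∈ S, c n * phase (ω n * t)‖ ^ 2 ≤ (T - t₀ + K) * ∑ n ∈ S, ‖c n‖ ^ 2 := by
  have h1 : ∀ t : ℝ, ((‖∑ n ∈ S, c n * phase (ω n * t)‖ ^ 2 : ℝ) : ℂ) =
      ∑ m ∈ S, ∑ n ∈ S, c m * conj (c n) * phase ((ω m - ω n) * t) := by
    intro t
    rw [Complex.ofReal_pow, ← Complex.mul_conj', map_sum, Finset.sum_mul_sum]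
    refine Finset.sum_congr rfl fun m _ => Finset.sum_congr rfl fun n _ => ?_
    rw [map_mul, conj_phase, show (ω m - ω n) * t = ω m * t + -(ω n * t) by ring, phase_add]
    ring
  set J : ℕ → ℕ → ℂ := fun m n => ∫ t in t₀..T, phase ((ω m - ω n) * t) with hJ
  have h2 : ((∫ t in t₀..T, ‖∑ n ∈ S, c n * phase (ω n * t)‖ ^ 2 : ℝ) : ℂ) =
      ∑ m ∈ S, ∑ n ∈ S, c m * conj (c n) * J m n := by
    rw [← intervalIntegral.integral_ofReal]
    simp only [h1]
    rw [intervalIntegral.integral_finsetSum fun m _ => Continuous.intervalIntegrable (by fun_prop) _ _]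
    refine Finset.sum_congr rfl fun m _ => ?_
    rw [intervalIntegral.integral_finsetSum fun n _ => Continuous.intervalIntegrable (by fun_prop) _ _]
    refine Finset.sum_congr rfl fun n _ => ?_
    rw [intervalIntegral.integral_const_mul]
  set j : ℕ → ℕ → ℝ := fun m n => if n = m then T - t₀ else 2 / |ω m - ω n| with hj
  have hjJ : ∀ m ∈ S, ∀ n ∈ S, ‖J m n‖ ≤ j m n := by
    intro m hm n hn
    simp only [hj, hJ]
    split_ifs with h
    · have : ∀ t : ℝ, phase ((ω m - ω n) * t) = 1 := by intro t; rw [h]; simp [phase]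
      simp only [this]
      rw [intervalIntegral.integral_const, norm_smul, norm_one, mul_one, Real.norm_of_nonneg (by linarith)]
    · exact norm_integral_phase_le (sub_ne_zero.2 (hω m hm n hn h)) _ _
  have hj0 : ∀ m n, 0 ≤ j m n := by
    intro m n
    simp only [hj]
    split_ifs
    · linarith
    · positivity
  have hjs : ∀ m n, j m n = j n m := by
    intro m n
    simp only [hj, abs_sub_comm (ω m), eq_comm (a := n)]
  have hjsum : ∀ m ∈ S, ∑ n ∈ S, j m n ≤ T - t₀ + K := by
    intro m hm
    rw [← Finset.add_sum_erase S _ hm]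
    refine add_le_add (by simp [hj]) (le_trans (le_of_eq ?_) (hK m hm))
    refine Finset.sum_congr rfl fun n hn => ?_
    simp only [hj, if_neg (Finset.ne_of_mem_erase hn)]
  have h3 : ∫ t in t₀..T, ‖∑ n ∈ S, c n * phase (ω n * t)‖ ^ 2 ≤
      ∑ m ∈ S, ∑ n ∈ S, ‖c m‖ * ‖c n‖ * j m n := by
    calc _ ≤ ‖((∫ t in t₀..T, ‖∑ n ∈ S, c n * phase (ω n * t)‖ ^ 2 : ℝ) : ℂ)‖ := by
          rw [Complex.norm_real]; exact le_abs_self _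
      _ ≤ _ := by
          rw [h2]
          refine norm_sum_le_of_le _ fun m hm => norm_sum_le_of_le _ fun n hn => ?_
          rw [norm_mul, norm_mul, RCLike.norm_conj]
          have := hjJ m hm n hn
          gcongr
  refine h3.trans ?_
  -- As in Schur's test: 2|xy| ≤ x² + y² and the symmetry of `j` reduce the double sum to row sums.
  have h4 : ∑ m ∈ S, ∑ n ∈ S, ‖c m‖ * ‖c n‖ * j m n ≤
      ∑ m ∈ S, ∑ n ∈ S, (‖c m‖ ^ 2 * j m n / 2 + ‖c n‖ ^ 2 * j m n / 2) := by
    refine Finset.sum_le_sum fun m _ => Finset.sum_le_sum fun n _ => ?_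
    nlinarith [mul_nonneg (sq_nonneg (‖c m‖ - ‖c n‖)) (hj0 m n)]
  refine h4.trans ?_
  simp only [Finset.sum_add_distrib]
  have h5 : ∑ m ∈ S, ∑ n ∈ S, ‖c n‖ ^ 2 * j m n / 2 = ∑ m ∈ S, ∑ n ∈ S, ‖c m‖ ^ 2 * j m n / 2 := by
    rw [Finset.sum_comm]
    exact Finset.sum_congr rfl fun m _ => Finset.sum_congr rfl fun n _ => by rw [hjs]
  rw [h5, ← Finset.sum_add_distrib, Finset.mul_sum]
  refine Finset.sum_le_sum fun m hm => ?_
  rw [← Finset.sum_add_distrib]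
  calc ∑ n ∈ S, (‖c m‖ ^ 2 * j m n / 2 + ‖c m‖ ^ 2 * j m n / 2) = ‖c m‖ ^ 2 * ∑ n ∈ S, j m n := by
        rw [Finset.mul_sum]; exact Finset.sum_congr rfl fun n _ => by ring
    _ ≤ ‖c m‖ ^ 2 * (T - t₀ + K) := by have := hjsum m hm; gcongr
    _ = _ := by ring

theorem log_base_sub_ge {α : ℝ} (hα : 0 < α) {m n M : ℕ} (hmn : m < n) (hn : n < M) :
    ((n : ℝ) - m) / ((M : ℝ) + α) ≤ Real.log ((n : ℝ) + α) - Real.log ((m : ℝ) + α) := by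
  have hm := base_pos hα m
  have hn' := base_pos hα n
  have hmn' : (m : ℝ) < n := by exact_mod_cast hmn
  have hnM : (n : ℝ) < M := by exact_mod_cast hn
  have h := Real.log_le_sub_one_of_pos (div_pos hm hn')
  rw [Real.log_div hm.ne' hn'.ne'] at h
  have h2 : ((n : ℝ) - m) / ((M : ℝ) + α) ≤ ((n : ℝ) - m) / ((n : ℝ) + α) :=
    div_le_div_of_nonneg_left (by linarith) hn' (by linarith)
  have h3 : ((n : ℝ) - m) / ((n : ℝ) + α) = 1 - ((m : ℝ) + α) / ((n : ℝ) + α) := by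
    field_simp; ring
  linarith

theorem sum_inv_abs_sub_le (M m : ℕ) (hm : m < M) :
    ∑ n ∈ (Finset.range M).erase m, (1 : ℝ) / |(n : ℝ) - m| ≤ 2 * (1 + Real.log M) := by
  have hH : ∀ k ≤ M, ∑ i ∈ Finset.range k, (1 : ℝ) / ((i : ℝ) + 1) ≤ 1 + Real.log M := by
    intro k hk
    have := harmonic_le_one_add_log M
    rw [harmonic] at this
    push_cast at this
    refine le_trans (Finset.sum_le_sum_of_subset_of_nonneg (Finset.range_mono hk)
      fun _ _ _ => by positivity) ?_
    simpa only [one_div] using this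
  have hsplit : (Finset.range M).erase m = Finset.range m ∪ Finset.Ico (m + 1) M := by
    ext n
    simp only [Finset.mem_erase, Finset.mem_range, Finset.mem_union, Finset.mem_Ico]
    omega
  have hdisj : Disjoint (Finset.range m) (Finset.Ico (m + 1) M) := by
    rw [Finset.disjoint_left]
    intro n h1 h2
    rw [Finset.mem_range] at h1
    rw [Finset.mem_Ico] at h2
    omega
  rw [hsplit, Finset.sum_union hdisj, two_mul]
  refine add_le_add (le_trans (le_of_eq ?_) (hH m hm.le)) (le_trans (le_of_eq ?_) (hH (M - (m + 1)) (by omega)))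
  · rw [← Finset.sum_range_reflect]
    refine Finset.sum_congr rfl fun i hi => ?_
    rw [Finset.mem_range] at hi
    have h : ((m - 1 - i : ℕ) : ℝ) = (m : ℝ) - 1 - i := by
      rw [Nat.cast_sub (by omega), Nat.cast_sub (by omega)]; simp
    rw [h, show (m : ℝ) - 1 - i - m = -((i : ℝ) + 1) by ring, abs_neg, abs_of_pos (by positivity)]
  · rw [Finset.sum_Ico_eq_sum_range]
    refine Finset.sum_congr rfl fun i _ => ?_
    push_cast
    rw [show (m : ℝ) + 1 + i - m = (i : ℝ) + 1 by ring, abs_of_pos (by positivity)]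

/-- For `m, n < M` the frequencies are at least |n - m|/(M + α) apart, so the sum over `n` is
essentially harmonic. -/
theorem sum_log_base_gap_le {α : ℝ} (hα : 0 < α) {N M m : ℕ} (hm : m ∈ Finset.Ico N M) :
    ∑ n ∈ (Finset.Ico N M).erase m,
      2 / |(-Real.log ((m : ℝ) + α)) - (-Real.log ((n : ℝ) + α))| ≤
        4 * (((M : ℝ) + α) * (1 + Real.log M)) := by
  have hm := Finset.mem_Ico.1 hm
  have hM := base_pos hα M
  have hterm : ∀ n ∈ (Finset.Ico N M).erase m,
      2 / |(-Real.log ((m : ℝ) + α)) - (-Real.log ((n : ℝ) + α))| ≤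
        2 * ((M : ℝ) + α) * (1 / |(n : ℝ) - m|) := by
    intro n hn
    rw [Finset.mem_erase, Finset.mem_Ico] at hn
    have hne : (0 : ℝ) < |(n : ℝ) - m| := abs_pos.2 (sub_ne_zero.2 (by exact_mod_cast hn.1))
    have h : |(n : ℝ) - m| / ((M : ℝ) + α) ≤
        |(-Real.log ((m : ℝ) + α)) - (-Real.log ((n : ℝ) + α))| := by
      rw [neg_sub_neg]
      rcases lt_or_gt_of_ne hn.1 with h | h
      · have h1 := log_base_sub_ge hα h hm.2
        have h2 : (n : ℝ) < m := by exact_mod_cast h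
        rw [abs_sub_comm, abs_of_pos (by linarith), abs_sub_comm]
        exact h1.trans (le_abs_self _)
      · have h1 := log_base_sub_ge hα h hn.2.2
        have h2 : (m : ℝ) < n := by exact_mod_cast h
        rw [abs_of_pos (by linarith)]
        exact h1.trans (le_abs_self _)
    calc _ ≤ 2 / (|(n : ℝ) - m| / ((M : ℝ) + α)) := by gcongr
      _ = _ := by field_simp
  refine (Finset.sum_le_sum hterm).trans ?_
  rw [← Finset.mul_sum]
  have h1 : ∑ n ∈ (Finset.Ico N M).erase m, (1 : ℝ) / |(n : ℝ) - m| ≤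
      ∑ n ∈ (Finset.range M).erase m, (1 : ℝ) / |(n : ℝ) - m| := by
    refine Finset.sum_le_sum_of_subset_of_nonneg (Finset.erase_subset_erase _ ?_)
      fun _ _ _ => by positivity
    intro n hn
    exact Finset.mem_range.2 (Finset.mem_Ico.1 hn).2
  calc _ ≤ 2 * ((M : ℝ) + α) * (2 * (1 + Real.log M)) := by
        gcongr; exact h1.trans (sum_inv_abs_sub_le M m hm.2)
    _ = _ := by ring

theorem sum_Ico_rpow_le {a : ℝ} (ha : 1 / 2 < a) {N M : ℕ} (hN : 1 ≤ N) :
    ∑ n ∈ Finset.Ico N M, (n : ℝ) ^ (-(2 * a)) ≤ (1 + (2 * a - 1)⁻¹) * (N : ℝ) ^ (1 - 2 * a) := by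
  have hN1 : (1 : ℝ) ≤ N := by exact_mod_cast hN
  have hc : 0 < 2 * a - 1 := by linarith
  rcases le_or_gt M N with h | h
  · rw [Finset.Ico_eq_empty_of_le h, Finset.sum_empty]; positivity
  obtain ⟨R, rfl⟩ : ∃ R, M = R + 1 := ⟨M - 1, by omega⟩
  have hNR : N ≤ R := by omega
  have hNR' : (N : ℝ) ≤ R := by exact_mod_cast hNR
  rw [Finset.sum_eq_sum_Ico_succ_bot h, ← Finset.sum_Ico_add' (fun n : ℕ => (n : ℝ) ^ (-(2 * a)))]
  have hanti : AntitoneOn (fun x : ℝ => x ^ (-(2 * a))) (Icc (N : ℝ) R) := by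
    intro x hx y hy hxy
    exact Real.rpow_le_rpow_of_nonpos (by linarith [hx.1]) hxy (by linarith)
  have h1 := AntitoneOn.sum_le_integral_Ico hNR hanti
  rw [integral_rpow (Or.inr ⟨by intro h; linarith, fun h => by
    rw [uIcc_of_le hNR'] at h; linarith [h.1]⟩), show -(2 * a) + 1 = -(2 * a - 1) by ring] at h1
  have h2 : ((R : ℝ) ^ (-(2 * a - 1)) - (N : ℝ) ^ (-(2 * a - 1))) / (-(2 * a - 1)) ≤
      (2 * a - 1)⁻¹ * (N : ℝ) ^ (-(2 * a - 1)) := by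
    have h3 : 0 ≤ (R : ℝ) ^ (-(2 * a - 1)) := by positivity
    rw [div_neg, ← neg_div, div_eq_inv_mul]
    gcongr
    linarith
  have h4 : (N : ℝ) ^ (-(2 * a)) ≤ (N : ℝ) ^ (-(2 * a - 1)) :=
    Real.rpow_le_rpow_of_exponent_le hN1 (by linarith)
  rw [show 1 - 2 * a = -(2 * a - 1) by ring, add_mul, one_mul]
  exact add_le_add h4 (h1.trans h2)

/-- The coefficient `e^{2πiλn} (n + α)^{-σ}`. -/
def lerchCoeff (lam α σ : ℝ) (n : ℕ) : ℂ := lerchZ lam ^ n * ((((n : ℝ) + α) ^ (-σ) : ℝ) : ℂ)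

theorem norm_lerchCoeff {α : ℝ} (hα : 0 < α) (lam σ : ℝ) (n : ℕ) :
    ‖lerchCoeff lam α σ n‖ = ((n : ℝ) + α) ^ (-σ) := by
  have := base_pos hα n
  rw [lerchCoeff, norm_mul, norm_pow, norm_lerchZ, one_pow, one_mul, Complex.norm_real,
    Real.norm_of_nonneg (by positivity)]

theorem lerchTerm_eq {α : ℝ} (hα : 0 < α) (lam σ t : ℝ) (n : ℕ) :
    lerchTerm lam α (σ + t * Complex.I) n =
      lerchCoeff lam α σ n * phase (-Real.log ((n : ℝ) + α) * t) := by
  have h := base_pos hα n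
  have h' : ((((n : ℝ) + α : ℝ)) : ℂ) ≠ 0 := by exact_mod_cast h.ne'
  rw [lerchTerm, lerchCoeff, mul_assoc]
  congr 1
  rw [phase, neg_add, Complex.cpow_add _ _ h', ← Complex.ofReal_neg, ← Complex.ofReal_cpow h.le]
  congr 1
  rw [Complex.cpow_def_of_ne_zero h', ← Complex.ofReal_log h.le]
  congr 1
  push_cast
  ring

theorem log_base_injective {α : ℝ} (hα : 0 < α) {m n : ℕ} (h : n ≠ m) :
    -Real.log ((m : ℝ) + α) ≠ -Real.log ((n : ℝ) + α) := by
  intro h1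
  have h2 := Real.log_injOn_pos (base_pos hα m) (base_pos hα n) (neg_injective h1)
  exact h (by exact_mod_cast (add_right_cancel h2).symm)

theorem integral_norm_sq_sum_lerchTerm_le {α : ℝ} (hα : 0 < α) (lam σ : ℝ) {t₀ T : ℝ} (hT : t₀ ≤ T)
    (N M : ℕ) :
    ∫ t in t₀..T, ‖∑ n ∈ Finset.Ico N M, lerchTerm lam α (σ + t * Complex.I) n‖ ^ 2 ≤
      (T - t₀ + 4 * (((M : ℝ) + α) * (1 + Real.log M))) *
        ∑ n ∈ Finset.Ico N M, ((n : ℝ) + α) ^ (-(2 * σ)) := by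
  have h := integral_norm_sq_expSum_le (Finset.Ico N M) (lerchCoeff lam α σ)
    (fun n => -Real.log ((n : ℝ) + α)) hT (fun m _ n _ hne => log_base_injective hα hne)
    (fun m hm => sum_log_base_gap_le hα hm)
  simp only [lerchTerm_eq hα]
  refine h.trans (le_of_eq ?_)
  congr 1
  refine Finset.sum_congr rfl fun n _ => ?_
  have hpos := base_pos hα n
  rw [norm_lerchCoeff hα, ← Real.rpow_natCast, ← Real.rpow_mul hpos.le]
  congr 1
  push_cast
  ring

theorem continuousOn_lerchZeta_line {α : ℝ} (hα : 0 < α) (hα1 : α ≤ 1) (lam : ℝ) {σ : ℝ} (hσ : 0 < σ) :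
    ContinuousOn (fun t : ℝ => lerchZeta lam α (σ + t * Complex.I)) (Ioi 0) := by
  refine (analyticOnNhd_lerchZeta hα hα1 lam).continuousOn.comp
    (f := fun t : ℝ => (σ : ℂ) + t * Complex.I) (Continuous.continuousOn (by fun_prop)) ?_
  intro t ht
  have ht : 0 < t := ht
  simp [hσ, ht]

theorem continuous_lerchPartialSum_line {α : ℝ} (hα : 0 < α) (lam σ : ℝ) (N : ℕ) :
    Continuous fun t : ℝ => lerchPartialSum lam α (σ + t * Complex.I) N := by
  simp only [lerchPartialSum_eq, lerchTerm_eq hα]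
  fun_prop

theorem uIcc_subset_Ioi_zero {t₀ T : ℝ} (h1 : 1 ≤ t₀) (hT : t₀ ≤ T) : uIcc t₀ T ⊆ Ioi 0 := by
  rw [uIcc_of_le hT]; exact fun x hx => lt_of_lt_of_le (by linarith) hx.1

/-- A partial sum of length of order T is inserted. It approximates L pointwise, and its difference
from the sum of length `N` is an exponential sum, treated by the mean value bound with the loss of
one logarithm. -/
theorem exists_integral_norm_sq_sub_le {α : ℝ} (hα : 0 < α) (hα1 : α ≤ 1) (lam : ℝ) {a b : ℝ}
    (ha : 1 / 2 < a) (hab : a ≤ b) :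
    ∃ C, 0 < C ∧ ∀ σ, a ≤ σ → σ ≤ b → ∀ t₀ T, 1 ≤ t₀ → t₀ ≤ T → ∀ N : ℕ, 1 ≤ N → (N : ℝ) ≤ T →
      ∫ t in t₀..T, ‖lerchZeta lam α (σ + t * Complex.I) -
        lerchPartialSum lam α (σ + t * Complex.I) N‖ ^ 2 ≤
          C * (T * ((1 + Real.log T) * (N : ℝ) ^ (1 - 2 * a))) := by
  obtain ⟨C₁, hC₁, h₁⟩ := exists_norm_lerchZeta_sub_le hα hα1 lam
  set C₃ := C₁ * (b + 1) + 2 with hC₃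
  have hC₃1 : 1 ≤ C₃ := by nlinarith
  have hlC : 0 ≤ Real.log C₃ := Real.log_nonneg hC₃1
  set D := 1 + (2 * a - 1)⁻¹ with hD
  have hD0 : 0 < D := by
    have : 0 < (2 * a - 1)⁻¹ := inv_pos.2 (by linarith)
    linarith
  refine ⟨2 * (C₁ ^ 2 * C₃) + 2 * ((1 + 4 * (C₃ * (1 + Real.log C₃))) * D), by positivity, ?_⟩
  intro σ hσ1 hσ2 t₀ T ht₀ hT N hN hNT
  have hT1 : 1 ≤ T := by linarith
  have hlT : 0 ≤ Real.log T := Real.log_nonneg hT1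
  have hN1 : (1 : ℝ) ≤ N := by exact_mod_cast hN
  -- On the segment ‖s‖ ≤ b + T, so this length is admissible in the pointwise approximation for
  -- every `t`.
  set M := ⌈C₁ * (b + T)⌉₊ with hM
  have hM1 : C₁ * (b + T) ≤ M := Nat.le_ceil _
  have hM2 : (M : ℝ) < C₁ * (b + T) + 1 := Nat.ceil_lt_add_one (by nlinarith)
  have hTM : T ≤ M := by nlinarith
  have hMC : (M : ℝ) + α ≤ C₃ * T := by
    have h1 : C₁ * b ≤ C₁ * b * T := le_mul_of_one_le_right (by nlinarith) hT1
    rw [hC₃]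
    linarith
  have hNM : N ≤ M := by exact_mod_cast hNT.trans hTM
  set X := (N : ℝ) ^ (1 - 2 * a) with hX
  have hX0 : 0 < X := by positivity
  set m := (M : ℝ) + α with hm
  have hm0 : 1 ≤ m := by linarith
  have hcL : ContinuousOn (fun t : ℝ => lerchZeta lam α (σ + t * Complex.I)) (uIcc t₀ T) :=
    (continuousOn_lerchZeta_line hα hα1 lam (by linarith)).mono (uIcc_subset_Ioi_zero ht₀ hT)
  have hcP := continuous_lerchPartialSum_line hα lam σ
  have hpt : ∀ t ∈ Icc t₀ T, ‖lerchZeta lam α (σ + t * Complex.I) -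
      lerchPartialSum lam α (σ + t * Complex.I) N‖ ^ 2 ≤
      2 * (C₁ ^ 2 * (C₃ * T * X)) * t ^ (-2 : ℝ) +
        2 * ‖∑ n ∈ Finset.Ico N M, lerchTerm lam α (σ + t * Complex.I) n‖ ^ 2 := by
    intro t ht
    have ht1 : 1 ≤ t := ht₀.trans ht.1
    set s : ℂ := σ + t * Complex.I with hs
    have hsre : s.re = σ := by simp [hs]
    have hsim : s.im = t := by simp [hs]
    have hsn1 : t ≤ ‖s‖ := by
      rw [← hsim]; exact (le_abs_self _).trans (Complex.abs_im_le_norm s)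
    have hsn2 : ‖s‖ ≤ b + T := by
      refine (Complex.norm_le_abs_re_add_abs_im s).trans ?_
      rw [hsre, hsim, abs_of_pos (by linarith), abs_of_pos (by linarith)]
      linarith [ht.2]
    have h2 := h₁ s (by rw [hsre]; linarith) (by rw [hsim]; linarith) M
      (le_trans (by gcongr) (hM1.trans (by linarith)))
    rw [hsre] at h2
    have h3 : ‖lerchZeta lam α s - lerchPartialSum lam α s M‖ ^ 2 ≤
        C₁ ^ 2 * (C₃ * T * X) * t ^ (-2 : ℝ) := by
      have e1 : (m ^ (1 - σ)) ^ 2 ≤ C₃ * T * X := by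
        rw [← Real.rpow_natCast, ← Real.rpow_mul (by linarith)]
        calc m ^ ((1 - σ) * (2 : ℕ)) ≤ m ^ (1 + (1 - 2 * a)) :=
              Real.rpow_le_rpow_of_exponent_le hm0 (by push_cast; linarith)
          _ = m * m ^ (1 - 2 * a) := by rw [Real.rpow_add (by linarith), Real.rpow_one]
          _ ≤ (C₃ * T) * X := by
              have : m ^ (1 - 2 * a) ≤ X :=
                Real.rpow_le_rpow_of_nonpos (by linarith) (by linarith) (by linarith)
              gcongr
      have e2 : t ^ (-2 : ℝ) = (t ^ 2)⁻¹ := by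
        rw [Real.rpow_neg (by linarith)]; norm_cast
      calc _ ≤ (C₁ * (m ^ (1 - σ) / t)) ^ 2 := by
            have : C₁ * (m ^ (1 - σ) / ‖s‖) ≤ C₁ * (m ^ (1 - σ) / t) := by gcongr
            have := h2.trans this
            gcongr
        _ = C₁ ^ 2 * (m ^ (1 - σ)) ^ 2 * (t ^ 2)⁻¹ := by field_simp
        _ ≤ _ := by rw [e2]; gcongr
    have h4 : lerchPartialSum lam α s M - lerchPartialSum lam α s N =
        ∑ n ∈ Finset.Ico N M, lerchTerm lam α s n := by
      rw [lerchPartialSum_eq, lerchPartialSum_eq, Finset.sum_Ico_eq_sub _ hNM]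
    have h5 : ‖lerchZeta lam α s - lerchPartialSum lam α s N‖ ≤
        ‖lerchZeta lam α s - lerchPartialSum lam α s M‖ +
          ‖∑ n ∈ Finset.Ico N M, lerchTerm lam α s n‖ := by
      rw [← h4]
      exact norm_sub_le_norm_sub_add_norm_sub _ _ _
    have h6 := pow_le_pow_left₀ (norm_nonneg _) h5 2
    nlinarith [sq_nonneg (‖lerchZeta lam α s - lerchPartialSum lam α s M‖ -
      ‖∑ n ∈ Finset.Ico N M, lerchTerm lam α s n‖)]
  have hi1 : IntervalIntegrable (fun t : ℝ => 2 * (C₁ ^ 2 * (C₃ * T * X)) * t ^ (-2 : ℝ)) volume t₀ T :=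
    (intervalIntegral.intervalIntegrable_rpow (Or.inr fun h => by
      have := uIcc_subset_Ioi_zero ht₀ hT h; simp at this)).const_mul _
  have hcS : Continuous fun t : ℝ => ∑ n ∈ Finset.Ico N M, lerchTerm lam α (σ + t * Complex.I) n := by
    simp only [lerchTerm_eq hα]
    fun_prop
  have hi2 : IntervalIntegrable (fun t : ℝ =>
      2 * ‖∑ n ∈ Finset.Ico N M, lerchTerm lam α (σ + t * Complex.I) n‖ ^ 2) volume t₀ T :=
    Continuous.intervalIntegrable (by fun_prop) _ _
  have hmono := intervalIntegral.integral_mono_on hT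
    ((hcL.sub (hcP N).continuousOn).norm.pow 2).intervalIntegrable (hi1.add hi2) hpt
  refine hmono.trans ?_
  rw [intervalIntegral.integral_add hi1 hi2, intervalIntegral.integral_const_mul,
    intervalIntegral.integral_const_mul]
  have hI1 : ∫ t in t₀..T, t ^ (-2 : ℝ) ≤ 1 := by
    rw [integral_rpow (Or.inr ⟨by norm_num, fun h => by
      have := uIcc_subset_Ioi_zero ht₀ hT h; simp at this⟩)]
    norm_num
    rw [Real.rpow_neg_one, Real.rpow_neg_one]
    have h1 : t₀⁻¹ ≤ 1 := inv_le_one_of_one_le₀ ht₀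
    have h2 : 0 ≤ T⁻¹ := by positivity
    linarith
  have hI2 := integral_norm_sq_sum_lerchTerm_le hα lam σ hT N M
  have hS : ∑ n ∈ Finset.Ico N M, ((n : ℝ) + α) ^ (-(2 * σ)) ≤ D * X := by
    refine le_trans (Finset.sum_le_sum fun n hn => ?_) (sum_Ico_rpow_le ha hN)
    have hn1 : (1 : ℝ) ≤ n := by exact_mod_cast hN.trans (Finset.mem_Ico.1 hn).1
    calc ((n : ℝ) + α) ^ (-(2 * σ)) ≤ (n : ℝ) ^ (-(2 * σ)) :=
          Real.rpow_le_rpow_of_nonpos (by linarith) (by linarith) (by linarith)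
      _ ≤ _ := Real.rpow_le_rpow_of_exponent_le hn1 (by linarith)
  have hlog : 1 + Real.log M ≤ (1 + Real.log C₃) * (1 + Real.log T) := by
    have h1 : Real.log M ≤ Real.log (C₃ * T) := Real.log_le_log (by linarith) (by linarith)
    rw [Real.log_mul (by linarith) (by linarith)] at h1
    nlinarith
  have hlM : 0 ≤ Real.log M := Real.log_nonneg (by linarith)
  have hI2' : ∫ t in t₀..T, ‖∑ n ∈ Finset.Ico N M, lerchTerm lam α (σ + t * Complex.I) n‖ ^ 2 ≤
      (1 + 4 * (C₃ * (1 + Real.log C₃))) * D * (T * ((1 + Real.log T) * X)) := by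
    calc _ ≤ (T * (1 + Real.log T) + 4 * ((C₃ * T) * ((1 + Real.log C₃) * (1 + Real.log T)))) * (D * X) := by
          refine hI2.trans ?_
          have : T - t₀ ≤ T * (1 + Real.log T) := by nlinarith
          gcongr
      _ = _ := by ring
  have hX1 : T * X ≤ T * ((1 + Real.log T) * X) := by
    have : X ≤ (1 + Real.log T) * X := le_mul_of_one_le_left hX0.le (by linarith)
    gcongr
  calc _ ≤ 2 * (C₁ ^ 2 * (C₃ * T * X)) * 1 +
        2 * ((1 + 4 * (C₃ * (1 + Real.log C₃))) * D * (T * ((1 + Real.log T) * X))) := by gcongr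
    _ = 2 * (C₁ ^ 2 * C₃) * (T * X) +
        2 * ((1 + 4 * (C₃ * (1 + Real.log C₃))) * D * (T * ((1 + Real.log T) * X))) := by ring
    _ ≤ 2 * (C₁ ^ 2 * C₃) * (T * ((1 + Real.log T) * X)) +
        2 * ((1 + 4 * (C₃ * (1 + Real.log C₃))) * D * (T * ((1 + Real.log T) * X))) := by gcongr
    _ = _ := by ring

/-- With N close to √T the logarithm is compensated by N^(1 - 2a), and the off-diagonal terms of the
short sum, of order N log N, stay below a multiple of T. Thus no logarithm is lost. -/
theorem exists_integral_norm_sq_le {α : ℝ} (hα : 0 < α) (hα1 : α ≤ 1) (lam : ℝ) {a b : ℝ}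
    (ha : 1 / 2 < a) (hab : a ≤ b) :
    ∃ C, 0 < C ∧ ∀ σ, a ≤ σ → σ ≤ b → ∀ t₀ T, 1 ≤ t₀ → t₀ ≤ T →
      ∫ t in t₀..T, ‖lerchZeta lam α (σ + t * Complex.I)‖ ^ 2 ≤ C * T := by
  obtain ⟨C₁, hC₁, h₁⟩ := exists_integral_norm_sq_sub_le hα hα1 lam ha hab
  have hs := summable_baseBound_sq hα ha hab
  set B := ∑' n, baseBound α a b n ^ 2 with hB
  have hB0 : 0 ≤ B := tsum_nonneg fun n => sq_nonneg _
  set c := (2 * a - 1) / 2 with hc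
  have hc0 : 0 < c := by rw [hc]; linarith
  refine ⟨2 * (C₁ * ((1 + c⁻¹) * 2 ^ (2 * c))) + 2 * (9 * B), by positivity, ?_⟩
  intro σ hσ1 hσ2 t₀ T ht₀ hT
  have hT1 : 1 ≤ T := by linarith
  have hsq1 : 1 ≤ √T := Real.one_le_sqrt.2 hT1
  have hsq2 : √T * √T = T := Real.mul_self_sqrt (by linarith)
  set N := ⌊√T⌋₊ with hN
  have hN1 : 1 ≤ N := Nat.le_floor (by simpa using hsq1)
  have hN1' : (1 : ℝ) ≤ N := by exact_mod_cast hN1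
  have hN2 : (N : ℝ) ≤ √T := Nat.floor_le (by positivity)
  have hN3 : √T < N + 1 := Nat.lt_floor_add_one _
  have hN4 : √T / 2 ≤ N := by linarith
  have h2 := h₁ σ hσ1 hσ2 t₀ T ht₀ hT N hN1 (by nlinarith)
  have hlog : (1 + Real.log T) * (N : ℝ) ^ (1 - 2 * a) ≤ (1 + c⁻¹) * 2 ^ (2 * c) := by
    have e1 : (N : ℝ) ^ (1 - 2 * a) ≤ T ^ (-c) * 2 ^ (2 * c) := by
      calc _ ≤ (√T / 2) ^ (1 - 2 * a) :=
            Real.rpow_le_rpow_of_nonpos (by positivity) hN4 (by linarith)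
        _ = _ := by
            rw [Real.div_rpow (by positivity) (by norm_num), Real.sqrt_eq_rpow,
              ← Real.rpow_mul (by linarith), div_eq_mul_inv, ← Real.rpow_neg (by norm_num)]
            congr 2 <;> rw [hc] <;> ring
    have e2 : Real.log T ≤ T ^ c / c := Real.log_le_rpow_div (by linarith) hc0
    have e3 : 1 ≤ T ^ c := Real.one_le_rpow hT1 hc0.le
    have e4 : 1 + Real.log T ≤ (1 + c⁻¹) * T ^ c := by
      rw [add_mul, one_mul, ← div_eq_inv_mul]; linarith
    have e5 : T ^ c * T ^ (-c) = 1 := by rw [← Real.rpow_add (by linarith)]; simp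
    calc _ ≤ ((1 + c⁻¹) * T ^ c) * (T ^ (-c) * 2 ^ (2 * c)) := by
          have := Real.log_nonneg hT1
          gcongr
      _ = (1 + c⁻¹) * 2 ^ (2 * c) * (T ^ c * T ^ (-c)) := by ring
      _ = _ := by rw [e5, mul_one]
  have h3 := integral_norm_sq_sum_lerchTerm_le hα lam σ hT 0 N
  have hsum : ∑ n ∈ Finset.Ico 0 N, ((n : ℝ) + α) ^ (-(2 * σ)) ≤ B := by
    refine le_trans (Finset.sum_le_sum fun n hn => ?_) (hs.sum_le_tsum _ fun n _ => sq_nonneg _)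
    have hpos := base_pos hα n
    rw [show -(2 * σ) = -σ * (2 : ℕ) by push_cast; ring, Real.rpow_mul hpos.le, Real.rpow_natCast]
    have := rpow_le_baseBound hα hσ1 hσ2 n
    gcongr
  have hK : T - t₀ + 4 * (((N : ℝ) + α) * (1 + Real.log N)) ≤ 9 * T := by
    have e1 : 1 + Real.log N ≤ √T := by
      have := Real.log_le_sub_one_of_pos (by linarith : (0 : ℝ) < N)
      linarith
    have e2 : 0 ≤ Real.log N := Real.log_nonneg hN1'
    have e3 : ((N : ℝ) + α) * (1 + Real.log N) ≤ (2 * √T) * √T := by gcongr; linarith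
    nlinarith
  have hcL : ContinuousOn (fun t : ℝ => lerchZeta lam α (σ + t * Complex.I)) (uIcc t₀ T) :=
    (continuousOn_lerchZeta_line hα hα1 lam (by linarith)).mono (uIcc_subset_Ioi_zero ht₀ hT)
  have hcP := continuous_lerchPartialSum_line hα lam σ N
  have hi1 : IntervalIntegrable (fun t : ℝ => 2 * ‖lerchZeta lam α (σ + t * Complex.I) -
        lerchPartialSum lam α (σ + t * Complex.I) N‖ ^ 2) volume t₀ T :=
    (((hcL.sub hcP.continuousOn).norm.pow 2).intervalIntegrable).const_mul 2
  have hi2 : IntervalIntegrable (fun t : ℝ =>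
      2 * ‖lerchPartialSum lam α (σ + t * Complex.I) N‖ ^ 2) volume t₀ T :=
    Continuous.intervalIntegrable (by fun_prop) _ _
  have hmono := intervalIntegral.integral_mono_on hT ((hcL.norm.pow 2).intervalIntegrable)
    (hi1.add hi2) (fun t _ => by
      have h5 := norm_sub_norm_le (lerchZeta lam α (σ + t * Complex.I))
        (lerchPartialSum lam α (σ + t * Complex.I) N)
      have h6 : ‖lerchZeta lam α (σ + t * Complex.I)‖ ≤ ‖lerchZeta lam α (σ + t * Complex.I) -
        lerchPartialSum lam α (σ + t * Complex.I) N‖ +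
          ‖lerchPartialSum lam α (σ + t * Complex.I) N‖ := by linarith
      have h7 := pow_le_pow_left₀ (norm_nonneg _) h6 2
      simp only [Pi.pow_apply]
      nlinarith [sq_nonneg (‖lerchZeta lam α (σ + t * Complex.I) -
        lerchPartialSum lam α (σ + t * Complex.I) N‖ -
          ‖lerchPartialSum lam α (σ + t * Complex.I) N‖)])
  refine hmono.trans ?_
  rw [intervalIntegral.integral_add hi1 hi2, intervalIntegral.integral_const_mul,
    intervalIntegral.integral_const_mul]
  have h8 : ∫ t in t₀..T, ‖lerchPartialSum lam α (σ + t * Complex.I) N‖ ^ 2 ≤ 9 * T * B := by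
    simp only [lerchPartialSum_eq, Finset.range_eq_Ico]
    refine h3.trans ?_
    have : 0 ≤ ∑ n ∈ Finset.Ico 0 N, ((n : ℝ) + α) ^ (-(2 * σ)) :=
      Finset.sum_nonneg fun n _ => by have := base_pos hα n; positivity
    gcongr
  calc _ ≤ 2 * (C₁ * (T * ((1 + c⁻¹) * 2 ^ (2 * c)))) + 2 * (9 * T * B) := by
        refine add_le_add ?_ (by gcongr)
        refine mul_le_mul_of_nonneg_left (h2.trans ?_) zero_le_two
        gcongr
    _ = _ := by ring

/-! ### The method of moments for trigonometric sums with independent frequencies. -/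

/-- The derivative of the Taylor remainder of order n + 1 is i times the remainder of order n, so
the bounds follow by integrating upwards from 0. -/
theorem norm_phase_sub_taylor_nonneg (n : ℕ) : ∀ y : ℝ, 0 ≤ y →
    ‖phase y - ∑ j ∈ Finset.range n, ((y : ℂ) * Complex.I) ^ j / (j.factorial : ℂ)‖ ≤
      y ^ n / n.factorial := by
  induction n with
  | zero => intro y _; simp [norm_phase]
  | succ n ih =>
    intro y hy
    set f : ℝ → ℂ := fun y => phase y - ∑ j ∈ Finset.range (n + 1), ((y : ℂ) * Complex.I) ^ j / (j.factorial : ℂ) with hf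
    have hd : ∀ x : ℝ, HasDerivAt f (Complex.I *
        (phase x - ∑ j ∈ Finset.range n, ((x : ℂ) * Complex.I) ^ j / (j.factorial : ℂ))) x := by
      intro x
      have hlin : HasDerivAt (fun y : ℝ => (y : ℂ) * Complex.I) Complex.I x := by
        simpa using (Complex.ofRealCLM.hasDerivAt (x := x)).mul_const Complex.I
      have h1 : HasDerivAt phase (Complex.I * phase x) x := by
        have := hlin.cexp
        rwa [mul_comm] at this
      have h2 : HasDerivAt (fun y : ℝ => ∑ j ∈ Finset.range (n + 1),
          ((y : ℂ) * Complex.I) ^ j / (j.factorial : ℂ))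
          (∑ j ∈ Finset.range (n + 1), ((j : ℂ) * ((x : ℂ) * Complex.I) ^ (j - 1) * Complex.I) /
            (j.factorial : ℂ)) x :=
        HasDerivAt.fun_sum fun j _ => (hlin.pow j).div_const _
      refine (h1.sub h2).congr_deriv ?_
      rw [Finset.sum_range_succ', mul_sub, Finset.mul_sum]
      simp only [Nat.cast_zero, zero_mul, zero_div, add_zero]
      congr 1
      refine Finset.sum_congr rfl fun j _ => ?_
      have : ((j : ℂ) + 1) ≠ 0 := by exact_mod_cast Nat.succ_ne_zero j
      have hj : (j.factorial : ℂ) ≠ 0 := by exact_mod_cast j.factorial_ne_zero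
      rw [Nat.add_sub_cancel, Nat.factorial_succ]
      push_cast
      field_simp
    have hB : ∀ x : ℝ, HasDerivAt (fun x : ℝ => x ^ (n + 1) / ((n + 1).factorial : ℝ))
        (x ^ n / n.factorial) x := by
      intro x
      refine ((hasDerivAt_pow (n + 1) x).div_const _).congr_deriv ?_
      have : ((n : ℝ) + 1) ≠ 0 := by positivity
      have hj : (n.factorial : ℝ) ≠ 0 := by positivity
      rw [Nat.add_sub_cancel, Nat.factorial_succ]
      push_cast
      field_simp
    refine image_norm_le_of_norm_deriv_right_le_deriv_boundary (f := f) (a := 0) (b := y)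
      (fun x _ => (hd x).continuousAt.continuousWithinAt) (fun x _ => (hd x).hasDerivWithinAt)
      ?_ hB (fun x hx => ?_) ⟨hy, le_rfl⟩
    · simp [hf, phase, Finset.sum_range_succ']
    · rw [norm_mul, Complex.norm_I, one_mul]
      exact ih x hx.1

theorem norm_phase_sub_taylor (n : ℕ) (y : ℝ) :
    ‖phase y - ∑ j ∈ Finset.range n, ((y : ℂ) * Complex.I) ^ j / (j.factorial : ℂ)‖ ≤
      |y| ^ n / n.factorial := by
  rcases le_total 0 y with h | h
  · rw [abs_of_nonneg h]; exact norm_phase_sub_taylor_nonneg n y h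
  · rw [abs_of_nonpos h]
    have := norm_phase_sub_taylor_nonneg n (-y) (by linarith)
    rw [← RCLike.norm_conj] at this
    refine le_trans (le_of_eq ?_) this
    rw [map_sub, conj_phase, neg_neg, map_sum]
    congr 3
    funext j
    rw [map_div₀, map_pow, map_mul, Complex.conj_I, Complex.conj_ofReal]
    simp

theorem norm_taylor_sub_le {P Q : ℝ} {D η : ℝ} (j : ℕ) (h : |P - Q| ≤ D ^ j * η) :
    ‖((P : ℂ) * Complex.I ^ j) / (j.factorial : ℂ) - ((Q : ℂ) * Complex.I ^ j) / (j.factorial : ℂ)‖ ≤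
      D ^ j * η / j.factorial := by
  rw [← sub_div, ← sub_mul, norm_div, norm_mul, norm_pow, Complex.norm_I, one_pow, mul_one,
    ← Complex.ofReal_sub, Complex.norm_real, Complex.norm_natCast]
  exact div_le_div_of_nonneg_right h (by positivity)

/-- Stopping at an even order makes the remainder an ordinary moment, without absolute values. -/
theorem norm_integral_phase_sub_moments {Ω : Type*} [MeasurableSpace Ω] {μ : Measure Ω}
    [IsProbabilityMeasure μ] {Z : Ω → ℝ} (hZ : Measurable Z)
    (hZi : ∀ j : ℕ, Integrable (fun x => Z x ^ j) μ) (k : ℕ) :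
    ‖∫ x, phase (Z x) ∂μ - ∑ j ∈ Finset.range (2 * k),
      (((∫ x, Z x ^ j ∂μ : ℝ) : ℂ) * Complex.I ^ j) / (j.factorial : ℂ)‖ ≤
      (∫ x, Z x ^ (2 * k) ∂μ) / (2 * k).factorial := by
  have hi : ∀ j : ℕ, Integrable (fun x => ((Z x : ℂ) * Complex.I) ^ j / (j.factorial : ℂ)) μ := by
    intro j
    have : (fun x => ((Z x : ℂ) * Complex.I) ^ j / (j.factorial : ℂ)) =
        fun x => ((Z x ^ j : ℝ) : ℂ) * (Complex.I ^ j / (j.factorial : ℂ)) := by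
      funext x; push_cast; rw [mul_pow]; ring
    rw [this]
    exact (hZi j).ofReal.mul_const _
  have hph : Integrable (fun x => phase (Z x)) μ := by
    refine Integrable.of_bound (continuous_phase.measurable.comp hZ).aestronglyMeasurable 1
      (Eventually.of_forall fun x => (norm_phase _).le)
  have e : ∫ x, phase (Z x) ∂μ - ∑ j ∈ Finset.range (2 * k),
      (((∫ x, Z x ^ j ∂μ : ℝ) : ℂ) * Complex.I ^ j) / (j.factorial : ℂ) =
      ∫ x, (phase (Z x) - ∑ j ∈ Finset.range (2 * k),
        ((Z x : ℂ) * Complex.I) ^ j / (j.factorial : ℂ)) ∂μ := by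
    rw [integral_sub hph (integrable_finsetSum _ fun j _ => hi j),
      integral_finsetSum _ fun j _ => hi j]
    congr 1
    refine Finset.sum_congr rfl fun j _ => ?_
    rw [← integral_complex_ofReal, ← integral_mul_const, ← integral_div]
    refine integral_congr_ae (Eventually.of_forall fun x => ?_)
    simp only
    push_cast
    rw [mul_pow]
  rw [e, ← integral_div]
  refine norm_integral_le_of_norm_le ((hZi _).div_const _) (Eventually.of_forall fun x => ?_)
  refine (norm_phase_sub_taylor _ _).trans (le_of_eq ?_)
  rw [pow_mul, sq_abs, ← pow_mul]

/-- Characteristic functions of real random variables with nearby moments. -/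
theorem norm_integral_phase_sub_le {Ω₁ Ω₂ : Type*} [MeasurableSpace Ω₁] [MeasurableSpace Ω₂]
    {P : Measure Ω₁} {Q : Measure Ω₂} [IsProbabilityMeasure P] [IsProbabilityMeasure Q]
    {X : Ω₁ → ℝ} {Y : Ω₂ → ℝ} (hX : Measurable X) (hY : Measurable Y)
    (hXi : ∀ j : ℕ, Integrable (fun x => X x ^ j) P) (hYi : ∀ j : ℕ, Integrable (fun x => Y x ^ j) Q)
    {D η : ℝ} (hD : 0 ≤ D) (hη : 0 ≤ η) (k : ℕ)
    (h : ∀ j ≤ 2 * k, |∫ x, X x ^ j ∂P - ∫ x, Y x ^ j ∂Q| ≤ D ^ j * η) :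
    ‖∫ x, phase (X x) ∂P - ∫ x, phase (Y x) ∂Q‖ ≤
      3 * (1 + D) ^ (2 * k) * η + 2 * ((∫ x, Y x ^ (2 * k) ∂Q) / (2 * k).factorial) := by
  have h1 := norm_integral_phase_sub_moments hX hXi k
  have h2 := norm_integral_phase_sub_moments hY hYi k
  have hsum : ∑ j ∈ Finset.range (2 * k + 1), D ^ j * η / j.factorial ≤ 3 * (1 + D) ^ (2 * k) * η := by
    have h3 : ∑ j ∈ Finset.range (2 * k + 1), (1 : ℝ) ^ j / j.factorial ≤ 3 :=
      (Real.sum_le_exp_of_nonneg zero_le_one _).trans Real.exp_one_lt_three.le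
    calc _ ≤ ∑ j ∈ Finset.range (2 * k + 1), ((1 : ℝ) ^ j / j.factorial) * ((1 + D) ^ (2 * k) * η) := by
          refine Finset.sum_le_sum fun j hj => ?_
          have h4 : D ^ j ≤ (1 + D) ^ (2 * k) :=
            (pow_le_pow_left₀ hD (by linarith) j).trans
              (pow_le_pow_right₀ (by linarith) (by have := Finset.mem_range.1 hj; omega))
          rw [one_pow, one_div, inv_mul_eq_div]
          gcongr
      _ ≤ 3 * ((1 + D) ^ (2 * k) * η) := by rw [← Finset.sum_mul]; gcongr
      _ = _ := by ring
  rw [Finset.sum_range_succ] at hsum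
  -- The highest moment of `X` is itself compared with that of `Y`, so an upper bound is needed only
  -- for the moments of `Y`.
  have h5 : (∫ x, X x ^ (2 * k) ∂P) / (2 * k).factorial ≤
      (∫ x, Y x ^ (2 * k) ∂Q) / (2 * k).factorial + D ^ (2 * k) * η / (2 * k).factorial := by
    rw [← add_div]
    refine div_le_div_of_nonneg_right ?_ (by positivity)
    have := le_of_abs_le (h (2 * k) le_rfl)
    linarith
  have h6 : ‖∑ j ∈ Finset.range (2 * k),
        (((∫ x, X x ^ j ∂P : ℝ) : ℂ) * Complex.I ^ j) / (j.factorial : ℂ) -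
      ∑ j ∈ Finset.range (2 * k),
        (((∫ x, Y x ^ j ∂Q : ℝ) : ℂ) * Complex.I ^ j) / (j.factorial : ℂ)‖ ≤
      ∑ j ∈ Finset.range (2 * k), D ^ j * η / j.factorial := by
    rw [← Finset.sum_sub_distrib]
    exact norm_sum_le_of_le _ fun j hj => norm_taylor_sub_le j (h j (Finset.mem_range.1 hj).le)
  set SX := ∑ j ∈ Finset.range (2 * k),
        (((∫ x, X x ^ j ∂P : ℝ) : ℂ) * Complex.I ^ j) / (j.factorial : ℂ)
  set SY := ∑ j ∈ Finset.range (2 * k),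
        (((∫ x, Y x ^ j ∂Q : ℝ) : ℂ) * Complex.I ^ j) / (j.factorial : ℂ)
  calc ‖∫ x, phase (X x) ∂P - ∫ x, phase (Y x) ∂Q‖
      = ‖(∫ x, phase (X x) ∂P - SX) + (SX - SY) - (∫ x, phase (Y x) ∂Q - SY)‖ := by congr 1; ring
    _ ≤ ‖∫ x, phase (X x) ∂P - SX‖ + ‖SX - SY‖ + ‖∫ x, phase (Y x) ∂Q - SY‖ :=
        (norm_sub_le _ _).trans (by gcongr; exact norm_add_le _ _)
    _ ≤ _ := by linarith

/-- The uniform distribution on `(t₀, T]`. -/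
def timeMeasure (t₀ T : ℝ) : Measure ℝ := (ENNReal.ofReal (T - t₀))⁻¹ • volume.restrict (Ioc t₀ T)

theorem isProbabilityMeasure_timeMeasure {t₀ T : ℝ} (h : t₀ < T) :
    IsProbabilityMeasure (timeMeasure t₀ T) := by
  constructor
  rw [timeMeasure, Measure.smul_apply, Measure.restrict_apply_univ, Real.volume_Ioc, smul_eq_mul]
  exact ENNReal.inv_mul_cancel (by simpa using h) ENNReal.ofReal_ne_top

theorem integral_timeMeasure {t₀ T : ℝ} (h : t₀ < T) {E : Type*} [NormedAddCommGroup E]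
    [NormedSpace ℝ E] (f : ℝ → E) :
    ∫ t, f t ∂(timeMeasure t₀ T) = (T - t₀)⁻¹ • ∫ t in t₀..T, f t := by
  rw [timeMeasure, integral_smul_measure, intervalIntegral.integral_of_le h.le, ENNReal.toReal_inv,
    ENNReal.toReal_ofReal (by linarith)]

theorem integrable_timeMeasure {t₀ T : ℝ} (h : t₀ < T) {E : Type*} [NormedAddCommGroup E]
    {f : ℝ → E} (hf : IntervalIntegrable f volume t₀ T) : Integrable f (timeMeasure t₀ T) := by
  rw [timeMeasure]
  refine Integrable.smul_measure ((intervalIntegrable_iff_integrableOn_Ioc_of_le h.le).1 hf) ?_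
  simpa using h

variable {ι : Type*} [Fintype ι]

/-- The sign attached to a Boolean. -/
def boolSign (b : Bool) : ℤ := if b then 1 else -1

/-- The coefficient of a character in a real trigonometric sum. -/
def signCoeff (c : ι → ℂ) (x : ι × Bool) : ℂ := if x.2 then c x.1 else conj (c x.1)

/-- A real trigonometric sum with frequencies `ω`. -/
def trigLine (c : ι → ℂ) (ω : ι → ℝ) (t : ℝ) : ℝ := ∑ n, 2 * (c n * phase (ω n * t)).re

/-- The corresponding trigonometric sum on the torus. -/
def trigTorus (c : ι → ℂ) (θ : ι → UnitAddCircle) : ℝ := ∑ n, 2 * (c n * fourier 1 (θ n)).re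

/-- The Haar measure on the torus. -/
def torusMeasure (ι : Type*) [Fintype ι] : Measure (ι → UnitAddCircle) :=
  Measure.pi fun _ => AddCircle.haarAddCircle

instance : IsProbabilityMeasure (torusMeasure ι) := by unfold torusMeasure; infer_instance

@[fun_prop]
theorem continuous_trigLine (c : ι → ℂ) (ω : ι → ℝ) : Continuous (trigLine c ω) := by
  unfold trigLine
  have : ∀ n, Continuous fun t => c n * phase (ω n * t) := fun n => by fun_prop
  fun_prop

@[fun_prop]
theorem continuous_trigTorus (c : ι → ℂ) : Continuous (trigTorus c) := by
  unfold trigTorus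
  have : ∀ n, Continuous fun θ : ι → UnitAddCircle => c n * fourier 1 (θ n) := fun n =>
    continuous_const.mul ((fourier 1).continuous.comp (continuous_apply n))
  fun_prop

theorem ofReal_trigLine (c : ι → ℂ) (ω : ι → ℝ) (t : ℝ) :
    (trigLine c ω t : ℂ) =
      ∑ x : ι × Bool, signCoeff c x * phase ((boolSign x.2 : ℝ) * ω x.1 * t) := by
  rw [trigLine, Fintype.sum_prod_type]
  push_cast
  refine Finset.sum_congr rfl fun n _ => ?_
  rw [Fintype.sum_bool]
  simp only [signCoeff, boolSign, if_true, Bool.false_eq_true, if_false, Int.cast_one, one_mul]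
  have h := Complex.re_eq_add_conj (c n * phase (ω n * t))
  rw [h, map_mul, conj_phase]
  push_cast
  rw [show (-1 : ℝ) * ω n * t = -(ω n * t) by ring]
  ring

theorem ofReal_trigTorus (c : ι → ℂ) (θ : ι → UnitAddCircle) :
    (trigTorus c θ : ℂ) = ∑ x : ι × Bool, signCoeff c x * fourier (boolSign x.2) (θ x.1) := by
  rw [trigTorus, Fintype.sum_prod_type]
  push_cast
  refine Finset.sum_congr rfl fun n _ => ?_
  rw [Fintype.sum_bool]
  simp only [signCoeff, boolSign, if_true, Bool.false_eq_true, if_false]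
  have h := Complex.re_eq_add_conj (c n * fourier 1 (θ n))
  rw [h, map_mul, ← fourier_neg]
  ring

theorem prod_phase {κ : Type*} (s : Finset κ) (x : κ → ℝ) : ∏ i ∈ s, phase (x i) = phase (∑ i ∈ s, x i) := by
  classical
  induction s using Finset.induction_on with
  | empty => simp [phase_zero]
  | insert a s ha ih => rw [Finset.prod_insert ha, Finset.sum_insert ha, phase_add, ih]

theorem prod_fourier {κ : Type*} (s : Finset κ) (k : κ → ℤ) (θ : UnitAddCircle) :
    ∏ i ∈ s, fourier (k i) θ = fourier (∑ i ∈ s, k i) θ := by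
  classical
  induction s using Finset.induction_on with
  | empty => simp
  | insert a s ha ih => rw [Finset.prod_insert ha, Finset.sum_insert ha, fourier_add, ih]

theorem trigLine_pow (c : ι → ℂ) (ω : ι → ℝ) (t : ℝ) (j : ℕ) :
    (trigLine c ω t : ℂ) ^ j = ∑ p : Fin j → ι × Bool, (∏ i, signCoeff c (p i)) *
      phase ((∑ i, (boolSign (p i).2 : ℝ) * ω (p i).1) * t) := by
  rw [ofReal_trigLine, Fintype.sum_pow]
  refine Finset.sum_congr rfl fun p _ => ?_
  rw [Finset.prod_mul_distrib, prod_phase, Finset.sum_mul]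

theorem trigTorus_pow (c : ι → ℂ) (θ : ι → UnitAddCircle) (j : ℕ) :
    (trigTorus c θ : ℂ) ^ j = ∑ p : Fin j → ι × Bool, (∏ i, signCoeff c (p i)) *
      ∏ i, fourier (boolSign (p i).2) (θ (p i).1) := by
  rw [ofReal_trigTorus, Fintype.sum_pow]
  refine Finset.sum_congr rfl fun p _ => ?_
  rw [Finset.prod_mul_distrib]

/-- Collecting characters coordinate by coordinate, the integral is 1 exactly when all total
exponents vanish. By independence over ℚ this happens exactly when the total frequency vanishes, so
the torus and the long time average have the same resonances. -/
theorem integral_prod_fourier {ω : ι → ℝ} (hω : LinearIndependent ℚ ω) {j : ℕ} (p : Fin j → ι × Bool) :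
    ∫ θ, ∏ i, fourier (boolSign (p i).2) (θ (p i).1) ∂(torusMeasure ι) =
      if ∑ i, (boolSign (p i).2 : ℝ) * ω (p i).1 = 0 then 1 else 0 := by
  classical
  set m : ι → ℤ := fun n => ∑ i with (p i).1 = n, boolSign (p i).2 with hm
  have h1 : ∀ θ : ι → UnitAddCircle, ∏ i, fourier (boolSign (p i).2) (θ (p i).1) =
      ∏ n, fourier (m n) (θ n) := by
    intro θ
    rw [← Finset.prod_fiberwise (s := Finset.univ) (g := fun i => (p i).1)]
    refine Finset.prod_congr rfl fun n _ => ?_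
    rw [hm, ← prod_fourier]
    refine Finset.prod_congr rfl fun i hi => ?_
    rw [(Finset.mem_filter.1 hi).2]
  have h2 : ∑ i, (boolSign (p i).2 : ℝ) * ω (p i).1 = ∑ n, (m n : ℝ) * ω n := by
    rw [← Finset.sum_fiberwise (s := Finset.univ) (g := fun i => (p i).1)]
    refine Finset.sum_congr rfl fun n _ => ?_
    rw [hm]
    push_cast
    rw [Finset.sum_mul]
    refine Finset.sum_congr rfl fun i hi => ?_
    rw [(Finset.mem_filter.1 hi).2]
  simp only [h1]
  rw [torusMeasure, integral_fintype_prod_eq_prod (𝕜 := ℂ)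
    (f := fun n (x : UnitAddCircle) => (fourier (m n) x : ℂ)), h2]
  simp only [integral_fourier]
  have h3 : (∑ n, (m n : ℝ) * ω n = 0) ↔ ∀ n, m n = 0 := by
    constructor
    · intro h
      have h4 := Fintype.linearIndependent_iff.1 hω (fun n => (m n : ℚ)) (by
        rw [← h]
        refine Finset.sum_congr rfl fun n _ => ?_
        rw [Rat.smul_def]
        push_cast
        rfl)
      intro n
      exact_mod_cast h4 n
    · intro h
      simp [h]
  split_ifs with h
  · simp [h3.1 h]
  · rw [h3] at h
    push Not at h
    obtain ⟨n, hn⟩ := h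
    exact Finset.prod_eq_zero (Finset.mem_univ n) (if_neg hn)

/-- Moments of trigonometric sums with well separated frequencies. -/
theorem abs_moment_sub_le {ω : ι → ℝ} (hω : LinearIndependent ℚ ω) (c : ι → ℂ) {t₀ T δ : ℝ}
    (hT : t₀ < T) (hδ : 0 < δ) (j : ℕ)
    (h : ∀ p : Fin j → ι × Bool, ∑ i, (boolSign (p i).2 : ℝ) * ω (p i).1 ≠ 0 →
      δ ≤ |∑ i, (boolSign (p i).2 : ℝ) * ω (p i).1|) :
    |∫ t, trigLine c ω t ^ j ∂(timeMeasure t₀ T) - ∫ θ, trigTorus c θ ^ j ∂(torusMeasure ι)| ≤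
      (2 * ∑ n, ‖c n‖) ^ j * (2 / (δ * (T - t₀))) := by
  classical
  have := isProbabilityMeasure_timeMeasure hT
  have hT' : 0 < T - t₀ := by linarith
  rw [← Real.norm_eq_abs, ← Complex.norm_real]
  push_cast
  rw [← integral_complex_ofReal, ← integral_complex_ofReal]
  push_cast
  simp only [trigLine_pow, trigTorus_pow]
  rw [integral_finsetSum _ fun p _ => integrable_timeMeasure hT
      (Continuous.intervalIntegrable (by fun_prop) _ _),
    integral_finsetSum _ fun p _ => ?_, ← Finset.sum_sub_distrib]
  swap
  · have hc : Continuous fun θ : ι → UnitAddCircle => (∏ i, signCoeff c (p i)) *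
        ∏ i, (fourier (boolSign (p i).2) (θ (p i).1) : ℂ) :=
      continuous_const.mul (continuous_finsetProd _ fun i _ =>
        (fourier _).continuous.comp (continuous_apply _))
    exact hc.integrable_of_hasCompactSupport (HasCompactSupport.of_compactSpace _)
  -- A resonant monomial has the same mean on both sides. Any other has mean 0 on the torus, and its
  -- time average is at most 2/(δ(T - t₀)) times the coefficient.
  have hterm : ∀ p : Fin j → ι × Bool,
      ‖∫ t, (∏ i, signCoeff c (p i)) * phase ((∑ i, (boolSign (p i).2 : ℝ) * ω (p i).1) * t) ∂(timeMeasure t₀ T) -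
        ∫ θ, (∏ i, signCoeff c (p i)) * ∏ i, fourier (boolSign (p i).2) (θ (p i).1) ∂(torusMeasure ι)‖ ≤
      (∏ i, ‖signCoeff c (p i)‖) * (2 / (δ * (T - t₀))) := by
    intro p
    rw [integral_const_mul, integral_const_mul, ← mul_sub, norm_mul, norm_prod, integral_prod_fourier hω]
    refine mul_le_mul_of_nonneg_left ?_ (Finset.prod_nonneg fun i _ => norm_nonneg _)
    split_ifs with h0
    · rw [h0]
      simp only [zero_mul, phase_zero, integral_const, probReal_univ, one_smul, sub_self, norm_zero]
      positivity
    · rw [sub_zero, integral_timeMeasure hT, norm_smul, norm_inv, Real.norm_of_nonneg hT'.le]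
      have h1 := norm_integral_phase_le h0 t₀ T
      have h2 := h p h0
      calc _ ≤ (T - t₀)⁻¹ * (2 / δ) := by
            gcongr; exact h1.trans (by gcongr)
        _ = _ := by field_simp
  refine (norm_sum_le_of_le _ fun p _ => hterm p).trans (le_of_eq ?_)
  rw [← Finset.sum_mul, ← Fintype.sum_pow (fun x => ‖signCoeff c x‖) j, Fintype.sum_prod_type]
  congr 2
  rw [Finset.mul_sum]
  refine Finset.sum_congr rfl fun n _ => ?_
  rw [Fintype.sum_bool]
  simp only [signCoeff, if_true, Bool.false_eq_true, if_false, RCLike.norm_conj]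
  ring

/-- The coordinates are independent, so the integral factorizes into circle integrals. Imaginary τ
gives the characteristic function, real τ the exponential moments. -/
theorem integral_exp_trigTorus (c : ι → ℂ) (τ : ℂ) :
    ∫ θ, Complex.exp (τ * trigTorus c θ) ∂(torusMeasure ι) =
      ∏ n, bes (4 * τ ^ 2 * (‖c n‖ ^ 2 : ℝ)) := by
  have h1 : ∀ θ : ι → UnitAddCircle, Complex.exp (τ * trigTorus c θ) =
      ∏ n, Complex.exp (((2 * τ * c n) * fourier 1 (θ n) + (2 * τ * conj (c n)) * fourier (-1) (θ n)) / 2) := by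
    intro θ
    rw [← Complex.exp_sum, trigTorus]
    congr 1
    push_cast
    rw [Finset.mul_sum]
    refine Finset.sum_congr rfl fun n _ => ?_
    rw [Complex.re_eq_add_conj (c n * fourier 1 (θ n)), map_mul, ← fourier_neg]
    ring
  simp only [h1]
  rw [torusMeasure, integral_fintype_prod_eq_prod (𝕜 := ℂ)
    (f := fun n (x : UnitAddCircle) =>
      Complex.exp (((2 * τ * c n) * fourier 1 x + (2 * τ * conj (c n)) * fourier (-1) x) / 2))]
  refine Finset.prod_congr rfl fun n _ => ?_
  rw [integral_exp_toCircle]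
  congr 1
  rw [Complex.ofReal_pow, ← Complex.mul_conj']
  ring

theorem integrable_torus {E : Type*} [NormedAddCommGroup E] {f : (ι → UnitAddCircle) → E} (hf : Continuous f) :
    Integrable f (torusMeasure ι) :=
  hf.integrable_of_hasCompactSupport (HasCompactSupport.of_compactSpace _)

/-- A sub-Gaussian bound, from the growth of at most exp (|w|/4) of each Bessel factor. -/
theorem integral_exp_mul_trigTorus_le (c : ι → ℂ) (ρ : ℝ) :
    ∫ θ, Real.exp (ρ * trigTorus c θ) ∂(torusMeasure ι) ≤ Real.exp (ρ ^ 2 * ∑ n, ‖c n‖ ^ 2) := by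
  calc _ ≤ ‖((∫ θ, Real.exp (ρ * trigTorus c θ) ∂(torusMeasure ι) : ℝ) : ℂ)‖ := by
        rw [Complex.norm_real]; exact le_abs_self _
    _ = ‖∏ n, bes (4 * (ρ : ℂ) ^ 2 * (‖c n‖ ^ 2 : ℝ))‖ := by
        rw [← integral_complex_ofReal, ← integral_exp_trigTorus]
        push_cast
        rfl
    _ ≤ ∏ n, Real.exp (ρ ^ 2 * ‖c n‖ ^ 2) := by
        rw [norm_prod]
        refine Finset.prod_le_prod (fun _ _ => norm_nonneg _) fun n _ => ?_
        refine (norm_bes_le _).trans (Real.exp_le_exp.2 (le_of_eq ?_))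
        rw [norm_mul, norm_mul, norm_pow, Complex.norm_real, Complex.norm_real, Real.norm_eq_abs,
          sq_abs, Real.norm_of_nonneg (by positivity)]
        norm_num
        ring
    _ = _ := by rw [← Real.exp_sum, Finset.mul_sum]

/-- The inequality x^{2k}/(2k)! ≤ e^{|x|} ≤ e^x + e^{-x} is applied at ρ times the sum. The
parameter ρ stays free, so that ρ^(-2k) can be played against the sub-Gaussian factor. -/
theorem integral_trigTorus_pow_le (c : ι → ℂ) (k : ℕ) {ρ : ℝ} (hρ : 0 < ρ) :
    (∫ θ, trigTorus c θ ^ (2 * k) ∂(torusMeasure ι)) / (2 * k).factorial ≤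
      2 * ((ρ ^ (2 * k))⁻¹ * Real.exp (ρ ^ 2 * ∑ n, ‖c n‖ ^ 2)) := by
  have h1 : ∀ θ : ι → UnitAddCircle, trigTorus c θ ^ (2 * k) / (2 * k).factorial ≤
      (ρ ^ (2 * k))⁻¹ * (Real.exp (ρ * trigTorus c θ) + Real.exp ((-ρ) * trigTorus c θ)) := by
    intro θ
    have h := Real.pow_div_factorial_le_exp |ρ * trigTorus c θ| (abs_nonneg _) (2 * k)
    have h2 : Real.exp |ρ * trigTorus c θ| ≤
        Real.exp (ρ * trigTorus c θ) + Real.exp ((-ρ) * trigTorus c θ) := by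
      rcases abs_cases (ρ * trigTorus c θ) with ⟨h, -⟩ | ⟨h, -⟩
      · rw [h]; linarith [Real.exp_pos ((-ρ) * trigTorus c θ)]
      · rw [h, neg_mul]; linarith [Real.exp_pos (ρ * trigTorus c θ)]
    have h3 : |ρ * trigTorus c θ| ^ (2 * k) = ρ ^ (2 * k) * trigTorus c θ ^ (2 * k) := by
      rw [pow_mul, sq_abs, ← pow_mul, mul_pow]
    rw [h3, mul_div_assoc] at h
    rw [← div_eq_inv_mul, le_div_iff₀ (by positivity), mul_comm]
    exact h.trans h2
  rw [← integral_div]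
  refine (integral_mono (integrable_torus (by fun_prop)) (integrable_torus (by fun_prop)) h1).trans ?_
  rw [integral_const_mul, integral_add (integrable_torus (by fun_prop)) (integrable_torus (by fun_prop))]
  have h4 := integral_exp_mul_trigTorus_le c ρ
  have h5 := integral_exp_mul_trigTorus_le c (-ρ)
  rw [neg_sq] at h5
  calc _ ≤ (ρ ^ (2 * k))⁻¹ * (Real.exp (ρ ^ 2 * ∑ n, ‖c n‖ ^ 2) + Real.exp (ρ ^ 2 * ∑ n, ‖c n‖ ^ 2)) := by
        gcongr
    _ = _ := by ring

/-- Quantitative Kronecker–Weyl equidistribution for a trigonometric sum. -/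
theorem norm_integral_phase_trigLine_sub_le {ω : ι → ℝ} (hω : LinearIndependent ℚ ω) (c : ι → ℂ)
    {t₀ T δ ρ : ℝ} (hT : t₀ < T) (hδ : 0 < δ) (hρ : 0 < ρ) (k : ℕ)
    (h : ∀ j ≤ 2 * k, ∀ p : Fin j → ι × Bool, ∑ i, (boolSign (p i).2 : ℝ) * ω (p i).1 ≠ 0 →
      δ ≤ |∑ i, (boolSign (p i).2 : ℝ) * ω (p i).1|) :
    ‖∫ t, phase (trigLine c ω t) ∂(timeMeasure t₀ T) - ∏ n, bes (-4 * (‖c n‖ ^ 2 : ℝ))‖ ≤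
      3 * (1 + 2 * ∑ n, ‖c n‖) ^ (2 * k) * (2 / (δ * (T - t₀))) +
        4 * ((ρ ^ (2 * k))⁻¹ * Real.exp (ρ ^ 2 * ∑ n, ‖c n‖ ^ 2)) := by
  have := isProbabilityMeasure_timeMeasure hT
  have hT' : 0 < T - t₀ := by linarith
  have h1 := norm_integral_phase_sub_le (P := timeMeasure t₀ T) (Q := torusMeasure ι)
    (continuous_trigLine c ω).measurable (continuous_trigTorus c).measurable
    (fun j => integrable_timeMeasure hT (Continuous.intervalIntegrable (by fun_prop) _ _))
    (fun j => integrable_torus (by fun_prop)) (D := 2 * ∑ n, ‖c n‖) (by positivity)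
    (η := 2 / (δ * (T - t₀))) (by positivity) k
    (fun j hj => abs_moment_sub_le hω c hT hδ j (h j hj))
  have h2 : ∫ θ, phase (trigTorus c θ) ∂(torusMeasure ι) = ∏ n, bes (-4 * (‖c n‖ ^ 2 : ℝ)) := by
    have := integral_exp_trigTorus c Complex.I
    rw [Complex.I_sq] at this
    rw [show ((-4 : ℂ)) = 4 * -1 by ring, ← this]
    refine integral_congr_ae (Eventually.of_forall fun θ => ?_)
    simp only [phase]
    rw [mul_comm]
  rw [h2] at h1
  have h3 := integral_trigTorus_pow_le c k hρ
  linarith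

/-! ### The Fourier transform of the value distribution of the Lerch zeta-function. -/

theorem kap_zero (w : ℂ) : kap 0 w = ((-(4 * Real.pi ^ 2 * ‖w‖ ^ 2) : ℝ) : ℂ) := by
  have h := Complex.mul_conj' w
  rw [kap]
  push_cast
  rw [← h, map_zero]
  ring_nf
  rw [Complex.I_sq]
  ring

theorem gexp_zero (w z : ℂ) : gexp 0 w z = phase (-2 * Real.pi * inner ℝ z w) := by
  simp [gexp, phase]

theorem norm_mgfFactor_kap_zero_le {α : ℝ} (hα : 0 < α) (n : ℕ) (σ : ℝ) (w : ℂ) :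
    ‖mgfFactor α n σ (kap 0 w)‖ ≤ 1 := by
  have h := (integrable_gexp_circle 0 w (((n : ℝ) + α) ^ (-σ))).2
  have e : mgfFactor α n σ (kap 0 w) = bes (((((n : ℝ) + α) ^ (-σ) : ℝ) : ℂ) ^ 2 * kap 0 w) := by
    rw [mgfFactor, base_cpow_neg_two_mul hα, ← Complex.ofReal_neg, Complex.ofReal_cpow (base_pos hα n).le]
  rw [e, ← h]
  refine (norm_integral_le_of_norm_le_const (C := 1) (Eventually.of_forall fun z => ?_)).trans (by simp)
  rw [gexp_zero, norm_phase]

theorem mgfFactor_kap_zero {α : ℝ} (hα : 0 < α) (n : ℕ) (σ : ℝ) (w : ℂ) :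
    mgfFactor α n σ (kap 0 w) =
      bes ((-(4 * Real.pi ^ 2 * ‖w‖ ^ 2 * ((n : ℝ) + α) ^ (-(2 * σ))) : ℝ) : ℂ) := by
  rw [mgfFactor, base_cpow_neg_two_mul hα, ← Complex.ofReal_neg, ← Complex.ofReal_cpow (base_pos hα n).le,
    kap_zero, ← Complex.ofReal_pow, ← Complex.ofReal_mul]
  congr 2
  rw [← Real.rpow_natCast, ← Real.rpow_mul (base_pos hα n).le, show -σ * (2 : ℕ) = -(2 * σ) by push_cast; ring]
  ring

theorem norm_mgfFactor_kap_zero_sub_one_le {α : ℝ} (hα : 0 < α) (n : ℕ) (σ : ℝ) (w : ℂ) :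
    ‖mgfFactor α n σ (kap 0 w) - 1‖ ≤ 3 * (4 * Real.pi ^ 2 * ‖w‖ ^ 2 * ((n : ℝ) + α) ^ (-(2 * σ))) := by
  have hpos := base_pos hα n
  set x := 4 * Real.pi ^ 2 * ‖w‖ ^ 2 * ((n : ℝ) + α) ^ (-(2 * σ)) with hx
  have hx0 : 0 ≤ x := by positivity
  rcases le_total x 1 with h | h
  · rw [mgfFactor_kap_zero hα, ← hx]
    refine (norm_bes_sub_one_le _).trans ?_
    rw [Complex.norm_real, norm_neg, Real.norm_of_nonneg hx0, mul_comm]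
    have := (Real.exp_le_exp.2 h).trans Real.exp_one_lt_three.le
    gcongr
  · have h1 := norm_mgfFactor_kap_zero_le hα n σ w
    have h2 := norm_sub_le (mgfFactor α n σ (kap 0 w)) 1
    rw [norm_one] at h2
    linarith

/-- Without tilt every factor is a characteristic function, of modulus at most 1, so the difference
of the products is bounded by the sum of the deviations of the omitted factors from 1. -/
theorem norm_mgfPartial_sub_mgf_le {α : ℝ} (hα : 0 < α) {a σ : ℝ} (ha : 1 / 2 < a) (hσ : a ≤ σ) (w : ℂ)
    {N : ℕ} (hN : 1 ≤ N) :
    ‖mgfPartial α N σ (kap 0 w) - mgf α σ (kap 0 w)‖ ≤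
      12 * Real.pi ^ 2 * (1 + (2 * a - 1)⁻¹) * (‖w‖ ^ 2 * (N : ℝ) ^ (1 - 2 * a)) := by
  have hle1 : ∀ M, ‖mgfPartial α M σ (kap 0 w)‖ ≤ 1 := fun M => by
    rw [mgfPartial, norm_prod]
    exact Finset.prod_le_one (fun _ _ => norm_nonneg _) fun n _ => norm_mgfFactor_kap_zero_le hα n σ w
  have hstep : ∀ M, N ≤ M → ‖mgfPartial α N σ (kap 0 w) - mgfPartial α M σ (kap 0 w)‖ ≤
      ∑ n ∈ Finset.Ico N M, ‖mgfFactor α n σ (kap 0 w) - 1‖ := by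
    intro M hM
    induction M, hM using Nat.le_induction with
    | base => simp
    | succ M hM ih =>
      rw [Finset.sum_Ico_succ_top hM]
      have e : mgfPartial α N σ (kap 0 w) - mgfPartial α (M + 1) σ (kap 0 w) =
          (mgfPartial α N σ (kap 0 w) - mgfPartial α M σ (kap 0 w)) -
            mgfPartial α M σ (kap 0 w) * (mgfFactor α M σ (kap 0 w) - 1) := by
        rw [mgfPartial, mgfPartial, mgfPartial, Finset.prod_range_succ]; ring
      rw [e]
      refine (norm_sub_le _ _).trans (add_le_add ih ?_)
      rw [norm_mul]
      exact mul_le_of_le_one_left (norm_nonneg _) (hle1 M)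
  have hlim := ((tendsto_mgfPartial hα (s := (σ : ℂ)) (by simp; linarith) (kap 0 w)).const_sub
    (mgfPartial α N σ (kap 0 w))).norm
  refine le_of_tendsto hlim ?_
  filter_upwards [eventually_ge_atTop N] with M hM
  refine (hstep M hM).trans ?_
  have h1 : ∀ n ∈ Finset.Ico N M, ‖mgfFactor α n σ (kap 0 w) - 1‖ ≤
      12 * Real.pi ^ 2 * ‖w‖ ^ 2 * (n : ℝ) ^ (-(2 * a)) := by
    intro n hn
    have hn1 : (1 : ℝ) ≤ n := by exact_mod_cast hN.trans (Finset.mem_Ico.1 hn).1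
    refine (norm_mgfFactor_kap_zero_sub_one_le hα n σ w).trans ?_
    have h2 : ((n : ℝ) + α) ^ (-(2 * σ)) ≤ (n : ℝ) ^ (-(2 * a)) :=
      calc _ ≤ (n : ℝ) ^ (-(2 * σ)) :=
            Real.rpow_le_rpow_of_nonpos (by linarith) (by linarith) (by linarith)
        _ ≤ _ := Real.rpow_le_rpow_of_exponent_le hn1 (by linarith)
    calc _ = 12 * Real.pi ^ 2 * ‖w‖ ^ 2 * ((n : ℝ) + α) ^ (-(2 * σ)) := by ring
      _ ≤ _ := by gcongr
  refine (Finset.sum_le_sum h1).trans ?_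
  rw [← Finset.mul_sum]
  calc _ ≤ 12 * Real.pi ^ 2 * ‖w‖ ^ 2 * ((1 + (2 * a - 1)⁻¹) * (N : ℝ) ^ (1 - 2 * a)) := by
        have := sum_Ico_rpow_le ha hN (M := M); gcongr
    _ = _ := by ring

theorem phase_lipschitz (x y : ℝ) : ‖phase x - phase y‖ ≤ |x - y| := by
  have e : phase x - phase y = phase y * (Complex.exp (Complex.I * ((x - y : ℝ) : ℂ)) - 1) := by
    rw [mul_sub, mul_one, phase, phase, ← Complex.exp_add]; congr 2; push_cast; ring
  rw [e, norm_mul, norm_phase, one_mul]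
  exact Real.norm_exp_I_mul_ofReal_sub_one_le

theorem norm_phase_inner_sub_le (z z' w : ℂ) :
    ‖phase (-2 * Real.pi * inner ℝ z w) - phase (-2 * Real.pi * inner ℝ z' w)‖ ≤
      2 * Real.pi * ‖w‖ * ‖z - z'‖ := by
  refine (phase_lipschitz _ _).trans ?_
  rw [← mul_sub, ← inner_sub_left, abs_mul, show (-2 * Real.pi) = -(2 * Real.pi) by ring, abs_neg,
    abs_of_pos (by positivity : 0 < 2 * Real.pi)]
  have h := abs_real_inner_le_norm (z - z') w
  calc _ ≤ 2 * Real.pi * (‖z - z'‖ * ‖w‖) := by gcongr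
    _ = _ := by ring

theorem pow_mul_exp_neg_le {c x : ℝ} (hc : 0 < c) (hx : 0 ≤ x) (k : ℕ) :
    x ^ k * Real.exp (-(c * x)) ≤ k.factorial / c ^ k := by
  have h := Real.pow_div_factorial_le_exp (c * x) (by positivity) k
  rw [Real.exp_neg, ← div_eq_mul_inv, div_le_div_iff₀ (Real.exp_pos _) (by positivity)]
  rw [div_le_iff₀ (by positivity), mul_pow] at h
  linarith

theorem two_pow_rpow (q : ℕ) (x : ℝ) : (((2 ^ q : ℕ) : ℝ)) ^ x = Real.exp (Real.log 2 * q * x) := by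
  push_cast
  rw [Real.rpow_def_of_pos (by positivity), Real.log_pow]
  congr 1
  ring

/-- The coefficients of the trigonometric sum `-2π⟨P_N(σ + it), w⟩`. -/
def innerCoeff (lam α σ : ℝ) (w : ℂ) (n : ℕ) : ℂ := -(Real.pi : ℂ) * w * conj (lerchCoeff lam α σ n)

theorem norm_innerCoeff {α : ℝ} (hα : 0 < α) (lam σ : ℝ) (w : ℂ) (n : ℕ) :
    ‖innerCoeff lam α σ w n‖ = Real.pi * ‖w‖ * ((n : ℝ) + α) ^ (-σ) := by
  rw [innerCoeff, norm_mul, norm_mul, norm_neg, RCLike.norm_conj, norm_lerchCoeff hα, Complex.norm_real,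
    Real.norm_of_nonneg Real.pi_pos.le]

theorem trigLine_innerCoeff {α : ℝ} (hα : 0 < α) (lam σ : ℝ) (w : ℂ) (N : ℕ) (t : ℝ) :
    trigLine (fun n : Fin N => innerCoeff lam α σ w n) (fun n : Fin N => Real.log (((n : ℕ) : ℝ) + α)) t =
      -2 * Real.pi * inner ℝ (lerchPartialSum lam α (σ + t * Complex.I) N) w := by
  rw [Complex.inner, lerchPartialSum_eq, map_sum, Finset.mul_sum, Complex.re_sum, Finset.mul_sum, trigLine,
    Finset.sum_range]
  refine Finset.sum_congr rfl fun n _ => ?_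
  rw [lerchTerm_eq hα, map_mul, conj_phase, innerCoeff]
  have e : -(Real.pi : ℂ) * w * conj (lerchCoeff lam α σ n) * phase (Real.log (((n : ℕ) : ℝ) + α) * t) =
      ((-Real.pi : ℝ) : ℂ) * (w * (conj (lerchCoeff lam α σ n) * phase (-(-Real.log (((n : ℕ) : ℝ) + α) * t)))) := by
    rw [show -(-Real.log (((n : ℕ) : ℝ) + α) * t) = Real.log (((n : ℕ) : ℝ) + α) * t by ring]
    push_cast; ring
  rw [e, Complex.re_ofReal_mul]
  ring

theorem prod_bes_innerCoeff {α : ℝ} (hα : 0 < α) (lam σ : ℝ) (w : ℂ) (N : ℕ) :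
    ∏ n : Fin N, bes (-4 * (‖innerCoeff lam α σ w n‖ ^ 2 : ℝ)) = mgfPartial α N σ (kap 0 w) := by
  rw [mgfPartial, Finset.prod_range]
  refine Finset.prod_congr rfl fun n _ => ?_
  rw [mgfFactor_kap_zero hα, norm_innerCoeff hα]
  congr 1
  rw [show -(2 * σ) = -σ * (2 : ℕ) by push_cast; ring, Real.rpow_mul (base_pos hα n).le, Real.rpow_natCast]
  push_cast
  ring

/-- Pointwise f ≤ f²/(2s) + s/2, in place of the Cauchy–Schwarz inequality. -/
theorem integral_le_of_integral_sq_le {Ω : Type*} [MeasurableSpace Ω] {μ : Measure Ω}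
    [IsProbabilityMeasure μ] {f : Ω → ℝ} (hf : Integrable f μ) (hf2 : Integrable (fun x => f x ^ 2) μ)
    {K s : ℝ} (hs : 0 < s) (h : ∫ x, f x ^ 2 ∂μ ≤ K * s ^ 2) : ∫ x, f x ∂μ ≤ (K + 1) / 2 * s := by
  have h1 : ∀ x, f x ≤ (2 * s)⁻¹ * f x ^ 2 + s / 2 := by
    intro x
    have : (2 * s)⁻¹ * f x ^ 2 + s / 2 - f x = (2 * s)⁻¹ * (f x - s) ^ 2 := by field_simp; ring
    have h2 : 0 ≤ (2 * s)⁻¹ * (f x - s) ^ 2 := by positivity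
    linarith
  refine (integral_mono hf ((hf2.const_mul _).add (integrable_const _)) h1).trans ?_
  simp only [Pi.add_apply]
  rw [integral_add (hf2.const_mul _) (integrable_const _), integral_const_mul, integral_const,
    probReal_univ, one_smul]
  calc _ ≤ (2 * s)⁻¹ * (K * s ^ 2) + s / 2 := by gcongr
    _ = _ := by field_simp

theorem intervalIntegrable_norm_sub_pow {α : ℝ} (hα : 0 < α) (hα1 : α ≤ 1) (lam : ℝ) {σ : ℝ}
    (hσ : 0 < σ) {t₀ T : ℝ} (h1 : 1 ≤ t₀) (hT : t₀ ≤ T) (N k : ℕ) :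
    IntervalIntegrable (fun t : ℝ => ‖lerchZeta lam α (σ + t * Complex.I) -
      lerchPartialSum lam α (σ + t * Complex.I) N‖ ^ k) volume t₀ T :=
  ((((continuousOn_lerchZeta_line hα hα1 lam hσ).mono (uIcc_subset_Ioi_zero h1 hT)).sub
    (continuous_lerchPartialSum_line hα lam σ N).continuousOn).norm.pow k).intervalIntegrable

/-- The length 2^q makes N^(1 - 2a) exponentially small in `q`. It has to absorb 19 powers of `q`:
nine from log T ≤ q⁹, and ten because a mean square of order q^(-10) is wanted. -/
theorem exists_integral_norm_sub_le {α : ℝ} (hα : 0 < α) (hα1 : α ≤ 1) (lam : ℝ) {a b : ℝ}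
    (ha : 1 / 2 < a) (hab : a ≤ b) {t₀ : ℝ} (ht₀ : 1 ≤ t₀) :
    ∃ C, 0 < C ∧ ∀ q : ℕ, 1 ≤ q → 2 * t₀ ≤ q → ∀ T, Real.exp ((q : ℝ) ^ 8) ≤ T →
      T ≤ Real.exp ((q : ℝ) ^ 9) → ∀ σ, a ≤ σ → σ ≤ b →
      ∫ t, ‖lerchZeta lam α (σ + t * Complex.I) - lerchPartialSum lam α (σ + t * Complex.I) (2 ^ q)‖
        ∂(timeMeasure t₀ T) ≤ C * ((q : ℝ) ^ 5)⁻¹ := by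
  obtain ⟨C₁, hC₁, h₁⟩ := exists_integral_norm_sq_sub_le hα hα1 lam ha hab
  set c := Real.log 2 * (2 * a - 1) with hc
  have hc0 : 0 < c := mul_pos (Real.log_pos one_lt_two) (by linarith)
  set K := 4 * C₁ * (Nat.factorial 19 / c ^ 19) with hK
  refine ⟨(K + 1) / 2, by positivity, fun q hq hqt T hT1 hT2 σ hσ1 hσ2 => ?_⟩
  have hq1 : (1 : ℝ) ≤ q := by exact_mod_cast hq
  have hqe : Real.exp q ≤ T := (Real.exp_le_exp.2 (le_self_pow₀ hq1 (by norm_num))).trans hT1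
  have hqT : (q : ℝ) ≤ T := by linarith [Real.add_one_le_exp (q : ℝ)]
  have hT0 : 0 < T := by linarith
  have htT : t₀ < T := by linarith
  have hN : ((2 ^ q : ℕ) : ℝ) ≤ T := by
    refine le_trans ?_ hqe
    have h := two_pow_rpow q 1
    rw [Real.rpow_one] at h
    rw [h]
    refine Real.exp_le_exp.2 ?_
    have := Real.log_two_lt_d9
    nlinarith
  have h2 := h₁ σ hσ1 hσ2 t₀ T ht₀ htT.le (2 ^ q) Nat.one_le_two_pow hN
  have hpr := isProbabilityMeasure_timeMeasure htT
  refine integral_le_of_integral_sq_le ?_ ?_ (s := ((q : ℝ) ^ 5)⁻¹) (by positivity) ?_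
  · have := intervalIntegrable_norm_sub_pow hα hα1 lam (σ := σ) (by linarith) ht₀ htT.le (2 ^ q) 1
    simp only [pow_one] at this
    exact integrable_timeMeasure htT this
  · exact integrable_timeMeasure htT
      (intervalIntegrable_norm_sub_pow hα hα1 lam (σ := σ) (by linarith) ht₀ htT.le (2 ^ q) 2)
  · rw [integral_timeMeasure htT, smul_eq_mul]
    have hlog : 1 + Real.log T ≤ 2 * (q : ℝ) ^ 9 := by
      have h3 : Real.log T ≤ (q : ℝ) ^ 9 := by rwa [Real.log_le_iff_le_exp hT0]
      have h4 : 1 ≤ (q : ℝ) ^ 9 := one_le_pow₀ hq1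
      linarith
    have hinv : (T - t₀)⁻¹ ≤ 2 * T⁻¹ := by
      rw [← div_eq_mul_inv, inv_eq_one_div, div_le_div_iff₀ (by linarith) hT0]
      linarith
    have hX : (((2 ^ q : ℕ) : ℝ)) ^ (1 - 2 * a) = Real.exp (-(c * q)) := by
      rw [two_pow_rpow, hc]; congr 1; ring
    have h19 := pow_mul_exp_neg_le hc0 (by linarith : (0 : ℝ) ≤ q) 19
    rw [hX] at h2
    have hlT : 0 ≤ Real.log T := Real.log_nonneg (by linarith)
    calc _ ≤ (2 * T⁻¹) * (C₁ * (T * ((2 * (q : ℝ) ^ 9) * Real.exp (-(c * q))))) := by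
          refine mul_le_mul hinv (h2.trans (by gcongr)) ?_ (by positivity)
          exact intervalIntegral.integral_nonneg htT.le fun _ _ => by positivity
      _ = 4 * C₁ * ((q : ℝ) ^ 19 * Real.exp (-(c * q))) * (((q : ℝ) ^ 5)⁻¹) ^ 2 := by
          field_simp; ring
      _ ≤ 4 * C₁ * (Nat.factorial 19 / c ^ 19) * (((q : ℝ) ^ 5)⁻¹) ^ 2 := by gcongr

/-- The moment method with N = 2^q, k = q³ and ρ = e. The coefficients contribute at most exp (6q⁴)
and the separation of frequencies at most exp (4Ωq⁷); both are beaten by T ≥ exp (q⁸). The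
truncation error is exp (-2q³) times the exponential of a multiple of q². These competing powers of
`q` explain the lower bound imposed on T. -/
theorem exists_norm_integral_phase_sub_mgfPartial_le {α : ℝ} (hα : α ∈ admissibleSet) (lam : ℝ) {a b : ℝ}
    (ha : 1 / 2 < a) (hab : a ≤ b) {t₀ : ℝ} (ht₀ : 1 ≤ t₀) :
    ∃ q₀ : ℕ, ∀ q : ℕ, q₀ ≤ q → ∀ T, Real.exp ((q : ℝ) ^ 8) ≤ T → ∀ σ, a ≤ σ → σ ≤ b →
      ∀ w : ℂ, ‖w‖ ≤ q →
      ‖∫ t, phase (-2 * Real.pi * inner ℝ (lerchPartialSum lam α (σ + t * Complex.I) (2 ^ q)) w)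
        ∂(timeMeasure t₀ T) - mgfPartial α (2 ^ q) σ (kap 0 w)‖ ≤ 16 * Real.exp (-q) := by
  obtain ⟨⟨hα0, hα1⟩, hli, Ω, hΩ, X₀, hX₀⟩ := hα
  have hs := summable_baseBound_sq hα0 ha hab
  set B := ∑' n, baseBound α a b n ^ 2 with hB
  have hB0 : 0 ≤ B := tsum_nonneg fun n => sq_nonneg _
  have hr2 : ∀ σ, a ≤ σ → σ ≤ b → ∀ n : ℕ, (((n : ℝ) + α) ^ (-σ)) ^ 2 ≤ baseBound α a b n ^ 2 := by
    intro σ h1 h2 n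
    have hpos := base_pos hα0 n
    have := rpow_le_baseBound hα0 h1 h2 n
    gcongr
  set R := 1 + B with hR
  have hr : ∀ σ, a ≤ σ → σ ≤ b → ∀ n : ℕ, ((n : ℝ) + α) ^ (-σ) ≤ R := by
    intro σ h1 h2 n
    have h3 := (hr2 σ h1 h2 n).trans (hs.le_tsum n fun _ _ => sq_nonneg _)
    nlinarith [sq_nonneg (((n : ℝ) + α) ^ (-σ) - 1)]
  -- The summands are the constants that `q` has to dominate in the estimates below.
  obtain ⟨q₀, hq₀⟩ := exists_nat_ge (1 + |X₀| + 2 * t₀ + (1 + 2 * Real.pi * R) + (7 + 4 * Ω) +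
    Real.exp 2 * Real.pi ^ 2 * B)
  refine ⟨q₀, fun q hq T hT σ hσ1 hσ2 w hw => ?_⟩
  have hqR : (q₀ : ℝ) ≤ q := by exact_mod_cast hq
  have hπR : 0 ≤ Real.pi * R := by positivity
  have hEB : 0 ≤ Real.exp 2 * Real.pi ^ 2 * B := by positivity
  have hX0 := abs_nonneg X₀
  have hq1 : (1 : ℝ) ≤ q := by linarith
  have hqe : Real.exp q ≤ T := (Real.exp_le_exp.2 (le_self_pow₀ hq1 (by norm_num))).trans hT
  have hqT : (q : ℝ) ≤ T := by linarith [Real.add_one_le_exp (q : ℝ)]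
  have hT0 : 0 < T := by linarith
  have htT : t₀ < T := by linarith
  set N := 2 ^ q with hN
  have hNq : (q : ℝ) ≤ N := by
    have : q < 2 ^ q := Nat.lt_two_pow_self
    exact_mod_cast this.le
  have hNe : (N : ℝ) ≤ Real.exp q := by
    have h := two_pow_rpow q 1
    rw [Real.rpow_one] at h
    rw [hN, h]
    refine Real.exp_le_exp.2 ?_
    have := Real.log_two_lt_d9
    nlinarith
  have hN1 : (1 : ℝ) ≤ N := by linarith
  set k := q ^ 3 with hk
  have hkR : (k : ℝ) = (q : ℝ) ^ 3 := by rw [hk]; push_cast; ring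
  set δ := (N : ℝ) ^ (-(Ω * ((2 * k : ℕ) : ℝ) ^ 2)) with hδ
  have hδ0 : 0 < δ := by positivity
  have hlin : LinearIndependent ℚ fun n : Fin N => Real.log (((n : ℕ) : ℝ) + α) :=
    hli.comp (fun n : Fin N => (n : ℕ)) Fin.val_injective
  have hsep : ∀ j ≤ 2 * k, ∀ p : Fin j → Fin N × Bool,
      ∑ i, (boolSign (p i).2 : ℝ) * Real.log ((((p i).1 : ℕ) : ℝ) + α) ≠ 0 →
      δ ≤ |∑ i, (boolSign (p i).2 : ℝ) * Real.log ((((p i).1 : ℕ) : ℝ) + α)| := by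
    intro j hj p hp
    -- Condition (2) on α is applied with X = N. Enlarging the exponent Ωj² to Ω(2k)² gives one δ
    -- for all orders j ≤ 2k.
    have h := hX₀ N (by linarith [le_abs_self X₀]) j (fun i => ((p i).1 : ℕ))
      (fun i => (boolSign (p i).2 : ℝ)) (fun i => by exact_mod_cast (p i).1.2.le)
      (fun i => by unfold boolSign; split_ifs <;> simp) hp
    refine le_trans (Real.rpow_le_rpow_of_exponent_le hN1 ?_) h
    have : (j : ℝ) ≤ ((2 * k : ℕ) : ℝ) := by exact_mod_cast hj
    have h5 : (j : ℝ) ^ 2 ≤ ((2 * k : ℕ) : ℝ) ^ 2 := by gcongr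
    nlinarith
  have hmain := norm_integral_phase_trigLine_sub_le hlin (fun n : Fin N => innerCoeff lam α σ w n) htT hδ0
    (Real.exp_pos 1) k hsep
  rw [prod_bes_innerCoeff hα0] at hmain
  simp only [trigLine_innerCoeff hα0] at hmain
  refine hmain.trans ?_
  have hD : 1 + 2 * ∑ n : Fin N, ‖innerCoeff lam α σ w n‖ ≤ Real.exp (3 * q) := by
    have h1 : ∑ n : Fin N, ‖innerCoeff lam α σ w n‖ ≤ N * (Real.pi * q * R) := by
      refine (Finset.sum_le_card_nsmul _ _ (Real.pi * q * R) fun n _ => ?_).trans (by simp)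
      rw [norm_innerCoeff hα0]
      have := hr σ hσ1 hσ2 n
      have := base_pos hα0 n
      gcongr
    have h2 : 1 ≤ (q : ℝ) * N := by nlinarith
    have hqe' : (q : ℝ) ≤ Real.exp q := by linarith [Real.add_one_le_exp (q : ℝ)]
    calc 1 + 2 * ∑ n : Fin N, ‖innerCoeff lam α σ w n‖ ≤ q * N + 2 * (N * (Real.pi * q * R)) := by
          gcongr
      _ = (1 + 2 * Real.pi * R) * q * N := by ring
      _ ≤ Real.exp q * Real.exp q * Real.exp q := by
          gcongr
          linarith
      _ = _ := by rw [← Real.exp_add, ← Real.exp_add]; congr 1; ring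
  have hinvδ : δ⁻¹ ≤ Real.exp (4 * Ω * (q : ℝ) ^ 7) := by
    rw [hδ, ← Real.rpow_neg (by linarith), neg_neg]
    calc (N : ℝ) ^ (Ω * ((2 * k : ℕ) : ℝ) ^ 2) ≤ (Real.exp q) ^ (Ω * ((2 * k : ℕ) : ℝ) ^ 2) := by gcongr
      _ = _ := by
          rw [← Real.exp_mul]
          congr 1
          push_cast
          rw [hkR]
          ring
  have hinvT : (T - t₀)⁻¹ ≤ 2 * Real.exp (-(q : ℝ) ^ 8) := by
    have h1 : (T - t₀)⁻¹ ≤ 2 * T⁻¹ := by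
      rw [← div_eq_mul_inv, inv_eq_one_div, div_le_div_iff₀ (by linarith) hT0]
      linarith
    rw [Real.exp_neg]
    exact h1.trans (by gcongr)
  have hS2 : ∑ n : Fin N, ‖innerCoeff lam α σ w n‖ ^ 2 ≤ Real.pi ^ 2 * q ^ 2 * B := by
    calc _ ≤ ∑ n : Fin N, Real.pi ^ 2 * q ^ 2 * baseBound α a b n ^ 2 := by
          refine Finset.sum_le_sum fun n _ => ?_
          rw [norm_innerCoeff hα0, mul_pow, mul_pow]
          have := hr2 σ hσ1 hσ2 n
          gcongr
      _ ≤ _ := by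
          rw [← Finset.mul_sum, ← Finset.sum_range (fun n => baseBound α a b n ^ 2)]
          gcongr
          exact hs.sum_le_tsum _ fun _ _ => sq_nonneg _
  have ht1 : 3 * (1 + 2 * ∑ n : Fin N, ‖innerCoeff lam α σ w n‖) ^ (2 * k) * (2 / (δ * (T - t₀))) ≤
      12 * Real.exp (-q) := by
    have e : (2 : ℝ) / (δ * (T - t₀)) = 2 * (δ⁻¹ * (T - t₀)⁻¹) := by
      rw [div_eq_mul_inv, mul_inv]
    have hTt : 0 < T - t₀ := by linarith
    rw [e]
    calc _ ≤ 3 * Real.exp (3 * q) ^ (2 * k) *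
          (2 * (Real.exp (4 * Ω * (q : ℝ) ^ 7) * (2 * Real.exp (-(q : ℝ) ^ 8)))) := by gcongr
      _ = 12 * Real.exp (6 * (q : ℝ) ^ 4 + 4 * Ω * (q : ℝ) ^ 7 + -(q : ℝ) ^ 8) := by
          rw [← Real.exp_nat_mul, Real.exp_add, Real.exp_add]
          push_cast
          rw [hkR, show 2 * (q : ℝ) ^ 3 * (3 * q) = 6 * (q : ℝ) ^ 4 by ring]
          ring
      _ ≤ _ := by
          gcongr
          have i1 : (q : ℝ) ^ 4 ≤ (q : ℝ) ^ 7 := pow_le_pow_right₀ hq1 (by norm_num)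
          have i2 : (q : ℝ) ≤ (q : ℝ) ^ 7 := le_self_pow₀ hq1 (by norm_num)
          have i3 : (7 + 4 * Ω) * (q : ℝ) ^ 7 ≤ q * (q : ℝ) ^ 7 :=
            mul_le_mul_of_nonneg_right (by linarith) (by positivity)
          have i4 : (q : ℝ) ^ 8 = q * (q : ℝ) ^ 7 := by ring
          linarith
  have ht2 : 4 * ((Real.exp 1 ^ (2 * k))⁻¹ *
      Real.exp (Real.exp 1 ^ 2 * ∑ n : Fin N, ‖innerCoeff lam α σ w n‖ ^ 2)) ≤ 4 * Real.exp (-q) := by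
    have e1 : Real.exp 1 ^ 2 = Real.exp 2 := by rw [← Real.exp_nat_mul]; norm_num
    have e2 : (Real.exp 1 ^ (2 * k))⁻¹ = Real.exp (-(2 * (q : ℝ) ^ 3)) := by
      rw [← Real.exp_nat_mul, ← Real.exp_neg]; push_cast; rw [hkR, mul_one]
    rw [e1, e2, ← Real.exp_add]
    have i1 : Real.exp 2 * ∑ n : Fin N, ‖innerCoeff lam α σ w n‖ ^ 2 ≤ (q : ℝ) ^ 3 := by
      calc _ ≤ Real.exp 2 * (Real.pi ^ 2 * q ^ 2 * B) := by gcongr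
        _ = (Real.exp 2 * Real.pi ^ 2 * B) * q ^ 2 := by ring
        _ ≤ q * q ^ 2 := by gcongr; linarith
        _ = _ := by ring
    have i2 : (q : ℝ) ≤ (q : ℝ) ^ 3 := le_self_pow₀ hq1 (by norm_num)
    gcongr
    linarith
  linarith

/-- The values of the Lerch zeta-function on a vertical line are asymptotically distributed
according to the limit law, quantitatively in terms of characteristic functions. -/
theorem exists_norm_integral_phase_sub_mgf_le {α : ℝ} (hα : α ∈ admissibleSet) (lam : ℝ) {a b : ℝ}
    (ha : 1 / 2 < a) (hab : a ≤ b) {t₀ : ℝ} (ht₀ : 1 ≤ t₀) :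
    ∃ C, 0 < C ∧ ∃ q₀ : ℕ, ∀ q : ℕ, q₀ ≤ q → ∀ T, Real.exp ((q : ℝ) ^ 8) ≤ T →
      T ≤ Real.exp ((q : ℝ) ^ 9) → ∀ σ, a ≤ σ → σ ≤ b → ∀ w : ℂ, ‖w‖ ≤ q →
      ‖∫ t, phase (-2 * Real.pi * inner ℝ (lerchZeta lam α (σ + t * Complex.I)) w)
        ∂(timeMeasure t₀ T) - mgf α σ (kap 0 w)‖ ≤ C * ((q : ℝ) ^ 4)⁻¹ := by
  have hα0 := hα.1.1
  have hα1 := hα.1.2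
  obtain ⟨C₁, hC₁, h₁⟩ := exists_integral_norm_sub_le hα0 hα1 lam ha hab ht₀
  obtain ⟨q₁, h₂⟩ := exists_norm_integral_phase_sub_mgfPartial_le hα lam ha hab ht₀
  obtain ⟨q₂, hq₂⟩ := exists_nat_ge (1 + 2 * t₀)
  set c := Real.log 2 * (2 * a - 1) with hc
  have hc0 : 0 < c := mul_pos (Real.log_pos one_lt_two) (by linarith)
  set D := 12 * Real.pi ^ 2 * (1 + (2 * a - 1)⁻¹) with hD
  have hD0 : 0 < D := by
    have : 0 < (2 * a - 1)⁻¹ := inv_pos.2 (by linarith)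
    positivity
  refine ⟨2 * Real.pi * C₁ + 16 * 24 + D * (Nat.factorial 6 / c ^ 6), by positivity, max q₁ q₂,
    fun q hq T hT1 hT2 σ hσ1 hσ2 w hw => ?_⟩
  have hq2 : (q₂ : ℝ) ≤ q := by exact_mod_cast (le_max_right _ _).trans hq
  have hq1 : (1 : ℝ) ≤ q := by linarith
  have hqe : Real.exp q ≤ T := (Real.exp_le_exp.2 (le_self_pow₀ hq1 (by norm_num))).trans hT1
  have hqT : (q : ℝ) ≤ T := by linarith [Real.add_one_le_exp (q : ℝ)]
  have htT : t₀ < T := by linarith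
  have hpr := isProbabilityMeasure_timeMeasure htT
  have hA := h₁ q (by exact_mod_cast hq1) (by linarith) T hT1 hT2 σ hσ1 hσ2
  have hB := h₂ q ((le_max_left _ _).trans hq) T hT1 σ hσ1 hσ2 w hw
  have hCc := norm_mgfPartial_sub_mgf_le hα0 ha hσ1 w (N := 2 ^ q) Nat.one_le_two_pow
  have hcL : ContinuousOn (fun t : ℝ => lerchZeta lam α (σ + t * Complex.I)) (uIcc t₀ T) :=
    (continuousOn_lerchZeta_line hα0 hα1 lam (by linarith)).mono (uIcc_subset_Ioi_zero ht₀ htT.le)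
  have hcP := (continuous_lerchPartialSum_line hα0 lam σ (2 ^ q)).continuousOn (s := uIcc t₀ T)
  have hiL : Integrable (fun t : ℝ => phase (-2 * Real.pi *
      inner ℝ (lerchZeta lam α (σ + t * Complex.I)) w)) (timeMeasure t₀ T) :=
    integrable_timeMeasure htT (continuous_phase.comp_continuousOn
      (continuousOn_const.mul (hcL.inner continuousOn_const))).intervalIntegrable
  have hiP : Integrable (fun t : ℝ => phase (-2 * Real.pi *
      inner ℝ (lerchPartialSum lam α (σ + t * Complex.I) (2 ^ q)) w)) (timeMeasure t₀ T) :=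
    integrable_timeMeasure htT (continuous_phase.comp_continuousOn
      (continuousOn_const.mul (hcP.inner continuousOn_const))).intervalIntegrable
  -- The phase has Lipschitz constant 2π‖w‖ ≤ 2πq in the value, which turns the mean error of order
  -- q^(-5) into q^(-4). The other two errors are exponentially small in `q`, up to powers of `q`.
  have hA' : ‖∫ t, phase (-2 * Real.pi * inner ℝ (lerchZeta lam α (σ + t * Complex.I)) w)
        ∂(timeMeasure t₀ T) - ∫ t, phase (-2 * Real.pi *
      inner ℝ (lerchPartialSum lam α (σ + t * Complex.I) (2 ^ q)) w) ∂(timeMeasure t₀ T)‖ ≤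
      2 * Real.pi * C₁ * ((q : ℝ) ^ 4)⁻¹ := by
    rw [← integral_sub hiL hiP]
    have hin : Integrable (fun t : ℝ => ‖lerchZeta lam α (σ + t * Complex.I) -
        lerchPartialSum lam α (σ + t * Complex.I) (2 ^ q)‖) (timeMeasure t₀ T) :=
      integrable_timeMeasure htT (hcL.sub hcP).norm.intervalIntegrable
    refine (norm_integral_le_of_norm_le (hin.const_mul (2 * Real.pi * ‖w‖))
      (Eventually.of_forall fun t => norm_phase_inner_sub_le _ _ _)).trans ?_
    rw [integral_const_mul]
    calc _ ≤ 2 * Real.pi * q * (C₁ * ((q : ℝ) ^ 5)⁻¹) := by gcongr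
      _ = _ := by field_simp
  have hB' : 16 * Real.exp (-q) ≤ 16 * 24 * ((q : ℝ) ^ 4)⁻¹ := by
    have := pow_mul_exp_neg_le one_pos (by linarith : (0 : ℝ) ≤ q) 4
    rw [one_mul, one_pow, div_one] at this
    norm_num [Nat.factorial] at this
    rw [mul_assoc, ← div_eq_mul_inv]
    have h4 : Real.exp (-q) ≤ 24 / (q : ℝ) ^ 4 := by
      rw [le_div_iff₀ (by positivity)]; linarith
    gcongr
  have hC' : D * (‖w‖ ^ 2 * (((2 ^ q : ℕ) : ℝ)) ^ (1 - 2 * a)) ≤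
      D * (Nat.factorial 6 / c ^ 6) * ((q : ℝ) ^ 4)⁻¹ := by
    have hX : (((2 ^ q : ℕ) : ℝ)) ^ (1 - 2 * a) = Real.exp (-(c * q)) := by
      rw [two_pow_rpow, hc]; congr 1; ring
    have := pow_mul_exp_neg_le hc0 (by linarith : (0 : ℝ) ≤ q) 6
    rw [hX, mul_assoc D]
    have h5 : ‖w‖ ^ 2 * Real.exp (-(c * q)) ≤ (Nat.factorial 6 / c ^ 6) * ((q : ℝ) ^ 4)⁻¹ := by
      calc _ ≤ (q : ℝ) ^ 2 * Real.exp (-(c * q)) := by gcongr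
        _ = ((q : ℝ) ^ 6 * Real.exp (-(c * q))) * ((q : ℝ) ^ 4)⁻¹ := by field_simp
        _ ≤ _ := by gcongr
    exact mul_le_mul_of_nonneg_left h5 hD0.le
  have htri := norm_sub_le_norm_sub_add_norm_sub
    (∫ t, phase (-2 * Real.pi * inner ℝ (lerchZeta lam α (σ + t * Complex.I)) w) ∂(timeMeasure t₀ T))
    (∫ t, phase (-2 * Real.pi *
      inner ℝ (lerchPartialSum lam α (σ + t * Complex.I) (2 ^ q)) w) ∂(timeMeasure t₀ T))
    (mgf α σ (kap 0 w))
  have htri2 := norm_sub_le_norm_sub_add_norm_sub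
    (∫ t, phase (-2 * Real.pi *
      inner ℝ (lerchPartialSum lam α (σ + t * Complex.I) (2 ^ q)) w) ∂(timeMeasure t₀ T))
    (mgfPartial α (2 ^ q) σ (kap 0 w)) (mgf α σ (kap 0 w))
  rw [add_mul, add_mul]
  linarith

/-! ### From nearby Fourier transforms to nearby means of log |z|. -/

theorem norm_gaussian (b : ℝ) (w : ℂ) :
    ‖Complex.exp (-(b : ℂ) * ‖w‖ ^ 2)‖ = Real.exp (-b * ‖w‖ ^ 2) := by
  rw [Complex.norm_exp]
  congr 1
  rw [← Complex.ofReal_pow, ← Complex.ofReal_neg, ← Complex.ofReal_mul, Complex.ofReal_re]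

theorem integrable_exp_neg_mul_sq_norm {b : ℝ} (hb : 0 < b) :
    Integrable fun w : ℂ => Real.exp (-b * ‖w‖ ^ 2) := by
  simpa only [norm_gaussian] using (integrable_gaussian_complex hb).norm

theorem integral_exp_neg_mul_sq_norm {b : ℝ} (hb : 0 < b) :
    ∫ w : ℂ, Real.exp (-b * ‖w‖ ^ 2) = Real.pi / b := by
  have h2 := integral_gaussian_phase hb 0 0
  simp only [inner_zero_left, mul_zero, sub_zero, Complex.ofReal_zero, zero_mul, Complex.exp_zero, mul_one,
    norm_zero, ne_eq, OfNat.ofNat_ne_zero, not_false_eq_true, zero_pow, Real.exp_zero] at h2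
  apply Complex.ofReal_injective
  rw [← h2, ← integral_complex_ofReal]
  refine integral_congr_ae (Eventually.of_forall fun w => ?_)
  simp only
  push_cast
  rfl

/-- A Gaussian is itself a Fourier transform, so its mean is an integral of `measFT ν` against a
Gaussian concentrated on ‖w‖ of order √u. -/
theorem integral_gaussian_eq {ν : Measure ℂ} [IsFiniteMeasure ν] {u : ℝ} (hu : 0 < u) :
    ((∫ z, Real.exp (-u * ‖z‖ ^ 2) ∂ν : ℝ) : ℂ) =
      ((Real.pi / u : ℝ) : ℂ) * ∫ w : ℂ, Complex.exp (-((Real.pi ^ 2 / u : ℝ) : ℂ) * ‖w‖ ^ 2) * measFT ν w := by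
  have hπ := Real.pi_pos
  have h := integral_gaussian_mul_measFT (ν := ν) (b := Real.pi ^ 2 / u) (by positivity) 0
  simp only [inner_zero_left, mul_zero, Complex.ofReal_zero, zero_mul, Complex.exp_zero, one_mul,
    sub_zero] at h
  rw [h, integral_const_mul, ← Complex.ofReal_mul]
  congr 1
  rw [show Real.pi ^ 2 / (Real.pi ^ 2 / u) = u by field_simp, ← mul_assoc,
    show Real.pi / u * (Real.pi / (Real.pi ^ 2 / u)) = 1 by field_simp, one_mul]

/-- Gaussian averages of two measures with nearby Fourier transforms. -/
theorem abs_integral_gaussian_sub_le {μ ν : Measure ℂ} [IsProbabilityMeasure μ] [IsProbabilityMeasure ν]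
    {ε q : ℝ} (hε : 0 ≤ ε) (hq : 0 < q) (h : ∀ w : ℂ, ‖w‖ ≤ q → ‖measFT μ w - measFT ν w‖ ≤ ε)
    {u : ℝ} (hu : 0 < u) :
    |∫ z, Real.exp (-u * ‖z‖ ^ 2) ∂μ - ∫ z, Real.exp (-u * ‖z‖ ^ 2) ∂ν| ≤ ε + u / q ^ 2 := by
  have hπ := Real.pi_pos
  set b := Real.pi ^ 2 / u with hb
  have hb0 : 0 < b := by positivity
  have hle : ∀ ρ : Measure ℂ, IsProbabilityMeasure ρ → ∀ w, ‖measFT ρ w‖ ≤ 1 := fun ρ _ w => by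
    simpa using norm_measFT_le ρ w
  have hi : ∀ ρ : Measure ℂ, IsProbabilityMeasure ρ →
      Integrable (fun w : ℂ => Complex.exp (-(b : ℂ) * ‖w‖ ^ 2) * measFT ρ w) := fun ρ hρ => by
    refine (integrable_gaussian_complex hb0).mul_bdd (c := 1)
      (continuous_measFT ρ).aestronglyMeasurable (Eventually.of_forall fun w => hle ρ hρ w)
  -- Beyond ‖w‖ = q only the trivial bound 2 for the difference is available. Half of the Gaussian
  -- decay produces the small factor and the other half is kept for integrability.
  set τ := 2 * Real.exp (-(b * q ^ 2) / 2) with hτ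
  have hpt : ∀ w : ℂ, ‖Complex.exp (-(b : ℂ) * ‖w‖ ^ 2) * measFT μ w -
      Complex.exp (-(b : ℂ) * ‖w‖ ^ 2) * measFT ν w‖ ≤
      ε * Real.exp (-b * ‖w‖ ^ 2) + τ * Real.exp (-(b / 2) * ‖w‖ ^ 2) := by
    intro w
    rw [← mul_sub, norm_mul, norm_gaussian]
    have he1 := Real.exp_pos (-b * ‖w‖ ^ 2)
    have he2 := Real.exp_pos (-(b / 2) * ‖w‖ ^ 2)
    have hτ0 : 0 < τ := by positivity
    rcases le_or_gt ‖w‖ q with hw | hw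
    · have := h w hw
      nlinarith [mul_pos hτ0 he2]
    · have h1 : ‖measFT μ w - measFT ν w‖ ≤ 2 := by
        refine (norm_sub_le _ _).trans ?_
        linarith [hle μ inferInstance w, hle ν inferInstance w]
      have h2 : Real.exp (-b * ‖w‖ ^ 2) ≤ Real.exp (-(b * q ^ 2) / 2) * Real.exp (-(b / 2) * ‖w‖ ^ 2) := by
        rw [← Real.exp_add]
        refine Real.exp_le_exp.2 ?_
        have : b * q ^ 2 ≤ b * ‖w‖ ^ 2 := by gcongr
        linarith
      calc _ ≤ (Real.exp (-(b * q ^ 2) / 2) * Real.exp (-(b / 2) * ‖w‖ ^ 2)) * 2 := by gcongr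
        _ = τ * Real.exp (-(b / 2) * ‖w‖ ^ 2) := by rw [hτ]; ring
        _ ≤ _ := by nlinarith
  rw [← Real.norm_eq_abs, ← Complex.norm_real, Complex.ofReal_sub, integral_gaussian_eq hu,
    integral_gaussian_eq hu, ← mul_sub, ← hb, ← integral_sub (hi μ inferInstance) (hi ν inferInstance),
    norm_mul, Complex.norm_real, Real.norm_of_nonneg (by positivity)]
  have h3 := norm_integral_le_of_norm_le (((integrable_exp_neg_mul_sq_norm hb0).const_mul ε).add
    ((integrable_exp_neg_mul_sq_norm (half_pos hb0)).const_mul τ)) (Eventually.of_forall hpt)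
  simp only [Pi.add_apply] at h3
  rw [integral_add ((integrable_exp_neg_mul_sq_norm hb0).const_mul ε)
    ((integrable_exp_neg_mul_sq_norm (half_pos hb0)).const_mul τ), integral_const_mul, integral_const_mul,
    integral_exp_neg_mul_sq_norm hb0, integral_exp_neg_mul_sq_norm (half_pos hb0)] at h3
  have h4 : τ ≤ 4 / (b * q ^ 2) := by
    have h5 := Real.add_one_le_exp (b * q ^ 2 / 2)
    have h6 : 0 < b * q ^ 2 := by positivity
    rw [hτ, neg_div, Real.exp_neg, ← div_eq_mul_inv, div_le_div_iff₀ (Real.exp_pos _) h6]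
    linarith
  have h7 : Real.pi / u * (Real.pi / b) = 1 := by rw [hb]; field_simp
  have h8 : Real.pi / u * (Real.pi / (b / 2)) = 2 := by rw [hb]; field_simp
  calc _ ≤ Real.pi / u * (ε * (Real.pi / b) + τ * (Real.pi / (b / 2))) := by gcongr
    _ = ε * (Real.pi / u * (Real.pi / b)) + τ * (Real.pi / u * (Real.pi / (b / 2))) := by ring
    _ ≤ ε * 1 + 4 / (b * q ^ 2) * 2 := by rw [h7, h8]; gcongr
    _ = ε + 8 / Real.pi ^ 2 * (u / q ^ 2) := by rw [hb]; field_simp; ring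
    _ ≤ _ := by
      have : 8 / Real.pi ^ 2 ≤ 1 := by
        rw [div_le_one (by positivity)]; nlinarith [Real.pi_gt_three]
      have : 0 < u / q ^ 2 := by positivity
      nlinarith

theorem integrable_exp_neg_mul_sq {μ : Measure ℂ} [IsFiniteMeasure μ] {u : ℝ} (hu : 0 ≤ u) :
    Integrable (fun z : ℂ => Real.exp (-u * ‖z‖ ^ 2)) μ := by
  refine Integrable.of_bound (Continuous.aestronglyMeasurable (by fun_prop)) 1
    (Eventually.of_forall fun z => ?_)
  rw [Real.norm_of_nonneg (Real.exp_pos _).le, Real.exp_le_one_iff]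
  have : 0 ≤ u * ‖z‖ ^ 2 := by positivity
  linarith

theorem integral_exp_neg_mul_Ioi {y : ℝ} (hy : 0 < y) :
    ∫ v in Ioi (0 : ℝ), Real.exp (-y * v) = y⁻¹ := by
  rw [integral_exp_mul_Ioi (by linarith)]
  simp [neg_div_neg_eq]

theorem integrable_exp_add {μ : Measure ℂ} [IsFiniteMeasure μ] {x : ℝ} (hx : 0 < x) :
    Integrable (Function.uncurry fun (z : ℂ) (v : ℝ) => Real.exp (-x * v) * Real.exp (-v * ‖z‖ ^ 2))
      (μ.prod (volume.restrict (Ioi 0))) := by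
  have h0 : Integrable (fun p : ℂ × ℝ => (1 : ℝ) * Real.exp (-x * p.2))
      (μ.prod (volume.restrict (Ioi 0))) :=
    (integrable_const (1 : ℝ)).mul_prod (exp_neg_integrableOn_Ioi 0 hx)
  have hae : ∀ᵐ p ∂(μ.prod (volume.restrict (Ioi (0 : ℝ)))), 0 < p.2 := by
    have := (ae_restrict_mem (μ := (volume : Measure ℝ)) measurableSet_Ioi (s := Ioi (0 : ℝ)))
    exact Measure.quasiMeasurePreserving_snd.ae this
  refine h0.mono' (Continuous.aestronglyMeasurable (by unfold Function.uncurry; fun_prop)) ?_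
  filter_upwards [hae] with p hp
  rw [Function.uncurry, Real.norm_of_nonneg (by positivity), one_mul]
  refine mul_le_of_le_one_right (Real.exp_pos _).le ?_
  rw [Real.exp_le_one_iff]
  have : 0 ≤ p.2 * ‖p.1‖ ^ 2 := by positivity
  linarith

/-- The Laplace integral of exp (-(‖z‖² + x)v) over v > 0 exhibits the integrand as a superposition
of Gaussians. -/
theorem integral_inv_add_eq {μ : Measure ℂ} [IsFiniteMeasure μ] {x : ℝ} (hx : 0 < x) :
    ∫ z, (‖z‖ ^ 2 + x)⁻¹ ∂μ =
      ∫ v in Ioi (0 : ℝ), Real.exp (-x * v) * ∫ z, Real.exp (-v * ‖z‖ ^ 2) ∂μ := by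
  have h := integral_integral_swap (integrable_exp_add (μ := μ) hx)
  simp only [integral_const_mul] at h
  rw [← h]
  refine integral_congr_ae (Eventually.of_forall fun z => ?_)
  simp only
  have hz : 0 < ‖z‖ ^ 2 + x := by positivity
  rw [← integral_exp_neg_mul_Ioi hz]
  refine integral_congr_ae (Eventually.of_forall fun v => ?_)
  simp only
  rw [← Real.exp_add]
  congr 1
  ring

/-- The Gaussian error ε + v/q² is integrated against exp (-xv); half of that exponential is spent
on the linear growth in `v`. -/
theorem abs_integral_inv_sub_le {μ ν : Measure ℂ} [IsProbabilityMeasure μ] [IsProbabilityMeasure ν]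
    {ε q : ℝ} (hε : 0 ≤ ε) (hq : 0 < q) (h : ∀ w : ℂ, ‖w‖ ≤ q → ‖measFT μ w - measFT ν w‖ ≤ ε)
    {x : ℝ} (hx : 0 < x) :
    |∫ z, (‖z‖ ^ 2 + x)⁻¹ ∂μ - ∫ z, (‖z‖ ^ 2 + x)⁻¹ ∂ν| ≤ ε / x + 4 / (q ^ 2 * x ^ 2) := by
  have hi : ∀ ρ : Measure ℂ, IsProbabilityMeasure ρ → IntegrableOn (fun v : ℝ =>
      Real.exp (-x * v) * ∫ z, Real.exp (-v * ‖z‖ ^ 2) ∂ρ) (Ioi 0) := by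
    intro ρ hρ
    have := (integrable_exp_add (μ := ρ) hx).integral_prod_right
    simp only [Function.uncurry, integral_const_mul] at this
    exact this
  rw [integral_inv_add_eq hx, integral_inv_add_eq hx,
    ← integral_sub (hi μ inferInstance) (hi ν inferInstance), ← Real.norm_eq_abs]
  have h1 : IntegrableOn (fun v : ℝ => ε * Real.exp (-x * v)) (Ioi 0) :=
    (exp_neg_integrableOn_Ioi 0 hx).const_mul ε
  have h2 : IntegrableOn (fun v : ℝ => 2 / (q ^ 2 * x) * Real.exp (-(x / 2) * v)) (Ioi 0) :=
    (exp_neg_integrableOn_Ioi 0 (half_pos hx)).const_mul _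
  have h3 := norm_integral_le_of_norm_le (h1.add h2) (f := fun v : ℝ =>
    Real.exp (-x * v) * ∫ z, Real.exp (-v * ‖z‖ ^ 2) ∂μ -
      Real.exp (-x * v) * ∫ z, Real.exp (-v * ‖z‖ ^ 2) ∂ν) ?_
  · simp only [Pi.add_apply] at h3
    rw [integral_add h1 h2, integral_const_mul, integral_const_mul, integral_exp_neg_mul_Ioi hx,
      integral_exp_neg_mul_Ioi (half_pos hx)] at h3
    refine h3.trans (le_of_eq ?_)
    field_simp
    ring
  · filter_upwards [ae_restrict_mem measurableSet_Ioi] with v hv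
    have hv : 0 < v := hv
    have h4 := abs_integral_gaussian_sub_le hε hq h hv
    rw [← mul_sub, norm_mul, Real.norm_of_nonneg (Real.exp_pos _).le, Real.norm_eq_abs, Pi.add_apply]
    have h5 : Real.exp (-x * v) = Real.exp (-(x / 2) * v) * Real.exp (-(x / 2) * v) := by
      rw [← Real.exp_add]; congr 1; ring
    have h6 : v * Real.exp (-(x / 2) * v) ≤ 2 / x := by
      have := Real.add_one_le_exp (x / 2 * v)
      rw [neg_mul, Real.exp_neg, ← div_eq_mul_inv, div_le_div_iff₀ (Real.exp_pos _) hx]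
      linarith
    calc _ ≤ Real.exp (-x * v) * (ε + v / q ^ 2) := by gcongr
      _ = ε * Real.exp (-x * v) + (v * Real.exp (-(x / 2) * v)) / q ^ 2 * Real.exp (-(x / 2) * v) := by
          rw [mul_add, h5]; ring
      _ ≤ ε * Real.exp (-x * v) + (2 / x) / q ^ 2 * Real.exp (-(x / 2) * v) := by gcongr
      _ = _ := by congr 2; field_simp

theorem half_log_add_le {y x : ℝ} (hy : 0 ≤ y) (hx : 0 < x) :
    1 / 2 * Real.log x ≤ 1 / 2 * Real.log (y + x) ∧
      1 / 2 * Real.log (y + x) ≤ 1 / 2 * Real.log x + y / (2 * x) := by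
  have h1 : Real.log x ≤ Real.log (y + x) := Real.log_le_log hx (by linarith)
  have h2 := Real.log_le_sub_one_of_pos (by positivity : 0 < (y + x) / x)
  rw [Real.log_div (by positivity) hx.ne'] at h2
  have h3 : (y + x) / x - 1 = y / x := by field_simp; ring
  have h4 : y / (2 * x) = 1 / 2 * (y / x) := by field_simp
  constructor <;> linarith

theorem integrable_half_log {μ : Measure ℂ} [IsFiniteMeasure μ] (hμ : Integrable (fun z : ℂ => ‖z‖ ^ 2) μ)
    {x : ℝ} (hx : 0 < x) : Integrable (fun z : ℂ => 1 / 2 * Real.log (‖z‖ ^ 2 + x)) μ := by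
  refine ((integrable_const |1 / 2 * Real.log x|).add (hμ.div_const (2 * x))).mono'
    (Measurable.aestronglyMeasurable (by fun_prop)) (Eventually.of_forall fun z => ?_)
  obtain ⟨h1, h2⟩ := half_log_add_le (sq_nonneg ‖z‖) hx
  have h3 : 0 ≤ ‖z‖ ^ 2 / (2 * x) := by positivity
  rw [Real.norm_eq_abs, Pi.add_apply, abs_le]
  constructor
  · linarith [neg_abs_le (1 / 2 * Real.log x)]
  · linarith [le_abs_self (1 / 2 * Real.log x)]

theorem hasDerivAt_integral_half_log {μ : Measure ℂ} [IsFiniteMeasure μ]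
    (hμ : Integrable (fun z : ℂ => ‖z‖ ^ 2) μ) {x : ℝ} (hx : 0 < x) :
    HasDerivAt (fun x => ∫ z, 1 / 2 * Real.log (‖z‖ ^ 2 + x) ∂μ)
      (1 / 2 * ∫ z, (‖z‖ ^ 2 + x)⁻¹ ∂μ) x := by
  rw [← integral_const_mul]
  refine (hasDerivAt_integral_of_dominated_loc_of_deriv_le (bound := fun _ => (x)⁻¹) (μ := μ)
    (F := fun x z => 1 / 2 * Real.log (‖z‖ ^ 2 + x)) (F' := fun x z => 1 / 2 * (‖z‖ ^ 2 + x)⁻¹)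
    (Ioi_mem_nhds (half_lt_self hx)) ?_ (integrable_half_log hμ hx)
    (Measurable.aestronglyMeasurable (by fun_prop)) ?_ (integrable_const _) ?_).2
  · exact Eventually.of_forall fun _ => Measurable.aestronglyMeasurable (by fun_prop)
  · refine Eventually.of_forall fun z τ hτ => ?_
    have hτ : x / 2 < τ := hτ
    have h0 : 0 ≤ ‖z‖ ^ 2 := by positivity
    rw [Real.norm_of_nonneg (by have : 0 < ‖z‖ ^ 2 + τ := by linarith
                                positivity)]
    have : (‖z‖ ^ 2 + τ)⁻¹ ≤ (x / 2)⁻¹ := inv_anti₀ (by positivity) (by linarith)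
    rw [inv_div] at this
    have h2 : 1 / 2 * (2 / x) = x⁻¹ := by field_simp
    linarith
  · refine Eventually.of_forall fun z τ hτ => ?_
    have hτ : x / 2 < τ := hτ
    have h0 : 0 < ‖z‖ ^ 2 + τ := by have := sq_nonneg ‖z‖; linarith
    have := (((hasDerivAt_id τ).const_add (‖z‖ ^ 2)).log h0.ne').const_mul (1 / 2)
    rwa [one_div (_ + _)] at this

/-- Averages of `log (|z|² + D)` under two measures with nearby Fourier transforms. -/
theorem abs_integral_half_log_sub_le {μ ν : Measure ℂ} [IsProbabilityMeasure μ] [IsProbabilityMeasure ν]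
    {ε q K : ℝ} (hε : 0 ≤ ε) (hq : 0 < q) (h : ∀ w : ℂ, ‖w‖ ≤ q → ‖measFT μ w - measFT ν w‖ ≤ ε)
    (hμ : Integrable (fun z : ℂ => ‖z‖ ^ 2) μ) (hν : Integrable (fun z : ℂ => ‖z‖ ^ 2) ν)
    (hμK : ∫ z, ‖z‖ ^ 2 ∂μ ≤ K) (hνK : ∫ z, ‖z‖ ^ 2 ∂ν ≤ K) {D W : ℝ} (hD : 0 < D) (hDW : D ≤ W) :
    |∫ z, 1 / 2 * Real.log (‖z‖ ^ 2 + D) ∂μ - ∫ z, 1 / 2 * Real.log (‖z‖ ^ 2 + D) ∂ν| ≤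
      K / W + W * (ε / D + 4 / (q ^ 2 * D ^ 2)) := by
  have hW : 0 < W := hD.trans_le hDW
  -- Φ is followed from `D` to a large `W`. Its derivative is half the difference of the means of
  -- 1/(‖z‖² + x). At `W` the second moments suffice, because the logarithm is log W up to ‖z‖²/W.
  set Φ : ℝ → ℝ := fun x => ∫ z, 1 / 2 * Real.log (‖z‖ ^ 2 + x) ∂μ -
    ∫ z, 1 / 2 * Real.log (‖z‖ ^ 2 + x) ∂ν with hΦ
  have hd : ∀ x ∈ Icc D W, HasDerivWithinAt Φ (1 / 2 * ∫ z, (‖z‖ ^ 2 + x)⁻¹ ∂μ -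
      1 / 2 * ∫ z, (‖z‖ ^ 2 + x)⁻¹ ∂ν) (Icc D W) x := fun x hx =>
    ((hasDerivAt_integral_half_log hμ (hD.trans_le hx.1)).sub
      (hasDerivAt_integral_half_log hν (hD.trans_le hx.1))).hasDerivWithinAt
  have hb : ∀ x ∈ Icc D W, ‖1 / 2 * ∫ z, (‖z‖ ^ 2 + x)⁻¹ ∂μ - 1 / 2 * ∫ z, (‖z‖ ^ 2 + x)⁻¹ ∂ν‖ ≤
      ε / D + 4 / (q ^ 2 * D ^ 2) := by
    intro x hx
    have hx0 := hD.trans_le hx.1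
    have h1 := abs_integral_inv_sub_le hε hq h hx0
    rw [← mul_sub, norm_mul, Real.norm_of_nonneg (by norm_num), Real.norm_eq_abs]
    have h2 : ε / x + 4 / (q ^ 2 * x ^ 2) ≤ ε / D + 4 / (q ^ 2 * D ^ 2) := by
      have := hx.1
      gcongr
    have h3 := abs_nonneg (∫ z, (‖z‖ ^ 2 + x)⁻¹ ∂μ - ∫ z, (‖z‖ ^ 2 + x)⁻¹ ∂ν)
    linarith
  have h1 := (convex_Icc D W).norm_image_sub_le_of_norm_hasDerivWithin_le hd hb
    (right_mem_Icc.2 hDW) (left_mem_Icc.2 hDW)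
  have hE : 0 ≤ ε / D + 4 / (q ^ 2 * D ^ 2) := by positivity
  rw [Real.norm_eq_abs, Real.norm_eq_abs, abs_sub_comm D W, abs_of_nonneg (by linarith : 0 ≤ W - D)] at h1
  have hW1 : ∀ ρ : Measure ℂ, IsProbabilityMeasure ρ → Integrable (fun z : ℂ => ‖z‖ ^ 2) ρ →
      ∫ z, ‖z‖ ^ 2 ∂ρ ≤ K → 1 / 2 * Real.log W ≤ ∫ z, 1 / 2 * Real.log (‖z‖ ^ 2 + W) ∂ρ ∧
        ∫ z, 1 / 2 * Real.log (‖z‖ ^ 2 + W) ∂ρ ≤ 1 / 2 * Real.log W + K / W := by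
    intro ρ _ hρ hK
    have hK0 : 0 ≤ K := (integral_nonneg fun z => by positivity).trans hK
    constructor
    · have := integral_mono (integrable_const (1 / 2 * Real.log W)) (integrable_half_log hρ hW)
        fun z => (half_log_add_le (sq_nonneg ‖z‖) hW).1
      simpa using this
    · have h5 := integral_mono (integrable_half_log hρ hW)
        ((integrable_const (1 / 2 * Real.log W)).add (hρ.div_const (2 * W)))
        fun z => (half_log_add_le (sq_nonneg ‖z‖) hW).2
      simp only [Pi.add_apply] at h5
      rw [integral_add (integrable_const _) (hρ.div_const _), integral_const, probReal_univ, one_smul,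
        integral_div] at h5
      have h6 : (∫ z, ‖z‖ ^ 2 ∂ρ) / (2 * W) ≤ K / (2 * W) := by gcongr
      have h7 : K / (2 * W) ≤ K / W := by gcongr; linarith
      linarith
  obtain ⟨a1, a2⟩ := hW1 μ inferInstance hμ hμK
  obtain ⟨b1, b2⟩ := hW1 ν inferInstance hν hνK
  have h2 : |Φ W| ≤ K / W := by
    simp only [hΦ]
    rw [abs_le]
    constructor <;> linarith
  have h3 : |Φ D| ≤ |Φ W| + |Φ D - Φ W| := by
    have := abs_add_le (Φ W) (Φ D - Φ W)
    rwa [add_sub_cancel] at this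
  have h4 : (ε / D + 4 / (q ^ 2 * D ^ 2)) * (W - D) ≤ W * (ε / D + 4 / (q ^ 2 * D ^ 2)) := by
    nlinarith
  change |Φ D| ≤ _
  linarith

/-- On the set in question the Gaussian is at least 1/e, and e < 3. This makes the mass of a small
disc accessible to the comparison of Fourier transforms. -/
theorem measureReal_small_le {μ : Measure ℂ} [IsProbabilityMeasure μ] {d : ℝ} (hd : 0 < d) :
    μ.real {z : ℂ | ‖z‖ ^ 2 < d} ≤ 3 * ∫ z, Real.exp (-d⁻¹ * ‖z‖ ^ 2) ∂μ := by
  have hm : MeasurableSet {z : ℂ | ‖z‖ ^ 2 < d} := measurableSet_lt (by fun_prop) measurable_const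
  rw [← integral_indicator_one hm, ← integral_const_mul]
  refine integral_mono ((integrable_const (1 : ℝ)).indicator hm)
    ((integrable_exp_neg_mul_sq (by positivity)).const_mul 3) fun z => ?_
  by_cases hz : z ∈ {z : ℂ | ‖z‖ ^ 2 < d}
  · rw [indicator_of_mem hz]
    have hz : ‖z‖ ^ 2 < d := hz
    have h1 : -1 ≤ -d⁻¹ * ‖z‖ ^ 2 := by
      have : d⁻¹ * ‖z‖ ^ 2 ≤ d⁻¹ * d := by gcongr
      rw [inv_mul_cancel₀ hd.ne'] at this
      linarith
    have h2 := Real.exp_le_exp.2 h1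
    have h3 : 1 / 3 ≤ Real.exp (-1) := by
      rw [Real.exp_neg, one_div]
      exact inv_anti₀ (Real.exp_pos 1) Real.exp_one_lt_three.le
    change (1 : ℝ) ≤ 3 * Real.exp (-d⁻¹ * ‖z‖ ^ 2)
    linarith
  · rw [indicator_of_notMem hz]
    positivity

/-- For y² ≥ d the smoothing changes the logarithm by at most d. For y² < d the loss -log y is
split, by completing a square, into √d log² y and 1/√d. The latter is affordable because the
corresponding disc will have mass O(d). -/
theorem abs_half_log_sub_log_le {y d : ℝ} (hy : 0 < y) (hd : 0 < d) (hd2 : d ≤ 1 / 2) :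
    |1 / 2 * Real.log (y ^ 2 + d ^ 2) - Real.log y| ≤
      d + √d * Real.log y ^ 2 + (√d)⁻¹ * indicator {y : ℝ | y ^ 2 < d} 1 y := by
  have hsq := Real.sqrt_pos.2 hd
  have hlog : Real.log y = 1 / 2 * Real.log (y ^ 2) := by rw [Real.log_pow]; push_cast; ring
  obtain ⟨h1, h2⟩ := half_log_add_le (sq_nonneg d) (by positivity : 0 < y ^ 2)
  rw [add_comm, ← hlog] at h1
  rw [add_comm, ← hlog] at h2
  rw [abs_of_nonneg (by linarith)]
  have h3 : 0 ≤ √d * Real.log y ^ 2 := by positivity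
  by_cases hyd : y ^ 2 < d
  · rw [indicator_of_mem (show y ∈ {y : ℝ | y ^ 2 < d} from hyd)]
    simp only [Pi.one_apply, mul_one]
    have h4 : Real.log (y ^ 2 + d ^ 2) ≤ 0 := Real.log_nonpos (by positivity) (by nlinarith)
    have h5 : -Real.log y ≤ √d * Real.log y ^ 2 + (√d)⁻¹ := by
      have h6 : 0 ≤ (√d)⁻¹ * (√d * Real.log y + 1 / 2) ^ 2 := by positivity
      have h7 : (√d)⁻¹ * (√d * Real.log y + 1 / 2) ^ 2 =
          √d * Real.log y ^ 2 + Real.log y + (√d)⁻¹ / 4 := by field_simp; ring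
      have h8 : 0 < (√d)⁻¹ := by positivity
      linarith
    linarith
  · rw [indicator_of_notMem (show y ∉ {y : ℝ | y ^ 2 < d} from hyd), mul_zero, add_zero]
    push Not at hyd
    have h4 : d ^ 2 / (2 * y ^ 2) ≤ d := by
      rw [div_le_iff₀ (by positivity)]; nlinarith
    linarith

theorem abs_integral_half_log_sub_log_le {μ : Measure ℂ} [IsProbabilityMeasure μ] {d κ : ℝ}
    (hd : 0 < d) (hd2 : d ≤ 1 / 2) (h0 : ∀ᵐ z ∂μ, z ≠ 0)
    (hμ : Integrable (fun z : ℂ => ‖z‖ ^ 2) μ) (hl : Integrable (fun z : ℂ => Real.log ‖z‖ ^ 2) μ)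
    (hκ : μ.real {z : ℂ | ‖z‖ ^ 2 < d} ≤ κ * d) :
    |∫ z, 1 / 2 * Real.log (‖z‖ ^ 2 + d ^ 2) ∂μ - ∫ z, Real.log ‖z‖ ∂μ| ≤
      √d * (1 + κ + ∫ z, Real.log ‖z‖ ^ 2 ∂μ) := by
  have hm : MeasurableSet {z : ℂ | ‖z‖ ^ 2 < d} := measurableSet_lt (by fun_prop) measurable_const
  have hsq := Real.sqrt_pos.2 hd
  have hdd : √d * √d = d := Real.mul_self_sqrt hd.le
  have hl1 : Integrable (fun z : ℂ => Real.log ‖z‖) μ :=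
    ((integrable_const (1 : ℝ)).add hl).mono' measurable_log_norm.aestronglyMeasurable
      (Eventually.of_forall fun z => abs_log_le_one_add_sq _)
  have hi2 : Integrable (fun z : ℂ => (√d)⁻¹ * indicator {z : ℂ | ‖z‖ ^ 2 < d} (1 : ℂ → ℝ) z) μ :=
    ((integrable_const (1 : ℝ)).indicator hm).const_mul _
  have hi1 : Integrable (fun z : ℂ => d + √d * Real.log ‖z‖ ^ 2) μ :=
    (integrable_const d).add (hl.const_mul _)
  rw [← integral_sub (integrable_half_log hμ (by positivity)) hl1, ← Real.norm_eq_abs]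
  have h1 := norm_integral_le_of_norm_le (hi1.add hi2) (f := fun z : ℂ =>
    1 / 2 * Real.log (‖z‖ ^ 2 + d ^ 2) - Real.log ‖z‖) (by
      filter_upwards [h0] with z hz
      exact abs_half_log_sub_log_le (norm_pos_iff.2 hz) hd hd2)
  refine h1.trans ?_
  simp only [Pi.add_apply]
  rw [integral_add hi1 hi2, integral_add (integrable_const d) (hl.const_mul _), integral_const_mul,
    integral_const_mul, integral_indicator_one hm, integral_const, probReal_univ, one_smul]
  have h2 : (√d)⁻¹ * μ.real {z : ℂ | ‖z‖ ^ 2 < d} ≤ √d * κ := by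
    calc _ ≤ (√d)⁻¹ * (κ * d) := by gcongr
      _ = (√d)⁻¹ * (κ * (√d * √d)) := by rw [hdd]
      _ = _ := by field_simp
  have h3 : d ≤ √d := by
    have : √d ≤ 1 := Real.sqrt_le_one.2 (by linarith)
    nlinarith
  linarith [mul_add (√d) (1 + κ) (∫ z, Real.log ‖z‖ ^ 2 ∂μ), mul_add (√d) 1 κ]

/-- Averages of `log |z|` under two measures with nearby Fourier transforms. -/
theorem abs_integral_log_norm_sub_le {μ ν : Measure ℂ} [IsProbabilityMeasure μ] [IsProbabilityMeasure ν]
    {q K d C₀ C₁ : ℝ} (hC₀ : 0 ≤ C₀) (hd : 0 < d) (hd2 : d ≤ 1 / 2) (hq : q * d ^ 8 = 1)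
    (h : ∀ w : ℂ, ‖w‖ ≤ q → ‖measFT μ w - measFT ν w‖ ≤ C₀ * (q ^ 4)⁻¹)
    (hμ : Integrable (fun z : ℂ => ‖z‖ ^ 2) μ) (hν : Integrable (fun z : ℂ => ‖z‖ ^ 2) ν)
    (hμK : ∫ z, ‖z‖ ^ 2 ∂μ ≤ K) (hνK : ∫ z, ‖z‖ ^ 2 ∂ν ≤ K)
    (hg : ∀ u : ℝ, 0 < u → ∫ z, Real.exp (-u * ‖z‖ ^ 2) ∂ν ≤ C₁ / u)
    (hμ0 : ∀ᵐ z ∂μ, z ≠ 0) (hν0 : ∀ᵐ z ∂ν, z ≠ 0)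
    (hμl : Integrable (fun z : ℂ => Real.log ‖z‖ ^ 2) μ)
    (hνl : Integrable (fun z : ℂ => Real.log ‖z‖ ^ 2) ν) :
    |∫ z, Real.log ‖z‖ ∂μ - ∫ z, Real.log ‖z‖ ∂ν| ≤
      √d * (K + 7 * C₀ + 9 + 6 * C₁ + ∫ z, Real.log ‖z‖ ^ 2 ∂μ + ∫ z, Real.log ‖z‖ ^ 2 ∂ν) := by
  have hq0 : 0 < q := by
    by_contra hcon
    push Not at hcon
    nlinarith [pow_pos hd 8]
  have hqd : q = (d ^ 8)⁻¹ := eq_inv_of_mul_eq_one_left hq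
  have hd1 : d ≤ 1 := by linarith
  have hK0 : 0 ≤ K := (integral_nonneg fun z => by positivity).trans hμK
  have hε : C₀ * (q ^ 4)⁻¹ = C₀ * d ^ 32 := by rw [hqd]; field_simp
  have hdp : ∀ n : ℕ, 1 ≤ n → d ^ n ≤ d := fun n hn => pow_le_of_le_one hd.le hd1 (by omega)
  -- With D = d², W = d^(-2) and q = d^(-8) all errors become positive powers of d.
  have h1 := abs_integral_half_log_sub_le (by positivity) hq0 h hμ hν hμK hνK (D := d ^ 2)
    (W := (d ^ 2)⁻¹) (by positivity) ((hdp 2 (by norm_num)).trans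
      (hd1.trans (one_le_inv_iff₀.2 ⟨by positivity, (hdp 2 (by norm_num)).trans hd1⟩)))
  have h1' : K / (d ^ 2)⁻¹ + (d ^ 2)⁻¹ * (C₀ * (q ^ 4)⁻¹ / d ^ 2 + 4 / (q ^ 2 * (d ^ 2) ^ 2)) =
      K * d ^ 2 + C₀ * d ^ 28 + 4 * d ^ 10 := by
    rw [hqd]; field_simp; ring
  rw [h1'] at h1
  have hsν := measureReal_small_le (μ := ν) hd
  have hsμ := measureReal_small_le (μ := μ) hd
  have hgd := hg d⁻¹ (by positivity)
  -- The small-disc bound is known for `ν` through `hg` and is transferred to `μ` by the Gaussian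
  -- with u = 1/d, at the cost C₀d³² + d¹⁵.
  have hcmp := abs_le.1 (abs_integral_gaussian_sub_le (by positivity) hq0 h (u := d⁻¹) (by positivity))
  have e1 : d⁻¹ / q ^ 2 = d ^ 15 := by rw [hqd]; field_simp
  rw [hε, e1] at hcmp
  rw [div_inv_eq_mul] at hgd
  have i32 : C₀ * d ^ 32 ≤ C₀ * d := by have := hdp 32 (by norm_num); gcongr
  have i28 : C₀ * d ^ 28 ≤ C₀ * d := by have := hdp 28 (by norm_num); gcongr
  have i2 : K * d ^ 2 ≤ K * d := by have := hdp 2 (by norm_num); gcongr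
  have i10 := hdp 10 (by norm_num)
  have i15 := hdp 15 (by norm_num)
  have h2 := abs_integral_half_log_sub_log_le hd hd2 hμ0 hμ hμl (κ := 3 * (C₁ + C₀ + 1))
    (hsμ.trans (by linarith [hcmp.2]))
  have h3 := abs_integral_half_log_sub_log_le hd hd2 hν0 hν hνl (κ := 3 * C₁)
    (hsν.trans (by linarith))
  have hds : d ≤ √d := by
    have h4 : √d ≤ 1 := Real.sqrt_le_one.2 hd1
    have h5 : √d * √d = d := Real.mul_self_sqrt hd.le
    nlinarith [Real.sqrt_nonneg d]
  have h6 := mul_le_mul_of_nonneg_right hds (by positivity : 0 ≤ K + C₀ + 4)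
  have h7 : 0 ≤ √d * C₀ := by positivity
  have e2 : d * (K + C₀ + 4) = K * d + C₀ * d + 4 * d := by ring
  generalize ∫ z, Real.log ‖z‖ ^ 2 ∂μ = a at *
  generalize ∫ z, Real.log ‖z‖ ^ 2 ∂ν = b at *
  have e3 : √d * (K + 7 * C₀ + 9 + 6 * C₁ + a + b) = √d * (K + C₀ + 4) +
    √d * (1 + 3 * (C₁ + C₀ + 1) + a) + √d * (1 + 3 * C₁ + b) + 3 * (√d * C₀) := by ring
  rw [e3]
  rw [e2] at h6
  obtain ⟨h11, h12⟩ := abs_le.1 h1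
  obtain ⟨h21, h22⟩ := abs_le.1 h2
  obtain ⟨h31, h32⟩ := abs_le.1 h3
  rw [abs_le]
  constructor <;> linarith

/-! ### Jensen's formula and local mean squares of log |f|. -/

open Metric MeromorphicOn InnerProductSpace

/-- Jensen's inequality, with the zeros in a smaller disc. -/
theorem sum_divisor_mul_log_le {f : ℂ → ℂ} {c : ℂ} {R R' : ℝ} (hR : 0 < R) (hRR : R ≤ R')
    (hf : AnalyticOnNhd ℂ f (closedBall c R')) (hc : f c ≠ 0) :
    (∑ᶠ u, (divisor f (closedBall c R) u : ℝ)) * Real.log (R' / R) + Real.log ‖f c‖ ≤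
      Real.circleAverage (fun z => Real.log ‖f z‖) c R' := by
  have hR' : 0 < R' := hR.trans_le hRR
  have hfR := hf.mono (closedBall_subset_closedBall hRR)
  have habs : |R'| = R' := abs_of_pos hR'
  rw [AnalyticOnNhd.circleAverage_log_norm hR'.ne' (by rwa [habs]) hc, habs, finsum_mul]
  -- A zero in the inner disc has weight at least log (R'/R) in Jensen's formula; the other zeros
  -- contribute nonnegative terms, which are dropped.
  refine add_le_add_left (finsum_le_finsum' ?_ ?_ fun u => ?_) _
  · exact ((divisor f (closedBall c R)).finiteSupport (isCompact_closedBall ..)).subset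
      fun _ _ => by simp_all
  · exact ((divisor f (closedBall c R')).finiteSupport (isCompact_closedBall ..)).subset
      fun _ _ => by simp_all
  have hnn : 0 ≤ (divisor f (closedBall c R') u : ℝ) := by exact_mod_cast hf.divisor_nonneg u
  by_cases h1 : u ∈ closedBall c R'
  · by_cases h3 : u = c
    · rw [h3, hf.divisor_apply (mem_closedBall_self hR'.le), hfR.divisor_apply (mem_closedBall_self hR.le),
        (hf c (mem_closedBall_self hR'.le)).analyticOrderAt_eq_zero.mpr hc]
      simp
    have h4 : 0 < ‖c - u‖ := norm_pos_iff.2 (sub_ne_zero.2 (Ne.symm h3))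
    rw [← div_eq_mul_inv]
    by_cases h2 : u ∈ closedBall c R
    · rw [hfR.divisor_apply h2, ← hf.divisor_apply h1]
      rw [mem_closedBall, dist_eq_norm'] at h2
      gcongr
    · rw [Function.locallyFinsuppWithin.apply_eq_zero_of_notMem _ h2, Int.cast_zero, zero_mul]
      rw [mem_closedBall, dist_eq_norm'] at h1
      exact mul_nonneg hnn (Real.log_nonneg ((one_le_div h4).2 h1))
  · have h2 : u ∉ closedBall c R := fun h => h1 (closedBall_subset_closedBall hRR h)
    rw [Function.locallyFinsuppWithin.apply_eq_zero_of_notMem _ h1,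
      Function.locallyFinsuppWithin.apply_eq_zero_of_notMem _ h2]
    simp

theorem log_norm_le_circleAverage {f : ℂ → ℂ} {c : ℂ} {R : ℝ} (hR : 0 < R)
    (hf : AnalyticOnNhd ℂ f (closedBall c R)) (hc : f c ≠ 0) :
    Real.log ‖f c‖ ≤ Real.circleAverage (fun z => Real.log ‖f z‖) c R := by
  have := sum_divisor_mul_log_le hR le_rfl hf hc
  rwa [div_self hR.ne', Real.log_one, mul_zero, zero_add] at this

theorem sq_circleAverage_norm_le {f : ℂ → ℂ} {c : ℂ} {R : ℝ} (hR : 0 ≤ R)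
    (hf : ContinuousOn f (sphere c R)) :
    Real.circleAverage (fun z => ‖f z‖) c R ^ 2 ≤ Real.circleAverage (fun z => ‖f z‖ ^ 2) c R := by
  set A := Real.circleAverage (fun z => ‖f z‖) c R with hA
  have h1 : CircleIntegrable (fun z => ‖f z‖) c R := hf.norm.circleIntegrable hR
  have h2 : CircleIntegrable (fun z => ‖f z‖ ^ 2) c R := (hf.norm.pow 2).circleIntegrable hR
  have h3 := Real.circleAverage_mono (f₁ := fun z => (2 * A) • ‖f z‖) (f₂ := fun z => A ^ 2 + ‖f z‖ ^ 2)
    (h1.const_fun_smul) ((circleIntegrable_const (A ^ 2) c R).fun_add h2)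
    (fun x _ => by simp only [smul_eq_mul]; nlinarith [sq_nonneg (A - ‖f x‖)])
  rw [Real.circleAverage_fun_smul, Real.circleAverage_fun_add (circleIntegrable_const (A ^ 2) c R) h2,
    Real.circleAverage_const, ← hA, smul_eq_mul] at h3
  linarith

/-- Since log y ≤ y, one has |log y| ≤ 2y - log y. Together with Jensen's lower bound for the mean
of log ‖f‖, this controls the mean of its absolute value. -/
theorem circleAverage_log_norm_le {f : ℂ → ℂ} {c : ℂ} {R : ℝ} (hR : 0 < R)
    (hf : AnalyticOnNhd ℂ f (sphere c R)) :
    Real.circleAverage (fun z => Real.log ‖f z‖) c R ≤ Real.circleAverage (fun z => ‖f z‖) c R ∧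
      Real.circleAverage (fun z => |Real.log ‖f z‖|) c R ≤
        2 * Real.circleAverage (fun z => ‖f z‖) c R - Real.circleAverage (fun z => Real.log ‖f z‖) c R := by
  have h1 : CircleIntegrable (fun z => ‖f z‖) c R := hf.continuousOn.norm.circleIntegrable hR.le
  have h2 : CircleIntegrable (fun z => Real.log ‖f z‖) c R :=
    hf.meromorphicOn.circleIntegrable_log_norm_of_nonneg hR.le
  have h0 : ∀ x : ℂ, Real.log ‖f x‖ ≤ ‖f x‖ := fun x => Real.log_le_self (norm_nonneg _)
  refine ⟨Real.circleAverage_mono h2 h1 fun x _ => h0 x, ?_⟩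
  have h3 := Real.circleAverage_mono (f₁ := fun z => |Real.log ‖f z‖|)
    (f₂ := fun z => (2 : ℝ) • ‖f z‖ - Real.log ‖f z‖) h2.abs ((h1.const_fun_smul).fun_sub h2)
    (fun x _ => by
      rw [smul_eq_mul, abs_le]
      constructor
      · linarith [norm_nonneg (f x)]
      · linarith [h0 x])
  rwa [Real.circleAverage_fun_sub h1.const_fun_smul h2, Real.circleAverage_fun_smul, smul_eq_mul] at h3

/-- A bound for a harmonic function in terms of its average on a circle. -/
theorem abs_le_circleAverage_abs {h : ℂ → ℝ} {c w : ℂ} {r R : ℝ} (hrR : r < R)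
    (hh : HarmonicOnNhd h (closedBall c R)) (hw : w ∈ ball c r) :
    |h w| ≤ (R + r) / (R - r) * Real.circleAverage (fun z => |h z|) c R := by
  have hr : 0 < r := pos_of_mem_ball hw
  have hR : 0 < R := hr.trans hrR
  have hwR : w ∈ ball c R := ball_subset_ball hrR.le hw
  rw [← hh.circleAverage_poissonKernel_smul hwR]
  refine Real.abs_circleAverage_le_circleAverage_abs.trans ?_
  have hcont : ContinuousOn h (sphere c R) := fun x hx =>
    (hh x (sphere_subset_closedBall hx)).1.continuousAt.continuousWithinAt
  have hK : ContinuousOn (poissonKernel c w) (sphere c R) := by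
    have h0 := continuousOn_herglotzRieszKernel_sphere (w := w) (c := c) (R := R) hwR
    rw [abs_of_pos hR] at h0
    refine (Complex.continuous_re.comp_continuousOn h0).congr ?_
    intro x _
    rw [poissonKernel_eq_re_herglotzRieszKernel]
  rw [← smul_eq_mul, ← Real.circleAverage_fun_smul]
  refine Real.circleAverage_mono ((hK.smul hcont).abs.circleIntegrable hR.le)
    ((hcont.abs.circleIntegrable hR.le).const_fun_smul) fun z hz => ?_
  rw [abs_of_pos hR] at hz
  simp only [Pi.abs_apply, Pi.mul_apply, smul_eq_mul, abs_mul]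
  refine mul_le_mul_of_nonneg_right ?_ (abs_nonneg _)
  have h1 := re_herglotzRieszKernel_le hz hwR
  have h2 := le_re_herglotzRieszKernel hz hwR
  rw [mem_ball, dist_eq_norm] at hw
  have h0 := norm_nonneg (w - c)
  have e : poissonKernel c w z = ((z - c + (w - c)) / ((z - c) - (w - c))).re := by
    rw [poissonKernel_eq_re_herglotzRieszKernel]
    rfl
  rw [e, abs_of_nonneg]
  · refine h1.trans ?_
    gcongr
  · refine le_trans ?_ h2
    have : 0 ≤ R - ‖w - c‖ := by linarith
    positivity

/-- The zeros are divided out, and the logarithm of the zero-free quotient is harmonic. The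
constants log 2R make every potential nonnegative on the disc and are compensated in `h`. Equality
can fail at the zeros, where log 0 takes the default value 0. -/
theorem exists_harmonic_add_sum {f : ℂ → ℂ} {c : ℂ} {R : ℝ} (hR : 0 < R)
    (hf : AnalyticOnNhd ℂ f (closedBall c R)) (hc : f c ≠ 0) :
    ∃ (Z : Finset ℂ) (m : ℂ → ℝ) (h : ℂ → ℝ), (∀ a ∈ Z, 0 ≤ m a ∧ a ∈ closedBall c R) ∧
      HarmonicOnNhd h (closedBall c R) ∧
      ∑ a ∈ Z, m a = ∑ᶠ u, (divisor f (closedBall c R) u : ℝ) ∧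
      (fun z => Real.log ‖f z‖) =ᶠ[codiscreteWithin (closedBall c R)]
        fun z => h z - ∑ a ∈ Z, m a * (Real.log (2 * R) - Real.log ‖z - a‖) := by
  set D := divisor f (closedBall c R) with hD
  have hfin : D.support.Finite := D.finiteSupport (isCompact_closedBall c R)
  have hcm : c ∈ closedBall c R := mem_closedBall_self hR.le
  have hord : ∀ u : closedBall c R, meromorphicOrderAt f u ≠ ⊤ := by
    refine (hf.meromorphicOn.exists_meromorphicOrderAt_ne_top_iff_forall
      ⟨⟨c, hcm⟩, (convex_closedBall c R).isPreconnected⟩).1 ⟨⟨c, hcm⟩, ?_⟩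
    rw [(hf c hcm).meromorphicOrderAt_eq, (hf c hcm).analyticOrderAt_eq_zero.2 hc]
    simp
  obtain ⟨g, hg, hg0, hfg⟩ := hf.meromorphicOn.extract_zeros_poles hord hfin
  have hlog := extract_zeros_poles_log hg0 hfg
  have hsub : (fun u => fun z : ℂ => (D u : ℝ) * Real.log ‖z - u‖).support ⊆ hfin.toFinset := by
    intro u hu
    simp only [Finite.coe_toFinset, Function.mem_support]
    intro h0
    apply hu
    simp only [h0]
    ext z
    simp
  refine ⟨hfin.toFinset, fun u => (D u : ℝ), fun z => Real.log ‖g z‖ +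
    ∑ a ∈ hfin.toFinset, (D a : ℝ) * Real.log (2 * R), fun a ha => ⟨?_, ?_⟩, ?_, ?_, ?_⟩
  · have := hf.divisor_nonneg a
    simpa using this
  · exact D.supportWithinDomain (by simpa using ha)
  · intro x hx
    exact ((hg x hx).harmonicAt_log_norm (hg0 ⟨x, hx⟩)).add ((analyticAt_const (v := ((∑ a ∈ hfin.toFinset, (D a : ℝ) * Real.log (2 * R) : ℝ) : ℂ))).harmonicAt_re)
  · rw [finsum_eq_sum_of_support_subset]
    intro u hu
    simpa using hu
  · filter_upwards [hlog] with z hz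
    rw [hz, Pi.add_apply, finsum_eq_sum_of_support_subset _ hsub, Finset.sum_apply]
    simp only [mul_sub, Finset.sum_sub_distrib]
    ring

theorem sq_sum_mul_le {Z : Finset ℂ} {m : ℂ → ℝ} (hm : ∀ a ∈ Z, 0 ≤ m a) (x : ℂ → ℝ) :
    (∑ a ∈ Z, m a * x a) ^ 2 ≤ (∑ a ∈ Z, m a) * ∑ a ∈ Z, m a * x a ^ 2 := by
  refine Finset.sum_sq_le_sum_mul_sum_of_sq_le_mul Z hm (fun a ha => mul_nonneg (hm a ha) (sq_nonneg _))
    fun a _ => le_of_eq (by ring)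

theorem sq_log_sub_log_le {R y : ℝ} (hy : y ≤ 2 * R) :
    (Real.log (2 * R) - Real.log y) ^ 2 ≤
      2 * (1 + Real.log (2 * R) ^ 2) * Real.exp (2 * R) * ((1 + Real.log y ^ 2) * Real.exp (-y)) := by
  have h1 : 1 ≤ Real.exp (2 * R) * Real.exp (-y) := by
    rw [← Real.exp_add]; exact Real.one_le_exp (by linarith)
  have h2 : (Real.log (2 * R) - Real.log y) ^ 2 ≤ 2 * (1 + Real.log (2 * R) ^ 2) * (1 + Real.log y ^ 2) := by
    nlinarith [sq_nonneg (Real.log (2 * R) + Real.log y), sq_nonneg (Real.log (2 * R) * Real.log y)]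
  have h3 : 0 ≤ 2 * (1 + Real.log (2 * R) ^ 2) * (1 + Real.log y ^ 2) := by positivity
  calc _ ≤ 2 * (1 + Real.log (2 * R) ^ 2) * (1 + Real.log y ^ 2) * 1 := by linarith
    _ ≤ 2 * (1 + Real.log (2 * R) ^ 2) * (1 + Real.log y ^ 2) * (Real.exp (2 * R) * Real.exp (-y)) := by gcongr
    _ = _ := by ring

/-- A pointwise bound for the logarithm of an analytic function, almost everywhere in a disc. -/
theorem exists_log_sq_le_add_sum {r R R' : ℝ} (hr : 0 < r) (hrR : r < R) (h1R : 1 ≤ R) (hRR : R < R')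
    {f : ℂ → ℂ} {c : ℂ} (hf : AnalyticOnNhd ℂ f (closedBall c R')) (hc : f c ≠ 0) {ℓ : ℝ}
    (hℓ : -ℓ ≤ Real.log ‖f c‖) :
    ∃ (Z : Finset ℂ) (m : ℂ → ℝ) (H : ℝ), (∀ a ∈ Z, 0 ≤ m a) ∧ 0 ≤ H ∧
      (∑ a ∈ Z, m a) * Real.log (R' / R) ≤ Real.circleAverage (fun z => ‖f z‖) c R' + ℓ ∧
      H ≤ (R + r) / (R - r) * (2 * Real.circleAverage (fun z => ‖f z‖) c R + ℓ + ∑ a ∈ Z, m a) ∧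
      ∀ᵐ z ∂(volume.restrict (ball c r)), Real.log ‖f z‖ ^ 2 ≤ 2 * H ^ 2 +
        2 * (∑ a ∈ Z, m a) * ∑ a ∈ Z, m a * (2 * (1 + Real.log (2 * R) ^ 2) * Real.exp (2 * R) *
          ((1 + Real.log ‖z - a‖ ^ 2) * Real.exp (-‖z - a‖))) := by
  have hR : 0 < R := hr.trans hrR
  have hR' : 0 < R' := hR.trans hRR
  have hfR := hf.mono (closedBall_subset_closedBall hRR.le)
  obtain ⟨Z, m, h, hZ, hh, hn, hlog⟩ := exists_harmonic_add_sum hR hfR hc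
  have hm : ∀ a ∈ Z, 0 ≤ m a := fun a ha => (hZ a ha).1
  have hκ : 0 < R - r := by linarith
  -- On the circle |h| is at most |log ‖f‖| plus the potentials. Each potential has mean log 2R -
  -- log R = log 2 there, because its pole lies in the closed disc.
  have havg : Real.circleAverage (fun z => |h z|) c R ≤
      2 * Real.circleAverage (fun z => ‖f z‖) c R + ℓ + ∑ a ∈ Z, m a := by
    have hi : ∀ a, CircleIntegrable (fun z => Real.log (2 * R) - Real.log ‖z - a‖) c R := fun a =>
      (circleIntegrable_const _ c R).fun_sub
        (MeromorphicOn.circleIntegrable_log_norm (f := fun z => z - a) (by intro x _; fun_prop))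
    have hfs : CircleIntegrable (fun z => |Real.log ‖f z‖|) c R :=
      ((hfR.mono sphere_subset_closedBall).meromorphicOn.circleIntegrable_log_norm_of_nonneg hR.le).abs
    have hsum : CircleIntegrable (fun z => ∑ a ∈ Z, m a • (Real.log (2 * R) - Real.log ‖z - a‖)) c R := by
      have := CircleIntegrable.sum Z (c := c) (R := R)
        (f := fun a => fun z => m a • (Real.log (2 * R) - Real.log ‖z - a‖))
        (fun a _ => (hi a).const_fun_smul)
      refine this.congr fun x _ => ?_
      simp
    have hcontx : ContinuousOn h (sphere c R) := fun x hx =>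
      (hh x (sphere_subset_closedBall hx)).1.continuousAt.continuousWithinAt
    have hcod : (fun z => |h z|) =ᶠ[codiscreteWithin (sphere c |R|)]
        fun z => |Real.log ‖f z‖ + ∑ a ∈ Z, m a • (Real.log (2 * R) - Real.log ‖z - a‖)| := by
      rw [abs_of_pos hR]
      filter_upwards [codiscreteWithin_mono sphere_subset_closedBall hlog] with z hz
      rw [hz]
      simp
    have e1 : Real.circleAverage (fun z => ∑ a ∈ Z, m a • (Real.log (2 * R) - Real.log ‖z - a‖)) c R =
        (∑ a ∈ Z, m a) * Real.log 2 := by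
      rw [Real.circleAverage_fun_sum (f := fun a z => m a • (Real.log (2 * R) - Real.log ‖z - a‖))
        (fun a _ => (hi a).const_fun_smul), Finset.sum_mul]
      refine Finset.sum_congr rfl fun a ha => ?_
      rw [Real.circleAverage_fun_smul, Real.circleAverage_fun_sub (circleIntegrable_const _ c R)
        (MeromorphicOn.circleIntegrable_log_norm (f := fun z => z - a) (by intro x _; fun_prop)),
        Real.circleAverage_const,
        circleAverage_log_norm_sub_const_of_mem_closedBall (by rw [abs_of_pos hR]; exact (hZ a ha).2),
        Real.log_mul two_ne_zero hR.ne', smul_eq_mul]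
      ring
    have hpos : ∀ z ∈ sphere c R, 0 ≤ ∑ a ∈ Z, m a • (Real.log (2 * R) - Real.log ‖z - a‖) := by
      intro z hz
      refine Finset.sum_nonneg fun a ha => mul_nonneg (hm a ha) ?_
      have h2 : ‖z - a‖ ≤ 2 * R := by
        have h3 := (hZ a ha).2
        rw [mem_closedBall, dist_eq_norm] at h3
        rw [mem_sphere, dist_eq_norm] at hz
        calc ‖z - a‖ = ‖(z - c) - (a - c)‖ := by congr 1; ring
          _ ≤ _ := (norm_sub_le _ _).trans (by linarith)
      rcases (norm_nonneg (z - a)).eq_or_lt with h4 | h4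
      · rw [← h4, Real.log_zero, sub_zero]; exact Real.log_nonneg (by linarith)
      · exact sub_nonneg.2 (Real.log_le_log h4 h2)
    rw [Real.circleAverage_congr_codiscreteWithin hcod hR.ne']
    have h3 := Real.circleAverage_mono (c := c) (R := R)
      (f₁ := fun z => |Real.log ‖f z‖ + ∑ a ∈ Z, m a • (Real.log (2 * R) - Real.log ‖z - a‖)|)
      (f₂ := fun z => |Real.log ‖f z‖| + ∑ a ∈ Z, m a • (Real.log (2 * R) - Real.log ‖z - a‖))
      (CircleIntegrable.abs (((hfR.mono
        sphere_subset_closedBall).meromorphicOn.circleIntegrable_log_norm_of_nonneg hR.le).fun_add hsum))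
      (hfs.fun_add hsum) (fun z hz => by
        rw [abs_of_pos hR] at hz
        refine (abs_add_le _ _).trans ?_
        rw [abs_of_nonneg (hpos z hz)])
    rw [Real.circleAverage_fun_add hfs hsum, e1] at h3
    have h4 := (circleAverage_log_norm_le hR (hfR.mono sphere_subset_closedBall)).2
    have h5 := log_norm_le_circleAverage hR hfR hc
    have h6 : (∑ a ∈ Z, m a) * Real.log 2 ≤ ∑ a ∈ Z, m a :=
      mul_le_of_le_one_right (Finset.sum_nonneg hm) (by linarith [Real.log_two_lt_d9])
    linarith
  refine ⟨Z, m, (R + r) / (R - r) * Real.circleAverage (fun z => |h z|) c R, hm, ?_, ?_, ?_, ?_⟩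
  · exact mul_nonneg (by positivity) (Real.circleAverage_nonneg_of_nonneg fun _ _ => abs_nonneg _)
  · have h1 := sum_divisor_mul_log_le hR hRR.le hf hc
    have h2 := (circleAverage_log_norm_le hR' (hf.mono sphere_subset_closedBall)).1
    rw [hn]
    linarith
  · exact mul_le_mul_of_nonneg_left havg (by positivity)
  · have hae : ∀ᵐ z ∂(volume.restrict (ball c r)), Real.log ‖f z‖ =
        h z - ∑ a ∈ Z, m a * (Real.log (2 * R) - Real.log ‖z - a‖) :=
      ae_restrict_le_codiscreteWithin measurableSet_ball (codiscreteWithin_mono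
        (ball_subset_closedBall.trans (closedBall_subset_closedBall hrR.le)) hlog)
    filter_upwards [hae, ae_restrict_mem measurableSet_ball] with z hz hzr
    rw [hz]
    set x := ∑ a ∈ Z, m a * (Real.log (2 * R) - Real.log ‖z - a‖) with hx
    have h1 := abs_le_circleAverage_abs hrR hh hzr
    have h2 : h z ^ 2 ≤ ((R + r) / (R - r) * Real.circleAverage (fun z => |h z|) c R) ^ 2 := by
      rw [← sq_abs]; gcongr
    have h3 := sq_sum_mul_le hm fun a => Real.log (2 * R) - Real.log ‖z - a‖
    rw [← hx] at h3
    have h4 : ∑ a ∈ Z, m a * (Real.log (2 * R) - Real.log ‖z - a‖) ^ 2 ≤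
        ∑ a ∈ Z, m a * (2 * (1 + Real.log (2 * R) ^ 2) * Real.exp (2 * R) *
          ((1 + Real.log ‖z - a‖ ^ 2) * Real.exp (-‖z - a‖))) := by
      refine Finset.sum_le_sum fun a ha => mul_le_mul_of_nonneg_left (sq_log_sub_log_le ?_) (hm a ha)
      have h3 := (hZ a ha).2
      rw [mem_closedBall, dist_eq_norm] at h3
      rw [mem_ball, dist_eq_norm] at hzr
      calc ‖z - a‖ = ‖(z - c) - (a - c)‖ := by congr 1; ring
        _ ≤ _ := (norm_sub_le _ _).trans (by linarith)
    have h5 := mul_le_mul_of_nonneg_left h4 (Finset.sum_nonneg hm)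
    have h6 : (h z - x) ^ 2 ≤ 2 * h z ^ 2 + 2 * x ^ 2 := by nlinarith [sq_nonneg (h z + x)]
    linarith

/-- A local mean square bound for the logarithm of an analytic function. -/
theorem exists_lintegral_log_sq_le {r R R' : ℝ} (hr : 0 < r) (hrR : r < R) (h1R : 1 ≤ R) (hRR : R < R') :
    ∃ C : ℝ, 0 ≤ C ∧ ∀ (f : ℂ → ℂ) (c : ℂ), AnalyticOnNhd ℂ f (closedBall c R') → f c ≠ 0 →
      ∀ ℓ : ℝ, -ℓ ≤ Real.log ‖f c‖ →
      ∫⁻ z in ball c r, ENNReal.ofReal (Real.log ‖f z‖ ^ 2) ≤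
        ENNReal.ofReal (C * (ℓ ^ 2 + Real.circleAverage (fun z => ‖f z‖ ^ 2) c R +
          Real.circleAverage (fun z => ‖f z‖ ^ 2) c R')) := by
  have hR : 0 < R := hr.trans hrR
  have hR' : 0 < R' := hR.trans hRR
  have hlam : 0 < Real.log (R' / R) := Real.log_pos ((one_lt_div hR).2 hRR)
  set L := Real.log (R' / R) with hL
  set κ := (R + r) / (R - r) with hκ
  have hκ0 : 0 < κ := div_pos (by linarith) (by linarith)
  set V := volume.real (ball (0 : ℂ) r) with hV
  set g : ℂ → ℝ := fun w => (1 + Real.log ‖w‖ ^ 2) * Real.exp (-‖w‖) with hg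
  have hgi : Integrable g := integrable_log_sq_mul_exp_neg_norm
  have hg0 : ∀ w, 0 ≤ g w := fun w => by positivity
  set G := ∫ w, g w with hG
  have hG0 : 0 ≤ G := integral_nonneg hg0
  set C₀ := 2 * (1 + Real.log (2 * R) ^ 2) * Real.exp (2 * R) with hC₀
  have hC₀0 : 0 ≤ C₀ := by positivity
  have hV0 : 0 ≤ V := measureReal_nonneg
  refine ⟨2 * V * (κ ^ 2 * (12 + 6 / L ^ 2)) + 4 * C₀ * G / L ^ 2, by positivity,
    fun f c hf hc ℓ hℓ => ?_⟩
  obtain ⟨Z, m, H, hm, hH0, hn, hH, hae⟩ := exists_log_sq_le_add_sum hr hrR h1R hRR hf hc hℓ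
  rw [← hL] at hn
  rw [← hκ] at hH
  simp only [← hC₀] at hae
  have hcon : ContinuousOn f (closedBall c R') := hf.continuousOn
  have hA := sq_circleAverage_norm_le hR.le
    (hcon.mono (sphere_subset_closedBall.trans (closedBall_subset_closedBall hRR.le)))
  have hA' := sq_circleAverage_norm_le hR'.le (hcon.mono sphere_subset_closedBall)
  set A := Real.circleAverage (fun z => ‖f z‖) c R
  set A' := Real.circleAverage (fun z => ‖f z‖) c R'
  set S := Real.circleAverage (fun z => ‖f z‖ ^ 2) c R
  set S' := Real.circleAverage (fun z => ‖f z‖ ^ 2) c R'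
  set n := ∑ a ∈ Z, m a with hndef
  have hn0 : 0 ≤ n := Finset.sum_nonneg hm
  have hga : ∀ a, Integrable (fun z => g (z - a)) := fun a => hgi.comp_sub_right a
  have hsumi : Integrable (fun z => 2 * n * ∑ a ∈ Z, m a * (C₀ * g (z - a)))
      (volume.restrict (ball c r)) :=
    ((integrable_finsetSum Z fun a _ => ((hga a).const_mul C₀).const_mul (m a)).const_mul
      (2 * n)).integrableOn
  have hcst : Integrable (fun _ : ℂ => 2 * H ^ 2) (volume.restrict (ball c r)) :=
    integrableOn_const (by finiteness)
  -- The squared potentials are bounded by translates of one integrable function, whose integral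
  -- does not depend on the position of the zero; only the total multiplicity `n` enters.
  have h1 : ∫ z in ball c r, (2 * H ^ 2 + 2 * n * ∑ a ∈ Z, m a * (C₀ * g (z - a))) ≤
      2 * H ^ 2 * V + 2 * n * (n * (C₀ * G)) := by
    rw [integral_add hcst hsumi, setIntegral_const]
    have e1 : volume.real (ball c r) = V := by
      rw [hV, Measure.real, Measure.real, Measure.addHaar_ball_center]
    have h2 : ∫ z in ball c r, 2 * n * ∑ a ∈ Z, m a * (C₀ * g (z - a)) ≤ 2 * n * (n * (C₀ * G)) := by
      refine (setIntegral_le_integral ((integrable_finsetSum Z fun a _ =>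
        ((hga a).const_mul C₀).const_mul (m a)).const_mul (2 * n)) (Eventually.of_forall fun z => ?_)).trans
        (le_of_eq ?_)
      · exact mul_nonneg (by positivity) (Finset.sum_nonneg fun a ha =>
          mul_nonneg (hm a ha) (mul_nonneg hC₀0 (hg0 _)))
      · rw [integral_const_mul, integral_finsetSum Z fun a _ => ((hga a).const_mul C₀).const_mul (m a)]
        simp only [integral_const_mul, integral_sub_right_eq_self g]
        rw [← Finset.sum_mul]
    rw [e1, smul_eq_mul]
    linarith
  calc ∫⁻ z in ball c r, ENNReal.ofReal (Real.log ‖f z‖ ^ 2)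
      ≤ ∫⁻ z in ball c r, ENNReal.ofReal (2 * H ^ 2 + 2 * n * ∑ a ∈ Z, m a * (C₀ * g (z - a))) :=
        lintegral_mono_ae (hae.mono fun z hz => ENNReal.ofReal_le_ofReal hz)
    _ = ENNReal.ofReal (∫ z in ball c r, (2 * H ^ 2 + 2 * n * ∑ a ∈ Z, m a * (C₀ * g (z - a)))) := by
        refine (ofReal_integral_eq_lintegral_ofReal (hcst.add hsumi) (Eventually.of_forall fun z => ?_)).symm
        exact add_nonneg (by positivity) (mul_nonneg (by positivity) (Finset.sum_nonneg fun a ha =>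
          mul_nonneg (hm a ha) (mul_nonneg hC₀0 (hg0 _))))
    _ ≤ ENNReal.ofReal _ := ENNReal.ofReal_le_ofReal (h1.trans ?_)
  have hn' : n ≤ (A' + ℓ) / L := (le_div_iff₀ hlam).2 hn
  have hn2 : n ^ 2 ≤ 2 * (ℓ ^ 2 + S + S') / L ^ 2 := by
    have hS : 0 ≤ S := (sq_nonneg A).trans hA
    calc n ^ 2 ≤ ((A' + ℓ) / L) ^ 2 := by gcongr
      _ = (A' + ℓ) ^ 2 / L ^ 2 := by rw [div_pow]
      _ ≤ _ := by gcongr; nlinarith [sq_nonneg (A' - ℓ)]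
  have hH2 : H ^ 2 ≤ κ ^ 2 * (12 + 6 / L ^ 2) * (ℓ ^ 2 + S + S') := by
    have hS' : 0 ≤ S' := (sq_nonneg A').trans hA'
    calc H ^ 2 ≤ (κ * (2 * A + ℓ + n)) ^ 2 := by gcongr
      _ = κ ^ 2 * (2 * A + ℓ + n) ^ 2 := by rw [mul_pow]
      _ ≤ κ ^ 2 * (12 * (ℓ ^ 2 + S + S') + 3 * (2 * (ℓ ^ 2 + S + S') / L ^ 2)) := by
        gcongr
        nlinarith [sq_nonneg (2 * A - ℓ), sq_nonneg (2 * A - n), sq_nonneg (ℓ - n)]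
      _ = _ := by ring
  calc 2 * H ^ 2 * V + 2 * n * (n * (C₀ * G)) = 2 * V * H ^ 2 + 2 * (C₀ * G) * n ^ 2 := by ring
    _ ≤ 2 * V * (κ ^ 2 * (12 + 6 / L ^ 2) * (ℓ ^ 2 + S + S')) +
        2 * (C₀ * G) * (2 * (ℓ ^ 2 + S + S') / L ^ 2) := by gcongr
    _ = _ := by ring

/-! ### The mean square of log |L| over rectangles. -/

open Metric

/-- Far to the right the Lerch zeta-function is bounded away from zero. -/
theorem exists_half_le_norm_lerchZeta {α : ℝ} (hα : 0 < α) (hα1 : α ≤ 1) (lam : ℝ) :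
    ∃ c₀ : ℝ, ∀ σ, c₀ ≤ σ → ∀ t : ℝ, 0 < t → 1 / 2 ≤ ‖lerchZeta lam α (σ + t * Complex.I)‖ := by
  have hsum := summable_base_rpow hα (σ := 2) (by norm_num)
  set S := ∑' n : ℕ, ((n : ℝ) + α) ^ (-2 : ℝ) with hS
  have hS0 : 0 ≤ S := tsum_nonneg fun n => by have := base_pos hα n; positivity
  have hlim : Tendsto (fun x : ℝ => (1 + α) ^ x) atTop atTop := by
    have : Tendsto (fun x : ℝ => Real.exp (Real.log (1 + α) * x)) atTop atTop :=
      Real.tendsto_exp_atTop.comp (tendsto_id.const_mul_atTop (Real.log_pos (by linarith)))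
    refine this.congr fun x => ?_
    rw [Real.rpow_def_of_pos (by linarith)]
  obtain ⟨x₀, hx₀⟩ := (hlim.eventually_ge_atTop (2 * S)).exists_forall_of_atTop
  refine ⟨max 2 (x₀ + 2), fun σ hσ t ht => ?_⟩
  have hσ2 : 2 ≤ σ := (le_max_left _ _).trans hσ
  have hx := hx₀ (σ - 2) (by linarith [(le_max_right 2 (x₀ + 2)).trans hσ])
  set s : ℂ := σ + t * Complex.I with hs
  have hre : s.re = σ := by simp [hs]
  have him : s.im = t := by simp [hs]
  have hs1 : s ≠ 1 := fun h => by rw [h] at him; simp at him; linarith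
  have hF := lerchZeta_eq_lerchF hα hα1 lam (s := s) (by linarith) (by linarith)
  have hl := (tendsto_lerchF hα lam (s := s) (by linarith) hs1).sub
    (tendsto_lerchMain hα lam (s := s) (fun _ => by linarith) (by linarith))
  simp only [add_sub_cancel_right, sub_zero] at hl
  rw [← hF] at hl
  have hbd : ∀ N, 1 / 2 ≤ ‖lerchPartialSum lam α s (N + 1)‖ := by
    intro N
    rw [lerchPartialSum_eq, Finset.sum_range_succ']
    have h1 : 1 ≤ ‖lerchTerm lam α s 0‖ := by
      rw [norm_lerchTerm hα, hre, Nat.cast_zero, zero_add]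
      exact Real.one_le_rpow_of_pos_of_le_one_of_nonpos hα hα1 (by linarith)
    have h2 : ‖∑ n ∈ Finset.range N, lerchTerm lam α s (n + 1)‖ ≤ 1 / 2 := by
      have h3 : ∀ n ∈ Finset.range N, ‖lerchTerm lam α s (n + 1)‖ ≤
          ((1 + α) ^ (σ - 2))⁻¹ * (((n + 1 : ℕ) : ℝ) + α) ^ (-2 : ℝ) := by
        intro n _
        have hb := base_pos hα (n + 1)
        rw [norm_lerchTerm hα, hre, show -σ = -(σ - 2) + -2 by ring, Real.rpow_add hb,
          ← Real.rpow_neg (by linarith)]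
        refine mul_le_mul_of_nonneg_right (Real.rpow_le_rpow_of_nonpos (by linarith) ?_ (by linarith))
          (by positivity)
        push_cast
        linarith [(Nat.cast_nonneg n : (0 : ℝ) ≤ n)]
      refine (norm_sum_le_of_le _ h3).trans ?_
      rw [← Finset.mul_sum]
      have h4 : ∑ n ∈ Finset.range N, (((n + 1 : ℕ) : ℝ) + α) ^ (-2 : ℝ) ≤ S := by
        have h5 := hsum.sum_le_tsum (Finset.range (N + 1)) fun n _ => by
          have := base_pos hα n; positivity
        rw [Finset.sum_range_succ'] at h5
        have : 0 ≤ (((0 : ℕ) : ℝ) + α) ^ (-2 : ℝ) := by have := base_pos hα 0; positivity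
        linarith
      have h6 : 0 < (1 + α) ^ (σ - 2) := by positivity
      rw [inv_mul_le_iff₀ h6]
      linarith
    have h7 := norm_sub_norm_le (lerchTerm lam α s 0) (-∑ n ∈ Finset.range N, lerchTerm lam α s (n + 1))
    rw [sub_neg_eq_add, norm_neg, add_comm (lerchTerm lam α s 0)] at h7
    linarith
  exact ge_of_tendsto' ((tendsto_add_atTop_iff_nat 1).2 hl.norm) hbd

/-- The logarithm of the absolute value of the Lerch zeta-function, extended by zero. -/
def lerchLog (lam α : ℝ) (z : ℂ) : ℝ :=
  Real.log ‖indicator {s : ℂ | 0 < s.re ∧ 0 < s.im} (lerchZeta lam α) z‖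

theorem lerchLog_eq (lam α : ℝ) {z : ℂ} (h1 : 0 < z.re) (h2 : 0 < z.im) :
    lerchLog lam α z = Real.log ‖lerchZeta lam α z‖ := by
  rw [lerchLog, indicator_of_mem (show z ∈ {s : ℂ | 0 < s.re ∧ 0 < s.im} from ⟨h1, h2⟩)]

theorem isOpen_quadrant : IsOpen {s : ℂ | 0 < s.re ∧ 0 < s.im} :=
  (isOpen_lt continuous_const Complex.continuous_re).inter (isOpen_lt continuous_const Complex.continuous_im)

theorem measurable_lerchLog {α : ℝ} (hα : 0 < α) (hα1 : α ≤ 1) (lam : ℝ) :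
    Measurable (lerchLog lam α) := by
  classical
  refine Real.measurable_log.comp (Measurable.norm ?_)
  rw [← piecewise_eq_indicator]
  exact ContinuousOn.measurable_piecewise (analyticOnNhd_lerchZeta hα hα1 lam).continuousOn
    continuousOn_const isOpen_quadrant.measurableSet

theorem circleMap_eq (c t ρ θ : ℝ) :
    circleMap ((c : ℂ) + t * Complex.I) ρ θ =
      ((c + ρ * Real.cos θ : ℝ) : ℂ) + ((t + ρ * Real.sin θ : ℝ) : ℂ) * Complex.I := by
  rw [circleMap, Complex.exp_mul_I]
  push_cast
  ring

/-- Mean squares over circles with centres on a vertical segment. -/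
theorem integral_circleAverage_norm_sq_le {α : ℝ} (hα : 0 < α) (hα1 : α ≤ 1) (lam : ℝ) {a b C : ℝ}
    (ha : 1 / 2 < a)
    (hC : ∀ σ, a ≤ σ → σ ≤ b → ∀ t₀ T, 1 ≤ t₀ → t₀ ≤ T →
      ∫ t in t₀..T, ‖lerchZeta lam α (σ + t * Complex.I)‖ ^ 2 ≤ C * T)
    (hC0 : 0 ≤ C) {c ρ p q : ℝ} (hρ : 0 ≤ ρ) (hac : a ≤ c - ρ) (hcb : c + ρ ≤ b) (hp : 1 ≤ p - ρ) (hpq : p ≤ q) :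
    IntervalIntegrable (fun t : ℝ => Real.circleAverage (fun z => ‖lerchZeta lam α z‖ ^ 2)
      ((c : ℂ) + t * Complex.I) ρ) volume p q ∧
    ∫ t in p..q, Real.circleAverage (fun z => ‖lerchZeta lam α z‖ ^ 2) ((c : ℂ) + t * Complex.I) ρ ≤
      C * (q + ρ) := by
  have hπ := Real.two_pi_pos
  set G : ℝ → ℝ → ℝ := fun t θ => ‖lerchZeta lam α (circleMap ((c : ℂ) + t * Complex.I) ρ θ)‖ ^ 2 with hG
  have hcos : ∀ θ, |ρ * Real.cos θ| ≤ ρ := fun θ => by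
    rw [abs_mul, abs_of_nonneg hρ]; exact mul_le_of_le_one_right hρ (Real.abs_cos_le_one θ)
  have hsin : ∀ θ, |ρ * Real.sin θ| ≤ ρ := fun θ => by
    rw [abs_mul, abs_of_nonneg hρ]; exact mul_le_of_le_one_right hρ (Real.abs_sin_le_one θ)
  have hcont : ContinuousOn (Function.uncurry G) (Icc p q ×ˢ Icc 0 (2 * Real.pi)) := by
    refine ((analyticOnNhd_lerchZeta hα hα1 lam).continuousOn.comp
      (f := fun x : ℝ × ℝ => circleMap ((c : ℂ) + x.1 * Complex.I) ρ x.2)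
      (Continuous.continuousOn (by unfold circleMap; fun_prop)) ?_).norm.pow 2
    rintro ⟨t, θ⟩ ⟨ht, -⟩
    have h1 := (abs_le.1 (hcos θ)).1
    have h2 := (abs_le.1 (hsin θ)).1
    have h3 := ht.1
    simp only at h3
    simp only [circleMap_eq, mem_ofPred_eq, Complex.add_re, Complex.ofReal_re, Complex.mul_re,
      Complex.I_re, mul_zero, Complex.ofReal_im, Complex.I_im, sub_self, add_zero,
      Complex.add_im, Complex.mul_im, mul_one, zero_add]
    constructor <;> linarith
  have hint : Integrable (Function.uncurry G) ((volume.restrict (Ioc p q)).prod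
      (volume.restrict (Ioc 0 (2 * Real.pi)))) := by
    rw [Measure.prod_restrict, ← Measure.volume_eq_prod]
    exact (hcont.integrableOn_compact (isCompact_Icc.prod isCompact_Icc)).mono_set
      (prod_mono Ioc_subset_Icc_self Ioc_subset_Icc_self)
  have e0 : ∀ t : ℝ, Real.circleAverage (fun z => ‖lerchZeta lam α z‖ ^ 2) ((c : ℂ) + t * Complex.I) ρ =
      (2 * Real.pi)⁻¹ * ∫ θ in Ioc 0 (2 * Real.pi), G t θ := fun t => by
    rw [Real.circleAverage_def, intervalIntegral.integral_of_le hπ.le, smul_eq_mul]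
  simp only [e0]
  constructor
  · rw [intervalIntegrable_iff_integrableOn_Ioc_of_le hpq]
    exact (hint.integral_prod_left).const_mul _
  rw [intervalIntegral.integral_const_mul, intervalIntegral.integral_of_le hpq, integral_integral_swap hint,
    inv_mul_le_iff₀ hπ]
  have hle : ∀ θ, ∫ t in Ioc p q, G t θ ≤ C * (q + ρ) := by
    intro θ
    have h1 := abs_le.1 (hcos θ)
    have h2 := abs_le.1 (hsin θ)
    rw [← intervalIntegral.integral_of_le hpq]
    simp only [hG, circleMap_eq]
    rw [intervalIntegral.integral_comp_add_right (fun y : ℝ =>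
      ‖lerchZeta lam α (((c + ρ * Real.cos θ : ℝ) : ℂ) + (y : ℂ) * Complex.I)‖ ^ 2)]
    refine (hC _ (by linarith) (by linarith) _ _ (by linarith) (by linarith)).trans ?_
    gcongr
    linarith
  have h3 := setIntegral_mono_on (μ := volume) (hint.integral_prod_right)
    (integrableOn_const (C := C * (q + ρ)) measure_Ioc_lt_top.ne : IntegrableOn _ (Ioc 0 (2 * Real.pi)) volume)
    measurableSet_Ioc fun θ _ => hle θ
  refine h3.trans (le_of_eq ?_)
  rw [setIntegral_const, Real.volume_real_Ioc_of_le hπ.le, sub_zero, smul_eq_mul]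

/-- By Tonelli: each point of the rectangle lies in the discs about c + it for all t within ε of its
ordinate, a set of measure 2ε. The centres can thus be kept on a line where L is bounded below,
while the discs reach across the rectangle. -/
theorem lintegral_rect_le_lintegral_ball {F : ℂ → ENNReal} (hF : Measurable F) {a b t₁ T ε c r : ℝ}
    (hbc : b ≤ c) (hr : c - a + ε ≤ r) :
    ENNReal.ofReal (2 * ε) * ∫⁻ z in Icc a b ×ℂ Icc t₁ T, F z ≤
      ∫⁻ t in Icc (t₁ - ε) (T + ε), ∫⁻ z in ball ((c : ℂ) + t * Complex.I) r, F z := by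
  set B := Icc a b ×ℂ Icc t₁ T with hB
  have hBm : MeasurableSet B := (isCompact_Icc.reProdIm isCompact_Icc).measurableSet
  set W : Set (ℂ × ℝ) := {x | |x.2 - x.1.im| < ε} with hW
  have hWm : MeasurableSet W := measurableSet_lt (by fun_prop) measurable_const
  set k : ℂ → ℝ → ENNReal := fun z t => W.indicator (fun x => F x.1) (z, t) with hk
  have hkm : Measurable (Function.uncurry k) := (hF.comp measurable_fst).indicator hWm
  have e1 : ∫⁻ z in B, ∫⁻ t, k z t = ENNReal.ofReal (2 * ε) * ∫⁻ z in B, F z := by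
    rw [← lintegral_const_mul _ hF]
    refine lintegral_congr fun z => ?_
    have h2 : (fun t => k z t) = (ball z.im ε).indicator fun _ => F z := by
      funext t
      simp only [hk]
      by_cases hw : |t - z.im| < ε
      · rw [indicator_of_mem (show (z, t) ∈ W from hw), indicator_of_mem (by rwa [mem_ball, Real.dist_eq])]
      · rw [indicator_of_notMem (show (z, t) ∉ W from hw),
          indicator_of_notMem (by rwa [mem_ball, Real.dist_eq])]
    rw [h2, lintegral_indicator measurableSet_ball, setLIntegral_const, Real.volume_ball, mul_comm]
  rw [← e1, lintegral_lintegral_swap hkm.aemeasurable, ← lintegral_indicator measurableSet_Icc]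
  refine lintegral_mono fun t => ?_
  simp only
  by_cases ht : t ∈ Icc (t₁ - ε) (T + ε)
  · rw [indicator_of_mem ht, ← lintegral_indicator hBm, ← lintegral_indicator measurableSet_ball]
    refine lintegral_mono fun z => ?_
    simp only
    by_cases hz : z ∈ B
    · rw [indicator_of_mem hz]
      by_cases hw : (z, t) ∈ W
      · rw [indicator_of_mem (show z ∈ ball ((c : ℂ) + t * Complex.I) r from ?_)]
        · simp only [hk, indicator_of_mem hw]; exact le_rfl
        · have h2 : |t - z.im| < ε := hw
          rw [mem_ball, dist_eq_norm]
          refine (Complex.norm_le_abs_re_add_abs_im _).trans_lt ?_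
          simp only [Complex.sub_re, Complex.add_re, Complex.ofReal_re, Complex.mul_re, Complex.I_re,
            mul_zero, Complex.ofReal_im, Complex.I_im, sub_self, add_zero, Complex.sub_im, Complex.add_im,
            Complex.mul_im, mul_one, zero_add]
          rw [abs_sub_comm] at h2
          have h3 : a ≤ z.re ∧ z.re ≤ b := hz.1
          have h4 : |z.re - c| ≤ c - a := abs_le.2 ⟨by linarith [h3.1], by linarith [h3.2]⟩
          linarith
      · simp only [hk, indicator_of_notMem hw]; exact zero_le
    · rw [indicator_of_notMem hz]; exact zero_le
  · rw [indicator_of_notMem ht, nonpos_iff_eq_zero, ← lintegral_indicator hBm]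
    refine (lintegral_congr fun z => ?_).trans lintegral_zero
    by_cases hz : z ∈ B
    · rw [indicator_of_mem hz]
      refine indicator_of_notMem (fun hw => ht ?_) _
      have h2 : |t - z.im| < ε := hw
      have h3 : t₁ ≤ z.im ∧ z.im ≤ T := hz.2
      obtain ⟨h5, h6⟩ := abs_lt.1 h2
      constructor <;> linarith [h3.1, h3.2]
    · rw [indicator_of_notMem hz]

/-- A mean square bound for the logarithm of the Lerch zeta-function. -/
theorem exists_lintegral_lerchLog_sq_le {α : ℝ} (hα : 0 < α) (hα1 : α ≤ 1) (lam : ℝ) {a b : ℝ}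
    (ha : 1 / 2 < a) :
    ∃ C t₁ : ℝ, 0 ≤ C ∧ 1 ≤ t₁ ∧ ∀ T, t₁ ≤ T →
      ∫⁻ z in Icc a b ×ℂ Icc t₁ T, ENNReal.ofReal (lerchLog lam α z ^ 2) ≤ ENNReal.ofReal (C * T) := by
  obtain ⟨c₀, hc₀⟩ := exists_half_le_norm_lerchZeta hα hα1 lam
  set ε := (a - 1 / 2) / 4 with hε
  have hε0 : 0 < ε := by simp only [hε]; linarith
  -- The centres lie where ‖L‖ ≥ 1/2 and the discs of radius r reach past the left edge. The largest
  -- disc has left end a - 3ε > 1/2, inside the region of the mean square bounds. The choice c ≥ a +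
  -- 1 ensures R ≥ 1.
  set c := max (max c₀ b) (a + 1) with hc
  have hc1 : c₀ ≤ c := (le_max_left _ _).trans (le_max_left _ _)
  have hc2 : b ≤ c := (le_max_right _ _).trans (le_max_left _ _)
  have hc3 : a + 1 ≤ c := le_max_right _ _
  set r := c - a + ε with hr
  set R := r + ε with hR
  set R' := R + ε with hR'
  have hr0 : 0 < r := by linarith
  have ha' : 1 / 2 < c - R' := by linarith
  obtain ⟨C₁, hC₁, h₁⟩ := exists_integral_norm_sq_le hα hα1 lam ha' (by linarith : c - R' ≤ c + R')
  obtain ⟨C₂, hC₂, h₂⟩ := exists_lintegral_log_sq_le hr0 (by linarith : r < R) (by linarith)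
    (by linarith : R < R')
  set t₁ := R' + 1 + ε with ht₁
  refine ⟨(C₂ * ((Real.log 2 ^ 2 * (1 + ε) + C₁ * (1 + ε + R)) + C₁ * (1 + ε + R'))) / (2 * ε), t₁,
    by positivity, by linarith, fun T hT => ?_⟩
  set F : ℂ → ENNReal := fun z => ENNReal.ofReal (lerchLog lam α z ^ 2) with hF
  have hFm : Measurable F := ((measurable_lerchLog hα hα1 lam).pow_const 2).ennreal_ofReal
  set p := t₁ - ε with hp
  set q := T + ε with hq
  set ct : ℝ → ℂ := fun t => (c : ℂ) + t * Complex.I with hct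
  set S : ℝ → ℝ → ℝ := fun ρ t => Real.circleAverage (fun z => ‖lerchZeta lam α z‖ ^ 2) (ct t) ρ with hS
  have hloc : ∀ t, p ≤ t → ∫⁻ z in ball (ct t) r, F z ≤
      ENNReal.ofReal (C₂ * ((Real.log 2 ^ 2 + S R t) + S R' t)) := by
    intro t ht
    have hsub : closedBall (ct t) R' ⊆ {s : ℂ | 0 < s.re ∧ 0 < s.im} := by
      intro z hz
      rw [mem_closedBall, dist_eq_norm] at hz
      have h1 := abs_le.1 ((Complex.abs_re_le_norm _).trans hz)
      have h2 := abs_le.1 ((Complex.abs_im_le_norm _).trans hz)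
      simp only [hct, Complex.sub_re, Complex.add_re, Complex.ofReal_re, Complex.mul_re, Complex.I_re,
        mul_zero, Complex.ofReal_im, Complex.I_im, sub_self, add_zero, Complex.sub_im, Complex.add_im,
        Complex.mul_im, mul_one, zero_add] at h1 h2
      constructor <;> linarith
    have hlow := hc₀ c hc1 t (by linarith)
    have h3 := h₂ (lerchZeta lam α) (ct t) ((analyticOnNhd_lerchZeta hα hα1 lam).mono hsub)
      (fun h => by rw [show (c : ℂ) + t * Complex.I = ct t from rfl, h, norm_zero] at hlow; linarith)
      (Real.log 2) (by
        have := Real.log_le_log (by norm_num) hlow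
        rwa [one_div, Real.log_inv] at this)
    refine le_trans (le_of_eq ?_) h3
    refine setLIntegral_congr_fun measurableSet_ball fun z hz => ?_
    obtain ⟨h5, h6⟩ := hsub (ball_subset_closedBall (ball_subset_ball (by linarith : r ≤ R') hz))
    simp only [hF, lerchLog_eq lam α h5 h6]
  obtain ⟨i1, j1⟩ := integral_circleAverage_norm_sq_le hα hα1 lam ha' h₁ hC₁.le (c := c) (ρ := R) (p := p)
    (q := q) (by linarith) (by linarith) (by linarith) (by linarith) (by linarith)
  obtain ⟨i2, j2⟩ := integral_circleAverage_norm_sq_le hα hα1 lam ha' h₁ hC₁.le (c := c) (ρ := R') (p := p)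
    (q := q) (by linarith) (by linarith) (by linarith) (by linarith) (by linarith)
  have hpq : p ≤ q := by linarith
  have hi : IntervalIntegrable (fun t => C₂ * ((Real.log 2 ^ 2 + S R t) + S R' t)) volume p q :=
    ((intervalIntegrable_const.add i1).add i2).const_mul C₂
  have hS0 : ∀ ρ t, 0 ≤ S ρ t := fun ρ t => Real.circleAverage_nonneg_of_nonneg fun _ _ => sq_nonneg _
  have key := (lintegral_rect_le_lintegral_ball hFm (a := a) (t₁ := t₁) (T := T) hc2 (le_of_eq hr.symm)).trans
    (setLIntegral_mono' measurableSet_Icc fun t ht => hloc t ht.1)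
  rw [← restrict_Ioc_eq_restrict_Icc, ← ofReal_integral_eq_lintegral_ofReal
    ((intervalIntegrable_iff_integrableOn_Ioc_of_le hpq).1 hi)
    (Eventually.of_forall fun t => by have := hS0 R t; have := hS0 R' t; positivity),
    ← intervalIntegral.integral_of_le hpq] at key
  have e2 : ∫ t in p..q, C₂ * ((Real.log 2 ^ 2 + S R t) + S R' t) ≤
      C₂ * ((Real.log 2 ^ 2 * (q - p) + C₁ * (q + R)) + C₁ * (q + R')) := by
    rw [intervalIntegral.integral_const_mul, intervalIntegral.integral_add
      (intervalIntegrable_const.add i1) i2, intervalIntegral.integral_add intervalIntegrable_const i1,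
      intervalIntegral.integral_const, smul_eq_mul, mul_comm (q - p)]
    gcongr
  have h0 : ENNReal.ofReal (2 * ε) ≠ 0 := by
    rw [ne_eq, ENNReal.ofReal_eq_zero, not_le]; positivity
  rw [← ENNReal.mul_le_mul_iff_right h0 ENNReal.ofReal_ne_top, ← ENNReal.ofReal_mul (by positivity)]
  refine key.trans (ENNReal.ofReal_le_ofReal (e2.trans ?_))
  have hT1 : 1 ≤ T := by linarith
  have k1 : ε ≤ ε * T := le_mul_of_one_le_right hε0.le hT1
  have k2 : R ≤ R * T := le_mul_of_one_le_right (by linarith) hT1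
  have k3 : R' ≤ R' * T := le_mul_of_one_le_right (by linarith) hT1
  have hp0 : 0 ≤ p := by linarith
  have hqp : q - p ≤ (1 + ε) * T := by rw [add_mul, one_mul]; linarith
  have hqR : q + R ≤ (1 + ε + R) * T := by rw [add_mul, add_mul, one_mul]; linarith
  have hqR' : q + R' ≤ (1 + ε + R') * T := by rw [add_mul, add_mul, one_mul]; linarith
  calc C₂ * ((Real.log 2 ^ 2 * (q - p) + C₁ * (q + R)) + C₁ * (q + R'))
      ≤ C₂ * ((Real.log 2 ^ 2 * ((1 + ε) * T) + C₁ * ((1 + ε + R) * T)) + C₁ * ((1 + ε + R') * T)) := by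
        gcongr
    _ = _ := by
      have he : 2 * ε ≠ 0 := by positivity
      generalize 2 * ε = e at he ⊢
      field_simp

/-! ### The mean value of log |L| on vertical segments. -/

/-- The limit law of the Lerch zeta-function on the line `Re s = σ`. -/
def limitLaw (α σ : ℝ) : Measure ℂ := dzMeasure.withDensity fun z => ENNReal.ofReal (dens α 0 σ z)

theorem integrable_limitLaw_iff {α σ : ℝ} (hα : 0 < α) (hσ : 1 / 2 < σ) {f : ℂ → ℝ} :
    Integrable f (limitLaw α σ) ↔ Integrable fun z => dens α 0 σ z * f z := by
  rw [limitLaw, integrable_withDensity_iff_integrable_smul'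
    (continuous_dens hα hσ (by norm_num)).measurable.ennreal_ofReal
    (Eventually.of_forall fun _ => ENNReal.ofReal_lt_top), integrable_dzMeasure_iff]
  simp only [ENNReal.toReal_ofReal (dens_nonneg hα hσ _), smul_eq_mul]

theorem integral_limitLaw {α σ : ℝ} (hα : 0 < α) (hσ : 1 / 2 < σ) (f : ℂ → ℝ) :
    ∫ z, f z ∂(limitLaw α σ) = ∫ z, dens α 0 σ z * f z ∂dzMeasure := by
  rw [limitLaw, integral_withDensity_dens hα hσ, integral_dzMeasure, ← integral_smul]
  simp only [smul_eq_mul, mul_assoc]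

theorem integrable_sq_norm_mul_exp_neg : Integrable fun z : ℂ => ‖z‖ ^ 2 * Real.exp (-‖z‖) := by
  have h := (integrable_exp_neg_norm.comp_smul (by norm_num : (1 / 2 : ℝ) ≠ 0)).const_mul 8
  refine h.mono' (Continuous.aestronglyMeasurable (by fun_prop)) (Eventually.of_forall fun z => ?_)
  rw [norm_smul, Real.norm_of_nonneg (by positivity), Real.norm_of_nonneg (by positivity)]
  have h1 := Real.quadratic_le_exp_of_nonneg (by positivity : 0 ≤ 1 / 2 * ‖z‖)
  have h2 : Real.exp (-‖z‖) = Real.exp (-(1 / 2 * ‖z‖)) * Real.exp (-(1 / 2 * ‖z‖)) := by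
    rw [← Real.exp_add]; congr 1; ring
  have h3 : Real.exp (1 / 2 * ‖z‖) * Real.exp (-(1 / 2 * ‖z‖)) = 1 := by
    rw [← Real.exp_add, add_neg_cancel, Real.exp_zero]
  have h4 : ‖z‖ ^ 2 ≤ 8 * Real.exp (1 / 2 * ‖z‖) := by nlinarith [norm_nonneg z]
  calc ‖z‖ ^ 2 * Real.exp (-‖z‖) ≤ 8 * Real.exp (1 / 2 * ‖z‖) * Real.exp (-‖z‖) := by gcongr
    _ = 8 * (Real.exp (1 / 2 * ‖z‖) * Real.exp (-(1 / 2 * ‖z‖))) * Real.exp (-(1 / 2 * ‖z‖)) := by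
      rw [h2]; ring
    _ = _ := by rw [h3, mul_one]

/-- Moments of the limit laws. -/
theorem exists_limitLaw_moments {α a b : ℝ} (hα : 0 < α) (ha : 1 / 2 < a) (hab : a ≤ b) :
    ∃ K : ℝ, 0 ≤ K ∧ ∀ σ, a ≤ σ → σ ≤ b →
      Integrable (fun z : ℂ => ‖z‖ ^ 2) (limitLaw α σ) ∧ ∫ z, ‖z‖ ^ 2 ∂(limitLaw α σ) ≤ K ∧
      (∀ u : ℝ, 0 < u → ∫ z, Real.exp (-u * ‖z‖ ^ 2) ∂(limitLaw α σ) ≤ K / u) ∧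
      Integrable (fun z : ℂ => Real.log ‖z‖ ^ 2) (limitLaw α σ) ∧
      ∫ z, Real.log ‖z‖ ^ 2 ∂(limitLaw α σ) ≤ K := by
  obtain ⟨C, hC, h⟩ := exists_abs_dens_le hα ha hab
  obtain ⟨g, hg, hg'⟩ := integrable_of_abs_le_dens hα ha hab
  have hJ := (integrable_sq_norm_mul_exp_neg.const_mul C)
  set J := ∫ z : ℂ, C * (‖z‖ ^ 2 * Real.exp (-‖z‖)) ∂dzMeasure with hJd
  refine ⟨|J| + C + |∫ z, g z ∂dzMeasure|, by positivity, fun σ h1 h2 => ?_⟩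
  have hσ : 1 / 2 < σ := ha.trans_le h1
  have hd0 := dens_nonneg hα hσ
  have hd : ∀ z, dens α 0 σ z ≤ C * Real.exp (-‖z‖) := fun z =>
    (le_abs_self _).trans ((h σ h1 h2 z).1 0 (by norm_num))
  have hm := (continuous_dens hα hσ (by norm_num : 0 ≤ 3)).measurable
  have hgl : ∀ z, dens α 0 σ z * Real.log ‖z‖ ^ 2 ≤ g z := fun z => by
    have := hg' σ h1 h2 0 (by norm_num) z
    rw [abs_of_nonneg (hd0 z)] at this
    nlinarith [hd0 z]
  have hle2 : ∀ z, dens α 0 σ z * ‖z‖ ^ 2 ≤ C * (‖z‖ ^ 2 * Real.exp (-‖z‖)) := fun z => by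
    have := mul_le_mul_of_nonneg_right (hd z) (sq_nonneg ‖z‖)
    linarith
  have i2 : Integrable fun z => dens α 0 σ z * ‖z‖ ^ 2 :=
    hJ.mono' (by fun_prop) (Eventually.of_forall fun z => by
      rw [Real.norm_of_nonneg (mul_nonneg (hd0 z) (sq_nonneg _))]; exact hle2 z)
  have i3 : Integrable fun z => dens α 0 σ z * Real.log ‖z‖ ^ 2 :=
    (integrable_dzMeasure_iff.1 hg).mono' (by fun_prop) (Eventually.of_forall fun z => by
      rw [Real.norm_of_nonneg (mul_nonneg (hd0 z) (sq_nonneg _))]; exact hgl z)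
  refine ⟨(integrable_limitLaw_iff hα hσ).2 i2, ?_, fun u hu => ?_, (integrable_limitLaw_iff hα hσ).2 i3, ?_⟩
  · rw [integral_limitLaw hα hσ]
    have := integral_mono (integrable_dzMeasure_iff.2 i2) (integrable_dzMeasure_iff.2 hJ) hle2
    have := le_abs_self J
    have := abs_nonneg (∫ z, g z ∂dzMeasure)
    linarith
  · rw [integral_limitLaw hα hσ, integral_dzMeasure, smul_eq_mul]
    have hgi := integrable_exp_neg_mul_sq_norm hu
    have h3 : ∫ z, dens α 0 σ z * Real.exp (-u * ‖z‖ ^ 2) ≤ ∫ z : ℂ, C * Real.exp (-u * ‖z‖ ^ 2) := by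
      refine integral_mono_of_nonneg (Eventually.of_forall fun z => mul_nonneg (hd0 z) (Real.exp_pos _).le)
        (hgi.const_mul C) (Eventually.of_forall fun z => mul_le_mul_of_nonneg_right ?_ (Real.exp_pos _).le)
      refine (hd z).trans (mul_le_of_le_one_right hC.le ?_)
      rw [Real.exp_le_one_iff]; linarith [norm_nonneg z]
    rw [integral_const_mul, integral_exp_neg_mul_sq_norm hu] at h3
    have hπ := Real.pi_pos
    calc (2 * Real.pi)⁻¹ * ∫ z, dens α 0 σ z * Real.exp (-u * ‖z‖ ^ 2)
        ≤ (2 * Real.pi)⁻¹ * (C * (Real.pi / u)) := by gcongr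
      _ = C / 2 / u := by field_simp
      _ ≤ _ := by
        gcongr
        have := abs_nonneg J
        have := abs_nonneg (∫ z, g z ∂dzMeasure)
        linarith
  · rw [integral_limitLaw hα hσ]
    have := integral_mono (integrable_dzMeasure_iff.2 i3) hg hgl
    have := le_abs_self (∫ z, g z ∂dzMeasure)
    have := abs_nonneg J
    linarith

theorem ae_limitLaw_ne_zero (α σ : ℝ) : ∀ᵐ z ∂(limitLaw α σ), z ≠ 0 := by
  refine (withDensity_absolutelyContinuous _ _).ae_le ?_
  rw [dzMeasure]
  exact (Measure.smul_absolutelyContinuous).ae_le (Measure.ae_ne volume 0)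

/-- The scale used for averages up to height `T`. -/
theorem exists_scale {T : ℝ} (hT0 : 0 < T) (hT : (256 : ℝ) ^ 9 ≤ Real.log T) (q₀ : ℕ) (hq₀ : (q₀ : ℝ) ^ 9 ≤ Real.log T) :
    ∃ q : ℕ, q₀ ≤ q ∧ Real.exp ((q : ℝ) ^ 8) ≤ T ∧ T ≤ Real.exp ((q : ℝ) ^ 9) ∧
      ∃ d : ℝ, 0 < d ∧ d ≤ 1 / 2 ∧ (q : ℝ) * d ^ 8 = 1 ∧ √d ≤ Real.log T ^ (-(1 / 144) : ℝ) := by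
  set x := Real.log T with hx
  have hx0 : 0 < x := lt_of_lt_of_le (by norm_num) hT
  set y := x ^ (1 / 9 : ℝ) with hy
  have hy0 : 0 < y := by positivity
  have hy9 : y ^ 9 = x := by
    rw [hy, ← Real.rpow_natCast, ← Real.rpow_mul hx0.le]; norm_num
  have hy256 : 256 ≤ y := by
    by_contra hcon
    push Not at hcon
    have : y ^ 9 < 256 ^ 9 := by gcongr
    linarith
  have hq := Nat.le_ceil y
  have hq' := (Nat.ceil_lt_add_one hy0.le).le
  have hqp : (0 : ℝ) < ⌈y⌉₊ := hy0.trans_le hq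
  -- Here q = ⌈(log T)^(1/9)⌉. Rounding up costs at most 2⁸ = 256 in q⁸ ≤ log T, whence the
  -- threshold 256⁹. The choice d = q^(-1/8) gives √d = q^(-1/16) ≤ (log T)^(-1/144).
  refine ⟨⌈y⌉₊, ?_, ?_, ?_, ((⌈y⌉₊ : ℝ)⁻¹) ^ (1 / 8 : ℝ), by positivity, ?_, ?_, ?_⟩
  · have : (q₀ : ℝ) ≤ y := by
      by_contra hcon
      push Not at hcon
      have : y ^ 9 < (q₀ : ℝ) ^ 9 := by gcongr
      linarith
    exact_mod_cast this.trans hq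
  · rw [← Real.le_log_iff_exp_le hT0, ← hx, ← hy9]
    calc (⌈y⌉₊ : ℝ) ^ 8 ≤ (2 * y) ^ 8 := by gcongr; linarith
      _ = 256 * y ^ 8 := by ring
      _ ≤ y * y ^ 8 := by gcongr
      _ = y ^ 9 := by ring
  · rw [← Real.log_le_iff_le_exp hT0, ← hx, ← hy9]
    gcongr
  · have h1 : ((⌈y⌉₊ : ℝ)⁻¹) ≤ (1 / 256) := by
      rw [one_div]; exact inv_anti₀ (by norm_num) (hy256.trans hq)
    calc _ ≤ (1 / 256 : ℝ) ^ (1 / 8 : ℝ) := by gcongr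
      _ = ((1 / 2 : ℝ) ^ (8 : ℝ)) ^ (1 / 8 : ℝ) := by norm_num
      _ = 1 / 2 := by rw [← Real.rpow_mul (by norm_num)]; norm_num
  · rw [← Real.rpow_natCast, ← Real.rpow_mul (by positivity)]
    norm_num
    exact mul_inv_cancel₀ hqp.ne'
  · rw [Real.sqrt_eq_rpow, ← Real.rpow_mul (by positivity), Real.inv_rpow hqp.le, ← Real.rpow_neg hqp.le]
    calc (⌈y⌉₊ : ℝ) ^ (-(1 / 8 * (1 / 2)) : ℝ) ≤ y ^ (-(1 / 8 * (1 / 2)) : ℝ) :=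
          Real.rpow_le_rpow_of_nonpos hy0 hq (by norm_num)
      _ = _ := by rw [hy, ← Real.rpow_mul hx0.le]; norm_num

/-- The mean value of `log |L|` on a vertical segment. -/
theorem exists_abs_integral_log_norm_lerchZeta_sub_le {α : ℝ} (hα : α ∈ admissibleSet) (lam : ℝ) {a b : ℝ}
    (ha : 1 / 2 < a) (hab : a ≤ b) {t₀ : ℝ} (ht₀ : 1 ≤ t₀) :
    ∃ C T₀ : ℝ, 0 ≤ C ∧ t₀ < T₀ ∧ ∀ T, T₀ ≤ T → ∀ σ, a ≤ σ → σ ≤ b →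
      (∀ᵐ t : ℝ ∂(volume.restrict (Ioc t₀ T)), lerchZeta lam α (σ + t * Complex.I) ≠ 0) →
      IntervalIntegrable (fun t : ℝ => Real.log ‖lerchZeta lam α (σ + t * Complex.I)‖ ^ 2) volume t₀ T →
      |(∫ t in t₀..T, Real.log ‖lerchZeta lam α (σ + t * Complex.I)‖) - (T - t₀) * logMean α 0 σ| ≤
        Real.log T ^ (-(1 / 144) : ℝ) * (C * T +
          ∫ t in t₀..T, Real.log ‖lerchZeta lam α (σ + t * Complex.I)‖ ^ 2) := by
  have hα0 := hα.1.1
  have hα1 := hα.1.2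
  obtain ⟨C₀, hC₀, q₀, h₀⟩ := exists_norm_integral_phase_sub_mgf_le hα lam ha hab ht₀
  obtain ⟨K, hK, hν⟩ := exists_limitLaw_moments hα0 ha hab
  obtain ⟨C₂, hC₂, h₂⟩ := exists_integral_norm_sq_le hα0 hα1 lam ha hab
  -- For T ≥ 2t₀ the normalized mean square is at most C₂T/(T - t₀) ≤ 2C₂.
  set B := K + 2 * C₂ with hB
  refine ⟨B + 7 * C₀ + 9 + 6 * K + K,
    max (2 * t₀) (Real.exp (max ((256 : ℝ) ^ 9) ((q₀ : ℝ) ^ 9))), by positivity,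
    lt_of_lt_of_le (by linarith) (le_max_left _ _), fun T hT σ h1 h2 hne hlog => ?_⟩
  have hσ : 1 / 2 < σ := ha.trans_le h1
  have hT2 : 2 * t₀ ≤ T := (le_max_left _ _).trans hT
  have hT3 : t₀ < T := by linarith
  have hT0 : 0 < T := by linarith
  have hlT : max ((256 : ℝ) ^ 9) ((q₀ : ℝ) ^ 9) ≤ Real.log T :=
    (Real.le_log_iff_exp_le hT0).2 ((le_max_right _ _).trans hT)
  obtain ⟨q, hq₀, hq1, hq2, d, hd0, hd2, hqd, hd⟩ := exists_scale hT0 ((le_max_left _ _).trans hlT) q₀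
    ((le_max_right _ _).trans hlT)
  have := isProbabilityMeasure_timeMeasure hT3
  have : IsProbabilityMeasure (limitLaw α σ) := isProbabilityMeasure_dens hα0 hσ
  set ψ : ℝ → ℂ := fun t => lerchZeta lam α (σ + t * Complex.I) with hψ
  have hcont : ContinuousOn ψ (uIcc t₀ T) :=
    (continuousOn_lerchZeta_line hα0 hα1 lam (by linarith)).mono (uIcc_subset_Ioi_zero ht₀ hT3.le)
  have hmeas : AEMeasurable ψ (timeMeasure t₀ T) := by
    rw [timeMeasure]
    refine AEMeasurable.smul_measure ?_ _
    refine (hcont.mono ?_).aemeasurable measurableSet_Ioc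
    rw [uIcc_of_le hT3.le]; exact Ioc_subset_Icc_self
  set μ : Measure ℂ := Measure.map ψ (timeMeasure t₀ T) with hμ
  have : IsProbabilityMeasure μ := Measure.isProbabilityMeasure_map hmeas
  have hTinv : 0 < (T - t₀)⁻¹ := inv_pos.2 (by linarith)
  have himap : ∀ f : ℂ → ℝ, Measurable f → ∫ z, f z ∂μ = (T - t₀)⁻¹ * ∫ t in t₀..T, f (ψ t) := by
    intro f hf
    rw [hμ, integral_map hmeas hf.aestronglyMeasurable, integral_timeMeasure hT3, smul_eq_mul]
  have hinmap : ∀ f : ℂ → ℝ, Measurable f → IntervalIntegrable (fun t => f (ψ t)) volume t₀ T →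
      Integrable f μ := by
    intro f hf hi
    exact (integrable_map_measure hf.aestronglyMeasurable hmeas).2 (integrable_timeMeasure hT3 hi)
  obtain ⟨n1, n2, n3, n4, n5⟩ := hν σ h1 h2
  have m1 : Integrable (fun z : ℂ => ‖z‖ ^ 2) μ :=
    hinmap _ (by fun_prop) ((hcont.norm.pow 2).intervalIntegrable)
  have m2 : ∫ z, ‖z‖ ^ 2 ∂μ ≤ B := by
    rw [himap _ (by fun_prop), inv_mul_le_iff₀ (by linarith)]
    refine (h₂ σ h1 h2 t₀ T ht₀ hT3.le).trans ?_
    nlinarith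
  have m3 : ∀ᵐ z ∂μ, z ≠ 0 := by
    refine (ae_map_iff hmeas (measurableSet_singleton (0 : ℂ)).compl).2 ?_
    rw [timeMeasure]
    exact (Measure.smul_absolutelyContinuous).ae_le hne
  have m4 : Integrable (fun z : ℂ => Real.log ‖z‖ ^ 2) μ := hinmap _ (by fun_prop) hlog
  have hft : ∀ w : ℂ, ‖w‖ ≤ q → ‖measFT μ w - measFT (limitLaw α σ) w‖ ≤ C₀ * ((q : ℝ) ^ 4)⁻¹ := by
    intro w hw
    have h5 := h₀ q hq₀ T hq1 hq2 σ h1 h2 w hw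
    have e1 : measFT μ w = ∫ t, phase (-2 * Real.pi * inner ℝ (lerchZeta lam α (σ + t * Complex.I)) w)
        ∂(timeMeasure t₀ T) := by
      rw [measFT, hμ, integral_map hmeas (Continuous.aestronglyMeasurable (by fun_prop))]
      rfl
    rw [e1, limitLaw, measFT_dens hα0 hσ]
    exact h5
  have main := abs_integral_log_norm_sub_le hC₀.le hd0 hd2 hqd hft m1 n1 m2
    (n2.trans (by linarith)) n3 m3 (ae_limitLaw_ne_zero α σ) m4 n4
  have e2 : ∫ z, Real.log ‖z‖ ∂(limitLaw α σ) = logMean α 0 σ := by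
    rw [integral_limitLaw hα0 hσ, logMean]
    simp only [mul_comm]
  rw [himap _ measurable_log_norm, himap _ (by fun_prop), e2] at main
  set P := ∫ t in t₀..T, Real.log ‖ψ t‖ with hP
  set Q := ∫ t in t₀..T, Real.log ‖ψ t‖ ^ 2 with hQ
  have hQ0 : 0 ≤ Q := intervalIntegral.integral_nonneg hT3.le fun t _ => sq_nonneg _
  have hTt : 0 < T - t₀ := by linarith
  have e3 : P - (T - t₀) * logMean α 0 σ = (T - t₀) * ((T - t₀)⁻¹ * P - logMean α 0 σ) := by
    field_simp
  rw [e3, abs_mul, abs_of_pos hTt]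
  have hlp : 0 ≤ Real.log T ^ (-(1 / 144) : ℝ) := (Real.sqrt_nonneg d).trans hd
  calc (T - t₀) * |(T - t₀)⁻¹ * P - logMean α 0 σ|
      ≤ (T - t₀) * (√d * (B + 7 * C₀ + 9 + 6 * K + (T - t₀)⁻¹ * Q + ∫ z, Real.log ‖z‖ ^ 2 ∂(limitLaw α σ))) := by
        gcongr
    _ ≤ (T - t₀) * (Real.log T ^ (-(1 / 144) : ℝ) * (B + 7 * C₀ + 9 + 6 * K + (T - t₀)⁻¹ * Q + K)) := by
        gcongr
    _ = Real.log T ^ (-(1 / 144) : ℝ) * ((B + 7 * C₀ + 9 + 6 * K + K) * (T - t₀) + Q) := by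
        field_simp; ring
    _ ≤ _ := by
        gcongr
        linarith

theorem isPreconnected_quadrant : IsPreconnected {s : ℂ | 0 < s.re ∧ 0 < s.im} :=
  ((convex_halfSpace_re_gt 0).inter (convex_halfSpace_im_gt 0)).isPreconnected

theorem eventually_codiscreteWithin_lerchZeta_ne_zero {α : ℝ} (hα : 0 < α) (hα1 : α ≤ 1) (lam : ℝ) :
    ∀ᶠ z in codiscreteWithin {s : ℂ | 0 < s.re ∧ 0 < s.im}, lerchZeta lam α z ≠ 0 := by
  rcases (analyticOnNhd_lerchZeta hα hα1 lam).eqOn_zero_or_eventually_ne_zero_of_preconnected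
    isPreconnected_quadrant with h | h
  · exfalso
    obtain ⟨c₀, hc₀⟩ := exists_half_le_norm_lerchZeta hα hα1 lam
    have h1 := hc₀ (max c₀ 1) (le_max_left _ _) 1 one_pos
    have h2 : lerchZeta lam α ((max c₀ 1 : ℝ) + (1 : ℝ) * Complex.I) = 0 := h (by
      have : 0 < max c₀ 1 := lt_of_lt_of_le one_pos (le_max_right _ _)
      simp [this])
    rw [h2, norm_zero] at h1
    norm_num at h1
  · exact h

theorem ae_ae_lerchZeta_ne_zero {α : ℝ} (hα : 0 < α) (hα1 : α ≤ 1) (lam : ℝ) :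
    ∀ᵐ σ : ℝ, ∀ᵐ t : ℝ, 0 < σ → 0 < t → lerchZeta lam α (σ + t * Complex.I) ≠ 0 := by
  have h1 : ∀ᵐ z : ℂ, z ∈ {s : ℂ | 0 < s.re ∧ 0 < s.im} → lerchZeta lam α z ≠ 0 :=
    (ae_restrict_iff' isOpen_quadrant.measurableSet).1
      (ae_restrict_le_codiscreteWithin isOpen_quadrant.measurableSet
        (eventually_codiscreteWithin_lerchZeta_ne_zero hα hα1 lam))
  have h2 := Complex.volume_preserving_equiv_real_prod.symm.quasiMeasurePreserving.ae h1
  rw [Measure.volume_eq_prod] at h2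
  filter_upwards [Measure.ae_ae_of_ae_prod h2] with σ hσ
  filter_upwards [hσ] with t ht h3 h4
  have e : Complex.measurableEquivRealProd.symm (σ, t) = σ + t * Complex.I := by
    rw [Complex.measurableEquivRealProd_symm_apply, Complex.mk_eq_add_mul_I]
  rw [e] at ht
  exact ht (by simp [h3, h4])

theorem setLIntegral_reProdIm (F : ℂ → ENNReal) (a b c d : ℝ) :
    ∫⁻ z in Icc a b ×ℂ Icc c d, F z = ∫⁻ x : ℝ × ℝ, F (x.1 + x.2 * Complex.I)
      ∂((volume.restrict (Ioc a b)).prod (volume.restrict (Ioc c d))) := by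
  rw [← Complex.volume_preserving_equiv_real_prod.symm.setLIntegral_comp_preimage_emb
    (MeasurableEquiv.measurableEmbedding _), restrict_Ioc_eq_restrict_Icc, restrict_Ioc_eq_restrict_Icc,
    Measure.prod_restrict, ← Measure.volume_eq_prod]
  have e : Complex.measurableEquivRealProd.symm ⁻¹' (Icc a b ×ℂ Icc c d) = Icc a b ×ˢ Icc c d := rfl
  rw [e]
  refine lintegral_congr fun x => ?_
  rw [Complex.measurableEquivRealProd_symm_apply, Complex.mk_eq_add_mul_I]

theorem measurable_lerchLog_prod {α : ℝ} (hα : 0 < α) (hα1 : α ≤ 1) (lam : ℝ) :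
    Measurable fun x : ℝ × ℝ => lerchLog lam α (x.1 + x.2 * Complex.I) :=
  (measurable_lerchLog hα hα1 lam).comp (by fun_prop)

theorem exists_integral_lerchLog_sq_le {α : ℝ} (hα : 0 < α) (hα1 : α ≤ 1) (lam : ℝ) {a b : ℝ}
    (ha : 1 / 2 < a) :
    ∃ C t₁ : ℝ, 0 ≤ C ∧ 1 ≤ t₁ ∧ ∀ T, t₁ ≤ T →
      Integrable (fun x : ℝ × ℝ => lerchLog lam α (x.1 + x.2 * Complex.I) ^ 2)
        ((volume.restrict (Ioc a b)).prod (volume.restrict (Ioc t₁ T))) ∧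
      ∫ x : ℝ × ℝ, lerchLog lam α (x.1 + x.2 * Complex.I) ^ 2
        ∂((volume.restrict (Ioc a b)).prod (volume.restrict (Ioc t₁ T))) ≤ C * T := by
  obtain ⟨C, t₁, hC, ht₁, h⟩ := exists_lintegral_lerchLog_sq_le hα hα1 lam ha
  refine ⟨C, t₁, hC, ht₁, fun T hT => ?_⟩
  have h1 := h T hT
  rw [setLIntegral_reProdIm] at h1
  have hm := (measurable_lerchLog_prod hα hα1 lam).pow_const 2
  constructor
  · refine ⟨hm.aestronglyMeasurable, ?_⟩
    rw [hasFiniteIntegral_iff_ofReal (Eventually.of_forall fun x => sq_nonneg _)]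
    exact h1.trans_lt ENNReal.ofReal_lt_top
  · rw [integral_eq_lintegral_of_nonneg_ae (Eventually.of_forall fun x => sq_nonneg _)
      hm.aestronglyMeasurable]
    exact ENNReal.toReal_le_of_le_ofReal (mul_nonneg hC (by linarith)) h1

/-- The mean value of `log |L|` on vertical segments, on average over the abscissa. -/
theorem exists_integral_abs_integral_lerchLog_sub_le {α : ℝ} (hα : α ∈ admissibleSet) (lam : ℝ) {a b : ℝ}
    (ha : 1 / 2 < a) (hab : a ≤ b) :
    ∃ C t₁ T₀ : ℝ, 0 ≤ C ∧ 1 ≤ t₁ ∧ t₁ < T₀ ∧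
      (∀ T, t₁ ≤ T → Integrable (fun x : ℝ × ℝ => lerchLog lam α (x.1 + x.2 * Complex.I))
        ((volume.restrict (Ioc a b)).prod (volume.restrict (Ioc t₁ T)))) ∧
      ∀ T, T₀ ≤ T → ∫ σ in a..b, |(∫ t in t₁..T, lerchLog lam α (σ + t * Complex.I)) -
          (T - t₁) * logMean α 0 σ| ≤ C * (T * Real.log T ^ (-(1 / 144) : ℝ)) := by
  have hα0 := hα.1.1
  have hα1 := hα.1.2
  obtain ⟨C₁, t₁, hC₁, ht₁, h₁⟩ := exists_integral_lerchLog_sq_le hα0 hα1 lam ha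
  obtain ⟨C₂, T₀, hC₂, hT₀, h₂⟩ := exists_abs_integral_log_norm_lerchZeta_sub_le hα lam ha hab ht₁
  have hm := measurable_lerchLog_prod hα0 hα1 lam
  refine ⟨(b - a) * C₂ + C₁, t₁, T₀, by nlinarith, ht₁, hT₀, fun T hT => ?_, fun T hT => ?_⟩
  · refine ((integrable_const (1 : ℝ)).add (h₁ T hT).1).mono' hm.aestronglyMeasurable
      (Eventually.of_forall fun x => ?_)
    rw [Real.norm_eq_abs, Pi.add_apply]
    rw [← sq_abs]; nlinarith [sq_nonneg (|lerchLog lam α (x.1 + x.2 * Complex.I)| - 1),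
      abs_nonneg (lerchLog lam α (x.1 + x.2 * Complex.I))]
  have hT1 : t₁ < T := hT₀.trans_le hT
  have hT0 : 0 < T := by linarith
  obtain ⟨hi, hb⟩ := h₁ T hT1.le
  set X := Real.log T ^ (-(1 / 144) : ℝ) with hX
  have hX0 : 0 ≤ X := Real.rpow_nonneg (Real.log_nonneg (by linarith)) _
  rw [integral_prod _ hi] at hb
  -- The bound on a single line contains the mean square of log |L| on that line, which is
  -- controlled only after integration over σ.
  have hpt : ∀ᵐ σ : ℝ ∂(volume.restrict (Ioc a b)), |(∫ t in t₁..T, lerchLog lam α (σ + t * Complex.I)) -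
      (T - t₁) * logMean α 0 σ| ≤ X * (C₂ * T +
        ∫ t in Ioc t₁ T, lerchLog lam α (σ + t * Complex.I) ^ 2) := by
    filter_upwards [ae_restrict_of_ae (ae_ae_lerchZeta_ne_zero hα0 hα1 lam), hi.prod_right_ae,
      ae_restrict_mem measurableSet_Ioc] with σ h3 h4 hσ
    have hσ0 : 0 < σ := by linarith [hσ.1]
    have hcongr : ∀ t ∈ Ioc t₁ T, lerchLog lam α (σ + t * Complex.I) =
        Real.log ‖lerchZeta lam α (σ + t * Complex.I)‖ := fun t ht =>
      lerchLog_eq lam α (by simpa using hσ0) (by simpa using (by linarith [ht.1] : 0 < t))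
    have h5 := h₂ T hT σ hσ.1.le hσ.2 (by
      filter_upwards [ae_restrict_of_ae h3, ae_restrict_mem measurableSet_Ioc] with t h6 ht
      exact h6 hσ0 (by linarith [ht.1]))
      ((intervalIntegrable_iff_integrableOn_Ioc_of_le hT1.le).2
        (IntegrableOn.congr_fun h4 (fun t ht => by simp only [hcongr t ht]) measurableSet_Ioc))
    rw [intervalIntegral.integral_of_le hT1.le, intervalIntegral.integral_of_le hT1.le] at h5
    have h7 : ∫ t in Ioc t₁ T, lerchLog lam α (σ + t * Complex.I) ^ 2 =
        ∫ t in Ioc t₁ T, Real.log ‖lerchZeta lam α (σ + t * Complex.I)‖ ^ 2 :=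
      setIntegral_congr_fun measurableSet_Ioc fun t ht => by simp only [hcongr t ht]
    rw [intervalIntegral.integral_of_le hT1.le, setIntegral_congr_fun measurableSet_Ioc hcongr, h7]
    exact h5
  have hi2 : Integrable (fun σ : ℝ => X * (C₂ * T +
      ∫ t in Ioc t₁ T, lerchLog lam α (σ + t * Complex.I) ^ 2)) (volume.restrict (Ioc a b)) :=
    ((integrable_const _).add hi.integral_prod_left).const_mul X
  rw [intervalIntegral.integral_of_le hab]
  refine (integral_mono_of_nonneg (Eventually.of_forall fun σ => abs_nonneg _) hi2 hpt).trans ?_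
  rw [integral_const_mul, integral_add (integrable_const _) hi.integral_prod_left, setIntegral_const,
    Real.volume_real_Ioc_of_le hab, smul_eq_mul]
  calc _ ≤ X * ((b - a) * (C₂ * T) + C₁ * T) := by gcongr
    _ = _ := by ring

/-! ### Jensen's formula averaged over the centres of the circles. -/

open Metric MeromorphicOn

theorem integral_mul_log_div {r : ℝ} (hr : 0 < r) :
    ∫ y in (0 : ℝ)..r, y * Real.log (r * y⁻¹) = r ^ 2 / 4 := by
  have h := intervalIntegral.integral_eq_sub_of_hasDerivAt_of_le hr.le
    (f := fun y => y ^ 2 / 2 * Real.log r - y * (y * Real.log y) / 2 + y ^ 2 / 4)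
    (f' := fun y => y * Real.log r - y * Real.log y)
    (Continuous.continuousOn (by
      have := Real.continuous_mul_log
      fun_prop)) (fun y hy => by
      have h1 := Real.hasDerivAt_mul_log hy.1.ne'
      have h2 := (((hasDerivAt_pow 2 y).div_const 2).mul_const (Real.log r)).sub
        (((hasDerivAt_id y).mul h1).div_const 2) |>.add ((hasDerivAt_pow 2 y).div_const 4)
      refine h2.congr_deriv ?_
      simp only [id_eq]
      push_cast
      ring) (Continuous.intervalIntegrable (by
      have := Real.continuous_mul_log
      fun_prop) _ _)
  have e : ∫ y in (0 : ℝ)..r, y * Real.log (r * y⁻¹) = ∫ y in (0 : ℝ)..r, (y * Real.log r - y * Real.log y) := by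
    refine intervalIntegral.integral_congr_ae (Eventually.of_forall fun y hy => ?_)
    rw [uIoc_of_le hr.le] at hy
    rw [Real.log_mul hr.ne' (inv_ne_zero hy.1.ne'), Real.log_inv]
    ring
  rw [e, h]
  ring

/-- The integral of the logarithmic potential of a disc. -/
theorem integral_posLog_mul_inv_norm {r : ℝ} (hr : 0 < r) :
    Integrable (fun z : ℂ => Real.posLog (r * ‖z‖⁻¹)) ∧
      ∫ z : ℂ, Real.posLog (r * ‖z‖⁻¹) = Real.pi * r ^ 2 / 2 := by
  have hpos : ∀ y ∈ Ioi (0 : ℝ), y * Real.posLog (r * y⁻¹) =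
      indicator (Ioc 0 r) (fun y => y * Real.log (r * y⁻¹)) y := by
    intro y hy
    have hy : 0 < y := hy
    have h0 : 0 < r * y⁻¹ := by positivity
    by_cases h : y ≤ r
    · rw [indicator_of_mem (show y ∈ Ioc 0 r from ⟨hy, h⟩), Real.posLog_eq_log]
      rw [abs_of_pos h0, ← div_eq_mul_inv]
      exact (one_le_div hy).2 h
    · rw [indicator_of_notMem (fun hm => h hm.2), (Real.posLog_eq_zero_iff _).2, mul_zero]
      rw [abs_of_pos h0, ← div_eq_mul_inv]
      exact (div_le_one hy).2 (not_le.1 h).le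
  have hint : IntegrableOn (fun y => y * Real.log (r * y⁻¹)) (Ioc 0 r) := by
    have h1 : IntegrableOn (fun y => y * Real.log r - y * Real.log y) (Ioc 0 r) :=
      ((Continuous.continuousOn (by have := Real.continuous_mul_log; fun_prop)).integrableOn_compact
        (isCompact_Icc (a := (0 : ℝ)) (b := r))).mono_set Ioc_subset_Icc_self
    refine h1.congr_fun (fun y hy => ?_) measurableSet_Ioc
    simp only
    rw [Real.log_mul hr.ne' (inv_ne_zero hy.1.ne'), Real.log_inv]
    ring
  constructor
  · rw [integrable_fun_norm_addHaar (volume : Measure ℂ) (f := fun y => Real.posLog (r * y⁻¹)),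
      Complex.finrank_real_complex]
    simp only [Nat.add_one_sub_one, pow_one, smul_eq_mul]
    refine IntegrableOn.congr_fun ?_ (fun y hy => (hpos y hy).symm) measurableSet_Ioi
    exact (((integrable_indicator_iff measurableSet_Ioc).2 hint)).integrableOn
  · rw [integral_fun_norm_addHaar (volume : Measure ℂ) (fun y => Real.posLog (r * y⁻¹)),
      Complex.finrank_real_complex]
    simp only [Nat.add_one_sub_one, pow_one, smul_eq_mul]
    rw [setIntegral_congr_fun measurableSet_Ioi hpos, setIntegral_indicator measurableSet_Ioc,
      inter_eq_self_of_subset_right Ioc_subset_Ioi_self, ← intervalIntegral.integral_of_le hr.le,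
      integral_mul_log_div hr, Measure.real, Complex.volume_ball]
    simp
    ring

theorem finite_inter_zeros {f : ℂ → ℂ} {U K : Set ℂ} (hf : AnalyticOnNhd ℂ f U) (hU : IsPreconnected U)
    {x : ℂ} (hx : x ∈ U) (hfx : f x ≠ 0) (hK : IsCompact K) (hKU : K ⊆ U) : {z | z ∈ K ∧ f z = 0}.Finite := by
  by_contra hinf
  obtain ⟨y, hy, hacc⟩ := Set.Infinite.exists_accPt_of_subset_isCompact hinf hK fun z hz => hz.1
  refine hfx (hf.eqOn_zero_of_preconnected_of_frequently_eq_zero hU (hKU hy) ?_ hx)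
  exact (accPt_iff_frequently_nhdsNE.1 hacc).mono fun z hz => hz.2

/-- Jensen's formula at a point, with the zeros taken from a fixed finite set. -/
theorem circleAverage_log_norm_sub_eq_sum {f : ℂ → ℂ} {z : ℂ} {r : ℝ} (hr : 0 < r)
    (hf : AnalyticOnNhd ℂ f (closedBall z r)) (hz : f z ≠ 0) {Z : Finset ℂ}
    (hZ : ∀ ρ ∈ closedBall z r, f ρ = 0 → ρ ∈ Z) (hZ0 : ∀ ρ ∈ Z, f ρ = 0) :
    Real.circleAverage (fun w => Real.log ‖f w‖) z r - Real.log ‖f z‖ =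
      ∑ ρ ∈ Z, (analyticOrderNatAt f ρ : ℝ) * Real.posLog (r * ‖z - ρ‖⁻¹) := by
  have habs : |r| = r := abs_of_pos hr
  rw [AnalyticOnNhd.circleAverage_log_norm hr.ne' (by rwa [habs]) hz, habs, add_sub_cancel_right,
    finsum_eq_sum_of_support_subset (s := Z)]
  · refine Finset.sum_congr rfl fun ρ hρ => ?_
    have hne : 0 < ‖z - ρ‖ := norm_pos_iff.2 (sub_ne_zero.2 fun h => hz (h ▸ hZ0 ρ hρ))
    have h0 : 0 < r * ‖z - ρ‖⁻¹ := by positivity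
    by_cases h : ρ ∈ closedBall z r
    · rw [hf.divisor_apply h, Real.posLog_eq_log]
      · rw [analyticOrderNatAt]
        cases analyticOrderAt f ρ <;> simp
      · rw [abs_of_pos h0, ← div_eq_mul_inv, one_le_div hne]
        rwa [mem_closedBall, dist_eq_norm'] at h
    · rw [Function.locallyFinsuppWithin.apply_eq_zero_of_notMem _ h, (Real.posLog_eq_zero_iff _).2]
      · simp
      · rw [abs_of_pos h0, ← div_eq_mul_inv, div_le_one hne]
        rw [mem_closedBall, dist_eq_norm', not_le] at h
        exact h.le
  · intro ρ hρ
    have hD : divisor f (closedBall z r) ρ ≠ 0 := by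
      intro h
      apply hρ
      simp [h]
    have hmem : ρ ∈ closedBall z r := by
      by_contra hcon
      exact hD (Function.locallyFinsuppWithin.apply_eq_zero_of_notMem _ hcon)
    refine hZ ρ hmem ?_
    by_contra hcon
    apply hD
    rw [hf.divisor_apply hmem, (hf ρ hmem).analyticOrderAt_eq_zero.2 hcon]
    simp

open Metric

theorem setIntegral_reProdIm (F : ℂ → ℝ) (a b c d : ℝ) :
    ∫ z in Icc a b ×ℂ Icc c d, F z = ∫ x in Ioc a b ×ˢ Ioc c d, F ((x.1 : ℝ) + (x.2 : ℝ) * Complex.I) := by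
  rw [← Complex.volume_preserving_equiv_real_prod.symm.setIntegral_preimage_emb
    (MeasurableEquiv.measurableEmbedding _)]
  have e : Complex.measurableEquivRealProd.symm ⁻¹' (Icc a b ×ℂ Icc c d) = Icc a b ×ˢ Icc c d := rfl
  have e2 : (volume : Measure (ℝ × ℝ)).restrict (Icc a b ×ˢ Icc c d) =
      (volume : Measure (ℝ × ℝ)).restrict (Ioc a b ×ˢ Ioc c d) := by
    rw [Measure.volume_eq_prod, ← Measure.prod_restrict, ← Measure.prod_restrict,
      restrict_Ioc_eq_restrict_Icc, restrict_Ioc_eq_restrict_Icc]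
  rw [e, e2]
  refine integral_congr_ae (Eventually.of_forall fun x => ?_)
  simp only
  rw [Complex.measurableEquivRealProd_symm_apply, Complex.mk_eq_add_mul_I]

theorem preimage_add_prod_Ioc (p q c d : ℝ) (h : ℝ × ℝ) :
    (fun x : ℝ × ℝ => x + h) ⁻¹' (Ioc (p + h.1) (q + h.1) ×ˢ Ioc (c + h.2) (d + h.2)) =
      Ioc p q ×ˢ Ioc c d := by
  ext x
  simp

theorem setIntegral_add_prod (V : ℝ × ℝ → ℝ) (p q c d : ℝ) (h : ℝ × ℝ) :
    ∫ x in Ioc p q ×ˢ Ioc c d, V (x + h) =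
      ∫ y in Ioc (p + h.1) (q + h.1) ×ˢ Ioc (c + h.2) (d + h.2), V y := by
  have h1 := (measurePreserving_add_right (volume : Measure (ℝ × ℝ)) h).setIntegral_preimage_emb
    (measurableEmbedding_addRight h) V (Ioc (p + h.1) (q + h.1) ×ˢ Ioc (c + h.2) (d + h.2))
  rw [preimage_add_prod_Ioc] at h1
  exact h1

theorem integrableOn_add_prod {V : ℝ × ℝ → ℝ} {p q c d : ℝ} {h : ℝ × ℝ}
    (hV : IntegrableOn V (Ioc (p + h.1) (q + h.1) ×ˢ Ioc (c + h.2) (d + h.2))) :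
    IntegrableOn (fun x => V (x + h)) (Ioc p q ×ˢ Ioc c d) := by
  rw [← (measurePreserving_add_right (volume : Measure (ℝ × ℝ)) h).integrableOn_comp_preimage
    (measurableEmbedding_addRight h), preimage_add_prod_Ioc] at hV
  exact hV

theorem abs_mul_cos_le {r : ℝ} (hr : 0 ≤ r) (θ : ℝ) : |r * Real.cos θ| ≤ r := by
  rw [abs_mul, abs_of_nonneg hr]; exact mul_le_of_le_one_right hr (Real.abs_cos_le_one θ)

theorem abs_mul_sin_le {r : ℝ} (hr : 0 ≤ r) (θ : ℝ) : |r * Real.sin θ| ≤ r := by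
  rw [abs_mul, abs_of_nonneg hr]; exact mul_le_of_le_one_right hr (Real.abs_sin_le_one θ)

/-- The integral over a rectangle of the circle averages of a function. -/
theorem setIntegral_circle_average {V : ℝ × ℝ → ℝ} (hVm : Measurable V) {p q c d r : ℝ} (hr : 0 ≤ r)
    (hV : IntegrableOn V (Ioc (p - r) (q + r) ×ˢ Ioc (c - r) (d + r))) :
    IntegrableOn (fun x : ℝ × ℝ => ∫ θ in (0 : ℝ)..2 * Real.pi, V (x + (r * Real.cos θ, r * Real.sin θ)))
        (Ioc p q ×ˢ Ioc c d) ∧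
      IntervalIntegrable (fun θ => ∫ y in Ioc (p + r * Real.cos θ) (q + r * Real.cos θ) ×ˢ
        Ioc (c + r * Real.sin θ) (d + r * Real.sin θ), V y) volume 0 (2 * Real.pi) ∧
      ∫ x in Ioc p q ×ˢ Ioc c d, ∫ θ in (0 : ℝ)..2 * Real.pi, V (x + (r * Real.cos θ, r * Real.sin θ)) =
        ∫ θ in (0 : ℝ)..2 * Real.pi, ∫ y in Ioc (p + r * Real.cos θ) (q + r * Real.cos θ) ×ˢ
          Ioc (c + r * Real.sin θ) (d + r * Real.sin θ), V y := by
  have hπ := Real.two_pi_pos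
  set B := Ioc p q ×ˢ Ioc c d with hB
  set H : ℝ → ℝ × ℝ := fun θ => (r * Real.cos θ, r * Real.sin θ) with hH
  set S : ℝ → Set (ℝ × ℝ) := fun θ => Ioc (p + (H θ).1) (q + (H θ).1) ×ˢ Ioc (c + (H θ).2) (d + (H θ).2)
    with hS
  set g : ℝ × ℝ → ℝ → ℝ := fun x θ => V (x + H θ) with hg
  have hgm : Measurable (Function.uncurry g) := hVm.comp (by fun_prop)
  have hsub : ∀ θ, S θ ⊆ Ioc (p - r) (q + r) ×ˢ Ioc (c - r) (d + r) := by
    intro θ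
    have h1 := abs_le.1 (abs_mul_cos_le hr θ)
    have h2 := abs_le.1 (abs_mul_sin_le hr θ)
    exact prod_mono (Ioc_subset_Ioc (by simp only [hH]; linarith) (by simp only [hH]; linarith))
      (Ioc_subset_Ioc (by simp only [hH]; linarith) (by simp only [hH]; linarith))
  have hint : Integrable (Function.uncurry g)
      (((volume : Measure (ℝ × ℝ)).restrict B).prod (volume.restrict (Ioc 0 (2 * Real.pi)))) := by
    -- All shifted rectangles lie in one enlarged rectangle, so the inner integrals of |V| are
    -- bounded uniformly in θ.
    rw [integrable_prod_iff' hgm.aestronglyMeasurable]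
    constructor
    · exact Eventually.of_forall fun θ => integrableOn_add_prod (hV.mono_set (hsub θ))
    · refine Integrable.of_bound ?_
        (∫ y in Ioc (p - r) (q + r) ×ˢ Ioc (c - r) (d + r), ‖V y‖) (Eventually.of_forall fun θ => ?_)
      · exact (hgm.norm.stronglyMeasurable.integral_prod_left (μ := volume.restrict B)).aestronglyMeasurable
      · rw [Real.norm_of_nonneg (integral_nonneg fun _ => norm_nonneg _)]
        have e := setIntegral_add_prod (fun y => ‖V y‖) p q c d (H θ)
        refine (le_of_eq e).trans ?_
        exact setIntegral_mono_set hV.norm (Eventually.of_forall fun _ => norm_nonneg _)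
          (hsub θ).eventuallyLE
  have e0 : ∀ x, ∫ θ in (0 : ℝ)..2 * Real.pi, g x θ = ∫ θ in Ioc 0 (2 * Real.pi), g x θ := fun x =>
    intervalIntegral.integral_of_le hπ.le
  have e1 : ∀ θ, ∫ x in B, g x θ = ∫ y in S θ, V y := fun θ => setIntegral_add_prod V p q c d (H θ)
  refine ⟨?_, ?_, ?_⟩
  · have := hint.integral_prod_left
    simp only [Function.uncurry_apply_pair, ← e0] at this
    exact this
  · have := hint.integral_prod_right
    simp only [Function.uncurry_apply_pair, e1] at this
    exact (intervalIntegrable_iff_integrableOn_Ioc_of_le hπ.le).2 this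
  · have := integral_integral_swap hint
    simp only [← e0, e1] at this
    rw [intervalIntegral.integral_of_le hπ.le (f := fun θ => ∫ y in S θ, V y)]
    exact this

/-- Jensen's formula, integrated over a rectangle. -/
theorem exists_sum_eq_setIntegral {α : ℝ} (hα : 0 < α) (hα1 : α ≤ 1) (lam : ℝ) {p q c d r : ℝ} (hr : 0 < r)
    (hp : 0 < p - r) (hc : 0 < c - r)
    (hV : IntegrableOn (fun x : ℝ × ℝ => lerchLog lam α (x.1 + x.2 * Complex.I))
      (Ioc (p - r) (q + r) ×ˢ Ioc (c - r) (d + r))) :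
    ∃ Z : Finset ℂ, (∀ ρ, ρ ∈ Z ↔ ρ ∈ Icc (p - r) (q + r) ×ℂ Icc (c - r) (d + r) ∧ lerchZeta lam α ρ = 0) ∧
      ∑ ρ ∈ Z, (analyticOrderNatAt (lerchZeta lam α) ρ : ℝ) *
          ∫ z in Icc p q ×ℂ Icc c d, Real.posLog (r * ‖z - ρ‖⁻¹) =
        ((2 * Real.pi)⁻¹ * ∫ θ in (0 : ℝ)..2 * Real.pi,
          ∫ y in Ioc (p + r * Real.cos θ) (q + r * Real.cos θ) ×ˢ
            Ioc (c + r * Real.sin θ) (d + r * Real.sin θ), lerchLog lam α (y.1 + y.2 * Complex.I)) -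
          ∫ y in Ioc p q ×ˢ Ioc c d, lerchLog lam α (y.1 + y.2 * Complex.I) := by
  have hL := analyticOnNhd_lerchZeta hα hα1 lam
  set K := Icc (p - r) (q + r) ×ℂ Icc (c - r) (d + r) with hK
  have hKU : K ⊆ {s : ℂ | 0 < s.re ∧ 0 < s.im} := fun z hz => ⟨hp.trans_le hz.1.1, hc.trans_le hz.2.1⟩
  have hKc : IsCompact K := isCompact_Icc.reProdIm isCompact_Icc
  obtain ⟨x₀, hx₀, hx₀0⟩ : ∃ x ∈ {s : ℂ | 0 < s.re ∧ 0 < s.im}, lerchZeta lam α x ≠ 0 := by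
    obtain ⟨c₀, hc₀⟩ := exists_half_le_norm_lerchZeta hα hα1 lam
    have h1 := hc₀ (max c₀ 1) (le_max_left _ _) 1 one_pos
    refine ⟨(max c₀ 1 : ℝ) + (1 : ℝ) * Complex.I, ?_, fun h2 => ?_⟩
    · have : 0 < max c₀ 1 := lt_of_lt_of_le one_pos (le_max_right _ _)
      simp [this]
    · rw [h2, norm_zero] at h1
      norm_num at h1
  have hfin := finite_inter_zeros hL isPreconnected_quadrant hx₀ hx₀0 hKc hKU
  refine ⟨hfin.toFinset, fun ρ => by simp, ?_⟩
  obtain ⟨v1, v2, v3⟩ := setIntegral_circle_average (measurable_lerchLog_prod hα hα1 lam) hr.le hV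
  have hBB : IntegrableOn (fun x : ℝ × ℝ => lerchLog lam α (x.1 + x.2 * Complex.I)) (Ioc p q ×ˢ Ioc c d) :=
    hV.mono_set (prod_mono (Ioc_subset_Ioc (by linarith) (by linarith))
      (Ioc_subset_Ioc (by linarith) (by linarith)))
  have hposi : ∀ ρ : ℂ, Integrable (fun z : ℂ => Real.posLog (r * ‖z - ρ‖⁻¹)) := fun ρ =>
    (integral_posLog_mul_inv_norm hr).1.comp_sub_right ρ
  have hBm : MeasurableSet (Icc p q ×ℂ Icc c d) := (isCompact_Icc.reProdIm isCompact_Icc).measurableSet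
  -- Jensen's formula is applied at every centre that is not itself a zero, hence at almost every
  -- centre. The potential of a zero outside the disc is 0 by the truncation in `Real.posLog`.
  have hpt : ∀ᵐ z ∂(volume.restrict (Icc p q ×ℂ Icc c d)),
      ∑ ρ ∈ hfin.toFinset, (analyticOrderNatAt (lerchZeta lam α) ρ : ℝ) * Real.posLog (r * ‖z - ρ‖⁻¹) =
        Real.circleAverage (lerchLog lam α) z r - lerchLog lam α z := by
    have hsubU : Icc p q ×ℂ Icc c d ⊆ {s : ℂ | 0 < s.re ∧ 0 < s.im} := fun z hz =>
      ⟨by linarith [hz.1.1], by linarith [hz.2.1]⟩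
    have hne : ∀ᵐ z ∂(volume.restrict (Icc p q ×ℂ Icc c d)), lerchZeta lam α z ≠ 0 :=
      ae_restrict_le_codiscreteWithin hBm (codiscreteWithin_mono hsubU
        (eventually_codiscreteWithin_lerchZeta_ne_zero hα hα1 lam))
    filter_upwards [hne, ae_restrict_mem hBm] with z hz hzB
    have hsub : closedBall z r ⊆ K := by
      intro w hw
      rw [mem_closedBall, dist_eq_norm] at hw
      have h1 := abs_le.1 ((Complex.abs_re_le_norm _).trans hw)
      have h2 := abs_le.1 ((Complex.abs_im_le_norm _).trans hw)
      rw [Complex.sub_re] at h1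
      rw [Complex.sub_im] at h2
      have h3 : p ≤ z.re ∧ z.re ≤ q := hzB.1
      have h4 : c ≤ z.im ∧ z.im ≤ d := hzB.2
      exact ⟨⟨by linarith [h3.1], by linarith [h3.2]⟩, ⟨by linarith [h4.1], by linarith [h4.2]⟩⟩
    have h5 := circleAverage_log_norm_sub_eq_sum hr (hL.mono (hsub.trans hKU)) hz
      (Z := hfin.toFinset) (fun ρ h6 h7 => by simpa using ⟨hsub h6, h7⟩)
      (fun ρ h6 => by simp at h6; exact h6.2)
    rw [← h5, lerchLog_eq lam α (hsubU hzB).1 (hsubU hzB).2]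
    congr 1
    refine Real.circleAverage_congr_sphere fun w hw => ?_
    rw [abs_of_pos hr] at hw
    obtain ⟨h8, h9⟩ := hKU (hsub (sphere_subset_closedBall hw))
    exact (lerchLog_eq lam α h8 h9).symm
  have e1 : ∫ z in Icc p q ×ℂ Icc c d, (Real.circleAverage (lerchLog lam α) z r - lerchLog lam α z) =
      ∑ ρ ∈ hfin.toFinset, (analyticOrderNatAt (lerchZeta lam α) ρ : ℝ) *
        ∫ z in Icc p q ×ℂ Icc c d, Real.posLog (r * ‖z - ρ‖⁻¹) := by
    rw [← integral_congr_ae hpt, integral_finsetSum _ fun ρ _ => ((hposi ρ).integrableOn).const_mul _]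
    simp only [integral_const_mul]
  rw [← e1, setIntegral_reProdIm (fun z => Real.circleAverage (lerchLog lam α) z r - lerchLog lam α z),
    ← v3, ← integral_const_mul, ← integral_sub (v1.const_mul _) hBB]
  refine integral_congr_ae (Eventually.of_forall fun x => ?_)
  simp only
  rw [Real.circleAverage_def, smul_eq_mul]
  congr 2
  refine intervalIntegral.integral_congr fun θ _ => ?_
  simp only [circleMap_eq, Prod.fst_add, Prod.snd_add]

/-! ### Asymptotics of the circle excess of log |L|. -/

/-- Mean values over initial strips give mean values over rectangles. -/
theorem abs_setIntegral_prod_sub_le {V : ℝ × ℝ → ℝ} {m g : ℝ → ℝ} {a b t₁ T₀ : ℝ} (ht : t₁ ≤ T₀)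
    (hm : IntegrableOn m (Ioc a b)) (hab : a ≤ b)
    (hV : ∀ T, t₁ ≤ T → IntegrableOn V (Ioc a b ×ˢ Ioc t₁ T))
    (h : ∀ T, T₀ ≤ T → ∫ σ in a..b, |(∫ t in t₁..T, V (σ, t)) - (T - t₁) * m σ| ≤ g T)
    {p q c d : ℝ} (hp : a ≤ p) (hpq : p ≤ q) (hq : q ≤ b) (hc : T₀ ≤ c) (hcd : c ≤ d) :
    |(∫ x in Ioc p q ×ˢ Ioc c d, V x) - (d - c) * ∫ σ in p..q, m σ| ≤ g c + g d := by
  have hI : ∀ T, t₁ ≤ T → Integrable V ((volume.restrict (Ioc a b)).prod (volume.restrict (Ioc t₁ T))) := by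
    intro T hT
    rw [Measure.prod_restrict]; exact hV T hT
  set E : ℝ → ℝ → ℝ := fun T σ => (∫ t in t₁..T, V (σ, t)) - (T - t₁) * m σ with hE
  have hEi : ∀ T, t₁ ≤ T → IntegrableOn (E T) (Ioc a b) := by
    intro T hT
    have h1 := (hI T hT).integral_prod_left
    simp only [← intervalIntegral.integral_of_le hT] at h1
    exact h1.sub (hm.const_mul _)
  have hsub : Ioc p q ⊆ Ioc a b := Ioc_subset_Ioc hp hq
  have hVpq : IntegrableOn V (Ioc p q ×ˢ Ioc c d) :=
    (hV d (by linarith)).mono_set (prod_mono hsub (Ioc_subset_Ioc_left (by linarith)))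
  have hae : ∀ᵐ σ ∂(volume.restrict (Ioc p q)), ∫ t in Ioc c d, V (σ, t) =
      (E d σ - E c σ) + (d - c) * m σ := by
    have h1 := ae_restrict_of_ae_restrict_of_subset hsub (hI d (by linarith)).prod_right_ae
    filter_upwards [h1] with σ hσ
    have hσ' : IntervalIntegrable (fun t => V (σ, t)) volume t₁ d :=
      (intervalIntegrable_iff_integrableOn_Ioc_of_le (by linarith)).2 hσ
    have h2 := intervalIntegral.integral_interval_sub_left hσ'
      (hσ'.mono_set (by rw [uIcc_of_le (by linarith), uIcc_of_le (by linarith)]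
                        exact Icc_subset_Icc_right hcd) : IntervalIntegrable _ volume t₁ c)
    rw [← intervalIntegral.integral_of_le hcd, ← h2, hE]
    ring
  have h3 : ∫ x in Ioc p q ×ˢ Ioc c d, V x = ∫ σ in Ioc p q, ((E d σ - E c σ) + (d - c) * m σ) := by
    rw [Measure.volume_eq_prod] at hVpq ⊢
    rw [setIntegral_prod _ hVpq]
    exact integral_congr_ae hae
  have hd' := hEi d (by linarith)
  have hc' := hEi c (by linarith)
  have h5 : IntegrableOn (fun σ => E d σ - E c σ) (Ioc p q) := (hd'.sub hc').mono_set hsub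
  rw [h3, integral_add h5 ((hm.mono_set hsub).const_mul _), integral_const_mul,
    intervalIntegral.integral_of_le hpq, add_sub_cancel_right]
  have h4 : ∀ T, T₀ ≤ T → ∫ σ in Ioc a b, |E T σ| ≤ g T := fun T hT => by
    rw [← intervalIntegral.integral_of_le hab]; exact h T hT
  calc |∫ σ in Ioc p q, (E d σ - E c σ)| ≤ ∫ σ in Ioc p q, |E d σ - E c σ| := abs_integral_le_integral_abs
    _ ≤ ∫ σ in Ioc a b, |E d σ - E c σ| :=
        setIntegral_mono_set (hd'.sub hc').abs (Eventually.of_forall fun _ => abs_nonneg _) hsub.eventuallyLE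
    _ ≤ ∫ σ in Ioc a b, (|E c σ| + |E d σ|) := by
        refine integral_mono (hd'.sub hc').abs (hc'.abs.add hd'.abs) fun σ => ?_
        simp only
        rw [add_comm]; exact abs_sub _ _
    _ = (∫ σ in Ioc a b, |E c σ|) + ∫ σ in Ioc a b, |E d σ| := integral_add hc'.abs hd'.abs
    _ ≤ g c + g d := add_le_add (h4 c hc) (h4 d (hc.trans hcd))

/-- Taylor's formula of order two with a bound for the remainder. -/
theorem abs_taylor_two_le {f f₁ f₂ f₃ : ℝ → ℝ} {a b K : ℝ}
    (h0 : ∀ x ∈ Icc a b, HasDerivAt f (f₁ x) x) (h1 : ∀ x ∈ Icc a b, HasDerivAt f₁ (f₂ x) x)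
    (h2 : ∀ x ∈ Icc a b, HasDerivAt f₂ (f₃ x) x) (hK : ∀ x ∈ Icc a b, |f₃ x| ≤ K)
    {x h r : ℝ} (hr : |h| ≤ r) (hx : a ≤ x - r) (hx' : x + r ≤ b) :
    |f (x + h) - f x - h * f₁ x - h ^ 2 / 2 * f₂ x| ≤ K * r ^ 3 := by
  have hr0 : 0 ≤ r := (abs_nonneg h).trans hr
  have hsub : Icc (x - r) (x + r) ⊆ Icc a b := Icc_subset_Icc hx hx'
  have hK0 : 0 ≤ K := (abs_nonneg _).trans (hK x (hsub ⟨by linarith, by linarith⟩))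
  have hxm : x ∈ Icc (x - r) (x + r) := ⟨by linarith, by linarith⟩
  have hc := convex_Icc (𝕜 := ℝ) (x - r) (x + r)
  have hd : ∀ y ∈ Icc (x - r) (x + r), |y - x| ≤ r := fun y hy => abs_le.2 ⟨by linarith [hy.1], by linarith [hy.2]⟩
  have e2 : ∀ y ∈ Icc (x - r) (x + r), |f₂ y - f₂ x| ≤ K * r := by
    intro y hy
    have := hc.norm_image_sub_le_of_norm_hasDerivWithin_le
      (fun z hz => (h2 z (hsub hz)).hasDerivWithinAt) (fun z hz => hK z (hsub hz)) hxm hy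
    exact this.trans (mul_le_mul_of_nonneg_left (hd y hy) hK0)
  have e1 : ∀ y ∈ Icc (x - r) (x + r), |f₁ y - f₁ x - (y - x) * f₂ x| ≤ K * r * r := by
    intro y hy
    have := hc.norm_image_sub_le_of_norm_hasDerivWithin_le (f := fun y => f₁ y - f₁ x - (y - x) * f₂ x)
      (f' := fun y => f₂ y - 1 * f₂ x) (C := K * r)
      (fun z hz => (((h1 z (hsub hz)).sub_const _).sub
        (((hasDerivAt_id z).sub_const x).mul_const _)).hasDerivWithinAt)
      (fun z hz => by rw [one_mul]; exact e2 z hz) hxm hy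
    simp only [sub_self, zero_mul, sub_zero] at this
    exact this.trans (mul_le_mul_of_nonneg_left (hd y hy) (by positivity))
  have e0 : ∀ y ∈ Icc (x - r) (x + r),
      |f y - f x - (y - x) * f₁ x - (y - x) ^ 2 / 2 * f₂ x| ≤ K * r * r * r := by
    intro y hy
    have := hc.norm_image_sub_le_of_norm_hasDerivWithin_le
      (f := fun y => f y - f x - (y - x) * f₁ x - (y - x) ^ 2 / 2 * f₂ x)
      (f' := fun y => f₁ y - 1 * f₁ x - (2 * (y - x) ^ 1 * 1) / 2 * f₂ x) (C := K * r * r)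
      (fun z hz => ((((h0 z (hsub hz)).sub_const _).sub
        (((hasDerivAt_id z).sub_const x).mul_const _)).sub
        (((((hasDerivAt_id z).sub_const x).pow 2).div_const 2).mul_const _)).hasDerivWithinAt)
      (fun z hz => by
        have := e1 z hz
        rw [Real.norm_eq_abs]
        convert this using 2
        ring) hxm hy
    simp only [sub_self, zero_mul, sub_zero, ne_eq, OfNat.ofNat_ne_zero, not_false_eq_true, zero_pow,
      zero_div] at this
    exact this.trans (mul_le_mul_of_nonneg_left (hd y hy) (by positivity))
  have h5 := abs_le.1 hr
  have := e0 (x + h) ⟨by linarith, by linarith⟩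
  rw [add_sub_cancel_left] at this
  calc _ ≤ _ := this
    _ = _ := by ring

theorem integral_cos_two_pi : ∫ θ in (0 : ℝ)..2 * Real.pi, Real.cos θ = 0 := by simp

theorem integral_cos_sq_two_pi : ∫ θ in (0 : ℝ)..2 * Real.pi, Real.cos θ ^ 2 = Real.pi := by
  rw [integral_cos_sq]; simp

/-- The linear Taylor term has mean 0 over the circle and cos² has mean 1/2, so the quadratic term
leaves r²/4 times the second derivative. -/
theorem abs_circle_average_sub_le {f f₁ f₂ f₃ : ℝ → ℝ} {a b K : ℝ}
    (h0 : ∀ x ∈ Icc a b, HasDerivAt f (f₁ x) x) (h1 : ∀ x ∈ Icc a b, HasDerivAt f₁ (f₂ x) x)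
    (h2 : ∀ x ∈ Icc a b, HasDerivAt f₂ (f₃ x) x) (hK : ∀ x ∈ Icc a b, |f₃ x| ≤ K)
    {x r : ℝ} (hr : 0 ≤ r) (hx : a ≤ x - r) (hx' : x + r ≤ b) :
    IntervalIntegrable (fun θ => f (x + r * Real.cos θ)) volume 0 (2 * Real.pi) ∧
    |(2 * Real.pi)⁻¹ * (∫ θ in (0 : ℝ)..2 * Real.pi, f (x + r * Real.cos θ)) - f x - r ^ 2 / 4 * f₂ x| ≤
      K * r ^ 3 := by
  have hπ := Real.pi_pos
  have hmem : ∀ θ, x + r * Real.cos θ ∈ Icc a b := fun θ => by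
    have := abs_le.1 (abs_mul_cos_le hr θ)
    exact ⟨by linarith, by linarith⟩
  have hcont : Continuous fun θ => f (x + r * Real.cos θ) := by
    have hf : ContinuousOn f (Icc a b) := fun y hy => (h0 y hy).continuousAt.continuousWithinAt
    exact hf.comp_continuous (by fun_prop) hmem
  have hi := hcont.intervalIntegrable (μ := volume) 0 (2 * Real.pi)
  refine ⟨hi, ?_⟩
  set P : ℝ → ℝ := fun θ => f x + (r * f₁ x) * Real.cos θ + (r ^ 2 / 2 * f₂ x) * Real.cos θ ^ 2 with hP
  have hPc : Continuous P := by fun_prop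
  have hPi : ∫ θ in (0 : ℝ)..2 * Real.pi, P θ = 2 * Real.pi * (f x + r ^ 2 / 4 * f₂ x) := by
    simp only [hP]
    rw [intervalIntegral.integral_add (Continuous.intervalIntegrable (by fun_prop) _ _)
      (Continuous.intervalIntegrable (by fun_prop) _ _),
      intervalIntegral.integral_add (Continuous.intervalIntegrable (by fun_prop) _ _)
      (Continuous.intervalIntegrable (by fun_prop) _ _), intervalIntegral.integral_const,
      intervalIntegral.integral_const_mul, intervalIntegral.integral_const_mul, integral_cos_two_pi,
      integral_cos_sq_two_pi, smul_eq_mul]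
    ring
  have hb : ‖∫ θ in (0 : ℝ)..2 * Real.pi, (f (x + r * Real.cos θ) - P θ)‖ ≤
      K * r ^ 3 * |2 * Real.pi - 0| := by
    refine intervalIntegral.norm_integral_le_of_norm_le_const fun θ _ => ?_
    have := abs_taylor_two_le h0 h1 h2 hK (abs_mul_cos_le hr θ) hx hx'
    rw [Real.norm_eq_abs]
    convert this using 2
    simp only [hP]; ring
  rw [intervalIntegral.integral_sub hi (hPc.intervalIntegrable _ _), hPi, Real.norm_eq_abs, sub_zero,
    abs_of_pos (by positivity : 0 < 2 * Real.pi)] at hb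
  have e : (2 * Real.pi)⁻¹ * (∫ θ in (0 : ℝ)..2 * Real.pi, f (x + r * Real.cos θ)) - f x - r ^ 2 / 4 * f₂ x =
      (2 * Real.pi)⁻¹ * ((∫ θ in (0 : ℝ)..2 * Real.pi, f (x + r * Real.cos θ)) -
        2 * Real.pi * (f x + r ^ 2 / 4 * f₂ x)) := by
    field_simp
    ring
  rw [e, abs_mul, abs_of_pos (by positivity), inv_mul_le_iff₀ (by positivity)]
  linarith

/-- The mean over the circle of radius `r` of the integral of `V` over shifted rectangles, minus the integral
over the rectangle itself. -/
def circleExcess (V : ℝ × ℝ → ℝ) (p q c d r : ℝ) : ℝ :=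
  ((2 * Real.pi)⁻¹ * ∫ θ in (0 : ℝ)..2 * Real.pi,
    ∫ y in Ioc (p + r * Real.cos θ) (q + r * Real.cos θ) ×ˢ
      Ioc (c + r * Real.sin θ) (d + r * Real.sin θ), V y) - ∫ y in Ioc p q ×ˢ Ioc c d, V y

/-- Up to `G`, a shifted rectangle integrates to (d - c) times the increment of the primitive `Q`
between the shifted abscissae; the vertical shift leaves the height unchanged. Averaging over the
circle brings in Q'' = m₁. One `G` comes from the average and one from the unshifted rectangle. -/
theorem abs_circleExcess_sub_le {V : ℝ × ℝ → ℝ} (hVm : Measurable V) {Q m m₁ m₂ : ℝ → ℝ} {a b G K T₁ T₂ : ℝ}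
    (h0 : ∀ x ∈ Icc a b, HasDerivAt Q (m x) x) (h1 : ∀ x ∈ Icc a b, HasDerivAt m (m₁ x) x)
    (h2 : ∀ x ∈ Icc a b, HasDerivAt m₁ (m₂ x) x) (hK : ∀ x ∈ Icc a b, |m₂ x| ≤ K)
    (hV : IntegrableOn V (Ioc a b ×ˢ Ioc T₁ T₂))
    (h : ∀ p q c d, a ≤ p → p ≤ q → q ≤ b → T₁ ≤ c → c ≤ d → d ≤ T₂ →
      |(∫ x in Ioc p q ×ˢ Ioc c d, V x) - (d - c) * ∫ σ in p..q, m σ| ≤ G)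
    {p q c d r : ℝ} (hr : 0 ≤ r) (hp : a ≤ p - r) (hpq : p ≤ q) (hq : q + r ≤ b) (hc : T₁ ≤ c - r) (hcd : c ≤ d)
    (hd : d + r ≤ T₂) :
    |circleExcess V p q c d r - (d - c) * (r ^ 2 / 4 * (m₁ q - m₁ p))| ≤
      2 * G + (d - c) * (2 * K * r ^ 3) := by
  have hπ := Real.pi_pos
  have hmc : ContinuousOn m (Icc a b) := fun x hx => (h1 x hx).continuousAt.continuousWithinAt
  have hmain : ∀ x y, a ≤ x → x ≤ y → y ≤ b → ∫ σ in x..y, m σ = Q y - Q x := by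
    intro x y hx hxy hy
    have hs : uIcc x y ⊆ Icc a b := by rw [uIcc_of_le hxy]; exact Icc_subset_Icc hx hy
    exact intervalIntegral.integral_eq_sub_of_hasDerivAt (fun z hz => h0 z (hs hz))
      ((hmc.mono hs).intervalIntegrable)
  have hbox := h p q c d (by linarith) hpq (by linarith) (by linarith) hcd (by linarith)
  rw [hmain p q (by linarith) hpq (by linarith)] at hbox
  obtain ⟨q1, q2⟩ := abs_circle_average_sub_le h0 h1 h2 hK hr (by linarith : a ≤ q - r) hq
  obtain ⟨p1, p2⟩ := abs_circle_average_sub_le h0 h1 h2 hK hr hp (by linarith : p + r ≤ b)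
  obtain ⟨-, v2, -⟩ := setIntegral_circle_average hVm (p := p) (q := q) (c := c) (d := d) hr
    (hV.mono_set (prod_mono (Ioc_subset_Ioc hp hq) (Ioc_subset_Ioc hc hd)))
  set W : ℝ → ℝ := fun θ => ∫ y in Ioc (p + r * Real.cos θ) (q + r * Real.cos θ) ×ˢ
      Ioc (c + r * Real.sin θ) (d + r * Real.sin θ), V y with hW
  have hb : ‖∫ θ in (0 : ℝ)..2 * Real.pi,
      (W θ - (d - c) * (Q (q + r * Real.cos θ) - Q (p + r * Real.cos θ)))‖ ≤ G * |2 * Real.pi - 0| := by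
    refine intervalIntegral.norm_integral_le_of_norm_le_const fun θ _ => ?_
    have h3 := abs_le.1 (abs_mul_cos_le hr θ)
    have h4 := abs_le.1 (abs_mul_sin_le hr θ)
    have h5 := h (p + r * Real.cos θ) (q + r * Real.cos θ) (c + r * Real.sin θ) (d + r * Real.sin θ)
      (by linarith) (by linarith) (by linarith) (by linarith) (by linarith) (by linarith)
    rw [hmain _ _ (by linarith) (by linarith) (by linarith), add_sub_add_right_eq_sub] at h5
    exact h5
  rw [intervalIntegral.integral_sub v2 ((q1.sub p1).const_mul _), intervalIntegral.integral_const_mul,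
    intervalIntegral.integral_sub q1 p1, Real.norm_eq_abs, sub_zero,
    abs_of_pos (by positivity : 0 < 2 * Real.pi)] at hb
  have hb' : |(2 * Real.pi)⁻¹ * (∫ θ in (0 : ℝ)..2 * Real.pi, W θ) -
      (d - c) * ((2 * Real.pi)⁻¹ * (∫ θ in (0 : ℝ)..2 * Real.pi, Q (q + r * Real.cos θ)) -
        (2 * Real.pi)⁻¹ * ∫ θ in (0 : ℝ)..2 * Real.pi, Q (p + r * Real.cos θ))| ≤ G := by
    have e : ∀ x y z : ℝ, (2 * Real.pi)⁻¹ * x - (d - c) * ((2 * Real.pi)⁻¹ * y - (2 * Real.pi)⁻¹ * z) =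
      (2 * Real.pi)⁻¹ * (x - (d - c) * (y - z)) := fun x y z => by ring
    rw [e, abs_mul, abs_of_pos (by positivity), inv_mul_le_iff₀ (by positivity)]
    linarith
  have hdc : 0 ≤ d - c := by linarith
  set I1 := (2 * Real.pi)⁻¹ * (∫ θ in (0 : ℝ)..2 * Real.pi, Q (q + r * Real.cos θ))
  set I2 := (2 * Real.pi)⁻¹ * (∫ θ in (0 : ℝ)..2 * Real.pi, Q (p + r * Real.cos θ))
  have hx : |(d - c) * ((I1 - Q q - r ^ 2 / 4 * m₁ q) - (I2 - Q p - r ^ 2 / 4 * m₁ p))| ≤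
      (d - c) * (2 * K * r ^ 3) := by
    rw [abs_mul, abs_of_nonneg hdc]
    refine mul_le_mul_of_nonneg_left ((abs_sub _ _).trans ?_) hdc
    linarith
  have e : circleExcess V p q c d r - (d - c) * (r ^ 2 / 4 * (m₁ q - m₁ p)) =
      ((2 * Real.pi)⁻¹ * (∫ θ in (0 : ℝ)..2 * Real.pi, W θ) - (d - c) * (I1 - I2)) -
      ((∫ x in Ioc p q ×ˢ Ioc c d, V x) - (d - c) * (Q q - Q p)) +
      (d - c) * ((I1 - Q q - r ^ 2 / 4 * m₁ q) - (I2 - Q p - r ^ 2 / 4 * m₁ p)) := by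
    rw [circleExcess]; ring
  rw [e]
  refine (abs_add_le _ _).trans ?_
  have := abs_sub ((2 * Real.pi)⁻¹ * (∫ θ in (0 : ℝ)..2 * Real.pi, W θ) - (d - c) * (I1 - I2))
    ((∫ x in Ioc p q ×ˢ Ioc c d, V x) - (d - c) * (Q q - Q p))
  linarith

/-- From e onwards (log x)/x decreases, so log y / log x ≤ y/x for x ≤ y. The left side is at least
1, and raising it to a power A ≤ 1 does not increase it. -/
theorem monotoneOn_mul_log_rpow {A : ℝ} (hA1 : A ≤ 1) :
    MonotoneOn (fun x : ℝ => x * Real.log x ^ (-A)) (Ici (Real.exp 1)) := by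
  intro x hx y hy hxy
  have hx0 : 0 < x := (Real.exp_pos 1).trans_le hx
  have hy0 : 0 < y := (Real.exp_pos 1).trans_le hy
  have hlx : 1 ≤ Real.log x := (Real.le_log_iff_exp_le hx0).2 hx
  have hlxy : Real.log x ≤ Real.log y := Real.log_le_log hx0 hxy
  have h1 : Real.log y / y ≤ Real.log x / x := Real.log_div_self_antitoneOn hx hy hxy
  rw [div_le_div_iff₀ hy0 hx0] at h1
  have h2 : (Real.log y / Real.log x) ^ A ≤ y / x := by
    calc (Real.log y / Real.log x) ^ A ≤ (Real.log y / Real.log x) ^ (1 : ℝ) :=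
          Real.rpow_le_rpow_of_exponent_le ((one_le_div (by linarith)).2 hlxy) hA1
      _ = Real.log y / Real.log x := Real.rpow_one _
      _ ≤ y / x := by rw [div_le_div_iff₀ (by linarith) hx0]; linarith
  rw [Real.div_rpow (by linarith) (by linarith), div_le_div_iff₀ (Real.rpow_pos_of_pos (by linarith) _) hx0] at h2
  simp only
  rw [Real.rpow_neg (by linarith), Real.rpow_neg (by linarith), ← div_eq_mul_inv, ← div_eq_mul_inv,
    div_le_div_iff₀ (Real.rpow_pos_of_pos (by linarith) _) (Real.rpow_pos_of_pos (by linarith) _)]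
  linarith

theorem hasDerivAt_integral_logMean {α a x : ℝ} (hα : 0 < α) (ha : 1 / 2 < a) (hax : a ≤ x) :
    HasDerivAt (fun y => ∫ σ in a..y, logMean α 0 σ) (logMean α 0 x) x := by
  have hc := continuousOn_logMean hα (show 0 ≤ 2 by norm_num)
  have hx : x ∈ Ioi (1 / 2 : ℝ) := ha.trans_le hax
  exact intervalIntegral.integral_hasDerivAt_right
    ((hc.mono (uIcc_subset_Ioi_half ha hax)).intervalIntegrable)
    (hc.stronglyMeasurableAtFilter isOpen_Ioi x hx) (hc.continuousAt (Ioi_mem_nhds hx))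

theorem exists_abs_circleExcess_lerchLog_sub_le {α : ℝ} (hα : α ∈ admissibleSet) (lam : ℝ) {a b : ℝ}
    (ha : 1 / 2 < a) (hab : a ≤ b) :
    ∃ C K T₁ : ℝ, 0 ≤ C ∧ 0 ≤ K ∧ 1 ≤ T₁ ∧
      (∀ x ∈ Icc a b, |logMean α 2 x| ≤ K) ∧
      ∀ T, T₁ ≤ T → IntegrableOn (fun x : ℝ × ℝ => lerchLog lam α (x.1 + x.2 * Complex.I))
          (Ioc a b ×ˢ Ioc T₁ (2 * T)) ∧
        ∀ p q c d r, 0 ≤ r → a ≤ p - r → p ≤ q → q + r ≤ b → T₁ ≤ c - r → c ≤ d → d + r ≤ 2 * T →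
          |circleExcess (fun x : ℝ × ℝ => lerchLog lam α (x.1 + x.2 * Complex.I)) p q c d r -
              (d - c) * (r ^ 2 / 4 * (logMean α 1 q - logMean α 1 p))| ≤
            C * (T * Real.log T ^ (-(1 / 144) : ℝ)) + (d - c) * (2 * K * r ^ 3) := by
  have hα0 : 0 < α := hα.1.1
  obtain ⟨C, t₁, T₀, hC, ht₁, ht, hV, h⟩ := exists_integral_abs_integral_lerchLog_sub_le hα lam ha hab
  have hIcc : ∀ x ∈ Icc a b, 1 / 2 < x := fun x hx => ha.trans_le hx.1
  obtain ⟨K, hK⟩ := isCompact_Icc.exists_bound_of_continuousOn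
    ((continuousOn_logMean hα0 le_rfl).mono (fun x hx => hIcc x hx : Icc a b ⊆ Ioi (1 / 2)))
  have hK0 : 0 ≤ K := (norm_nonneg _).trans (hK a ⟨le_rfl, hab⟩)
  set V : ℝ × ℝ → ℝ := fun x => lerchLog lam α (x.1 + x.2 * Complex.I) with hVdef
  have hm : IntegrableOn (logMean α 0) (Ioc a b) :=
    (intervalIntegrable_iff_integrableOn_Ioc_of_le hab).1
      (((continuousOn_logMean hα0 (by norm_num)).mono (uIcc_subset_Ioi_half ha hab)).intervalIntegrable)
  have hV' : ∀ T, t₁ ≤ T → IntegrableOn V (Ioc a b ×ˢ Ioc t₁ T) := by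
    intro T hT
    have := hV T hT
    rwa [Measure.prod_restrict] at this
  set g : ℝ → ℝ := fun T => C * (T * Real.log T ^ (-(1 / 144) : ℝ)) with hg
  have hT₁ : T₀ ≤ max T₀ (Real.exp 1) := le_max_left _ _
  -- A horizontal edge of a rectangle, at any height up to 2T, costs 2C times the error at T, hence
  -- G = 4C times that error for two edges and 2G = 8C for the excess. The height 2T leaves room for
  -- rectangles that overshoot T.
  refine ⟨8 * C, K, max T₀ (Real.exp 1), by positivity, hK0, ?_, hK, fun T hT => ?_⟩
  · linarith
  have hTe : Real.exp 1 ≤ T := (le_max_right _ _).trans hT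
  have hT0 : 0 < T := (Real.exp_pos 1).trans_le hTe
  have hlog : 1 ≤ Real.log T := (Real.le_log_iff_exp_le hT0).2 hTe
  have hgT : ∀ τ, max T₀ (Real.exp 1) ≤ τ → τ ≤ 2 * T → g τ ≤ 2 * (C * (T * Real.log T ^ (-(1 / 144) : ℝ))) := by
    intro τ h1 h2
    have h3 := monotoneOn_mul_log_rpow (A := 1 / 144) (by norm_num)
      ((le_max_right _ _).trans h1 : Real.exp 1 ≤ τ) (by simp only [mem_Ici]; linarith : 2 * T ∈ Ici (Real.exp 1)) h2
    have h4 : Real.log (2 * T) ^ (-(1 / 144) : ℝ) ≤ Real.log T ^ (-(1 / 144) : ℝ) :=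
      Real.rpow_le_rpow_of_nonpos (by linarith) (Real.log_le_log hT0 (by linarith)) (by norm_num)
    simp only at h3
    calc g τ ≤ C * (2 * T * Real.log (2 * T) ^ (-(1 / 144) : ℝ)) := mul_le_mul_of_nonneg_left h3 hC
      _ ≤ C * (2 * T * Real.log T ^ (-(1 / 144) : ℝ)) :=
          mul_le_mul_of_nonneg_left (mul_le_mul_of_nonneg_left h4 (by linarith)) hC
      _ = _ := by ring
  have hVi : IntegrableOn V (Ioc a b ×ˢ Ioc (max T₀ (Real.exp 1)) (2 * T)) :=
    (hV' (2 * T) (by linarith)).mono_set (prod_mono le_rfl (Ioc_subset_Ioc_left (by linarith)))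
  refine ⟨hVi, fun p q c d r hr hp hpq hq hc hcd hd => ?_⟩
  have := abs_circleExcess_sub_le (measurable_lerchLog_prod hα0 hα.1.2 lam)
    (G := 4 * (C * (T * Real.log T ^ (-(1 / 144) : ℝ))))
    (fun x hx => hasDerivAt_integral_logMean hα0 ha hx.1)
    (fun x hx => hasDerivAt_logMean hα0 (hIcc x hx) (by norm_num))
    (fun x hx => hasDerivAt_logMean hα0 (hIcc x hx) (by norm_num)) hK hVi
    (fun p q c d h1 h2 h3 h4 h5 h6 => by
      have h7 := abs_setIntegral_prod_sub_le ht.le hm hab hV' h h1 h2 h3 (hT₁.trans h4) h5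
      have h8 := hgT c h4 (h5.trans h6)
      have h9 := hgT d (h4.trans h5) h6
      simp only [hg] at h8 h9
      linarith) hr hp hpq hq hc hcd hd
  linarith

/-! ### Counting the zeros. -/

theorem posLog_mul_inv_eq_zero {r : ℝ} {x : ℝ} (hr : 0 ≤ r) (h : r ≤ x) : Real.posLog (r * x⁻¹) = 0 := by
  have hx : 0 ≤ x := hr.trans h
  rw [Real.posLog_eq_zero_iff, abs_of_nonneg (by positivity), ← div_eq_mul_inv]
  exact div_le_one_of_le₀ h hx

theorem integral_posLog_sub {r : ℝ} (hr : 0 < r) (ρ : ℂ) :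
    ∫ z : ℂ, Real.posLog (r * ‖z - ρ‖⁻¹) = Real.pi * r ^ 2 / 2 := by
  rw [integral_sub_right_eq_self (fun z : ℂ => Real.posLog (r * ‖z‖⁻¹)) ρ]
  exact (integral_posLog_mul_inv_norm hr).2

theorem setIntegral_posLog_le {r : ℝ} (hr : 0 < r) (ρ : ℂ) (B : Set ℂ) :
    ∫ z in B, Real.posLog (r * ‖z - ρ‖⁻¹) ≤ Real.pi * r ^ 2 / 2 := by
  rw [← integral_posLog_sub hr ρ]
  exact setIntegral_le_integral ((integral_posLog_mul_inv_norm hr).1.comp_sub_right ρ)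
    (Eventually.of_forall fun _ => Real.posLog_nonneg)

theorem setIntegral_posLog_eq {r : ℝ} (hr : 0 < r) {p q c d : ℝ} {ρ : ℂ} (h1 : p + r ≤ ρ.re) (h2 : ρ.re + r ≤ q)
    (h3 : c + r ≤ ρ.im) (h4 : ρ.im + r ≤ d) :
    ∫ z in Icc p q ×ℂ Icc c d, Real.posLog (r * ‖z - ρ‖⁻¹) = Real.pi * r ^ 2 / 2 := by
  rw [← integral_posLog_sub hr ρ]
  refine setIntegral_eq_integral_of_forall_compl_eq_zero fun z hz => posLog_mul_inv_eq_zero hr.le ?_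
  by_contra! h
  apply hz
  have h5 := abs_le.1 ((Complex.abs_re_le_norm _).trans h.le)
  have h6 := abs_le.1 ((Complex.abs_im_le_norm _).trans h.le)
  rw [Complex.sub_re] at h5
  rw [Complex.sub_im] at h6
  exact ⟨⟨by linarith, by linarith⟩, ⟨by linarith, by linarith⟩⟩

theorem setIntegral_posLog_eq_zero {r : ℝ} (hr : 0 < r) {p q c d : ℝ} {ρ : ℂ}
    (h : ¬ (p - r < ρ.re ∧ ρ.re < q + r ∧ c - r < ρ.im ∧ ρ.im < d + r)) :
    ∫ z in Icc p q ×ℂ Icc c d, Real.posLog (r * ‖z - ρ‖⁻¹) = 0 := by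
  refine setIntegral_eq_zero_of_forall_eq_zero fun z hz => posLog_mul_inv_eq_zero hr.le ?_
  by_contra! h0
  apply h
  have h5 := abs_lt.1 ((Complex.abs_re_le_norm _).trans_lt h0)
  have h6 := abs_lt.1 ((Complex.abs_im_le_norm _).trans_lt h0)
  rw [Complex.sub_re] at h5
  rw [Complex.sub_im] at h6
  have h7 : p ≤ z.re ∧ z.re ≤ q := hz.1
  have h8 : c ≤ z.im ∧ z.im ≤ d := hz.2
  exact ⟨by linarith, by linarith, by linarith, by linarith⟩

theorem zeroCount_eq_sum {lam α σ₁ σ₂ T : ℝ} (h : (zerosInRectangle lam α σ₁ σ₂ T).Finite) :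
    (zeroCount lam α σ₁ σ₂ T : ℝ) = ∑ ρ ∈ h.toFinset, (analyticOrderNatAt (lerchZeta lam α) ρ : ℝ) := by
  rw [zeroCount, finsum_mem_eq_finite_toFinset_sum _ h, Nat.cast_sum]

/-- The rectangle is shrunk by r: only zeros at distance less than r from it contribute. These
belong to the counted rectangle, and each contributes at most πr²/2. -/
theorem circleExcess_le_zeroCount_mul {α : ℝ} (hα : 0 < α) (hα1 : α ≤ 1) {lam σ₁ σ₂ c T r : ℝ} (hr : 0 < r)
    (hσ : 0 < σ₁) (hc : 0 < c - r) (hfin : (zerosInRectangle lam α σ₁ σ₂ T).Finite)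
    (hV : IntegrableOn (fun x : ℝ × ℝ => lerchLog lam α (x.1 + x.2 * Complex.I))
      (Ioc (σ₁ + r - r) (σ₂ - r + r) ×ˢ Ioc (c - r) (T - r + r))) :
    circleExcess (fun x : ℝ × ℝ => lerchLog lam α (x.1 + x.2 * Complex.I)) (σ₁ + r) (σ₂ - r) c (T - r) r ≤
      zeroCount lam α σ₁ σ₂ T * (Real.pi * r ^ 2 / 2) := by
  obtain ⟨Z, hZ, e⟩ := exists_sum_eq_setIntegral hα hα1 lam hr (by linarith) hc hV
  rw [circleExcess, ← e, zeroCount_eq_sum hfin, Finset.sum_mul]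
  have h1 : ∀ ρ ∈ Z, ρ ∉ hfin.toFinset → (analyticOrderNatAt (lerchZeta lam α) ρ : ℝ) *
      ∫ z in Icc (σ₁ + r) (σ₂ - r) ×ℂ Icc c (T - r), Real.posLog (r * ‖z - ρ‖⁻¹) = 0 := by
    intro ρ hρ hn
    rw [setIntegral_posLog_eq_zero hr, mul_zero]
    rintro ⟨h2, h3, h4, h5⟩
    apply hn
    rw [Set.Finite.mem_toFinset]
    exact ⟨by linarith, by linarith, by linarith, by linarith, ((hZ ρ).1 hρ).2⟩
  classical
  calc _ = ∑ ρ ∈ Z.filter (· ∈ hfin.toFinset), (analyticOrderNatAt (lerchZeta lam α) ρ : ℝ) *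
        ∫ z in Icc (σ₁ + r) (σ₂ - r) ×ℂ Icc c (T - r), Real.posLog (r * ‖z - ρ‖⁻¹) := by
        refine (Finset.sum_filter_of_ne fun ρ hρ hne => ?_).symm
        by_contra hn
        exact hne (h1 ρ hρ hn)
    _ ≤ ∑ ρ ∈ Z.filter (· ∈ hfin.toFinset), (analyticOrderNatAt (lerchZeta lam α) ρ : ℝ) *
          (Real.pi * r ^ 2 / 2) :=
        Finset.sum_le_sum fun ρ _ => mul_le_mul_of_nonneg_left (setIntegral_posLog_le hr ρ _) (Nat.cast_nonneg _)
    _ ≤ _ := Finset.sum_le_sum_of_subset_of_nonneg (fun ρ hρ => (Finset.mem_filter.1 hρ).2)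
        fun ρ _ _ => by positivity

/-- The rectangle is enlarged by r: a counted zero with ordinate at least c + r has its whole disc
inside and contributes exactly πr²/2. The zeros below c + r are set aside, because the mean value of
log |L| is not available near the real axis. -/
theorem zeroCount_mul_le {α : ℝ} (hα : 0 < α) (hα1 : α ≤ 1) {lam σ₁ σ₂ c T r : ℝ} (hr : 0 < r)
    (hσ : 0 < σ₁ - r - r) (hc : 0 < c - r) (hfin : ∀ T, (zerosInRectangle lam α σ₁ σ₂ T).Finite)
    (hV : IntegrableOn (fun x : ℝ × ℝ => lerchLog lam α (x.1 + x.2 * Complex.I))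
      (Ioc (σ₁ - r - r) (σ₂ + r + r) ×ˢ Ioc (c - r) (T + r + r))) :
    zeroCount lam α σ₁ σ₂ T * (Real.pi * r ^ 2 / 2) ≤
      zeroCount lam α σ₁ σ₂ (c + r) * (Real.pi * r ^ 2 / 2) +
      circleExcess (fun x : ℝ × ℝ => lerchLog lam α (x.1 + x.2 * Complex.I)) (σ₁ - r) (σ₂ + r) c (T + r) r := by
  obtain ⟨Z, hZ, e⟩ := exists_sum_eq_setIntegral hα hα1 lam hr hσ hc hV
  rw [circleExcess, ← e, zeroCount_eq_sum (hfin T), zeroCount_eq_sum (hfin (c + r)), Finset.sum_mul,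
    Finset.sum_mul, ← Finset.sum_filter_add_sum_filter_not (hfin T).toFinset (fun ρ => ρ.im < c + r)]
  refine add_le_add ?_ ?_
  · refine Finset.sum_le_sum_of_subset_of_nonneg (fun ρ hρ => ?_) fun ρ _ _ => by positivity
    rw [Finset.mem_filter, Set.Finite.mem_toFinset] at hρ
    rw [Set.Finite.mem_toFinset]
    exact ⟨hρ.1.1, hρ.1.2.1, hρ.1.2.2.1, hρ.2, hρ.1.2.2.2.2⟩
  · have h1 : ∀ ρ ∈ (hfin T).toFinset.filter (fun ρ => ¬ ρ.im < c + r),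
        (analyticOrderNatAt (lerchZeta lam α) ρ : ℝ) * (Real.pi * r ^ 2 / 2) =
        (analyticOrderNatAt (lerchZeta lam α) ρ : ℝ) *
          ∫ z in Icc (σ₁ - r) (σ₂ + r) ×ℂ Icc c (T + r), Real.posLog (r * ‖z - ρ‖⁻¹) := by
      intro ρ hρ
      rw [Finset.mem_filter, Set.Finite.mem_toFinset, not_lt] at hρ
      obtain ⟨⟨h2, h3, h4, h5, -⟩, h6⟩ := hρ
      rw [setIntegral_posLog_eq hr (by linarith) (by linarith) h6 (by linarith)]
    rw [Finset.sum_congr rfl h1]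
    refine Finset.sum_le_sum_of_subset_of_nonneg (fun ρ hρ => ?_) fun ρ _ _ =>
      mul_nonneg (Nat.cast_nonneg _) (integral_nonneg fun _ => Real.posLog_nonneg)
    rw [Finset.mem_filter, Set.Finite.mem_toFinset, not_lt] at hρ
    obtain ⟨⟨h2, h3, h4, h5, h7⟩, h6⟩ := hρ
    exact (hZ ρ).2 ⟨⟨⟨by linarith, by linarith⟩, ⟨by linarith, by linarith⟩⟩, h7⟩

theorem meromorphicAt_lerchMain {α : ℝ} (hα : 0 < α) (lam : ℝ) (n : ℕ) (x : ℂ) :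
    MeromorphicAt (fun s => lerchMain lam α s n) x := by
  have h : ((((n : ℝ) + α : ℝ)) : ℂ) ≠ 0 := by exact_mod_cast (base_pos hα n).ne'
  unfold lerchMain
  split_ifs
  · have h1 : Differentiable ℂ fun s : ℂ => (((n : ℝ) + α : ℝ) : ℂ) ^ (1 - s) := fun s =>
      ((differentiableAt_const _).sub differentiableAt_id).const_cpow (Or.inl h)
    have h2 : Differentiable ℂ fun s : ℂ => s - 1 := differentiable_id.sub_const _
    exact (h1.analyticAt x).meromorphicAt.div (h2.analyticAt x).meromorphicAt
  · have h1 : Differentiable ℂ fun s => lerchTerm lam α s n / (1 - lerchZ lam) := fun s =>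
      (differentiableAt_lerchTerm hα lam n s).div_const _
    exact (h1.analyticAt x).meromorphicAt

/-- Near s = 1 the error terms have a common summable majorant. Their sum E is therefore bounded
there, and (s - 1)E(s) extends analytically; the main term has an explicit pole. -/
theorem meromorphicAt_lerchF {α : ℝ} (hα : 0 < α) (lam : ℝ) {x : ℂ} (hx : 0 < x.re) :
    MeromorphicAt (lerchF lam α) x := by
  by_cases hx1 : x ≠ 1
  · refine (AnalyticAt.meromorphicAt ?_)
    have hU : IsOpen ({s : ℂ | 0 < s.re} ∩ {1}ᶜ) :=
      (isOpen_lt continuous_const Complex.continuous_re).inter isOpen_compl_singleton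
    exact (DifferentiableOn.analyticAt (s := {s : ℂ | 0 < s.re} ∩ {1}ᶜ)
      (fun s hs => (differentiableAt_lerchF hα lam hs.1 hs.2).differentiableWithinAt)
      (hU.mem_nhds ⟨hx, hx1⟩))
  · rw [not_not] at hx1
    subst hx1
    obtain ⟨K, hK, hbd⟩ := norm_lerchErr_le hα lam
    set E : ℂ → ℂ := fun s => ∑' n, lerchErr lam α n s with hE
    have hEd : ∀ s : ℂ, 0 < s.re → s ≠ 1 → DifferentiableAt ℂ E s := by
      intro s h1 h2
      have h3 := (differentiableAt_lerchF hα lam h1 h2).sub (differentiableAt_lerchMain hα lam 0 h2)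
      refine h3.congr_of_eventuallyEq (Eventually.of_forall fun q => ?_)
      simp [hE, lerchF]
    set u : ℕ → ℝ := fun n => K * 2 * (((n : ℝ) + α) ^ (-(3 / 2) : ℝ) + ((n : ℝ) + α) ^ (-3 : ℝ)) with hu
    have hus : Summable u :=
      ((summable_base_rpow hα (by norm_num)).add (summable_base_rpow hα (by norm_num))).mul_left _
    have hnear : ∀ᶠ s : ℂ in 𝓝[≠] 1, 1 / 2 < s.re ∧ s.re < 2 ∧ ‖s‖ < 2 ∧ s ≠ 1 := by
      have hO : IsOpen {s : ℂ | 1 / 2 < s.re ∧ s.re < 2 ∧ ‖s‖ < 2} :=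
        (isOpen_lt continuous_const Complex.continuous_re).inter
          ((isOpen_lt Complex.continuous_re continuous_const).inter (isOpen_lt continuous_norm continuous_const))
      have h0 : (1 : ℂ) ∈ {s : ℂ | 1 / 2 < s.re ∧ s.re < 2 ∧ ‖s‖ < 2} := by norm_num
      have h1 : _ ∈ 𝓝[≠] (1 : ℂ) := mem_nhdsWithin_of_mem_nhds (hO.mem_nhds h0)
      filter_upwards [h1, self_mem_nhdsWithin] with s ⟨h2, h3, h4⟩ h5
      exact ⟨h2, h3, h4, h5⟩
    have hEb : ∀ᶠ s : ℂ in 𝓝[≠] 1, ‖E s‖ ≤ ∑' n, u n := by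
      filter_upwards [hnear] with s ⟨h1, h2, h3, h4⟩
      refine tsum_of_norm_bounded hus.hasSum fun n => (hbd s (by linarith) h4 n).trans ?_
      have hpos := base_pos hα n
      simp only [hu]
      refine mul_le_mul (mul_le_mul_of_nonneg_left h3.le (by linarith)) ?_ (by positivity) (by linarith)
      rcases le_total 1 ((n : ℝ) + α) with h5 | h5
      · exact (Real.rpow_le_rpow_of_exponent_le h5 (by linarith)).trans
          (le_add_of_nonneg_right (by positivity))
      · exact (Real.rpow_le_rpow_of_exponent_ge hpos h5 (by linarith)).trans
          (le_add_of_nonneg_left (by positivity))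
    have hEm : MeromorphicAt E 1 := by
      refine ⟨1, Complex.analyticAt_of_differentiable_on_punctured_nhds_of_continuousAt ?_ ?_⟩
      · filter_upwards [hnear] with s ⟨h1, h2, h3, h4⟩
        exact ((differentiableAt_id.sub_const 1).pow 1).smul (hEd s (by linarith) h4)
      · rw [continuousAt_iff_punctured_nhds]
        have h0 : Tendsto (fun s : ℂ => ‖s - 1‖ * ∑' n, u n) (𝓝[≠] 1) (𝓝 0) := by
          have : Tendsto (fun s : ℂ => ‖s - 1‖ * ∑' n, u n) (𝓝 1) (𝓝 (‖(1 : ℂ) - 1‖ * ∑' n, u n)) :=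
            Continuous.tendsto (by fun_prop) 1
          rw [sub_self, norm_zero, zero_mul] at this
          exact this.mono_left nhdsWithin_le_nhds
        simp only [pow_one, sub_self, zero_smul]
        refine squeeze_zero_norm' ?_ h0
        filter_upwards [hEb] with s hs
        rw [norm_smul]
        exact mul_le_mul_of_nonneg_left hs (norm_nonneg _)
    exact (meromorphicAt_lerchMain hα lam 0 1).add hEm

/-- The closed rectangle meets the real axis, where analyticity of `lerchZeta` is not at hand. The
zeros are also zeros of `lerchF`, which is meromorphic for Re s > 0. An accumulation point would
make it vanish identically nearby, hence in the whole quadrant, contradicting the lower bound far to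
the right. -/
theorem finite_zerosInRectangle {α : ℝ} (hα : 0 < α) (hα1 : α ≤ 1) (lam : ℝ) {σ₁ σ₂ : ℝ} (hσ : 0 < σ₁) (T : ℝ) :
    (zerosInRectangle lam α σ₁ σ₂ T).Finite := by
  by_contra hinf
  have hsub : zerosInRectangle lam α σ₁ σ₂ T ⊆ Icc σ₁ σ₂ ×ℂ Icc 0 T := fun s hs =>
    ⟨⟨hs.1.le, hs.2.1.le⟩, ⟨hs.2.2.1.le, hs.2.2.2.1.le⟩⟩
  obtain ⟨x, hxK, hacc⟩ := Set.Infinite.exists_accPt_of_subset_isCompact hinf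
    (isCompact_Icc.reProdIm isCompact_Icc) hsub
  rw [accPt_iff_frequently_nhdsNE] at hacc
  have hx : 0 < x.re := hσ.trans_le hxK.1.1
  have hzero : ∃ᶠ y in 𝓝[≠] x, (0 < y.re ∧ 0 < y.im) ∧ lerchF lam α y = 0 := by
    refine hacc.mono fun y hy => ?_
    have h1 : 0 < y.re := hσ.trans hy.1
    exact ⟨⟨h1, hy.2.2.1⟩, by rw [← lerchZeta_eq_lerchF hα hα1 lam h1 hy.2.2.1]; exact hy.2.2.2.2⟩
  rcases (meromorphicAt_lerchF hα lam hx).eventually_eq_zero_or_eventually_ne_zero with h | h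
  · obtain ⟨y, ⟨⟨⟨hy1, hy2⟩, -⟩, hy⟩, hyx⟩ := ((hzero.and_eventually
      (eventually_eventually_nhdsWithin.2 h)).and_eventually eventually_mem_nhdsWithin).exists
    rw [isOpen_compl_singleton.nhdsWithin_eq hyx] at hy
    have hq : {s : ℂ | 0 < s.re ∧ 0 < s.im} ∈ 𝓝 y := isOpen_quadrant.mem_nhds ⟨hy1, hy2⟩
    have hy0 : lerchZeta lam α =ᶠ[𝓝 y] 0 := by
      filter_upwards [hy, hq] with s h1 h2
      rw [lerchZeta_eq_lerchF hα hα1 lam h2.1 h2.2, h1, Pi.zero_apply]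
    have hall := (analyticOnNhd_lerchZeta hα hα1 lam).eqOn_zero_of_preconnected_of_eventuallyEq_zero
      isPreconnected_quadrant (show y ∈ {s : ℂ | 0 < s.re ∧ 0 < s.im} from ⟨hy1, hy2⟩) hy0
    obtain ⟨c₀, hc₀⟩ := exists_half_le_norm_lerchZeta hα hα1 lam
    have h1 := hc₀ (max c₀ 1) (le_max_left _ _) 1 one_pos
    have h2 : (0 : ℝ) < max c₀ 1 := lt_of_lt_of_le one_pos (le_max_right _ _)
    rw [hall (show ((max c₀ 1 : ℝ) + (1 : ℝ) * Complex.I : ℂ) ∈ {s : ℂ | 0 < s.re ∧ 0 < s.im} by simp [h2]),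
      Pi.zero_apply, norm_zero] at h1
    norm_num at h1
  · obtain ⟨y, ⟨-, hy⟩, hy'⟩ := (hzero.and_eventually h).exists
    exact hy' hy

theorem zeroCount_mono {α : ℝ} (hα : 0 < α) (hα1 : α ≤ 1) (lam : ℝ) {σ₁ σ₂ : ℝ} (hσ : 0 < σ₁) {T T' : ℝ}
    (h : T ≤ T') : zeroCount lam α σ₁ σ₂ T ≤ zeroCount lam α σ₁ σ₂ T' := by
  have hfin := fun T => finite_zerosInRectangle hα hα1 lam (σ₂ := σ₂) hσ T
  rw [← Nat.cast_le (α := ℝ), zeroCount_eq_sum (hfin T), zeroCount_eq_sum (hfin T')]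
  refine Finset.sum_le_sum_of_subset_of_nonneg (fun ρ hρ => ?_) fun ρ _ _ => by positivity
  rw [Set.Finite.mem_toFinset] at hρ ⊢
  exact ⟨hρ.1, hρ.2.1, hρ.2.2.1, hρ.2.2.2.1.trans_le h, hρ.2.2.2.2⟩

/-- The passage from an excess X over a rectangle of height T' to a count. Δ is the increment of m'
between the perturbed abscissae and D the true one. Each replacement costs a multiple of T r after
division by πr²/2. -/
theorem abs_mul_two_div_sub_le {X T T' r D Δ K C c : ℝ} (hr : 0 < r) (hK : 0 ≤ K) (hC : 0 ≤ C)
    (hT' : 0 ≤ T') (hT'T : T' ≤ T + c) (hTc : |T' - T| ≤ c) (hcr : c ≤ T) (hTr : 1 ≤ T * r) (hΔ : |Δ - D| ≤ 2 * K * r)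
    (hX : |X - T' * (r ^ 2 / 4 * Δ)| ≤ C * (T * r ^ 3) + T' * (2 * K * r ^ 3)) :
    |X / (Real.pi * r ^ 2 / 2) - 1 / (2 * Real.pi) * D * T| ≤ (2 * C + 10 * K + |D| * c) * (T * r) := by
  have hπ := Real.pi_pos
  have hπ1 : 1 ≤ Real.pi := by linarith [Real.pi_gt_three]
  have e : X / (Real.pi * r ^ 2 / 2) - 1 / (2 * Real.pi) * D * T =
      Real.pi⁻¹ * ((X - T' * (r ^ 2 / 4 * Δ)) * (2 / r ^ 2) + T' / 2 * (Δ - D) + D / 2 * (T' - T)) := by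
    field_simp
    ring
  have h1 : |(X - T' * (r ^ 2 / 4 * Δ)) * (2 / r ^ 2)| ≤ 2 * C * (T * r) + 8 * K * (T * r) := by
    rw [abs_mul, abs_of_pos (by positivity : 0 < 2 / r ^ 2)]
    calc _ ≤ (C * (T * r ^ 3) + T' * (2 * K * r ^ 3)) * (2 / r ^ 2) :=
          mul_le_mul_of_nonneg_right hX (by positivity)
      _ = 2 * C * (T * r) + T' * (4 * K * r) := by field_simp; ring
      _ ≤ 2 * C * (T * r) + (2 * T) * (4 * K * r) := by gcongr; linarith
      _ = _ := by ring
  have hT2 : T' ≤ 2 * T := by linarith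
  have h2 : |T' / 2 * (Δ - D)| ≤ 2 * K * (T * r) := by
    rw [abs_mul, abs_of_nonneg (by positivity)]
    calc T' / 2 * |Δ - D| ≤ T * (2 * K * r) :=
          mul_le_mul (by linarith) hΔ (abs_nonneg _) (by linarith)
      _ = _ := by ring
  have h3 : |D / 2 * (T' - T)| ≤ |D| * c * (T * r) := by
    rw [abs_mul, abs_div, abs_two]
    have hc : 0 ≤ c := (abs_nonneg _).trans hTc
    calc |D| / 2 * |T' - T| ≤ |D| * c := by
          have := mul_le_mul_of_nonneg_left hTc (abs_nonneg D)
          have := mul_nonneg (abs_nonneg D) (abs_nonneg (T' - T))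
          linarith
      _ ≤ _ := le_mul_of_one_le_right (by positivity) hTr
  rw [e, abs_mul, abs_of_pos (by positivity), inv_mul_le_iff₀ hπ]
  have h4 := abs_add_three ((X - T' * (r ^ 2 / 4 * Δ)) * (2 / r ^ 2)) (T' / 2 * (Δ - D)) (D / 2 * (T' - T))
  have hc : 0 ≤ c := (abs_nonneg _).trans hTc
  have h5 : (2 * C + 10 * K + |D| * c) * (T * r) ≤ Real.pi * ((2 * C + 10 * K + |D| * c) * (T * r)) :=
    le_mul_of_one_le_left (by positivity) hπ1
  linarith

theorem tendsto_log_rpow_neg {A : ℝ} (hA : 0 < A) : Tendsto (fun T : ℝ => Real.log T ^ (-A)) atTop (𝓝 0) :=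
  (tendsto_rpow_neg_atTop hA).comp Real.tendsto_log_atTop

theorem eventually_one_le_mul_log_rpow {A : ℝ} (hA1 : A ≤ 1) :
    ∀ᶠ T : ℝ in atTop, 1 ≤ T * Real.log T ^ (-A) := by
  filter_upwards [eventually_ge_atTop (Real.exp 1)] with T hT
  have := monotoneOn_mul_log_rpow hA1 (self_mem_Ici : Real.exp 1 ∈ Ici (Real.exp 1)) hT hT
  simp only [Real.log_exp, Real.one_rpow, mul_one] at this
  linarith [Real.add_one_le_exp 1]

/-- The number of zeros in the rectangle is `C T + O(T (log T)^(-A))`. -/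
theorem zeroCount_sub_isBigO {α : ℝ} (hα : α ∈ admissibleSet) (lam : ℝ) {σ₁ σ₂ : ℝ} (hσ₁ : 1 / 2 < σ₁)
    (hσ : σ₁ < σ₂) :
    (fun T : ℝ => (zeroCount lam α σ₁ σ₂ T : ℝ) - zeroConstant α σ₁ σ₂ * T) =O[atTop]
      (fun T : ℝ => T * Real.log T ^ (-(1 / 432) : ℝ)) := by
  have hα0 := hα.1.1
  have hα1 := hα.1.2
  have hfin := fun T => finite_zerosInRectangle hα0 hα1 lam (σ₂ := σ₂) (by linarith : 0 < σ₁) T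
  have ha : 1 / 2 < (σ₁ + 1 / 2) / 2 := by linarith
  obtain ⟨C, K, T₁, hC, hK, hT₁, hKb, h⟩ := exists_abs_circleExcess_lerchLog_sub_le hα lam ha
    (by linarith : (σ₁ + 1 / 2) / 2 ≤ σ₂ + 1)
  set a := (σ₁ + 1 / 2) / 2 with hadef
  set b := σ₂ + 1 with hbdef
  set V : ℝ × ℝ → ℝ := fun x => lerchLog lam α (x.1 + x.2 * Complex.I) with hVdef
  set c := T₁ + 1 with hcdef
  set D := logMean α 1 σ₂ - logMean α 1 σ₁ with hD
  have hLip : ∀ x y : ℝ, x ∈ Icc a b → y ∈ Icc a b → |logMean α 1 y - logMean α 1 x| ≤ K * |y - x| := by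
    intro x y hx hy
    exact (convex_Icc (𝕜 := ℝ) a b).norm_image_sub_le_of_norm_hasDerivWithin_le
      (fun z hz => (hasDerivAt_logMean hα0 (ha.trans_le hz.1) (by norm_num)).hasDerivWithinAt)
      (fun z hz => hKb z hz) hx hy
  rw [zeroConstant_eq hα0 hσ₁ hσ.le]
  have hη : 0 < min (1 / 2) (min ((σ₁ - 1 / 2) / 4) ((σ₂ - σ₁) / 2)) :=
    lt_min (by norm_num) (lt_min (by linarith) (by linarith))
  -- The zeros below height c + 1 contribute a constant, absorbed because T r ≥ 1.
  refine Asymptotics.IsBigO.of_bound (zeroCount lam α σ₁ σ₂ (c + 1) + (2 * C + 10 * K + |D| * (c + 1))) ?_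
  filter_upwards [(tendsto_log_rpow_neg (A := 1 / 432) (by norm_num)).eventually (gt_mem_nhds hη),
    eventually_one_le_mul_log_rpow (A := 1 / 432) (by norm_num),
    eventually_ge_atTop (c + 2), eventually_gt_atTop (1 : ℝ)] with T hr hTr hT hT1
  have hlog : 0 < Real.log T := Real.log_pos hT1
  -- This choice of r makes the error in the mean value of log |L| equal in order to the Taylor
  -- remainder T r³; after division by r² both are of order T r.
  have hr3 : Real.log T ^ (-(1 / 144) : ℝ) = (Real.log T ^ (-(1 / 432) : ℝ)) ^ 3 := by
    rw [← Real.rpow_natCast, ← Real.rpow_mul hlog.le]; norm_num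
  have hr0 : 0 < Real.log T ^ (-(1 / 432) : ℝ) := Real.rpow_pos_of_pos hlog _
  obtain ⟨hVi, hex⟩ := h T (by linarith)
  rw [hr3] at hex
  set r := Real.log T ^ (-(1 / 432) : ℝ) with hrdef
  obtain ⟨hr1, hr2⟩ := lt_min_iff.1 hr
  obtain ⟨hr2, hr3'⟩ := lt_min_iff.1 hr2
  have hTpos : 0 < T := by linarith
  rw [Real.norm_of_nonneg (by positivity : 0 ≤ T * r), Real.norm_eq_abs]
  have hp : 0 < Real.pi * r ^ 2 / 2 := by positivity
  have hmem₁ : σ₁ ∈ Icc a b := ⟨by linarith, by linarith⟩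
  have hmem₂ : σ₂ ∈ Icc a b := ⟨by linarith, by linarith⟩
  have hΔ : ∀ s : ℝ, |s| = r → |(logMean α 1 (σ₂ + s) - logMean α 1 (σ₁ - s)) - D| ≤ 2 * K * r := by
    intro s hs
    have hs' := abs_le.1 hs.le
    have h1 := hLip σ₂ (σ₂ + s) hmem₂ ⟨by linarith, by linarith⟩
    have h2 := hLip σ₁ (σ₁ - s) hmem₁ ⟨by linarith, by linarith⟩
    rw [add_sub_cancel_left, hs] at h1
    rw [sub_sub_cancel_left, abs_neg, hs] at h2
    have e : (logMean α 1 (σ₂ + s) - logMean α 1 (σ₁ - s)) - D =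
      (logMean α 1 (σ₂ + s) - logMean α 1 σ₂) - (logMean α 1 (σ₁ - s) - logMean α 1 σ₁) := by
      rw [hD]; ring
    rw [e]
    refine (abs_sub _ _).trans ?_
    linarith
  have hN₀ : (zeroCount lam α σ₁ σ₂ (c + r) : ℝ) ≤ zeroCount lam α σ₁ σ₂ (c + 1) * (T * r) :=
    (Nat.cast_le.2 (zeroCount_mono hα0 hα1 lam (by linarith) (by linarith))).trans
      (le_mul_of_one_le_right (Nat.cast_nonneg _) hTr)
  have hN₁ : 0 ≤ (zeroCount lam α σ₁ σ₂ (c + 1) : ℝ) * (T * r) := by positivity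
  have hup := hex (σ₁ - r) (σ₂ + r) c (T + r) r hr0.le (by linarith) (by linarith) (by linarith) (by linarith)
    (by linarith) (by linarith)
  have hlo := hex (σ₁ + r) (σ₂ - r) c (T - r) r hr0.le (by linarith) (by linarith) (by linarith) (by linarith)
    (by linarith) (by linarith)
  have hup' := abs_mul_two_div_sub_le hr0 hK hC (by linarith) (by linarith : T + r - c ≤ T + (c + 1))
    (by rw [abs_le]; constructor <;> linarith) (by linarith) hTr (hΔ r (abs_of_pos hr0)) hup
  have hΔ' := hΔ (-r) (by rw [abs_neg, abs_of_pos hr0])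
  rw [← sub_eq_add_neg, sub_neg_eq_add] at hΔ'
  have hlo' := abs_mul_two_div_sub_le hr0 hK hC (by linarith) (by linarith : T - r - c ≤ T + (c + 1))
    (by rw [abs_le]; constructor <;> linarith) (by linarith) hTr hΔ' hlo
  have hcu := zeroCount_mul_le hα0 hα1 (lam := lam) (σ₁ := σ₁) (σ₂ := σ₂) (c := c) (T := T) hr0 (by linarith)
    (by linarith) hfin (hVi.mono_set (prod_mono (Ioc_subset_Ioc (by linarith) (by linarith))
      (Ioc_subset_Ioc (by linarith) (by linarith))))
  have hcl := circleExcess_le_zeroCount_mul hα0 hα1 (lam := lam) (σ₁ := σ₁) (σ₂ := σ₂) (c := c) (T := T) hr0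
    (by linarith) (by linarith) (hfin T) (hVi.mono_set (prod_mono (Ioc_subset_Ioc (by linarith) (by linarith))
      (Ioc_subset_Ioc (by linarith) (by linarith))))
  rw [← sub_le_iff_le_add', ← sub_mul, ← le_div_iff₀ hp] at hcu
  rw [← div_le_iff₀ hp] at hcl
  rw [add_mul, abs_le]
  have h1 := (abs_le.1 hup').2
  have h2 := (abs_le.1 hlo').1
  constructor
  · linarith only [h2, hcl, hN₁]
  · linarith only [h1, hcu, hN₀]

/-- The error term is o(T), so a negative constant would make the count of zeros negative for large
T. The constant does not involve λ, and λ = 0 serves. -/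
theorem zeroConstant_nonneg {α : ℝ} (hα : α ∈ admissibleSet) {σ₁ σ₂ : ℝ} (hσ₁ : 1 / 2 < σ₁) (hσ : σ₁ < σ₂) :
    0 ≤ zeroConstant α σ₁ σ₂ := by
  by_contra! hneg
  obtain ⟨B, hB0, hB⟩ := (zeroCount_sub_isBigO hα 0 hσ₁ hσ).exists_pos
  rw [Asymptotics.isBigOWith_iff] at hB
  have h1 : ∀ᶠ T : ℝ in atTop, Real.log T ^ (-(1 / 432) : ℝ) < -zeroConstant α σ₁ σ₂ / B :=
    (tendsto_log_rpow_neg (by norm_num)).eventually (gt_mem_nhds (div_pos (by linarith) hB0))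
  obtain ⟨T, hT, h2, hT1⟩ := (hB.and (h1.and (eventually_gt_atTop (1 : ℝ)))).exists
  have hlog : 0 < Real.log T := Real.log_pos hT1
  have hr0 : 0 < Real.log T ^ (-(1 / 432) : ℝ) := Real.rpow_pos_of_pos hlog _
  have hT0 : 0 < T := by linarith
  rw [Real.norm_of_nonneg (by positivity : 0 ≤ T * Real.log T ^ (-(1 / 432) : ℝ)), Real.norm_eq_abs] at hT
  rw [lt_div_iff₀ hB0] at h2
  have h3 := mul_lt_mul_of_pos_right h2 hT0
  have h4 := le_abs_self ((zeroCount 0 α σ₁ σ₂ T : ℝ) - zeroConstant α σ₁ σ₂ * T)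
  have h5 : (0 : ℝ) ≤ zeroCount 0 α σ₁ σ₂ T := Nat.cast_nonneg _
  linarith

end LerchZeros

end

theorem mainTheorem1 :
    ∃ A : ℝ, 0 < A ∧
      ∀ lam α : ℝ, α ∈ LerchZeros.admissibleSet →
        ∀ σ₁ σ₂ : ℝ, 1 / 2 < σ₁ → σ₁ < σ₂ →
          -- the density function and the constant are well defined
          (∀ σ : ℝ, 1 / 2 < σ → LerchZeros.IsLimitDensity α σ (LerchZeros.densityM α σ)) ∧
          (∀ z : ℂ, ContDiffOn ℝ 2 (fun σ : ℝ => LerchZeros.densityM α σ z) (Set.Ioi (1 / 2))) ∧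
          (∀ σ : ℝ, 1 / 2 < σ →
            MeasureTheory.Integrable
              (fun z : ℂ => Real.log ‖z‖ * LerchZeros.densityM_deriv2 α σ z)
              LerchZeros.dzMeasure) ∧
          IntervalIntegrable (LerchZeros.logIntegral α) MeasureTheory.volume σ₁ σ₂ ∧
          -- the zeros are well defined and finite in number
          AnalyticOnNhd ℂ (LerchZeros.lerchZeta lam α) {s : ℂ | 1 / 2 < s.re ∧ 0 < s.im} ∧
          (∀ T : ℝ, (LerchZeros.zerosInRectangle lam α σ₁ σ₂ T).Finite) ∧
          -- the asymptotic formula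
          0 ≤ LerchZeros.zeroConstant α σ₁ σ₂ ∧
          (fun T : ℝ => (LerchZeros.zeroCount lam α σ₁ σ₂ T : ℝ)
              - LerchZeros.zeroConstant α σ₁ σ₂ * T)
            =O[Filter.atTop] (fun T : ℝ => T * (Real.log T) ^ (-A)) := by
  refine ⟨1 / 432, by norm_num, fun lam α hα σ₁ σ₂ hσ₁ hσ => ?_⟩
  obtain ⟨⟨hα0, hα1⟩, -⟩ := id hα
  refine ⟨fun σ hσ' => ?_, LerchZeros.contDiffOn_densityM hα0,
    fun σ hσ' => LerchZeros.integrable_log_mul_densityM_deriv2 hα0 hσ',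
    LerchZeros.intervalIntegrable_logIntegral hα0 hσ₁ hσ.le,
    (LerchZeros.analyticOnNhd_lerchZeta hα0 hα1 lam).mono fun s hs => ⟨by linarith [hs.1], hs.2⟩,
    LerchZeros.finite_zerosInRectangle hα0 hα1 lam (by linarith),
    LerchZeros.zeroConstant_nonneg hα hσ₁ hσ, LerchZeros.zeroCount_sub_isBigO hα lam hσ₁ hσ⟩
  rw [LerchZeros.densityM_eq hα0 hσ']
  exact LerchZeros.isLimitDensity_dens hα0 hσ'
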